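/- Let $W$ be a compact surface with boundary circles $b_1,\dots,b_k$ and with the structure of a Liouville domain: a one-form $\lambda$ with $d\lambda$ an area form and Liouville field $X$ ($\iota_Xd\lambda=\lambda$) pointing outwards along $\partial W$. Let $H\colon W\to\mathbb R$ be smooth, $\iota_{X_H}d\lambda=-dH$, suppose that $X_H$ has a flow on $W$, and let $\psi$ be its time-$1$ map. Fix $\varepsilon>0$ such that the Liouville flow $Fl$ gives a collar $(-\varepsilon,0]\times\partial W\hookrightarrow W$ on which $\lambda=e^s\lambda|_{\partial W}$ and such that $\psi$ is the identity on this collar. *Open book.* Choose a smooth $U<0$ on $W$ with $\psi^*\lambda=\lambda-dU$; it is constant on the collar of $b_i$, and we put $a_i=-U|_{b_i}/2\pi>0$. For each $i$ choose profile functions $h_1,h_2\colon[0,1)\to\mathbb R$, smooth in $r^2$, with $h_1\sim1-r^2$ and $h_2\sim r^2$ at $0$, $h_1'<0$ on $(0,1)$, $h_2'>0$ on $(0,\frac12)$, and $h_1=e^{-\varepsilon r}$, $h_2=a_i$ for $r\ge\frac12$. Let $W_0$ be $W$ without the collar part $[-\varepsilon/2,0]\times\partial W$. The contact open book $Y=OB(W,\psi)$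 is obtained from the mapping torus $M=W_0\times\mathbb R/(w,\phi)\sim(\psi(w),\phi+U(w))$, with contact form $d\phi+\lambda$, and $B=\partial W\times\{|z|<1\}$, with contact form $h_1(r)\lambda|_{\partial W}+h_2(r)\,d\phi$ ($z=re^{i\phi}$), by gluing $(x;r,\phi)\mapsto[Fl_{-\varepsilon r}(x),a_i\phi]$ for $x\in b_i$, $\frac12<r<1$. Write $\alpha$ for its contact form. *Integrability.* Let $N$ be a three-manifold with contact form $\alpha_N$. Its symplectization is $(\mathbb R\times N,\ d(e^t\alpha_N))$. It is called completely integrable with integrals $t,F$ if $F\colon\mathbb R\times N\to\mathbb R$ is smooth, $d(e^t\alpha_N)$ is symplectic, $t$ and $F$ are in involution, and $dt,dF$ are linearly independent on an open dense subset. *Statement.* 1. Functions $U,h_1,h_2$ as above exist, and for each choice of them the open book $Y$ exists as a closed smooth three-manifold with contact form. 2. For each such choice there is $F\colon\mathbb R\times Y\to\mathbb R$ such that the symplectization of $Y$ is completely integrable with integrals $t,F$, where $F$ extends $H$: one has $F(t,[w,\phi])=H(w)$ for all $w$ outside the collar and outside the interior of $\{dH=0\}$; and, for each $i$ such that $H$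 is constant on the collar of $b_i$, $F(t,(x;r,\phi))=h_2(r)+H|_{b_i}-a_i$ for $x\in b_i$, $r\le\frac12$. 3. Let $(W',\lambda',H',\psi')$ be another such tuple, and let $Y,Y'$ be open books obtained as above from $(W,\psi)$ and $(W',\psi')$. For all boundary components $b_i\subset\partial W$ and $b'_{i'}\subset\partial W'$ and all points $p,p'$ of the corresponding binding circles, the contact connected sum $Z=Y\#Y'$ can be performed along Darboux balls centred at $p$ and $p'$ and contained in the parts $r<\frac12$ of the solid tori around these circles in such a way that $Z$ is closed and its contact structure has a contact form which equals that of $Y$ (of $Y'$) outside the respective solid torus $\{r<\frac12\}$ and whose symplectization is completely integrable with integrals $t,F$, where $F$ extends both $H$ and $H'$ as in 2 (the formula in terms of $h_2$ being claimed at the components other than $b_i$, $b'_{i'}$). Here the contact connected sum is defined as follows. Let $\theta=dt+\rho^2d\varphi$ on $\mathbb R\times\mathbb C$, $\zeta=\rho e^{i\varphi}$, $N=|\zeta|^4+4t^2$. Let $e,e'$ be embeddings of $\{N<R\}$, $R>1$, into $Y$ and $Y'$ that pull the contact forms back to positive multiples of $\theta$. Remove the images of $\{N\le1/R\}$ and glue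 $e(p)$ to $e'(I(p))$ for $1/R<N(p)<R$, where $I(t,\zeta)=\bigl(-t/N,\ \zeta/(|\zeta|^2-2it)\bigr)$ is the contact inversion, $I^*\theta=\theta/N$. The contact structure of the sum restricts to the given co-oriented ones on both pieces. -/

import Mathlib

open scoped Manifold ContDiff
open Set

universe u

noncomputable section

/-! ### One-forms on manifolds (possibly with boundary) -/

section Forms

variable {E : Type*} [NormedAddCommGroup E] [NormedSpace ℝ E]
  {B : Type*} [TopologicalSpace B] (I : ModelWithCorners ℝ E B)
  {M : Type*} [TopologicalSpace M] [ChartedSpace B M]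

variable (M) in
/-- A (not necessarily continuous) differential one-form on `M`. -/
abbrev OneForm : Type _ := (p : M) → (TangentSpace I p →L[ℝ] ℝ)

variable {I}

/-- The coefficients of a one-form in the preferred chart at `p`: the pullback of the form under
the inverse of that chart. -/
def OneForm.chartRep (α : OneForm I M) (p : M) : E → (E →L[ℝ] ℝ) := fun y =>
  (α ((extChartAt I p).symm y)).comp
    (mfderivWithin 𝓘(ℝ, E) I (extChartAt I p).symm (range I) y)

/-- A one-form is smooth if its coefficients in charts are smooth. -/
def OneForm.IsSmooth (α : OneForm I M) : Prop :=
  ∀ p : M, ContDiffOn ℝ ∞ (α.chartRep p) (extChartAt I p).target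

/-- The exterior derivative `dα` at `p`, computed in the preferred chart at `p` (whose differential
at `p` is the identity of `TangentSpace I p`):
`dα (v, w) = (∂_v α) w - (∂_w α) v`. -/
def OneForm.d (α : OneForm I M) (p : M) (v w : TangentSpace I p) : ℝ :=
  (show E →L[ℝ] E →L[ℝ] ℝ from
      fderivWithin ℝ (α.chartRep p) (range I) (extChartAt I p p)) v w -
    (show E →L[ℝ] E →L[ℝ] ℝ from
      fderivWithin ℝ (α.chartRep p) (range I) (extChartAt I p p)) w v

variable (I) in
/-- The differential `df` of a real-valued function, as a one-form. -/
def dFun (f : M → ℝ) : OneForm I M := fun p => mfderiv I 𝓘(ℝ, ℝ) f p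

/-- Nondegeneracy of the two-form `dα`. -/
def OneForm.HasSymplecticDifferential (α : OneForm I M) : Prop :=
  ∀ (p : M) (v : TangentSpace I p), (∀ w : TangentSpace I p, α.d p v w = 0) → v = 0

/-- Contact forms: `α` is smooth and nowhere zero, and `dα` is nondegenerate on `ker α`. On
three-manifolds this says that `α ∧ dα` vanishes nowhere. -/
structure IsContactForm (α : OneForm I M) : Prop where
  smooth : α.IsSmooth
  ne_zero : ∀ p : M, α p ≠ 0
  nondegenerate : ∀ (p : M) (v : TangentSpace I p), α p v = 0 →
    (∀ w : TangentSpace I p, α p w = 0 → α.d p v w = 0) → v = 0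

/-- The functions `f` and `g` are in involution for the symplectic form `dβ`: one has
`dβ (X_f, X_g) = 0`, where `X_f` and `X_g` are the Hamiltonian vector fields of `f` and `g`. -/
def InInvolution (β : OneForm I M) (f g : M → ℝ) : Prop :=
  ∀ (p : M) (v w : TangentSpace I p),
    (∀ x : TangentSpace I p, β.d p v x = -(dFun I f p x)) →
    (∀ x : TangentSpace I p, β.d p w x = -(dFun I g p x)) → β.d p v w = 0

/-- Complete integrability in the sense of Arnold and Liouville on the exact symplectic manifold
`(M, dβ)` of dimension `2 n`: `n` smooth functions, pairwise in involution, whose differentials are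
linearly independent on a dense (automatically open) subset. -/
structure IsCompletelyIntegrable (β : OneForm I M) {n : ℕ} (f : Fin n → M → ℝ) : Prop where
  dim_eq : Module.finrank ℝ E = 2 * n
  smooth_form : β.IsSmooth
  symplectic : β.HasSymplecticDifferential
  smooth : ∀ i, ContMDiff I 𝓘(ℝ, ℝ) ∞ (f i)
  involution : ∀ i j, InInvolution β (f i) (f j)
  independent : Dense {p : M | LinearIndependent ℝ (fun i : Fin n => dFun I (f i) p)}

/-- The Liouville form `e^t α` of the symplectization `ℝ × M` of `(M, α)`. -/
def symplectizationForm (α : OneForm I M) : OneForm (𝓘(ℝ, ℝ).prod I) (ℝ × M) := fun p =>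
  Real.exp p.1 • (α p.2).comp (ContinuousLinearMap.snd ℝ ℝ E)

end Forms

/-! ### Liouville surfaces and autonomous Hamiltonians -/

section Pages

variable (W : Type u) [TopologicalSpace W] [ChartedSpace (EuclideanHalfSpace 2) W]

/-- The strip `ℝ × (-ε, 0]`, with coordinates `(x, s)`. -/
def collarStrip (ε : ℝ) : Set (ℝ × ℝ) := {p | -ε < p.2 ∧ p.2 ≤ 0}

/-- The structure of a Liouville domain on a surface `W` whose boundary consists of `k` circles: a
one-form `λ` with `dλ` an area form, such that the Liouville vector field `X` (given by
`i_X dλ = λ`) points outwards along `∂W`. The flow of `X` near the boundary is part of the data: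
the curve `x ↦ collar i (x, 0)` is the Reeb flow line of `λ|_∂W` which runs around the `i`-th
boundary circle, of length `len i`, and `collar i (x, s)` is obtained from `collar i (x, 0)` by
following `X` for the time `s ≤ 0`; this is what `collar_pullback`, that is
`(collar i)^* λ = e^s dx`, expresses. -/
structure LiouvilleSurface (k : ℕ) where
  form : OneForm (𝓡∂ 2) W
  smooth_form : form.IsSmooth
  symplectic : form.HasSymplecticDifferential
  len : Fin k → ℝ
  len_pos : ∀ i, 0 < len i
  width : ℝ
  width_pos : 0 < width
  collar : Fin k → ℝ × ℝ → W
  collar_smooth : ∀ i,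
    ContMDiffOn 𝓘(ℝ, ℝ × ℝ) (𝓡∂ 2) ∞ (collar i) (collarStrip width)
  collar_eq_iff : ∀ i j, ∀ p ∈ collarStrip width, ∀ q ∈ collarStrip width,
    (collar i p = collar j q ↔ i = j ∧ p.2 = q.2 ∧ ∃ n : ℤ, p.1 - q.1 = n * len i)
  boundary_eq : (𝓡∂ 2).boundary W = {w | ∃ i x, collar i (x, 0) = w}
  collar_pullback : ∀ i, ∀ p ∈ collarStrip width, ∀ v : ℝ × ℝ,
    form (collar i p)
      (mfderivWithin 𝓘(ℝ, ℝ × ℝ) (𝓡∂ 2) (collar i) (collarStrip width) p v)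
        = Real.exp p.2 * v.1

variable {W} {k : ℕ}

/-- The collar `(-ε, 0] × ∂W`, as a subset of `W`. -/
def LiouvilleSurface.collarRegion (S : LiouvilleSurface W k) : Set W :=
  {w | ∃ i, ∃ p ∈ collarStrip S.width, S.collar i p = w}

/-- The page without the outer half `[-ε/2, 0] × ∂W` of the collar. -/
def LiouvilleSurface.core (S : LiouvilleSurface W k) : Set W :=
  {w | ∀ i x s, -(S.width / 2) ≤ s → s ≤ 0 → S.collar i (x, s) ≠ w}

/-- An autonomous Hamiltonian `H` on `W` with its flow, `i_{X_H} dλ = -dH`, such that the time-one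
map is the identity on the collar of `∂W`. -/
structure AutonomousHamiltonian (S : LiouvilleSurface W k) where
  H : W → ℝ
  smooth_H : ContMDiff (𝓡∂ 2) 𝓘(ℝ, ℝ) ∞ H
  flow : ℝ × W → W
  smooth_flow : ContMDiff (𝓘(ℝ, ℝ).prod (𝓡∂ 2)) (𝓡∂ 2) ∞ flow
  flow_zero : ∀ w, flow (0, w) = w
  flow_hamiltonian : ∀ (t : ℝ) (w : W) (v : TangentSpace (𝓡∂ 2) (flow (t, w))),
    S.form.d (flow (t, w))
      (mfderiv 𝓘(ℝ, ℝ) (𝓡∂ 2) (fun τ : ℝ => flow (τ, w)) t (1 : ℝ)) v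
        = -(dFun (𝓡∂ 2) H (flow (t, w)) v)
  flow_one_collar : ∀ w ∈ S.collarRegion, flow (1, w) = w

/-- The time-one map `ψ`. -/
def AutonomousHamiltonian.ψ {S : LiouvilleSurface W k} (A : AutonomousHamiltonian S) : W → W :=
  fun w => A.flow (1, w)

end Pages

/-! ### Contact open books -/

section OpenBooks

/-- The profile functions `h₁, h₂ : [0, 1) → ℝ` of the contact form `h₁ λ + h₂ dφ` near the
binding. They are smooth functions of `r²`, with `h₁ ∼ 1 - r²` and `h₂ ∼ r²` at `r = 0`; `h₁` is
decreasing; `h₂` increases until `r = 1/2`; from there on `h₁ = e^(-ε r)` and `h₂` is constant. -/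
structure IsBindingProfile (ε a : ℝ) (h₁ h₂ : ℝ → ℝ) : Prop where
  near_zero₁ : ∃ g : ℝ → ℝ, ContDiff ℝ ∞ g ∧ g 0 = 1 ∧ deriv g 0 = -1 ∧
    ∀ r ∈ Ico (0 : ℝ) 1, h₁ r = g (r ^ 2)
  near_zero₂ : ∃ g : ℝ → ℝ, ContDiff ℝ ∞ g ∧ g 0 = 0 ∧ deriv g 0 = 1 ∧
    ∀ r ∈ Ico (0 : ℝ) 1, h₂ r = g (r ^ 2)
  decreasing₁ : ∀ r ∈ Ioo (0 : ℝ) 1, deriv h₁ r < 0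
  increasing₂ : ∀ r ∈ Ioo (0 : ℝ) (1 / 2), 0 < deriv h₂ r
  tail₁ : ∀ r ∈ Ico (1 / 2 : ℝ) 1, h₁ r = Real.exp (-(ε * r))
  tail₂ : ∀ r ∈ Ico (1 / 2 : ℝ) 1, h₂ r = a

variable {W : Type u} [TopologicalSpace W] [ChartedSpace (EuclideanHalfSpace 2) W] {k : ℕ}
  {S : LiouvilleSurface W k}

/-- The choices in the construction of the contact open book: a negative function `U` with
`ψ^* λ = λ - dU`, and profile functions near each binding component. Near the `i`-th boundary
circle `U` is constant, and `φ ↦ φ + U` has to match one full turn of the angle around the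
binding; so the constant value of `h₂` is `-U / (2π)` there. -/
structure GirouxData (A : AutonomousHamiltonian S) where
  U : W → ℝ
  smooth_U : ContMDiff (𝓡∂ 2) 𝓘(ℝ, ℝ) ∞ U
  U_neg : ∀ w, U w < 0
  pullback_form : ∀ (w : W) (v : TangentSpace (𝓡∂ 2) w),
    S.form (A.ψ w) (mfderiv (𝓡∂ 2) (𝓡∂ 2) A.ψ w v) = S.form w v - dFun (𝓡∂ 2) U w v
  h₁ : Fin k → ℝ → ℝ
  h₂ : Fin k → ℝ → ℝ
  profile : ∀ i,
    IsBindingProfile S.width (-U (S.collar i (0, 0)) / (2 * Real.pi)) (h₁ i) (h₂ i)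

variable {A : AutonomousHamiltonian S}

/-- The constant value of `h₂` on `[1/2, 1)` near the `i`-th binding component. -/
def GirouxData.slope (D : GirouxData A) (i : Fin k) : ℝ :=
  -D.U (S.collar i (0, 0)) / (2 * Real.pi)

/-- The map `(w, φ) ↦ (ψ w, φ + U w)`, whose orbits are the points of the mapping torus. -/
def GirouxData.deck (D : GirouxData A) : W × ℝ → W × ℝ :=
  fun p => (A.ψ p.1, p.2 + D.U p.1)

/-- A three-manifold `Y` with contact form `form` is the contact open book `OB(W, ψ)`. It is the
union of two open pieces.
* The mapping torus `M = (core × ℝ) / ((w, φ) ∼ (ψ w, φ + U w))` with the contact form `dφ + λ`,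
  where `core` is the page without a closed collar; `page : core × ℝ → Y` is the quotient map onto
  `M`, followed by the inclusion.
* The neighbourhood `B = ∂W × D²` of the binding, with the contact form `h₁(r) λ|_∂W + h₂(r) dφ`;
  `binding i (x, z)` is the point of `B` over the point `collar i (x, 0)` of the `i`-th boundary
  circle and `z = r e^(iφ)`, `r < 1`.

The pieces are glued by `(x; r, φ) ↦ [Fl_{-ε r} x, a φ]`, for `1/2 < r < 1`, where `Fl` is the
Liouville flow and `a = slope i`. Since `page` and `binding` pull `form` back to contact forms, they
are local diffeomorphisms, so these conditions determine `(Y, form)` up to a diffeomorphism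
which preserves the contact form. -/
structure OpenBook (D : GirouxData A) (Y : Type u) [TopologicalSpace Y]
    [ChartedSpace (EuclideanSpace ℝ (Fin 3)) Y] where
  form : OneForm (𝓡 3) Y
  contact : IsContactForm form
  page : W × ℝ → Y
  page_smooth : ContMDiffOn ((𝓡∂ 2).prod 𝓘(ℝ, ℝ)) (𝓡 3) ∞ page (S.core ×ˢ univ)
  page_eq_iff : ∀ p ∈ S.core ×ˢ (univ : Set ℝ), ∀ q ∈ S.core ×ˢ (univ : Set ℝ),
    (page p = page q ↔ ∃ n : ℕ, D.deck^[n] p = q ∨ D.deck^[n] q = p)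
  page_pullback : ∀ p ∈ S.core ×ˢ (univ : Set ℝ),
    ∀ v : TangentSpace ((𝓡∂ 2).prod 𝓘(ℝ, ℝ)) p,
      form (page p) (mfderiv ((𝓡∂ 2).prod 𝓘(ℝ, ℝ)) (𝓡 3) page p v) = v.2 + S.form p.1 v.1
  binding : Fin k → ℝ × ℂ → Y
  binding_smooth : ∀ i,
    ContMDiffOn 𝓘(ℝ, ℝ × ℂ) (𝓡 3) ∞ (binding i) (univ ×ˢ Metric.ball 0 1)
  binding_eq_iff : ∀ i j (x x' : ℝ) (z z' : ℂ), ‖z‖ < 1 → ‖z'‖ < 1 →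
    (binding i (x, z) = binding j (x', z') ↔ i = j ∧ z = z' ∧ ∃ n : ℤ, x - x' = n * S.len i)
  binding_pullback : ∀ i (x : ℝ) (z : ℂ), ‖z‖ < 1 → ∀ v : ℝ × ℂ,
    form (binding i (x, z)) (mfderiv 𝓘(ℝ, ℝ × ℂ) (𝓡 3) (binding i) (x, z) v)
      = D.h₁ i ‖z‖ * v.1
        + D.h₂ i ‖z‖ * (((starRingEnd ℂ) z * v.2).im / ‖z‖ ^ 2)
  cover : ∀ y : Y, (∃ p ∈ S.core ×ˢ (univ : Set ℝ), page p = y) ∨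
    ∃ i x, ∃ z : ℂ, ‖z‖ < 1 ∧ binding i (x, z) = y
  glue : ∀ i (x r φ : ℝ), 1 / 2 < r → r < 1 →
    binding i (x, r * Complex.exp (φ * Complex.I))
      = page (S.collar i (x, -(S.width * r)), D.slope i * φ)
  overlap : ∀ i (x : ℝ) (z : ℂ), ‖z‖ < 1 → ∀ p ∈ S.core ×ˢ (univ : Set ℝ),
    binding i (x, z) = page p → 1 / 2 < ‖z‖

variable {D : GirouxData A} {Y : Type u} [TopologicalSpace Y]
  [ChartedSpace (EuclideanSpace ℝ (Fin 3)) Y]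

/-- The solid torus `{r < 1/2}` around the `i`-th binding component. -/
def OpenBook.bindingRegion (O : OpenBook D Y) (i : Fin k) : Set Y :=
  {y | ∃ x, ∃ z : ℂ, ‖z‖ < 1 / 2 ∧ O.binding i (x, z) = y}

/-- The function `F`, defined on the symplectization of the open book or of a manifold that contains
a part of it by `j`, extends the Hamiltonian `H` of the monodromy: `F (t, [w, φ]) = H w` for `w` off
the collar of `∂W`, with the exception of points near which `H` is locally constant (where `ψ` is
the identity, and `F` may differ from `H` so as not to be locally constant); and
`F = h₂(r) + H - h₂(1)` near each binding component (in `P`) near which `H` is constant. -/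
def OpenBook.ExtendsHamiltonian (O : OpenBook D Y) (P : Set (Fin k)) {Z : Type u} (j : Y → Z)
    (F : ℝ × Z → ℝ) : Prop :=
  (∀ t φ : ℝ, ∀ w : W, w ∉ S.collarRegion → w ∉ interior {w | dFun (𝓡∂ 2) A.H w = 0} →
    F (t, j (O.page (w, φ))) = A.H w) ∧
  ∀ i ∈ P, (∀ p ∈ collarStrip S.width, A.H (S.collar i p) = A.H (S.collar i (0, 0))) →
    ∀ t x : ℝ, ∀ z : ℂ, ‖z‖ ≤ 1 / 2 →
      F (t, j (O.binding i (x, z))) = D.h₂ i ‖z‖ + A.H (S.collar i (0, 0)) - D.slope i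

end OpenBooks

/-! ### The contact connected sum -/

section ConnectedSum

/-- The standard contact form `dt + ρ² dφ` on `ℝ³ = ℝ × ℂ`, with coordinates `(t, ζ)`,
`ζ = ρ e^(iφ)`, evaluated at `p` on the vector `v`. -/
def standardContactForm (p v : ℝ × ℂ) : ℝ := v.1 + ((starRingEnd ℂ) p.2 * v.2).im

/-- The fourth power of the Heisenberg gauge of `ℝ × ℂ`; it is multiplied by `c⁴` under the
contact dilation `(t, ζ) ↦ (c² t, c ζ)`. -/
def gaugePow (p : ℝ × ℂ) : ℝ := ‖p.2‖ ^ 4 + 4 * p.1 ^ 2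

/-- The standard ball `{gaugePow < R}` in `ℝ³`. -/
def standardBall (R : ℝ) : Set (ℝ × ℂ) := {p | gaugePow p < R}

/-- The contact inversion of `ℝ³` minus the origin. It exchanges `{gaugePow < 1}` and
`{gaugePow > 1}`, and it pulls back the standard contact form to `1 / gaugePow` times this form. -/
def contactInversion (p : ℝ × ℂ) : ℝ × ℂ :=
  (-p.1 / gaugePow p, p.2 / ((‖p.2‖ : ℂ) ^ 2 - 2 * (p.1 : ℂ) * Complex.I))

/-- Darboux balls: `e` embeds the standard ball into `Y`, with `e^* α` a positive multiple of the
standard contact form. -/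
structure IsDarbouxBall {Y : Type*} [TopologicalSpace Y]
    [ChartedSpace (EuclideanSpace ℝ (Fin 3)) Y] (α : OneForm (𝓡 3) Y) (R : ℝ)
    (e : ℝ × ℂ → Y) : Prop where
  smooth : ContMDiffOn 𝓘(ℝ, ℝ × ℂ) (𝓡 3) ∞ e (standardBall R)
  injOn : InjOn e (standardBall R)
  pullback : ∀ p ∈ standardBall R, ∃ c : ℝ, 0 < c ∧ ∀ v : ℝ × ℂ,
    α (e p) (mfderiv 𝓘(ℝ, ℝ × ℂ) (𝓡 3) e p v) = c * standardContactForm p v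

/-- The contact manifold `(Z, ker α)` is the contact connected sum of `(Y₁, ker α₁)` and
`(Y₂, ker α₂)`: remove the smaller balls `{gaugePow ≤ 1/R}` from Darboux balls `e₁, e₂` of size
`R > 1`, and glue the remaining shells `{1/R < gaugePow < R}` by the contact inversion. The maps
`jᵢ` are the inclusions of the two pieces; they preserve the co-oriented contact structures. -/
structure ContactConnectedSum {Y₁ Y₂ Z : Type u}
    [TopologicalSpace Y₁] [ChartedSpace (EuclideanSpace ℝ (Fin 3)) Y₁]
    [TopologicalSpace Y₂] [ChartedSpace (EuclideanSpace ℝ (Fin 3)) Y₂]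
    [TopologicalSpace Z] [ChartedSpace (EuclideanSpace ℝ (Fin 3)) Z]
    (α₁ : OneForm (𝓡 3) Y₁) (α₂ : OneForm (𝓡 3) Y₂) (α : OneForm (𝓡 3) Z) where
  R : ℝ
  one_lt_R : 1 < R
  e₁ : ℝ × ℂ → Y₁
  e₂ : ℝ × ℂ → Y₂
  ball₁ : IsDarbouxBall α₁ R e₁
  ball₂ : IsDarbouxBall α₂ R e₂
  j₁ : Y₁ → Z
  j₂ : Y₂ → Z
  smooth₁ : ContMDiffOn (𝓡 3) (𝓡 3) ∞ j₁ (e₁ '' {p | gaugePow p ≤ 1 / R})ᶜ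
  smooth₂ : ContMDiffOn (𝓡 3) (𝓡 3) ∞ j₂ (e₂ '' {p | gaugePow p ≤ 1 / R})ᶜ
  injOn₁ : InjOn j₁ (e₁ '' {p | gaugePow p ≤ 1 / R})ᶜ
  injOn₂ : InjOn j₂ (e₂ '' {p | gaugePow p ≤ 1 / R})ᶜ
  factor₁ : Y₁ → ℝ
  factor₂ : Y₂ → ℝ
  pullback₁ : ∀ y ∈ (e₁ '' {p | gaugePow p ≤ 1 / R})ᶜ, 0 < factor₁ y ∧
    ∀ v : TangentSpace (𝓡 3) y,
      α (j₁ y) (mfderiv (𝓡 3) (𝓡 3) j₁ y v) = factor₁ y * α₁ y v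
  pullback₂ : ∀ y ∈ (e₂ '' {p | gaugePow p ≤ 1 / R})ᶜ, 0 < factor₂ y ∧
    ∀ v : TangentSpace (𝓡 3) y,
      α (j₂ y) (mfderiv (𝓡 3) (𝓡 3) j₂ y v) = factor₂ y * α₂ y v
  cover : ∀ z : Z, (∃ y ∈ (e₁ '' {p | gaugePow p ≤ 1 / R})ᶜ, j₁ y = z) ∨
    ∃ y ∈ (e₂ '' {p | gaugePow p ≤ 1 / R})ᶜ, j₂ y = z
  glue : ∀ y₁ ∈ (e₁ '' {p | gaugePow p ≤ 1 / R})ᶜ, ∀ y₂ ∈ (e₂ '' {p | gaugePow p ≤ 1 / R})ᶜ,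
    (j₁ y₁ = j₂ y₂ ↔
      ∃ p, 1 / R < gaugePow p ∧ gaugePow p < R ∧ e₁ p = y₁ ∧ e₂ (contactInversion p) = y₂)

end ConnectedSum

end

/-! Integrability is a statement about the Reeb field `R`. On `(ℝ × N, d(e^t α))` the Hamiltonian
field of `t` is `e^{-t} R`, so `t` Poisson commutes with a function `f` of the point of `N` as soon
as `R f = 0`, and `dt, df` are independent wherever `df ≠ 0`. Hence it is enough to find a smooth
Reeb-invariant `f` with `df ≠ 0` on a dense set (`IsReebIntegral`,
`isCompletelyIntegrable_of_reebInvariant`).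

On the mapping torus `R = ∂_φ`, so every `ψ`-invariant function of the page descends to an invariant
of `R`; the autonomous `H` is one. It is altered in two ways: near `∂W` it is cut off to constants
`c_i`, and where the result is locally constant a small generic function is added. Both changes keep
`ψ`-invariance, because they take place where `ψ` is the identity: on the collar, and on the
interior of `{dH = 0}`, where the flow stands still (`AutonomousHamiltonian.exists_page_function`).
Near the binding the contact form is rotation invariant and `R` is tangent to the tori `r = const`.
So `h₂(r) - a_i + c_i` is invariant; it joins smoothly with the constant `c_i` because `h₂ = a_i`
for `r ≥ 1/2`, and it is noncritical for `0 < r < 1/2`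
(`OpenBookModel.IsParametrized.isReebIntegral`).

For the connected sum the mechanism is Clairaut's: the value `α(∂_φ)` of a rotation invariant
contact form on the rotation field is Reeb-invariant. The choice `c_i = a_i` makes the integral
equal to `h₂ = α(∂_φ)` near the chosen binding circle. Around a binding point there are Darboux
balls that respect the rotation, with `e^*α = c(|ζ|²) θ` and integral `c(|ζ|²) |ζ|²`
(`OpenBook.exists_isReebBall`). The contact inversion commutes with rotations and pulls `θ` back to
`θ / N`. Therefore the forms of the two sides can be interpolated in the shell by a form `m(|ζ|², t)
θ`, and the two integrals are joined by `m |ζ|²`, again the value on the rotation field. What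
remains is that this function is noncritical on a dense part of the shell. One ball is chosen much
smaller than the other, which makes `m` strictly monotone in `t²` (`fderiv_shellFactor_ne_zero`).

Existence. By Cartan's formula the action `∫ (λ(X_H) - H) dt` is a primitive of `ψ^*λ - λ`; its
negative, shifted by a constant, is `U`. The three-manifolds come from a gluing lemma
(`exists_contact_gluing`): a set is covered by parametrized pieces carrying contact forms, and
coinciding points are related by germs of smooth maps that pull one form back to the other. A map
that pulls some form back to a contact form is an immersion, so in equal dimensions these germs are
automatically diffeomorphisms and the forms define the manifold structure along with the contact
form. Hausdorffness and compactness are checked directly; for the mapping torus they rest on the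
uniform bound `U ≤ -m < 0`. -/

set_option linter.unusedSectionVars false

noncomputable section
open Filter Topology

/-! ### One-forms and the contact condition on normed spaces -/

section EuclideanForms

variable {V : Type*} [NormedAddCommGroup V] [NormedSpace ℝ V]

/-- The exterior derivative of a one-form on a normed space. -/
def extD (β : V → V →L[ℝ] ℝ) (x v w : V) : ℝ := fderiv ℝ β x v w - fderiv ℝ β x w v

/-- The contact condition at a point, for a one-form on a normed space. -/
structure ContactAt (β : V → V →L[ℝ] ℝ) (x : V) : Prop where
  ne_zero : β x ≠ 0
  nondegenerate : ∀ v, β x v = 0 → (∀ w, β x w = 0 → extD β x v w = 0) → v = 0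

theorem extD_congr {β β' : V → V →L[ℝ] ℝ} {x : V} (h : β =ᶠ[𝓝 x] β') :
    extD β x = extD β' x := by
  funext v w
  simp only [extD, h.fderiv_eq]

theorem ContactAt.congr {β β' : V → V →L[ℝ] ℝ} {x : V} (h : β =ᶠ[𝓝 x] β')
    (hβ : ContactAt β x) : ContactAt β' x := by
  refine ⟨h.eq_of_nhds ▸ hβ.ne_zero, fun v hv hw => hβ.nondegenerate v ?_ fun w h1 => ?_⟩
  · rw [h.eq_of_nhds, hv]
  · rw [extD_congr h]
    exact hw w (by rw [← h.eq_of_nhds, h1])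

end EuclideanForms

/-! ### Pullback of forms to normed spaces; naturality of the exterior derivative -/

section Pullback

variable {E : Type*} [NormedAddCommGroup E] [NormedSpace ℝ E]
  {B : Type*} [TopologicalSpace B] {I : ModelWithCorners ℝ E B}
  {M : Type*} [TopologicalSpace M] [ChartedSpace B M]
  {V : Type*} [NormedAddCommGroup V] [NormedSpace ℝ V]
  {V' : Type*} [NormedAddCommGroup V'] [NormedSpace ℝ V']

/-- The pullback of a one-form under a map from a normed space. -/
def OneForm.pb (α : OneForm I M) (Φ : V → M) : V → V →L[ℝ] ℝ := fun x =>
  (show E →L[ℝ] ℝ from α (Φ x)).comp (show V →L[ℝ] E from mfderiv 𝓘(ℝ, V) I Φ x)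

theorem OneForm.pb_apply (α : OneForm I M) (Φ : V → M) (x v : V) :
    α.pb Φ x v = α (Φ x) (mfderiv 𝓘(ℝ, V) I Φ x v) := rfl

theorem OneForm.pb_congr (α : OneForm I M) {Φ Ψ : V → M} {x : V} (h : Φ =ᶠ[𝓝 x] Ψ) :
    α.pb Φ =ᶠ[𝓝 x] α.pb Ψ := by
  filter_upwards [eventually_eventually_nhds.2 h] with y hy
  have hy' : Φ =ᶠ[𝓝 y] Ψ := hy
  ext v
  rw [OneForm.pb_apply, OneForm.pb_apply, hy'.mfderiv_eq]
  have := hy'.eq_of_nhds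
  congr 2

theorem OneForm.pb_comp (α : OneForm I M) {Φ : V → M} {τ : V' → V} {x : V'}
    (hΦ : MDifferentiableAt 𝓘(ℝ, V) I Φ (τ x)) (hτ : DifferentiableAt ℝ τ x) :
    α.pb (Φ ∘ τ) x = (α.pb Φ (τ x)).comp (fderiv ℝ τ x) := by
  ext v
  rw [OneForm.pb_apply, mfderiv_comp x hΦ hτ.mdifferentiableAt, mfderiv_eq_fderiv]
  rfl

variable [IsManifold I ∞ M]

theorem contDiffAt_extChartAt_comp {Φ : V → M} {x₀ : V} {n : WithTop ℕ∞} 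
    (hn : n ≤ ∞)
    (hΦ : ContMDiffAt 𝓘(ℝ, V) I n Φ x₀) (p : M) (hp : Φ x₀ ∈ (extChartAt I p).source) :
    ContDiffAt ℝ n (extChartAt I p ∘ Φ) x₀ := by
  rw [← contMDiffAt_iff_contDiffAt]
  refine ContMDiffAt.comp x₀ ?_ hΦ
  exact ((contMDiffOn_extChartAt (n := ∞)).contMDiffAt
    ((isOpen_extChartAt_source p).mem_nhds hp |> fun h => by simpa using h)).of_le hn

/-- Chain rule for `Φ = chart⁻¹ ∘ (chart ∘ Φ)`. Near the boundary the inverse chart is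
differentiable only within `range I`, but that is where `chart ∘ Φ` takes its values. -/
theorem OneForm.pb_eq_chartRep (α : OneForm I M) {Φ : V → M} {x₀ : V} (p : M)
    (hΦ : ContMDiffAt 𝓘(ℝ, V) I 1 Φ x₀) (hp : Φ x₀ ∈ (extChartAt I p).source) :
    ∀ᶠ x in 𝓝 x₀, extChartAt I p (Φ x) ∈ (extChartAt I p).target ∧
      α.pb Φ x = (α.chartRep p (extChartAt I p (Φ x))).comp
        (fderiv ℝ (extChartAt I p ∘ Φ) x) := by
  have h1 : ∀ᶠ x in 𝓝 x₀, Φ x ∈ (extChartAt I p).source :=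
    hΦ.continuousAt.preimage_mem_nhds ((isOpen_extChartAt_source p).mem_nhds hp)
  have h2 : ∀ᶠ x in 𝓝 x₀, ContMDiffAt 𝓘(ℝ, V) I 1 Φ x := (contMDiffAt_iff_contMDiffAt_nhds (by simp)).1 hΦ
  filter_upwards [h1.eventually_nhds, h2] with x hx hx2
  have hxs := hx.self_of_nhds
  refine ⟨(extChartAt I p).map_source hxs, ?_⟩
  have hg := contDiffAt_extChartAt_comp (by simp) hx2 p hxs
  have hd : MDifferentiableAt 𝓘(ℝ, V) 𝓘(ℝ, E) (extChartAt I p ∘ Φ) x :=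
    (hg.differentiableAt (by simp)).mdifferentiableAt
  have hs : MDifferentiableWithinAt 𝓘(ℝ, E) I (extChartAt I p).symm (range I)
      ((extChartAt I p ∘ Φ) x) :=
    mdifferentiableWithinAt_extChartAt_symm ((extChartAt I p).map_source hxs)
  have hcomp := mfderivWithin_comp (s := univ) x hs hd.mdifferentiableWithinAt
    (fun y _ => by
      simp only [mem_preimage, Function.comp, extChartAt, OpenPartialHomeomorph.extend,
        PartialEquiv.coe_trans, ModelWithCorners.toPartialEquiv_coe]
      exact mem_range_self _) (uniqueMDiffWithinAt_univ _)
  have heq : Φ =ᶠ[𝓝 x] (extChartAt I p).symm ∘ (extChartAt I p ∘ Φ) := by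
    filter_upwards [hx] with y hy
    exact ((extChartAt I p).left_inv hy).symm
  ext v
  rw [OneForm.pb_apply, heq.mfderiv_eq, ← mfderivWithin_univ, hcomp, mfderivWithin_univ,
    mfderiv_eq_fderiv]
  simp only [OneForm.chartRep]
  have e1 : Φ x = (extChartAt I p).symm (extChartAt I p (Φ x)) :=
    ((extChartAt I p).left_inv hxs).symm
  simp only [Function.comp]
  congr 2

theorem OneForm.IsSmooth.contDiffAt_pb {α : OneForm I M} (hα : α.IsSmooth) {Φ : V → M} {x₀ : V}
    (hΦ : ContMDiffAt 𝓘(ℝ, V) I ∞ Φ x₀) : ContDiffAt ℝ ∞ (α.pb Φ) x₀ := by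
  set p := Φ x₀ with hp
  have hp' : Φ x₀ ∈ (extChartAt I p).source := mem_extChartAt_source p
  have h := α.pb_eq_chartRep p (hΦ.of_le (by simp)) hp'
  have hg := contDiffAt_extChartAt_comp le_rfl hΦ p hp'
  refine ContDiffAt.congr_of_eventuallyEq ?_ (h.mono fun x hx => hx.2)
  have h1 : ContDiffAt ℝ ∞ (fun x => α.chartRep p (extChartAt I p (Φ x))) x₀ := by
    have := (hα p) (extChartAt I p (Φ x₀)) ((extChartAt I p).map_source hp')
    rw [← contDiffWithinAt_univ]
    have hc := ContDiffWithinAt.comp_of_preimage_mem_nhdsWithin (g := α.chartRep p)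
      (f := extChartAt I p ∘ Φ) (s := univ) x₀ this hg.contDiffWithinAt ?_
    · exact hc
    · rw [nhdsWithin_univ]
      exact h.mono fun x hx => hx.1
  exact h1.clm_comp (hg.fderiv_right (m := ∞) (by simp))

/-- Product rule applied to the chart expression of the pullback; the terms with the second
derivative of `Φ` cancel by symmetry. Since `OneForm.d` is defined through preferred charts, this is
what allows `dα` to be computed in any parametrization. -/
theorem OneForm.d_pullback {α : OneForm I M} (hα : α.IsSmooth) {Φ : V → M} {x₀ : V}
    (hΦ : ContMDiffAt 𝓘(ℝ, V) I ∞ Φ x₀) (v w : V) :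
    α.d (Φ x₀) (mfderiv 𝓘(ℝ, V) I Φ x₀ v) (mfderiv 𝓘(ℝ, V) I Φ x₀ w) =
      extD (α.pb Φ) x₀ v w := by
  set p := Φ x₀ with hp
  have hp' : Φ x₀ ∈ (extChartAt I p).source := mem_extChartAt_source p
  have h := α.pb_eq_chartRep p (hΦ.of_le (by simp)) hp'
  have hg := contDiffAt_extChartAt_comp le_rfl hΦ p hp'
  set g : V → E := extChartAt I p ∘ Φ with hgdef
  set A := fderivWithin ℝ (α.chartRep p) (range I) (extChartAt I p p) with hA
  have hder : HasFDerivWithinAt (α.chartRep p) A (range I) (g x₀) := by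
    have h1 := (hα p).differentiableOn (by simp) (extChartAt I p p)
      ((extChartAt I p).map_source (mem_extChartAt_source p))
    have h2 : DifferentiableWithinAt ℝ (α.chartRep p) (range I) (extChartAt I p p) :=
      h1.mono_of_mem_nhdsWithin (extChartAt_target_mem_nhdsWithin p)
    exact h2.hasFDerivWithinAt
  have hgd : HasFDerivAt g (fderiv ℝ g x₀) x₀ := (hg.differentiableAt (by simp)).hasFDerivAt
  have hcomp : HasFDerivAt (fun x => α.chartRep p (g x)) (A.comp (fderiv ℝ g x₀)) x₀ := by
    rw [← hasFDerivWithinAt_univ]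
    exact hder.comp x₀ hgd.hasFDerivWithinAt (fun y _ => by
      simp only [hgdef, Function.comp, extChartAt, OpenPartialHomeomorph.extend,
        PartialEquiv.coe_trans, ModelWithCorners.toPartialEquiv_coe]
      exact mem_range_self _)
  have hg2 : HasFDerivAt (fderiv ℝ g) (fderiv ℝ (fderiv ℝ g) x₀) x₀ :=
    ((hg.fderiv_right (m := ∞) (by simp)).differentiableAt (by simp)).hasFDerivAt
  have hpb : fderiv ℝ (α.pb Φ) x₀ = _ :=
    ((hcomp.clm_comp hg2).congr_of_eventuallyEq (h.mono fun x hx => hx.2)).fderiv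
  have hsymm : IsSymmSndFDerivAt ℝ g x₀ := hg.isSymmSndFDerivAt
    (by simp only [minSmoothness_of_isRCLikeNormedField]; exact WithTop.coe_le_coe.2 (le_top : (2 : ℕ∞) ≤ ⊤))
  have hmf : mfderiv 𝓘(ℝ, V) I Φ x₀ = fderiv ℝ g x₀ := by
    rw [MDifferentiableAt.mfderiv (hΦ.mdifferentiableAt (by simp))]
    simp only [modelWithCornersSelf_coe, range_id, fderivWithin_univ]
    rfl
  have key : ∀ a b : E, a = fderiv ℝ g x₀ v → b = fderiv ℝ g x₀ w →
      A a b - A b a = extD (α.pb Φ) x₀ v w := by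
    intro a b ha hb
    have e3 := hsymm v w
    simp only [extD, hpb, add_apply, ContinuousLinearMap.comp_apply,
      ContinuousLinearMap.compL_apply, ContinuousLinearMap.flip_apply, ha, hb, e3]
    ring
  exact key _ _ (DFunLike.congr_fun hmf v) (DFunLike.congr_fun hmf w)

end Pullback
end

noncomputable section
open Filter Topology

/-! ### Local parametrizations, and testing forms in them -/

section Params

variable {E : Type*} [NormedAddCommGroup E] [NormedSpace ℝ E]
  {B : Type*} [TopologicalSpace B] {I : ModelWithCorners ℝ E B}
  {M : Type*} [TopologicalSpace M] [ChartedSpace B M] [IsManifold I ∞ M]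
  {V : Type*} [NormedAddCommGroup V] [NormedSpace ℝ V]
  {V' : Type*} [NormedAddCommGroup V'] [NormedSpace ℝ V']

variable (I) in
/-- A smooth map from a normed space whose derivative at `x` is bijective. -/
structure IsParamAt (Φ : V → M) (x : V) : Prop where
  smooth : ContMDiffAt 𝓘(ℝ, V) I ∞ Φ x
  bijective : Function.Bijective (mfderiv 𝓘(ℝ, V) I Φ x)

theorem IsParamAt.mdiff {Φ : V → M} {x : V} (h : IsParamAt I Φ x) :
    MDifferentiableAt 𝓘(ℝ, V) I Φ x := h.smooth.mdifferentiableAt (by simp)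

theorem isParamAt_extChartAt_symm (p : M) {x : E} (hx : x ∈ (extChartAt I p).target)
    (hx' : range I ∈ 𝓝 x) : IsParamAt I (extChartAt I p).symm x := by
  have ht : (extChartAt I p).target ∈ 𝓝 x := by
    have := extChartAt_target_mem_nhdsWithin_of_mem (I := I) hx
    rwa [nhdsWithin_eq_nhds.2 hx'] at this
  refine ⟨(contMDiffOn_extChartAt_symm p).contMDiffAt ht, ?_⟩
  have h1 := mfderiv_extChartAt_comp_mfderivWithin_extChartAt_symm (I := I) hx
  have h2 := mfderivWithin_extChartAt_symm_comp_mfderiv_extChartAt (I := I) hx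
  rw [mfderivWithin_eq_mfderiv (uniqueMDiffWithinAt_iff_uniqueDiffWithinAt.2
    (uniqueDiffWithinAt_of_mem_nhds hx')) ((contMDiffOn_extChartAt_symm p).contMDiffAt ht
      |>.mdifferentiableAt (by simp : (∞ : WithTop ℕ∞) ≠ 0))] at h1 h2
  refine ⟨Function.LeftInverse.injective fun v => DFunLike.congr_fun h1 v,
    Function.RightInverse.surjective fun v => DFunLike.congr_fun h2 v⟩

theorem exists_isParamAt_of_isInteriorPoint (p : M) (hp : I.IsInteriorPoint p) :
    ∃ (Φ : E → M) (x : E), Φ x = p ∧ IsParamAt I Φ x :=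
  ⟨(extChartAt I p).symm, extChartAt I p p, extChartAt_to_inv p,
    isParamAt_extChartAt_symm p (mem_extChartAt_target p) (range_mem_nhds_isInteriorPoint hp)⟩

theorem IsParamAt.comp {Φ : V → M} {τ : V' → V} {x : V'} (h : IsParamAt I Φ (τ x))
    (hτ : ContDiffAt ℝ ∞ τ x) (hb : Function.Bijective (fderiv ℝ τ x)) :
    IsParamAt I (Φ ∘ τ) x := by
  refine ⟨h.smooth.comp x hτ.contMDiffAt, ?_⟩
  rw [mfderiv_comp x h.mdiff (hτ.differentiableAt (by simp)).mdifferentiableAt, mfderiv_eq_fderiv]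
  exact h.bijective.comp hb

/-- The inverse function theorem for `Φ` read in the chart at `Φ x₀`, followed by that chart. The
boundary of `M` plays no role: the chart expression is a map between normed spaces with bijective
derivative. -/
theorem IsParamAt.exists_localInverse [CompleteSpace V] [CompleteSpace E] {Φ : V → M} {x₀ : V}
    (h : IsParamAt I Φ x₀) :
    ∃ σ : M → V, ContMDiffAt I 𝓘(ℝ, V) ∞ σ (Φ x₀) ∧ σ (Φ x₀) = x₀ ∧
      (∀ᶠ y in 𝓝 (Φ x₀), Φ (σ y) = y) ∧ ∀ᶠ x in 𝓝 x₀, σ (Φ x) = x := by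
  set p := Φ x₀ with hp
  have hp' : Φ x₀ ∈ (extChartAt I p).source := mem_extChartAt_source p
  have hg := contDiffAt_extChartAt_comp le_rfl h.smooth p hp'
  set g : V → E := extChartAt I p ∘ Φ with hgdef
  have hmf : mfderiv 𝓘(ℝ, V) I Φ x₀ = fderiv ℝ g x₀ := by
    rw [MDifferentiableAt.mfderiv h.mdiff]
    simp only [modelWithCornersSelf_coe, range_id, fderivWithin_univ]
    rfl
  have hb : Function.Bijective (fderiv ℝ g x₀) := by
    have := h.bijective
    rw [hmf] at this
    exact this
  let e : V ≃L[ℝ] E := ContinuousLinearEquiv.ofBijective (fderiv ℝ g x₀)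
    (LinearMap.ker_eq_bot.2 hb.1) (LinearMap.range_eq_top.2 hb.2)
  have he : HasFDerivAt g (e : V →L[ℝ] E) x₀ := by
    have : (e : V →L[ℝ] E) = fderiv ℝ g x₀ := by ext; rfl
    rw [this]
    exact (hg.differentiableAt (by simp)).hasFDerivAt
  let h' := hg.toOpenPartialHomeomorph g he (by simp)
  have hs : x₀ ∈ h'.source := hg.mem_toOpenPartialHomeomorph_source he (by simp)
  have hc : (h' : V → E) = g := rfl
  have hgx : g x₀ = extChartAt I p p := rfl
  have hsm : ContDiffAt ℝ ∞ h'.symm (g x₀) := hg.to_localInverse he (by simp)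
  have hcp : ContMDiffAt I 𝓘(ℝ, E) ∞ (extChartAt I p) p := contMDiffAt_extChartAt
  have hσ : ContMDiffAt I 𝓘(ℝ, V) ∞ (h'.symm ∘ extChartAt I p) p :=
    ContMDiffAt.comp p (by rw [← hgx]; exact hsm.contMDiffAt) hcp
  have hσp : (h'.symm ∘ extChartAt I p) p = x₀ := by
    have := h'.left_inv hs
    rwa [hc] at this
  refine ⟨h'.symm ∘ extChartAt I p, hσ, hσp, ?_, ?_⟩
  · have h1 : ∀ᶠ y in 𝓝 p, extChartAt I p y ∈ h'.target :=
      hcp.continuousAt.preimage_mem_nhds (h'.open_target.mem_nhds (h'.map_source hs))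
    have h2 : ∀ᶠ y in 𝓝 p, Φ ((h'.symm ∘ extChartAt I p) y) ∈ (extChartAt I p).source := by
      have : ContinuousAt (Φ ∘ (h'.symm ∘ extChartAt I p)) p :=
        ContinuousAt.comp (by rw [hσp]; exact h.smooth.continuousAt) hσ.continuousAt
      refine this.preimage_mem_nhds ((isOpen_extChartAt_source p).mem_nhds ?_)
      simp only [Function.comp] at hσp ⊢
      rw [hσp]
      exact hp'
    filter_upwards [h1, h2, extChartAt_source_mem_nhds (I := I) p] with y h1 h2 h3
    refine (extChartAt I p).injOn h2 h3 ?_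
    have := h'.right_inv h1
    rwa [hc] at this
  · filter_upwards [h'.open_source.mem_nhds hs] with x hx
    have := h'.left_inv hx
    rwa [hc] at this

theorem IsParamAt.map_nhds_eq [CompleteSpace V] [CompleteSpace E] {Φ : V → M} {x₀ : V}
    (h : IsParamAt I Φ x₀) : map Φ (𝓝 x₀) = 𝓝 (Φ x₀) := by
  refine le_antisymm h.smooth.continuousAt fun S hS => ?_
  obtain ⟨σ, hσ, hx, h1, -⟩ := h.exists_localInverse
  have : ∀ᶠ y in 𝓝 (Φ x₀), σ y ∈ Φ ⁻¹' S :=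
    hσ.continuousAt.preimage_mem_nhds (by rw [hx]; exact hS)
  filter_upwards [this, h1] with y hy h1
  rw [← h1]
  exact hy

/-- Smoothness of a form at a point can be tested in a single parametrization `Φ`, because any other
map `Ψ` is locally `Φ ∘ (σ ∘ Ψ)` with a local inverse `σ` of `Φ`. -/
theorem OneForm.contDiffAt_pb_of_isParamAt [CompleteSpace V] [CompleteSpace E]
    {α : OneForm I M} {Φ : V → M} {x₀ : V}
    (h : IsParamAt I Φ x₀) (hα : ContDiffAt ℝ ∞ (α.pb Φ) x₀) {Ψ : V' → M} {y₀ : V'}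
    (hΨ : ContMDiffAt 𝓘(ℝ, V') I ∞ Ψ y₀) (he : Ψ y₀ = Φ x₀) :
    ContDiffAt ℝ ∞ (α.pb Ψ) y₀ := by
  obtain ⟨σ, hσ, hx, h1, -⟩ := h.exists_localInverse
  have hτ : ContDiffAt ℝ ∞ (σ ∘ Ψ) y₀ := by
    rw [← contMDiffAt_iff_contDiffAt]
    exact ContMDiffAt.comp y₀ (by rw [he]; exact hσ) hΨ
  have hτ0 : (σ ∘ Ψ) y₀ = x₀ := by simp only [Function.comp, he, hx]
  have e1 : Ψ =ᶠ[𝓝 y₀] Φ ∘ (σ ∘ Ψ) := by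
    have := hΨ.continuousAt.preimage_mem_nhds (t := {y | Φ (σ y) = y}) (by rw [he]; exact h1)
    filter_upwards [this] with y hy
    exact (show Φ (σ (Ψ y)) = Ψ y from hy).symm
  have e2 : ∀ᶠ x in 𝓝 x₀, MDifferentiableAt 𝓘(ℝ, V) I Φ x :=
    ((contMDiffAt_iff_contMDiffAt_nhds (by simp)).1 (h.smooth.of_le
      (by simp : (1 : WithTop ℕ∞) ≤ ∞))).mono fun x hx => hx.mdifferentiableAt (by simp)
  have e3 : ∀ᶠ y in 𝓝 y₀, DifferentiableAt ℝ (σ ∘ Ψ) y :=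
    ((hτ.of_le (by simp : (1 : WithTop ℕ∞) ≤ ∞)).eventually (by simp)).mono
      fun x hx => hx.differentiableAt (by simp)
  have e4 : ∀ᶠ y in 𝓝 y₀, MDifferentiableAt 𝓘(ℝ, V) I Φ ((σ ∘ Ψ) y) :=
    hτ.continuousAt.eventually (by rw [hτ0]; exact e2)
  have e5 : α.pb Ψ =ᶠ[𝓝 y₀] fun y => (α.pb Φ ((σ ∘ Ψ) y)).comp (fderiv ℝ (σ ∘ Ψ) y) := by
    filter_upwards [α.pb_congr e1, e3, e4] with y h1 h2 h3
    rw [h1, α.pb_comp h3 h2]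
  refine ContDiffAt.congr_of_eventuallyEq ?_ e5
  exact (ContDiffAt.comp y₀ (by rw [hτ0]; exact hα) hτ).clm_comp (hτ.fderiv_right (by simp))

theorem OneForm.isSmooth_of_params [I.Boundaryless] [CompleteSpace V] [CompleteSpace E]
    {α : OneForm I M}
    (h : ∀ p, ∃ (Φ : V → M) (x : V), Φ x = p ∧ IsParamAt I Φ x ∧ ContDiffAt ℝ ∞ (α.pb Φ) x) :
    α.IsSmooth := by
  intro p y hy
  obtain ⟨Φ, x, hx, hΦ, hs⟩ := h ((extChartAt I p).symm y)
  have hp : ContMDiffAt 𝓘(ℝ, E) I ∞ (extChartAt I p).symm y :=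
    (contMDiffOn_extChartAt_symm p).contMDiffAt ((isOpen_extChartAt_target p).mem_nhds hy)
  have := OneForm.contDiffAt_pb_of_isParamAt hΦ hs hp hx.symm
  have e : α.chartRep p = α.pb (extChartAt I p).symm := by
    funext z
    simp only [OneForm.chartRep, I.range_eq_univ, mfderivWithin_univ]
    rfl
  rw [e]
  exact this.contDiffWithinAt

theorem OneForm.d_zero_left (α : OneForm I M) (p : M) (w : TangentSpace I p) :
    α.d p 0 w = 0 := by
  have : ∀ (A : E →L[ℝ] E →L[ℝ] ℝ) (w : E), A 0 w - A w 0 = 0 := by simp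
  exact this _ _

theorem OneForm.d_swap (α : OneForm I M) (p : M) (v w : TangentSpace I p) :
    α.d p v w = -α.d p w v := by
  simp only [OneForm.d]
  ring

theorem OneForm.d_zero_right (α : OneForm I M) (p : M) (w : TangentSpace I p) :
    α.d p w 0 = 0 := by
  rw [OneForm.d_swap, OneForm.d_zero_left, neg_zero]

theorem OneForm.d_self (α : OneForm I M) (p : M) (w : TangentSpace I p) :
    α.d p w w = 0 := by
  simp [OneForm.d]

/-- A vector killed by the derivative of `Φ` is in the kernel of `Φ^*α` and of `d(Φ^*α) = Φ^*dα`,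
which meet only in zero. This turns the pullback formulas of the open book into immersion
statements. -/
theorem injective_mfderiv_of_contactAt {α : OneForm I M} (hα : α.IsSmooth) {Φ : V → M} {x : V}
    (hΦ : ContMDiffAt 𝓘(ℝ, V) I ∞ Φ x) (hc : ContactAt (α.pb Φ) x) :
    Function.Injective (mfderiv 𝓘(ℝ, V) I Φ x) := by
  have key : ∀ v : V, mfderiv 𝓘(ℝ, V) I Φ x v = 0 → v = 0 := by
    intro v hv
    refine hc.nondegenerate v ?_ fun w _ => ?_
    · rw [OneForm.pb_apply]
      exact (congrArg (α (Φ x)) hv).trans (map_zero _)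
    · rw [← OneForm.d_pullback hα hΦ]
      exact (congrArg (fun u => α.d (Φ x) u (mfderiv 𝓘(ℝ, V) I Φ x w)) hv).trans
        (OneForm.d_zero_left _ _ _)
  exact (injective_iff_map_eq_zero _).2 key

theorem isParamAt_of_injective [FiniteDimensional ℝ V] [FiniteDimensional ℝ E]
    (hd : Module.finrank ℝ V = Module.finrank ℝ E) {Φ : V → M} {x : V}
    (hΦ : ContMDiffAt 𝓘(ℝ, V) I ∞ Φ x) (hi : Function.Injective (mfderiv 𝓘(ℝ, V) I Φ x)) :
    IsParamAt I Φ x :=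
  ⟨hΦ, hi, (LinearMap.injective_iff_surjective_of_finrank_eq_finrank
    (f := ((show V →L[ℝ] E from mfderiv 𝓘(ℝ, V) I Φ x) : V →ₗ[ℝ] E)) hd).1 hi⟩

theorem IsContactForm.contactAt_pb {α : OneForm I M} (hα : IsContactForm α) {Φ : V → M} {x : V}
    (h : IsParamAt I Φ x) : ContactAt (α.pb Φ) x := by
  refine ⟨fun h0 => hα.ne_zero (Φ x) ?_, fun v hv hw => ?_⟩
  · ext v
    obtain ⟨u, rfl⟩ := h.bijective.2 v
    exact DFunLike.congr_fun h0 u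
  · refine h.bijective.1 (Eq.trans ?_ (map_zero (mfderiv 𝓘(ℝ, V) I Φ x)).symm)
    refine hα.nondegenerate (Φ x) _ hv fun w hw' => ?_
    obtain ⟨u, rfl⟩ := h.bijective.2 w
    exact (OneForm.d_pullback hα.smooth h.smooth v u).trans (hw u hw')

theorem isContactForm_of_params {α : OneForm I M} (hα : α.IsSmooth)
    (h : ∀ p, ∃ (Φ : V → M) (x : V), Φ x = p ∧ IsParamAt I Φ x ∧ ContactAt (α.pb Φ) x) :
    IsContactForm α := by
  refine ⟨hα, fun p h0 => ?_, fun p v hv hw => ?_⟩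
  · obtain ⟨Φ, x, rfl, hΦ, hc⟩ := h p
    refine hc.ne_zero ?_
    ext v
    rw [OneForm.pb_apply, h0]
    rfl
  · obtain ⟨Φ, x, rfl, hΦ, hc⟩ := h p
    obtain ⟨u, rfl⟩ := hΦ.bijective.2 v
    have : u = 0 := hc.nondegenerate u hv fun w h1 => by
      exact (OneForm.d_pullback hα hΦ.smooth u w).symm.trans (hw _ h1)
    exact (congrArg _ this).trans (map_zero (mfderiv 𝓘(ℝ, V) I Φ x))

theorem dFun_apply_mfderiv {f : M → ℝ} {Φ : V → M} {x : V}
    (hf : MDifferentiableAt I 𝓘(ℝ, ℝ) f (Φ x)) (hΦ : MDifferentiableAt 𝓘(ℝ, V) I Φ x) (v : V) :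
    dFun I f (Φ x) (mfderiv 𝓘(ℝ, V) I Φ x v) = fderiv ℝ (f ∘ Φ) x v := by
  rw [← mfderiv_eq_fderiv, mfderiv_comp x hf hΦ]
  rfl

end Params

/-! ### The exterior derivative of `e^t α` -/

section Symplectization

variable {E : Type*} [NormedAddCommGroup E] [NormedSpace ℝ E] [CompleteSpace E]
  {B : Type*} [TopologicalSpace B] {I : ModelWithCorners ℝ E B} [I.Boundaryless]
  {M : Type*} [TopologicalSpace M] [ChartedSpace B M] [IsManifold I ∞ M]

theorem symplectization_pb {V : Type*} [NormedAddCommGroup V] [NormedSpace ℝ V]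
    (α : OneForm I M) {Φ : V → M} {x : V}
    (hΦ : MDifferentiableAt 𝓘(ℝ, V) I Φ x) (t : ℝ) :
    (symplectizationForm α).pb (fun p : ℝ × V => (p.1, Φ p.2)) (t, x) =
      Real.exp t • (α.pb Φ x).comp (ContinuousLinearMap.snd ℝ ℝ V) ∧
    ∀ v : ℝ × V, mfderiv 𝓘(ℝ, ℝ × V) (𝓘(ℝ, ℝ).prod I) (fun p : ℝ × V => (p.1, Φ p.2)) (t, x) v =
      (v.1, mfderiv 𝓘(ℝ, V) I Φ x v.2) := by
  have h1 : HasMFDerivAt 𝓘(ℝ, ℝ × V) 𝓘(ℝ, ℝ) (Prod.fst : ℝ × V → ℝ) (t, x)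
      (ContinuousLinearMap.fst ℝ ℝ V) := hasFDerivAt_fst.hasMFDerivAt
  have h2 : HasMFDerivAt 𝓘(ℝ, ℝ × V) 𝓘(ℝ, V) (Prod.snd : ℝ × V → V) (t, x)
      (ContinuousLinearMap.snd ℝ ℝ V) := hasFDerivAt_snd.hasMFDerivAt
  have h3 := h1.prodMk (HasMFDerivAt.comp (t, x) (g := Φ) hΦ.hasMFDerivAt h2)
  have key : ∀ v : ℝ × V, mfderiv 𝓘(ℝ, ℝ × V) (𝓘(ℝ, ℝ).prod I)
      (fun p : ℝ × V => (p.1, Φ p.2)) (t, x) v = (v.1, mfderiv 𝓘(ℝ, V) I Φ x v.2) :=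
    fun v => DFunLike.congr_fun h3.mfderiv v
  refine ⟨?_, key⟩
  refine ContinuousLinearMap.ext fun v => ?_
  rw [OneForm.pb_apply]
  exact congrArg (symplectizationForm α (t, Φ x)) (key v)

theorem extD_symplectization {V : Type*} [NormedAddCommGroup V] [NormedSpace ℝ V]
    {β : V → V →L[ℝ] ℝ} {x : V} (hβ : DifferentiableAt ℝ β x) (t : ℝ) (v w : ℝ × V) :
    extD (fun p : ℝ × V => Real.exp p.1 • (β p.2).comp (ContinuousLinearMap.snd ℝ ℝ V)) (t, x) v w
      = Real.exp t * (extD β x v.2 w.2 + v.1 * β x w.2 - w.1 * β x v.2) := by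
  have h1 : HasFDerivAt (fun p : ℝ × V => Real.exp p.1)
      (Real.exp t • ContinuousLinearMap.fst ℝ ℝ V) (t, x) :=
    (Real.hasDerivAt_exp t).comp_hasFDerivAt (t, x) (f := Prod.fst) hasFDerivAt_fst
  have h2 : HasFDerivAt (fun p : ℝ × V => β p.2)
      ((fderiv ℝ β x).comp (ContinuousLinearMap.snd ℝ ℝ V)) (t, x) :=
    HasFDerivAt.comp (t, x) (g := β) (f := Prod.snd) hβ.hasFDerivAt hasFDerivAt_snd
  have h3 : HasFDerivAt (fun p : ℝ × V => (β p.2).comp (ContinuousLinearMap.snd ℝ ℝ V))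
      (((ContinuousLinearMap.compL ℝ (ℝ × V) V ℝ).flip (ContinuousLinearMap.snd ℝ ℝ V)).comp
        ((fderiv ℝ β x).comp (ContinuousLinearMap.snd ℝ ℝ V))) (t, x) :=
    HasFDerivAt.comp (t, x)
      (g := (ContinuousLinearMap.compL ℝ (ℝ × V) V ℝ).flip (ContinuousLinearMap.snd ℝ ℝ V))
      (ContinuousLinearMap.hasFDerivAt _) h2
  have h4 : HasFDerivAt (fun p : ℝ × V =>
      Real.exp p.1 • (β p.2).comp (ContinuousLinearMap.snd ℝ ℝ V)) _ (t, x) := h1.smul h3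
  rw [extD, h4.fderiv]
  simp only [extD, add_apply, smul_apply, ContinuousLinearMap.comp_apply,
    ContinuousLinearMap.compL_apply, ContinuousLinearMap.flip_apply,
    ContinuousLinearMap.smulRight_apply, ContinuousLinearMap.coe_fst', ContinuousLinearMap.coe_snd',
    smul_eq_mul]
  ring

theorem contMDiffAt_symplectization_param {V : Type*} [NormedAddCommGroup V] [NormedSpace ℝ V]
    {Φ : V → M} {x : V} (hΦ : ContMDiffAt 𝓘(ℝ, V) I ∞ Φ x) (t : ℝ) :
    ContMDiffAt 𝓘(ℝ, ℝ × V) (𝓘(ℝ, ℝ).prod I) ∞ (fun p : ℝ × V => (p.1, Φ p.2)) (t, x) :=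
  (contDiff_fst.contMDiff.contMDiffAt).prodMk
    (ContMDiffAt.comp (t, x) (g := Φ) hΦ contDiff_snd.contMDiff.contMDiffAt)

theorem symplectization_param {V : Type*} [NormedAddCommGroup V] [NormedSpace ℝ V]
    {Φ : V → M} {x : V} (hΦ : IsParamAt I Φ x) (t : ℝ) :
    IsParamAt (𝓘(ℝ, ℝ).prod I) (fun p : ℝ × V => (p.1, Φ p.2)) (t, x) := by
  have h := (symplectization_pb (fun _ => 0) hΦ.mdiff t).2
  refine ⟨contMDiffAt_symplectization_param hΦ.smooth t, fun (v : ℝ × V) (w : ℝ × V) hvw => ?_,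
    fun (u : ℝ × E) => ?_⟩
  · have h' : ((v.1, mfderiv 𝓘(ℝ, V) I Φ x v.2) : ℝ × E) = (w.1, mfderiv 𝓘(ℝ, V) I Φ x w.2) :=
      (h v).symm.trans (hvw.trans (h w))
    have h1 : v.1 = w.1 := congrArg (Prod.fst : ℝ × E → ℝ) h'
    have h2 : v.2 = w.2 := hΦ.bijective.1 (congrArg (Prod.snd : ℝ × E → E) h')
    exact Prod.ext h1 h2
  · obtain ⟨v, hv⟩ := hΦ.bijective.2 u.2
    exact ⟨(u.1, v), (h (u.1, v)).trans (Prod.ext rfl hv)⟩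

theorem symplectization_pb_eventually {V : Type*} [NormedAddCommGroup V] [NormedSpace ℝ V]
    (α : OneForm I M) {Φ : V → M} {x : V} (hΦ : ContMDiffAt 𝓘(ℝ, V) I ∞ Φ x) (t : ℝ) :
    (symplectizationForm α).pb (fun p : ℝ × V => (p.1, Φ p.2)) =ᶠ[𝓝 (t, x)]
      fun p => Real.exp p.1 • (α.pb Φ p.2).comp (ContinuousLinearMap.snd ℝ ℝ V) := by
  have e2 : ∀ᶠ x in 𝓝 x, MDifferentiableAt 𝓘(ℝ, V) I Φ x :=
    ((contMDiffAt_iff_contMDiffAt_nhds (by simp)).1 (hΦ.of_le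
      (by simp : (1 : WithTop ℕ∞) ≤ ∞))).mono fun x hx => hx.mdifferentiableAt (by simp)
  have e3 : ∀ᶠ p : ℝ × V in 𝓝 (t, x), MDifferentiableAt 𝓘(ℝ, V) I Φ p.2 :=
    (continuous_snd.tendsto (t, x)).eventually e2
  filter_upwards [e3] with p hp
  exact (symplectization_pb α hp p.1).1

theorem symplectizationForm_isSmooth {α : OneForm I M} (hα : α.IsSmooth) :
    (symplectizationForm α).IsSmooth := by
  refine OneForm.isSmooth_of_params (V := ℝ × E) fun p => ?_
  obtain ⟨Φ, x, hx, hΦ⟩ := exists_isParamAt_of_isInteriorPoint (I := I) p.2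
    (BoundarylessManifold.isInteriorPoint)
  refine ⟨fun q => (q.1, Φ q.2), (p.1, x), by simp [hx], symplectization_param hΦ p.1,
    ContDiffAt.congr_of_eventuallyEq ?_ (symplectization_pb_eventually α hΦ.smooth p.1)⟩
  have h1 : ContDiffAt ℝ ∞ (fun q : ℝ × E => α.pb Φ q.2) (p.1, x) :=
    ContDiffAt.comp (p.1, x) (g := α.pb Φ) (hα.contDiffAt_pb hΦ.smooth) contDiffAt_snd
  exact (Real.contDiff_exp.comp contDiff_fst).contDiffAt.smul (h1.clm_comp contDiffAt_const)

theorem symplectization_d {α : OneForm I M} (hα : α.IsSmooth) (t : ℝ) (y : M)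
    (τ σ : ℝ) (v w : TangentSpace I y) :
    (symplectizationForm α).d (t, y) (τ, v) (σ, w) =
      Real.exp t * (α.d y v w + τ * α y w - σ * α y v) := by
  obtain ⟨Φ, x, rfl, hΦ⟩ := exists_isParamAt_of_isInteriorPoint (I := I) y
    (BoundarylessManifold.isInteriorPoint)
  obtain ⟨v, rfl⟩ := hΦ.bijective.2 v
  obtain ⟨w, rfl⟩ := hΦ.bijective.2 w
  have h := (symplectization_pb α hΦ.mdiff t).2
  have hd := OneForm.d_pullback (symplectizationForm_isSmooth hα)
    (contMDiffAt_symplectization_param hΦ.smooth t) (τ, v) (σ, w)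
  rw [extD_congr (symplectization_pb_eventually α hΦ.smooth t), extD_symplectization
    ((hα.contDiffAt_pb hΦ.smooth).differentiableAt (by simp)), ← OneForm.d_pullback hα hΦ.smooth,
    OneForm.pb_apply, OneForm.pb_apply] at hd
  rw [← hd]
  exact congrArg₂ ((symplectizationForm α).d (t, Φ x)) (h (τ, v)).symm (h (σ, w)).symm

end Symplectization

/-! ### Reeb-invariant functions and complete integrability -/

section Integrable

variable {M : Type*} [TopologicalSpace M] [ChartedSpace (EuclideanSpace ℝ (Fin 3)) M]
  [IsManifold (𝓡 3) ∞ M]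

/-- A function on a contact three-manifold which is invariant under the Reeb flow and whose
differential does not vanish on a dense subset makes the symplectization integrable. -/
theorem isCompletelyIntegrable_of_reebInvariant {α : OneForm (𝓡 3) M} (hα : IsContactForm α)
    {f : M → ℝ} (hf : ContMDiff (𝓡 3) 𝓘(ℝ, ℝ) ∞ f)
    (hR : ∀ (y : M) (v : TangentSpace (𝓡 3) y), (∀ w, α.d y v w = 0) → dFun (𝓡 3) f y v = 0)
    (hd : Dense {y : M | dFun (𝓡 3) f y ≠ 0}) :
    IsCompletelyIntegrable (symplectizationForm α) ![Prod.fst, fun p => f p.2] := by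
  have hF : ∀ (t : ℝ) (y : M) (σ : ℝ) (w : TangentSpace (𝓡 3) y),
      dFun (𝓘(ℝ, ℝ).prod (𝓡 3)) (fun p : ℝ × M => f p.2) (t, y) (σ, w) = dFun (𝓡 3) f y w := by
    intro t y σ w
    have h1 : HasMFDerivAt (𝓘(ℝ, ℝ).prod (𝓡 3)) 𝓘(ℝ, ℝ) (fun p : ℝ × M => f p.2) (t, y) _ :=
      HasMFDerivAt.comp (t, y) (g := f) (f := Prod.snd)
      ((hf y).mdifferentiableAt (by simp)).hasMFDerivAt (hasMFDerivAt_snd (t, y))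
    exact DFunLike.congr_fun h1.mfderiv (show TangentSpace (𝓘(ℝ, ℝ).prod (𝓡 3)) (t, y) from (σ, w))
  have hT : ∀ (t : ℝ) (y : M) (σ : ℝ) (w : TangentSpace (𝓡 3) y),
      dFun (𝓘(ℝ, ℝ).prod (𝓡 3)) (Prod.fst : ℝ × M → ℝ) (t, y) (σ, w) = σ := by
    intro t y σ w
    exact DFunLike.congr_fun (hasMFDerivAt_fst (t, y)).mfderiv
      (show TangentSpace (𝓘(ℝ, ℝ).prod (𝓡 3)) (t, y) from (σ, w))
  have hkey' : ∀ (t : ℝ) (y : M) (τ : ℝ) (v : TangentSpace (𝓡 3) y)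
      (w : TangentSpace (𝓘(ℝ, ℝ).prod (𝓡 3)) (t, y)),
      (∀ x, (symplectizationForm α).d (t, y) (show TangentSpace (𝓘(ℝ, ℝ).prod (𝓡 3)) (t, y)
        from (τ, v)) x = -(dFun (𝓘(ℝ, ℝ).prod (𝓡 3)) Prod.fst (t, y) x)) →
      (∀ x, (symplectizationForm α).d (t, y) w x =
        -(dFun (𝓘(ℝ, ℝ).prod (𝓡 3)) (fun p : ℝ × M => f p.2) (t, y) x)) →
      (symplectizationForm α).d (t, y) (show TangentSpace (𝓘(ℝ, ℝ).prod (𝓡 3)) (t, y)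
        from (τ, v)) w = 0 := by
    intro t y τ v w hv hw
    have h1 : ∀ σ (u : TangentSpace (𝓡 3) y),
        Real.exp t * (α.d y v u + τ * α y u - σ * α y v) = -σ := fun σ u =>
      (symplectization_d hα.smooth t y τ σ v u).symm.trans
        ((hv (show TangentSpace (𝓘(ℝ, ℝ).prod (𝓡 3)) (t, y) from (σ, u))).trans
          (congrArg _ (hT t y σ u)))
    -- Pairing with `∂_t`, with `v` itself and with arbitrary `u` gives in turn `α v = e^{-t}`, `τ =
    -- 0` and `v ∈ ker dα`: the Hamiltonian field of `t` is `e^{-t}` times the Reeb field.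
    have h2 : Real.exp t * α y v = 1 := by
      have := h1 1 0
      rw [α.d_zero_right, map_zero] at this
      linarith
    have hτ : τ = 0 := by
      have := h1 0 v
      rw [α.d_self] at this
      linear_combination this - τ * h2
    have h3 : dFun (𝓡 3) f y v = 0 := by
      refine hR y v fun u => ?_
      have := h1 0 u
      rw [hτ] at this
      have h6 : Real.exp t * α.d y v u = 0 := by linear_combination this
      exact (mul_eq_zero.1 h6).resolve_left (Real.exp_pos t).ne'
    rw [OneForm.d_swap]
    have h7 := hw (show TangentSpace (𝓘(ℝ, ℝ).prod (𝓡 3)) (t, y) from (τ, v))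
    exact (congrArg Neg.neg (h7.trans (congrArg Neg.neg ((hF t y τ v).trans h3)))).trans (by simp)
  have hkey : ∀ (p : ℝ × M) (v w : TangentSpace (𝓘(ℝ, ℝ).prod (𝓡 3)) p),
    (∀ x, (symplectizationForm α).d p v x = -(dFun (𝓘(ℝ, ℝ).prod (𝓡 3)) Prod.fst p x)) →
    (∀ x, (symplectizationForm α).d p w x =
      -(dFun (𝓘(ℝ, ℝ).prod (𝓡 3)) (fun p : ℝ × M => f p.2) p x)) →
      (symplectizationForm α).d p v w = 0 := fun p v w => hkey' p.1 p.2 v.1 v.2 w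
  have hsymp : ∀ (t : ℝ) (y : M) (τ : ℝ) (v : TangentSpace (𝓡 3) y),
      (∀ w, (symplectizationForm α).d (t, y) (show TangentSpace (𝓘(ℝ, ℝ).prod (𝓡 3)) (t, y)
        from (τ, v)) w = 0) → τ = 0 ∧ v = 0 := by
    intro t y τ v hv
    have h1 : ∀ σ (u : TangentSpace (𝓡 3) y),
        α.d y v u + τ * α y u - σ * α y v = 0 := fun σ u =>
      (mul_eq_zero.1 ((symplectization_d hα.smooth t y τ σ v u).symm.trans
        (hv (show TangentSpace (𝓘(ℝ, ℝ).prod (𝓡 3)) (t, y) from (σ, u))))).resolve_left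
          (Real.exp_pos t).ne'
    have h2 : α y v = 0 := by
      have := h1 1 0
      rw [α.d_zero_right, map_zero] at this
      linarith
    have h3 : v = 0 := hα.nondegenerate y v h2 fun w hw => by
      have := h1 0 w
      rw [hw] at this
      linarith
    refine ⟨?_, h3⟩
    by_contra h
    refine hα.ne_zero y (ContinuousLinearMap.ext fun u => ?_)
    have := h1 0 u
    rw [h3, α.d_zero_left] at this
    have h5 : τ * α y u = 0 := by linarith
    exact (mul_eq_zero.1 h5).resolve_left h
  refine ⟨by simp, symplectizationForm_isSmooth hα.smooth, ?_, ?_, ?_, ?_⟩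
  · intro p v hv
    obtain ⟨h1, h2⟩ := hsymp p.1 p.2 v.1 v.2 hv
    exact Prod.ext h1 h2
  · intro i
    fin_cases i
    · exact contMDiff_fst
    · exact hf.comp contMDiff_snd
  · intro i j p v w hv hw
    have hself : ∀ (g : ℝ × M → ℝ)
        (_ : ∀ x, (symplectizationForm α).d p v x = -(dFun (𝓘(ℝ, ℝ).prod (𝓡 3)) g p x))
        (_ : ∀ x, (symplectizationForm α).d p w x = -(dFun (𝓘(ℝ, ℝ).prod (𝓡 3)) g p x)),
        (symplectizationForm α).d p v w = 0 := by
      intro g h1 h2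
      rw [h1 w, ← h2 w, OneForm.d_self]
    fin_cases i <;> fin_cases j
    · exact hself _ hv hw
    · exact hkey p v w hv hw
    · rw [OneForm.d_swap, hkey p w v hw hv, neg_zero]
    · exact hself _ hv hw
  · refine ((dense_univ (X := ℝ)).prod hd).mono ?_
    rintro ⟨t, y⟩ ⟨-, hy⟩
    have hind : ∀ (a b : ℝ), (∀ (σ : ℝ) (u : TangentSpace (𝓡 3) y),
        a * σ + b * dFun (𝓡 3) f y u = 0) → a = 0 ∧ b = 0 := by
      intro a b h
      have ha : a = 0 := by
        have := h 1 0
        rw [map_zero] at this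
        linarith
      refine ⟨ha, ?_⟩
      by_contra hb
      refine hy (ContinuousLinearMap.ext fun u => ?_)
      have := h 0 u
      have h5 : b * dFun (𝓡 3) f y u = 0 := by linarith
      exact (mul_eq_zero.1 h5).resolve_left hb
    have e : (fun i : Fin 2 => dFun (𝓘(ℝ, ℝ).prod (𝓡 3))
        ((![Prod.fst, fun p => f p.2] : Fin 2 → ℝ × M → ℝ) i) (t, y)) =
        ![dFun (𝓘(ℝ, ℝ).prod (𝓡 3)) Prod.fst (t, y),
          dFun (𝓘(ℝ, ℝ).prod (𝓡 3)) (fun p : ℝ × M => f p.2) (t, y)] := by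
      funext i
      fin_cases i <;> rfl
    show LinearIndependent ℝ _
    rw [e, LinearIndependent.pair_iff]
    intro a b h
    refine hind a b fun σ u => ?_
    have h1 := DFunLike.congr_fun h (show TangentSpace (𝓘(ℝ, ℝ).prod (𝓡 3)) (t, y) from (σ, u))
    have h2 := hT t y σ u
    have h3 := hF t y σ u
    calc a * σ + b * dFun (𝓡 3) f y u = _ := by rw [← h3]; nth_rewrite 1 [← h2]; rfl
      _ = 0 := h1

end Integrable
end

noncomputable section
open Filter Topology

/-! ### Local changes of coordinates that preserve contact forms -/

section Germs

variable {V : Type*} [NormedAddCommGroup V] [NormedSpace ℝ V]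
  {V' : Type*} [NormedAddCommGroup V'] [NormedSpace ℝ V']

theorem extD_comp {β : V → V →L[ℝ] ℝ} {τ : V' → V} {x : V'} (hβ : DifferentiableAt ℝ β (τ x))
    (hτ : ContDiffAt ℝ ∞ τ x) (v w : V') :
    extD (fun y => (β (τ y)).comp (fderiv ℝ τ y)) x v w =
      extD β (τ x) (fderiv ℝ τ x v) (fderiv ℝ τ x w) := by
  have h1 : HasFDerivAt (fun y => β (τ y)) ((fderiv ℝ β (τ x)).comp (fderiv ℝ τ x)) x :=
    hβ.hasFDerivAt.comp x (hτ.differentiableAt (by simp)).hasFDerivAt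
  have h2 : HasFDerivAt (fderiv ℝ τ) (fderiv ℝ (fderiv ℝ τ) x) x :=
    ((hτ.fderiv_right (m := ∞) (by simp)).differentiableAt (by simp)).hasFDerivAt
  have hsymm : IsSymmSndFDerivAt ℝ τ x := hτ.isSymmSndFDerivAt
    (by simp only [minSmoothness_of_isRCLikeNormedField]
        exact WithTop.coe_le_coe.2 (le_top : (2 : ℕ∞) ≤ ⊤))
  have e3 := hsymm v w
  simp only [extD, (h1.clm_comp h2).fderiv, add_apply, ContinuousLinearMap.comp_apply,
    ContinuousLinearMap.compL_apply, ContinuousLinearMap.flip_apply, e3]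
  ring

theorem injective_fderiv_of_contactAt {β : V → V →L[ℝ] ℝ} {β' : V' → V' →L[ℝ] ℝ} {τ : V' → V}
    {x : V'} (hβ : DifferentiableAt ℝ β (τ x)) (hτ : ContDiffAt ℝ ∞ τ x)
    (he : ∀ᶠ y in 𝓝 x, (β (τ y)).comp (fderiv ℝ τ y) = β' y) (hc : ContactAt β' x) :
    Function.Injective (fderiv ℝ τ x) := by
  have hc' : ContactAt (fun y => (β (τ y)).comp (fderiv ℝ τ y)) x :=
    hc.congr (he.mono fun y hy => hy.symm)
  rw [injective_iff_map_eq_zero]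
  intro v hv
  refine hc'.nondegenerate v (by simp [hv]) fun w _ => ?_
  rw [extD_comp hβ hτ, hv]
  simp [extD]

variable {Y : Type*}

/-- The maps `Φ` and `Φ'` differ near `x` and `y` by a smooth local change of coordinates which
pulls the form `β'` back to `β`. -/
def ContactGerm (Φ : V → Y) (Φ' : V' → Y) (β : V → V →L[ℝ] ℝ) (β' : V' → V' →L[ℝ] ℝ)
    (x : V) (y : V') : Prop :=
  ∃ τ : V → V', ContDiffAt ℝ ∞ τ x ∧ τ x = y ∧
    ∀ᶠ x' in 𝓝 x, Φ' (τ x') = Φ x' ∧ (β' (τ x')).comp (fderiv ℝ τ x') = β x'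

theorem eventually_differentiableAt {τ : V → V'} {x : V} (h : ContDiffAt ℝ ∞ τ x) :
    ∀ᶠ y in 𝓝 x, DifferentiableAt ℝ τ y :=
  ((h.of_le (by simp : (1 : WithTop ℕ∞) ≤ ∞)).eventually (by simp)).mono
    fun _ hx => hx.differentiableAt (by simp)

theorem exists_contDiffAt_localInverse [CompleteSpace V] [CompleteSpace V'] {τ : V → V'} {x : V}
    (h : ContDiffAt ℝ ∞ τ x) (hb : Function.Bijective (fderiv ℝ τ x)) :
    ∃ σ : V' → V, ContDiffAt ℝ ∞ σ (τ x) ∧ σ (τ x) = x ∧ (∀ᶠ y in 𝓝 (τ x), τ (σ y) = y) ∧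
      ∀ᶠ y in 𝓝 x, σ (τ y) = y := by
  have hp : IsParamAt 𝓘(ℝ, V') τ x := ⟨h.contMDiffAt, by rw [mfderiv_eq_fderiv]; exact hb⟩
  obtain ⟨σ, h1, h2, h3, h4⟩ := hp.exists_localInverse
  exact ⟨σ, h1.contDiffAt, h2, h3, h4⟩

/-- A map that pulls `β'` back to a contact form is an immersion, so in equal dimensions it has a
smooth local inverse. Hence a transition has to be exhibited in one direction only. -/
theorem ContactGerm.symm [FiniteDimensional ℝ V] [FiniteDimensional ℝ V']
    (hd : Module.finrank ℝ V = Module.finrank ℝ V')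
    {Φ : V → Y} {Φ' : V' → Y} {β : V → V →L[ℝ] ℝ} {β' : V' → V' →L[ℝ] ℝ} {x : V} {y : V'}
    (h : ContactGerm Φ Φ' β β' x y) (hc : ContactAt β x) (hβ : DifferentiableAt ℝ β' y) :
    ContactGerm Φ' Φ β' β y x := by
  have := FiniteDimensional.complete ℝ V
  have := FiniteDimensional.complete ℝ V'
  obtain ⟨τ, hτ, rfl, he⟩ := h
  have hi := injective_fderiv_of_contactAt hβ hτ (he.mono fun _ h => h.2) hc
  obtain ⟨σ, h1, h2, h3, h4⟩ := exists_contDiffAt_localInverse hτ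
    ⟨hi, (LinearMap.injective_iff_surjective_of_finrank_eq_finrank (f := (fderiv ℝ τ x : V →ₗ[ℝ] V'))
      hd).1 hi⟩
  refine ⟨σ, h1, h2, ?_⟩
  have hd1 : ∀ᶠ y' in 𝓝 (τ x), DifferentiableAt ℝ τ (σ y') :=
    h1.continuousAt.eventually (by rw [h2]; exact eventually_differentiableAt hτ)
  have he' := h1.continuousAt.eventually (by rw [h2]; exact he)
  filter_upwards [eventually_eventually_nhds.2 h3, he', hd1, eventually_differentiableAt h1]
    with y' h5 h6 h7 h8
  have h5' : (τ ∘ σ) =ᶠ[𝓝 y'] id := h5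
  have h9 : τ (σ y') = y' := h5'.eq_of_nhds
  refine ⟨by rw [← h6.1, h9], ?_⟩
  rw [← h6.2, ContinuousLinearMap.comp_assoc, ← fderiv_comp y' h7 h8, h5'.fderiv_eq, fderiv_id, h9]
  rfl

theorem ContactGerm.trans {V'' : Type*} [NormedAddCommGroup V''] [NormedSpace ℝ V'']
    {Φ : V → Y} {Φ' : V' → Y} {Φ'' : V'' → Y}
    {β : V → V →L[ℝ] ℝ} {β' : V' → V' →L[ℝ] ℝ} {β'' : V'' → V'' →L[ℝ] ℝ} {x : V} {y : V'} {z : V''}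
    (h : ContactGerm Φ Φ' β β' x y) (h' : ContactGerm Φ' Φ'' β' β'' y z) :
    ContactGerm Φ Φ'' β β'' x z := by
  obtain ⟨τ, hτ, rfl, he⟩ := h
  obtain ⟨τ', hτ', rfl, he'⟩ := h'
  refine ⟨τ' ∘ τ, hτ'.comp x hτ, rfl, ?_⟩
  filter_upwards [he, hτ.continuousAt.eventually he', eventually_differentiableAt hτ,
    hτ.continuousAt.eventually (eventually_differentiableAt hτ')] with y h1 h2 h3 h4
  refine ⟨by simp only [Function.comp]; rw [h2.1, h1.1], ?_⟩
  rw [fderiv_comp y h4 h3, ← ContinuousLinearMap.comp_assoc]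
  simp only [Function.comp]
  rw [h2.2, h1.2]

end Germs

/-! ### Gluing parametrized pieces to a contact three-manifold -/

section Gluing

variable {V : Type*} [NormedAddCommGroup V] [NormedSpace ℝ V]

/-- `Y` is a bare set. The inverses of the parametrizations are charts whose transitions are the
given germs, hence smooth with open domains, and they generate the topology. The germs also respect
the forms, so these fit together. Separation and compactness are left to the applications. -/
theorem exists_contact_gluing (L : V ≃L[ℝ] EuclideanSpace ℝ (Fin 3)) {Y : Type*} {ι : Type*}
    (Ω : ι → Set V) (hΩ : ∀ a, IsOpen (Ω a)) (Φ : ι → V → Y) (hinj : ∀ a, InjOn (Φ a) (Ω a))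
    (hcover : ∀ y, ∃ a, ∃ x ∈ Ω a, Φ a x = y) (β : ι → V → V →L[ℝ] ℝ)
    (hβ : ∀ a, ContDiffOn ℝ ∞ (β a) (Ω a)) (hc : ∀ a, ∀ x ∈ Ω a, ContactAt (β a) x)
    (hg : ∀ a b x y, x ∈ Ω a → y ∈ Ω b → Φ a x = Φ b y →
      ContactGerm (Φ a) (Φ b) (β a) (β b) x y ∨ ContactGerm (Φ b) (Φ a) (β b) (β a) y x) :
    ∃ (_ : TopologicalSpace Y) (_ : ChartedSpace (EuclideanSpace ℝ (Fin 3)) Y)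
      (_ : IsManifold (𝓡 3) ∞ Y) (α : OneForm (𝓡 3) Y), IsContactForm α ∧
      ∀ a, ∀ x ∈ Ω a, IsParamAt (𝓡 3) (Φ a) x ∧ α.pb (Φ a) x = β a x := by
  have : FiniteDimensional ℝ V := L.symm.toLinearEquiv.finiteDimensional
  have := FiniteDimensional.complete ℝ V
  have hfin : Module.finrank ℝ V = Module.finrank ℝ (EuclideanSpace ℝ (Fin 3)) :=
    L.toLinearEquiv.finrank_eq
  have hβx : ∀ a, ∀ x ∈ Ω a, DifferentiableAt ℝ (β a) x := fun a x hx =>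
    ((hβ a).contDiffAt ((hΩ a).mem_nhds hx)).differentiableAt (by simp)
  have hg' : ∀ a b x y, x ∈ Ω a → y ∈ Ω b → Φ a x = Φ b y →
      ContactGerm (Φ a) (Φ b) (β a) (β b) x y := fun a b x y hx hy hxy =>
    (hg a b x y hx hy hxy).elim id fun h => h.symm rfl (hc b y hy) (hβx a x hx)
  let e : ι → PartialEquiv Y (EuclideanSpace ℝ (Fin 3)) := fun a =>
    ((hinj a).toPartialEquiv (Φ a) (Ω a)).symm.trans L.toEquiv.toPartialEquiv
  have hsrc : ∀ a, (e a).source = Φ a '' Ω a := fun a => by simp [e, InjOn.toPartialEquiv, BijOn.toPartialEquiv]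
  have hsymm : ∀ a z, (e a).symm z = Φ a (L.symm z) := fun a z => rfl
  have htgt : ∀ a, (e a).target = L.symm ⁻¹' (Ω a) := fun a => by
    simp [e, InjOn.toPartialEquiv, BijOn.toPartialEquiv]
  have heval : ∀ a, ∀ x ∈ Ω a, e a (Φ a x) = L x := fun a x hx => by
    have := (e a).right_inv (x := L x) (by rw [htgt]; simpa using hx)
    rwa [hsymm, L.symm_apply_apply] at this
  have htrans : ∀ a b z, z ∈ ((e a).symm.trans (e b)).source →
      ((e a).symm.trans (e b)).source ∈ 𝓝 z ∧ ContDiffAt ℝ ∞ ((e a).symm.trans (e b)) z := by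
    intro a b z hz
    rw [PartialEquiv.trans_source, PartialEquiv.symm_source, htgt, hsrc] at hz ⊢
    obtain ⟨hz1, y, hy, hyz⟩ := hz
    obtain ⟨τ, h1, rfl, h3⟩ := hg' a b _ y hz1 hy (by rw [hyz]; rfl)
    have hLc : ContinuousAt L.symm z := L.symm.continuous.continuousAt
    have h4 : ∀ᶠ z' in 𝓝 z, L.symm z' ∈ Ω a ∧ τ (L.symm z') ∈ Ω b ∧
        Φ b (τ (L.symm z')) = Φ a (L.symm z') := by
      filter_upwards [hLc.eventually ((hΩ a).mem_nhds hz1), hLc.eventually h3,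
        hLc.eventually (h1.continuousAt.eventually ((hΩ b).mem_nhds hy))] with z' h5 h6 h7
      exact ⟨h5, h7, h6.1⟩
    refine ⟨?_, ?_⟩
    · filter_upwards [h4] with z' h
      exact ⟨h.1, _, h.2.1, h.2.2⟩
    · have h5 : ContDiffAt ℝ ∞ (fun z' => L (τ (L.symm z'))) z :=
        L.contDiff.contDiffAt.comp z (h1.comp z L.symm.contDiff.contDiffAt)
      refine h5.congr_of_eventuallyEq ?_
      filter_upwards [h4] with z' h
      rw [← heval b _ h.2.1, h.2.2]
      rfl
  -- One piece and one preimage are fixed for each point; they supply both the preferred chart and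
  -- the value of the form there.
  choose A X hX hAX using hcover
  let c : ChartedSpaceCore (EuclideanSpace ℝ (Fin 3)) Y :=
    { atlas := range e
      chartAt := fun y => e (A y)
      mem_chart_source := fun y => by
        rw [hsrc]
        exact ⟨X y, hX y, hAX y⟩
      chart_mem_atlas := fun y => ⟨_, rfl⟩
      open_source := by
        rintro _ _ ⟨a, rfl⟩ ⟨b, rfl⟩
        exact isOpen_iff_mem_nhds.2 fun z hz => (htrans a b z hz).1
      continuousOn_toFun := by
        rintro _ _ ⟨a, rfl⟩ ⟨b, rfl⟩ z hz
        exact (htrans a b z hz).2.continuousAt.continuousWithinAt }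
  let _ : TopologicalSpace Y := c.toTopologicalSpace
  let _ : ChartedSpace (EuclideanSpace ℝ (Fin 3)) Y := c.toChartedSpace
  let E : ∀ a, OpenPartialHomeomorph Y (EuclideanSpace ℝ (Fin 3)) := fun a =>
    c.openPartialHomeomorph (e a) ⟨a, rfl⟩
  have hatlas : ∀ f ∈ atlas (EuclideanSpace ℝ (Fin 3)) Y, ∃ a, f = E a := by
    intro f hf
    obtain ⟨_, ⟨e', rfl⟩, hf⟩ := hf
    obtain ⟨_, ⟨⟨a, rfl⟩, rfl⟩, hf⟩ := hf
    exact ⟨a, hf⟩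
  have hatlas' : ∀ a, E a ∈ atlas (EuclideanSpace ℝ (Fin 3)) Y := fun a =>
    mem_iUnion.2 ⟨e a, mem_iUnion.2 ⟨⟨a, rfl⟩, rfl⟩⟩
  have : IsManifold (𝓡 3) ∞ Y := by
    refine isManifold_of_contDiffOn _ _ _ fun f f' hf hf' => ?_
    obtain ⟨a, rfl⟩ := hatlas f hf
    obtain ⟨b, rfl⟩ := hatlas f' hf'
    intro z hz
    exact (htrans a b z hz.1).2.contDiffWithinAt
  have hparam : ∀ a, ∀ x ∈ Ω a, IsParamAt (𝓡 3) (Φ a) x := by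
    intro a x hx
    have hmem : Φ a x ∈ (E a).source := by
      show Φ a x ∈ (e a).source
      rw [hsrc]
      exact ⟨x, hx, rfl⟩
    have ht : L x ∈ (E a).target := by
      show L x ∈ (e a).target
      rw [htgt]
      simpa using hx
    have h1 : ContMDiffAt (𝓡 3) (𝓡 3) ∞ (E a).symm (L x) :=
      (contMDiffOn_symm_of_mem_maximalAtlas
        (IsManifold.subset_maximalAtlas (hatlas' a))).contMDiffAt ((E a).open_target.mem_nhds ht)
    have h2 : ContMDiffAt (𝓡 3) (𝓡 3) ∞ (E a) (Φ a x) :=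
      (contMDiffOn_of_mem_maximalAtlas
        (IsManifold.subset_maximalAtlas (hatlas' a))).contMDiffAt ((E a).open_source.mem_nhds hmem)
    have h3 : ContMDiffAt 𝓘(ℝ, V) (𝓡 3) ∞ (Φ a) x := by
      have := ContMDiffAt.comp x (g := (E a).symm) (f := L) h1 L.contDiff.contMDiff.contMDiffAt
      refine this.congr_of_eventuallyEq (Eventually.of_forall fun z => ?_)
      show Φ a z = Φ a (L.symm (L z))
      rw [L.symm_apply_apply]
    refine isParamAt_of_injective hfin h3 ?_
    have h4 : (E a) ∘ (Φ a) =ᶠ[𝓝 x] L := by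
      filter_upwards [(hΩ a).mem_nhds hx] with z hz
      exact heval a z hz
    have h5 := mfderiv_comp x (h2.mdifferentiableAt (by simp)) (h3.mdifferentiableAt (by simp))
    rw [h4.mfderiv_eq, mfderiv_eq_fderiv, L.fderiv] at h5
    have h6 : ∀ v : V, L v = _ := fun v => DFunLike.congr_fun h5 v
    intro v w hvw
    refine L.injective ((h6 v).trans (Eq.trans ?_ (h6 w).symm))
    exact congrArg (mfderiv (𝓡 3) (𝓡 3) (E a) (Φ a x)) hvw
  let inv : ∀ y : Y, TangentSpace (𝓡 3) y →L[ℝ] V := fun y =>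
    (((ContinuousLinearEquiv.ofBijective
      (show V →L[ℝ] EuclideanSpace ℝ (Fin 3) from mfderiv 𝓘(ℝ, V) (𝓡 3) (Φ (A y)) (X y))
      (LinearMap.ker_eq_bot.2 (hparam _ _ (hX y)).bijective.1)
      (LinearMap.range_eq_top.2 (hparam _ _ (hX y)).bijective.2)).symm :
        EuclideanSpace ℝ (Fin 3) ≃L[ℝ] V) : EuclideanSpace ℝ (Fin 3) →L[ℝ] V)
  have hinv : ∀ y (v : V), inv y (mfderiv 𝓘(ℝ, V) (𝓡 3) (Φ (A y)) (X y) v) = v := fun y v =>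
    ContinuousLinearEquiv.ofBijective_symm_apply_apply
      (show V →L[ℝ] EuclideanSpace ℝ (Fin 3) from mfderiv 𝓘(ℝ, V) (𝓡 3) (Φ (A y)) (X y)) _ _ v
  let α : OneForm (𝓡 3) Y := fun y => (β (A y) (X y)).comp (inv y)
  have hpb : ∀ a, ∀ x ∈ Ω a, α.pb (Φ a) x = β a x := by
    intro a x hx
    -- Independence of the choices: the germ `τ` from piece `a` to the chosen piece carries the
    -- chosen form to `β a`, and its derivative is the inverse of the chosen parametrization applied
    -- to that of `Φ a`.
    obtain ⟨τ, h1, h2, h3⟩ := hg' a (A (Φ a x)) x (X (Φ a x)) hx (hX _) (hAX _).symm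
    have h4 : Φ a =ᶠ[𝓝 x] Φ (A (Φ a x)) ∘ τ := h3.mono fun z hz => hz.1.symm
    have h5 := h3.self_of_nhds.2
    have hp := hparam _ _ (hX (Φ a x))
    rw [← h2] at hp
    have h6 := mfderiv_comp x hp.mdiff (h1.differentiableAt (by simp)).mdifferentiableAt
    rw [← h4.mfderiv_eq, mfderiv_eq_fderiv] at h6
    ext v
    rw [OneForm.pb_apply, ← h5]
    have h7 := DFunLike.congr_fun h6 v
    have h8 : inv (Φ a x) (mfderiv 𝓘(ℝ, V) (𝓡 3) (Φ a) x v) = fderiv ℝ τ x v := by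
      refine (congrArg (inv (Φ a x)) h7).trans ?_
      rw [h2]
      exact hinv (Φ a x) (fderiv ℝ τ x v)
    show β (A (Φ a x)) (X (Φ a x)) (inv (Φ a x) (mfderiv 𝓘(ℝ, V) (𝓡 3) (Φ a) x v)) = _
    rw [h8, h2]
    rfl
  have hev : ∀ a, ∀ x ∈ Ω a, α.pb (Φ a) =ᶠ[𝓝 x] β a := fun a x hx => by
    filter_upwards [(hΩ a).mem_nhds hx] with z hz
    exact hpb a z hz
  have hsm : α.IsSmooth := by
    refine OneForm.isSmooth_of_params (V := V) fun p => ?_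
    refine ⟨Φ (A p), X p, hAX p, hparam _ _ (hX p), ContDiffAt.congr_of_eventuallyEq ?_
      (hev _ _ (hX p))⟩
    exact (hβ _).contDiffAt ((hΩ _).mem_nhds (hX p))
  refine ⟨c.toTopologicalSpace, c.toChartedSpace, this, α, isContactForm_of_params (V := V) hsm fun p => ?_,
    fun a x hx => ⟨hparam a x hx, hpb a x hx⟩⟩
  exact ⟨Φ (A p), X p, hAX p, hparam _ _ (hX p), (hc _ _ (hX p)).congr (hev _ _ (hX p)).symm⟩

end Gluing
end

noncomputable section
open Filter Topology

/-! ### Topology of the collar and of the core -/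

section Surface

variable {W : Type u} [TopologicalSpace W] [T2Space W] [CompactSpace W]
    [ChartedSpace (EuclideanHalfSpace 2) W] [IsManifold (𝓡∂ 2) ∞ W] {k : ℕ}

namespace LiouvilleSurface

variable (S : LiouvilleSurface W k)

theorem isOpen_openStrip (ε : ℝ) : IsOpen {p : ℝ × ℝ | -ε < p.2 ∧ p.2 < 0} :=
  (isOpen_lt continuous_const continuous_snd).inter (isOpen_lt continuous_snd continuous_const)

theorem collarStrip_mem_nhds {ε : ℝ} {p : ℝ × ℝ} (hp : -ε < p.2) (hp0 : p.2 < 0) :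
    collarStrip ε ∈ 𝓝 p :=
  mem_of_superset ((isOpen_openStrip ε).mem_nhds ⟨hp, hp0⟩) fun _ hq => ⟨hq.1, hq.2.le⟩

theorem collar_contMDiffAt (i : Fin k) {p : ℝ × ℝ} (hp : -S.width < p.2) (hp0 : p.2 < 0) :
    ContMDiffAt 𝓘(ℝ, ℝ × ℝ) (𝓡∂ 2) ∞ (S.collar i) p :=
  (S.collar_smooth i).contMDiffAt (collarStrip_mem_nhds hp hp0)

theorem collar_pb (i : Fin k) {p : ℝ × ℝ} (hp : -S.width < p.2) (hp0 : p.2 < 0) :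
    S.form.pb (S.collar i) p = Real.exp p.2 • ContinuousLinearMap.fst ℝ ℝ ℝ := by
  refine ContinuousLinearMap.ext fun v => ?_
  rw [OneForm.pb_apply]
  have := S.collar_pullback i p ⟨hp, hp0.le⟩ v
  rwa [mfderivWithin_of_mem_nhds (collarStrip_mem_nhds hp hp0)] at this

theorem extD_exp_fst (p v w : ℝ × ℝ) :
    extD (fun q : ℝ × ℝ => Real.exp q.2 • ContinuousLinearMap.fst ℝ ℝ ℝ) p v w =
      Real.exp p.2 * (v.2 * w.1 - w.2 * v.1) := by
  have h1 : HasFDerivAt (fun p : ℝ × ℝ => Real.exp p.2)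
      (Real.exp p.2 • ContinuousLinearMap.snd ℝ ℝ ℝ) p :=
    (Real.hasDerivAt_exp p.2).comp_hasFDerivAt p (f := Prod.snd) hasFDerivAt_snd
  have h4 : HasFDerivAt (fun q : ℝ × ℝ => Real.exp q.2 • ContinuousLinearMap.fst ℝ ℝ ℝ) _ p :=
    h1.smul_const _
  rw [extD, h4.fderiv]
  simp only [ContinuousLinearMap.smulRight_apply, smul_apply, ContinuousLinearMap.coe_fst',
    ContinuousLinearMap.coe_snd', smul_eq_mul]
  ring

/-- The collar map pulls `dλ` back to `e^s ds ∧ dx`, which is nondegenerate, so it is an immersion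
between surfaces. -/
theorem collar_isParamAt (i : Fin k) {p : ℝ × ℝ} (hp : -S.width < p.2) (hp0 : p.2 < 0) :
    IsParamAt (𝓡∂ 2) (S.collar i) p := by
  have hs := S.collar_contMDiffAt i hp hp0
  refine isParamAt_of_injective (by simp) hs ?_
  have he : S.form.pb (S.collar i) =ᶠ[𝓝 p]
      fun q : ℝ × ℝ => Real.exp q.2 • ContinuousLinearMap.fst ℝ ℝ ℝ := by
    filter_upwards [(isOpen_openStrip S.width).mem_nhds ⟨hp, hp0⟩] with q hq
    exact S.collar_pb i hq.1 hq.2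
  have key : ∀ v : ℝ × ℝ, mfderiv 𝓘(ℝ, ℝ × ℝ) (𝓡∂ 2) (S.collar i) p v = 0 → v = 0 := by
    intro v hv
    have h1 : ∀ w : ℝ × ℝ, Real.exp p.2 * (v.2 * w.1 - w.2 * v.1) = 0 := fun w => by
      rw [← extD_exp_fst, ← extD_congr he, ← OneForm.d_pullback S.smooth_form hs]
      exact (congrArg (fun u => S.form.d (S.collar i p) u
        (mfderiv 𝓘(ℝ, ℝ × ℝ) (𝓡∂ 2) (S.collar i) p w)) hv).trans (OneForm.d_zero_left _ _ _)
    have h2 := (mul_eq_zero.1 (h1 (1, 0))).resolve_left (Real.exp_pos _).ne'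
    have h3 := (mul_eq_zero.1 (h1 (0, 1))).resolve_left (Real.exp_pos _).ne'
    exact Prod.ext (by simpa using h3) (by simpa using h2)
  exact (injective_iff_map_eq_zero _).2 key

theorem collar_isInteriorPoint (i : Fin k) {p : ℝ × ℝ} (hp : -S.width < p.2) (hp0 : p.2 < 0) :
    (𝓡∂ 2).IsInteriorPoint (S.collar i p) :=
  (S.collar_isParamAt i hp hp0).mdiff.isInteriorPoint_of_surjective_mfderiv
    (S.collar_isParamAt i hp hp0).bijective.2 BoundarylessManifold.isInteriorPoint

theorem isInteriorPoint_iff (w : W) :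
    (𝓡∂ 2).IsInteriorPoint w ↔ ∀ i x, S.collar i (x, 0) ≠ w := by
  have h := S.boundary_eq
  have h1 : w ∈ (𝓡∂ 2).boundary W ↔ ∃ i x, S.collar i (x, 0) = w := by rw [h]; rfl
  rw [(𝓡∂ 2).isInteriorPoint_iff_not_isBoundaryPoint]
  rw [show (𝓡∂ 2).IsBoundaryPoint w ↔ w ∈ (𝓡∂ 2).boundary W from Iff.rfl, h1]
  simp

theorem collar_add_int_mul (i : Fin k) (x s : ℝ) (n : ℤ) (h : (x, s) ∈ collarStrip S.width) :
    S.collar i (x + n * S.len i, s) = S.collar i (x, s) :=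
  (S.collar_eq_iff i i (x + n * S.len i, s) h (x, s) h).2 ⟨rfl, rfl, n, by simp⟩

theorem exists_collar_reduce (i : Fin k) (x s : ℝ) (h : (x, s) ∈ collarStrip S.width) :
    ∃ x' ∈ Icc 0 (S.len i), S.collar i (x', s) = S.collar i (x, s) := by
  refine ⟨x + (-⌊x / S.len i⌋ : ℤ) * S.len i, ?_, S.collar_add_int_mul i x s _ h⟩
  have hl := S.len_pos i
  have h1 := Int.floor_le (x / S.len i)
  have h2 := Int.lt_floor_add_one (x / S.len i)
  rw [le_div_iff₀ hl] at h1
  rw [div_lt_iff₀ hl] at h2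
  push_cast
  constructor <;> nlinarith

theorem collar_image_reduce (i : Fin k) {A : Set ℝ} (hA : A ⊆ Ioc (-S.width) 0) :
    S.collar i '' (univ ×ˢ A) = S.collar i '' (Icc 0 (S.len i) ×ˢ A) := by
  refine Subset.antisymm ?_ (image_mono (prod_mono_left (subset_univ _)))
  rintro _ ⟨⟨x, s⟩, ⟨-, hs⟩, rfl⟩
  obtain ⟨x', h1, h2⟩ := S.exists_collar_reduce i x s (hA hs)
  exact ⟨(x', s), ⟨h1, hs⟩, h2⟩

theorem isCompact_collar_image (i : Fin k) {A : Set ℝ} (hA : A ⊆ Ioc (-S.width) 0)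
    (hc : IsCompact A) : IsCompact (S.collar i '' (univ ×ˢ A)) := by
  rw [S.collar_image_reduce i hA]
  refine (isCompact_Icc.prod hc).image_of_continuousOn ((S.collar_smooth i).continuousOn.mono ?_)
  rintro ⟨x, s⟩ ⟨-, hs⟩
  exact hA hs

/-- The data do not say that the collar fills a neighbourhood of the boundary; connectedness shows
it. Let `D₀` be the image of the interior points of a small half ball at the boundary point that
avoids the inner end `K'` of the collar. `D₀` contains neither boundary points nor points of `K'`,
so within it the compact set `K` and the open set `O` coincide. As `D₀` is connected and meets `O`,
it lies in `O`, and its closure lies in `K`. -/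
theorem collar_image_mem_nhds (i : Fin k) (x : ℝ) {δ : ℝ} (hδ : 0 < δ) (hδε : δ < S.width) :
    S.collar i '' (univ ×ˢ Icc (-δ) 0) ∈ 𝓝 (S.collar i (x, 0)) := by
  set p := S.collar i (x, 0) with hp
  set K := S.collar i '' (univ ×ˢ Icc (-δ) 0) with hK
  have hsub : Icc (-δ) 0 ⊆ Ioc (-S.width) 0 := fun s hs => ⟨by linarith [hs.1], hs.2⟩
  have hx0 : (x, (0 : ℝ)) ∈ collarStrip S.width := ⟨by simpa using S.width_pos, le_rfl⟩
  have hKc : IsClosed K := (S.isCompact_collar_image i hsub isCompact_Icc).isClosed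
  set K' := S.collar i '' (univ ×ˢ {-δ}) with hK'
  have hK'c : IsClosed K' := (S.isCompact_collar_image i (by
    rintro _ rfl; exact ⟨by linarith, by linarith⟩) isCompact_singleton).isClosed
  have hpK' : p ∉ K' := by
    rintro ⟨⟨y, s⟩, ⟨-, hs⟩, h⟩
    rw [mem_singleton_iff] at hs
    subst hs
    have := ((S.collar_eq_iff i i _ ⟨by simpa using hδε, by simpa using hδ.le⟩ _ hx0).1 h).2.1
    simp only at this
    linarith
  set c := extChartAt (𝓡∂ 2) p with hc
  have hn : c.target ∩ c.symm ⁻¹' K'ᶜ ∈ 𝓝[range (𝓡∂ 2)] (c p) := by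
    refine inter_mem (extChartAt_target_mem_nhdsWithin p) ?_
    have h1 : ContinuousWithinAt c.symm (range (𝓡∂ 2)) (c p) :=
      (continuousAt_extChartAt_symm (I := 𝓡∂ 2) p).continuousWithinAt
    refine h1.preimage_mem_nhdsWithin (hK'c.isOpen_compl.mem_nhds ?_)
    rw [hc, extChartAt_to_inv]
    exact hpK'
  obtain ⟨r, hr, hball⟩ := Metric.mem_nhdsWithin_iff.1 hn
  set D₀ := c.symm '' (Metric.ball (c p) r ∩ interior (range (𝓡∂ 2))) with hD₀
  set D := c.symm '' (Metric.ball (c p) r ∩ range (𝓡∂ 2)) with hD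
  have hDn : D ∈ 𝓝 p := by
    have h1 : c.source ∩ c ⁻¹' Metric.ball (c p) r ∈ 𝓝 p :=
      inter_mem (extChartAt_source_mem_nhds p)
        ((continuousAt_extChartAt p).preimage_mem_nhds (Metric.ball_mem_nhds _ hr))
    refine mem_of_superset h1 fun w hw => ⟨c w, ⟨hw.2, ?_⟩, c.left_inv hw.1⟩
    exact extChartAt_target_subset_range p (c.map_source hw.1)
  have hcont : ContinuousOn c.symm (Metric.ball (c p) r ∩ range (𝓡∂ 2)) :=
    (continuousOn_extChartAt_symm p).mono fun y hy => (hball hy).1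
  have hconn : IsPreconnected D₀ := by
    refine IsPreconnected.image ?_ _ (hcont.mono (inter_subset_inter_right _ interior_subset))
    exact ((convex_ball _ _).inter (𝓡∂ 2).convex_range.interior).isPreconnected
  have hDcl : D ⊆ closure D₀ := by
    rintro _ ⟨y, hy, rfl⟩
    have h1 : y ∈ closure (Metric.ball (c p) r ∩ interior (range (𝓡∂ 2))) := by
      refine Metric.isOpen_ball.inter_closure ⟨hy.1, ?_⟩
      exact (𝓡∂ 2).range_subset_closure_interior hy.2
    have h2 : ContinuousWithinAt c.symm (Metric.ball (c p) r ∩ interior (range (𝓡∂ 2))) y :=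
      (hcont y hy).mono (inter_subset_inter_right _ interior_subset)
    exact h2.mem_closure_image h1
  have hint : ∀ w ∈ D₀, (𝓡∂ 2).IsInteriorPoint w ∧ w ∉ K' := by
    rintro _ ⟨y, hy, rfl⟩
    have hy' := hball ⟨hy.1, interior_subset hy.2⟩
    refine ⟨?_, hy'.2⟩
    have hs : c.symm y ∈ (chartAt (EuclideanHalfSpace 2) p).source := by
      rw [← extChartAt_source (𝓡∂ 2)]; exact c.map_target hy'.1
    rw [ModelWithCorners.isInteriorPoint_iff_of_mem_atlas (n := ∞) (by simp)
      (chart_mem_atlas (EuclideanHalfSpace 2) p) hs]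
    have h3 : c (c.symm y) = y := c.right_inv hy'.1
    show c (c.symm y) ∈ interior c.target
    rw [h3, mem_interior_iff_mem_nhds]
    have := extChartAt_target_mem_nhdsWithin_of_mem (I := 𝓡∂ 2) hy'.1
    rwa [nhdsWithin_eq_nhds.2 (mem_interior_iff_mem_nhds.1 hy.2)] at this
  set O := S.collar i '' (univ ×ˢ Ioo (-δ) 0) with hO
  have hOo : IsOpen O := by
    rw [isOpen_iff_mem_nhds]
    rintro _ ⟨⟨y, s⟩, ⟨-, hs⟩, rfl⟩
    rw [← (S.collar_isParamAt i (p := (y, s)) (by simp only; linarith [hs.1]) hs.2).map_nhds_eq]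
    exact image_mem_map ((isOpen_univ.prod isOpen_Ioo).mem_nhds ⟨mem_univ _, hs⟩)
  have hOK : ∀ w ∈ D₀, w ∈ K → w ∈ O := by
    rintro w hw ⟨⟨y, s⟩, ⟨-, hs⟩, rfl⟩
    obtain ⟨h1, h2⟩ := hint _ hw
    refine ⟨(y, s), ⟨mem_univ _, lt_of_le_of_ne hs.1 ?_, lt_of_le_of_ne hs.2 ?_⟩, rfl⟩
    · rintro rfl; exact h2 ⟨(y, -δ), ⟨mem_univ _, mem_singleton _⟩, rfl⟩
    · rintro rfl; exact (S.isInteriorPoint_iff _).1 h1 i y rfl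
  have hOsub : O ⊆ K := image_mono (prod_mono_right Ioo_subset_Icc_self)
  -- The collar points `(x, s)` with `s → 0` from below are interior points that converge to `p`, so
  -- they enter `D₀`.
  have hne : (D₀ ∩ O).Nonempty := by
    have h1 : ContinuousWithinAt (S.collar i) (collarStrip S.width) (x, 0) :=
      (S.collar_smooth i).continuousOn _ hx0
    have h2 : Tendsto (fun s : ℝ => (x, s)) (𝓝[<] 0) (𝓝[collarStrip S.width] (x, 0)) := by
      refine tendsto_nhdsWithin_iff.2 ⟨?_, ?_⟩
      · exact (Continuous.tendsto (by fun_prop) 0).mono_left nhdsWithin_le_nhds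
      · filter_upwards [Ioo_mem_nhdsLT (show -S.width < 0 by linarith [S.width_pos])] with s hs
        exact ⟨hs.1, hs.2.le⟩
    have h3 := (h1.tendsto.comp h2).eventually hDn
    obtain ⟨s, hs1, hs2⟩ := (h3.and (Ioo_mem_nhdsLT (show -δ < 0 by linarith))).exists
    obtain ⟨y, hy, hys⟩ := hs1
    have hyI : (𝓡∂ 2).IsInteriorPoint (c.symm y) := by
      rw [hys]
      exact S.collar_isInteriorPoint i (by simp only; linarith [hs2.1]) hs2.2
    refine ⟨c.symm y, ⟨y, ⟨hy.1, ?_⟩, rfl⟩, ⟨(x, s), ⟨mem_univ _, hs2⟩, hys.symm⟩⟩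
    have hy' := hball hy
    have hs : c.symm y ∈ (chartAt (EuclideanHalfSpace 2) p).source := by
      rw [← extChartAt_source (𝓡∂ 2)]; exact c.map_target hy'.1
    have := (ModelWithCorners.isInteriorPoint_iff_of_mem_atlas (n := ∞) (by simp)
      (chart_mem_atlas (EuclideanHalfSpace 2) p) hs).1 hyI
    have h4 : c (c.symm y) ∈ interior c.target := this
    rw [c.right_inv hy'.1] at h4
    exact interior_mono (extChartAt_target_subset_range p) h4
  have hD₀K : D₀ ⊆ O := by
    refine hconn.subset_left_of_subset_union hOo hKc.isOpen_compl
      (disjoint_compl_right.mono_left hOsub) (fun w hw => ?_) hne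
    by_cases h : w ∈ K
    · exact Or.inl (hOK w hw h)
    · exact Or.inr h
  exact mem_of_superset hDn (hDcl.trans (closure_minimal (hD₀K.trans hOsub) hKc))

theorem isOpen_collar_image (i : Fin k) {δ : ℝ} (hδε : δ ≤ S.width) :
    IsOpen (S.collar i '' (univ ×ˢ Ioc (-δ) 0)) := by
  rw [isOpen_iff_mem_nhds]
  rintro _ ⟨⟨y, s⟩, ⟨-, hs⟩, rfl⟩
  rcases hs.2.lt_or_eq with h | h
  · rw [← (S.collar_isParamAt i (p := (y, s)) (by simp only; linarith [hs.1]) h).map_nhds_eq]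
    refine mem_of_superset (image_mem_map ((isOpen_univ.prod isOpen_Ioo).mem_nhds
      ⟨mem_univ _, hs.1, h⟩)) (image_mono (prod_mono_right Ioo_subset_Ioc_self))
  · simp only at h
    subst h
    have h0 : 0 < δ := by linarith [hs.1]
    refine mem_of_superset (S.collar_image_mem_nhds i y (δ := δ / 2) (by linarith)
      (by linarith)) (image_mono (prod_mono_right fun s hs => ⟨by linarith [hs.1], hs.2⟩))

theorem collarRegion_eq : S.collarRegion = ⋃ i, S.collar i '' (univ ×ˢ Ioc (-S.width) 0) := by
  ext w
  simp only [collarRegion, mem_ofPred_eq, mem_iUnion, mem_image, mem_prod, mem_univ, true_and]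
  rfl

theorem isOpen_collarRegion : IsOpen S.collarRegion := by
  rw [collarRegion_eq]
  exact isOpen_iUnion fun i => S.isOpen_collar_image i le_rfl

theorem core_eq : S.core = (⋃ i, S.collar i '' (univ ×ˢ Icc (-(S.width / 2)) 0))ᶜ := by
  ext w
  simp only [core, mem_ofPred_eq, mem_compl_iff, mem_iUnion, mem_image, mem_prod, mem_univ,
    true_and, Prod.exists, not_exists, not_and]
  exact ⟨fun h i x s hs => h i x s hs.1 hs.2, fun h i x s h1 h2 => h i x s ⟨h1, h2⟩⟩

theorem isOpen_core : IsOpen S.core := by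
  rw [core_eq, isOpen_compl_iff]
  refine isClosed_iUnion_of_finite fun i => (S.isCompact_collar_image i ?_ isCompact_Icc).isClosed
  exact fun s hs => ⟨by linarith [hs.1, S.width_pos], hs.2⟩

theorem isInteriorPoint_of_mem_core {w : W} (hw : w ∈ S.core) : (𝓡∂ 2).IsInteriorPoint w :=
  (S.isInteriorPoint_iff w).2 fun i x => hw i x 0 (by linarith [S.width_pos]) le_rfl

theorem collar_mem_core_iff (i : Fin k) {p : ℝ × ℝ} (hp : p ∈ collarStrip S.width) :
    S.collar i p ∈ S.core ↔ p.2 < -(S.width / 2) := by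
  constructor
  · intro h
    by_contra h'
    exact h i p.1 p.2 (not_lt.1 h') hp.2 rfl
  · intro h j x s h1 h2 h3
    have := ((S.collar_eq_iff j i _ ⟨by simp only; linarith [S.width_pos], h2⟩ p hp).1 h3).2.1
    simp only at this
    linarith

theorem mem_core_of_notMem_collarRegion {w : W} (hw : w ∉ S.collarRegion) : w ∈ S.core :=
  fun i x s h1 h2 h => hw ⟨i, (x, s), ⟨by simp only; linarith [S.width_pos], h2⟩, h⟩

end LiouvilleSurface

end Surface
end

noncomputable section
open Filter Topology

theorem HasMFDerivAt.hasDerivAt' {F : Type*} [NormedAddCommGroup F] [NormedSpace ℝ F] {f : ℝ → F}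
    {t : ℝ} {f' : ℝ →L[ℝ] F} (h : HasMFDerivAt 𝓘(ℝ, ℝ) 𝓘(ℝ, F) f t f') :
    HasDerivAt f (f' 1) t :=
  HasFDerivAt.hasDerivAt h.hasFDerivAt

/-! ### Hamiltonian flow lines and the time-one map -/

section FormLinear

variable {E : Type*} [NormedAddCommGroup E] [NormedSpace ℝ E]
  {B : Type*} [TopologicalSpace B] {I : ModelWithCorners ℝ E B}
  {M : Type*} [TopologicalSpace M] [ChartedSpace B M]

theorem OneForm.d_sub_left (α : OneForm I M) (p : M) (u v w : TangentSpace I p) :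
    α.d p (u - v) w = α.d p u w - α.d p v w := by
  have : ∀ (A : E →L[ℝ] E →L[ℝ] ℝ) (u v w : E),
      A (u - v) w - A w (u - v) = (A u w - A w u) - (A v w - A w v) := by
    intro A u v w
    simp only [map_sub, sub_apply]
    ring
  exact this _ _ _ _

theorem OneForm.HasSymplecticDifferential.eq_of_d_eq {α : OneForm I M}
    (h : α.HasSymplecticDifferential) {p : M} {u v : TangentSpace I p}
    (huv : ∀ w, α.d p u w = α.d p v w) : u = v :=
  sub_eq_zero.1 (h p _ fun w => by rw [α.d_sub_left, huv, sub_self])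

end FormLinear

section Flow

variable {W : Type u} [TopologicalSpace W] [T2Space W] [CompactSpace W]
    [ChartedSpace (EuclideanHalfSpace 2) W] [IsManifold (𝓡∂ 2) ∞ W] {k : ℕ}
    {S : LiouvilleSurface W k}

namespace AutonomousHamiltonian

variable (A : AutonomousHamiltonian S)

/-- Integral curves of the Hamiltonian vector field. -/
structure IsFlowLine (γ : ℝ → W) : Prop where
  smooth : ContMDiff 𝓘(ℝ, ℝ) (𝓡∂ 2) ∞ γ
  hamiltonian : ∀ (t : ℝ) (v : TangentSpace (𝓡∂ 2) (γ t)),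
    S.form.d (γ t) (mfderiv 𝓘(ℝ, ℝ) (𝓡∂ 2) γ t (1 : ℝ)) v = -(dFun (𝓡∂ 2) A.H (γ t) v)

theorem contMDiff_flow_left (w : W) : ContMDiff 𝓘(ℝ, ℝ) (𝓡∂ 2) ∞ (fun t => A.flow (t, w)) :=
  A.smooth_flow.comp (contMDiff_id.prodMk contMDiff_const)

theorem isFlowLine_flow (w : W) : A.IsFlowLine (fun t => A.flow (t, w)) :=
  ⟨A.contMDiff_flow_left w, fun t v => A.flow_hamiltonian t w v⟩

variable {A}

theorem IsFlowLine.comp_add {γ : ℝ → W} (h : A.IsFlowLine γ) (s : ℝ) :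
    A.IsFlowLine (fun t => γ (t + s)) := by
  have h1 : ContMDiff 𝓘(ℝ, ℝ) 𝓘(ℝ, ℝ) ∞ (fun t : ℝ => t + s) :=
    (contDiff_id.add contDiff_const).contMDiff
  refine ⟨h.smooth.comp h1, fun t v => ?_⟩
  have h2 : mfderiv 𝓘(ℝ, ℝ) (𝓡∂ 2) (fun t => γ (t + s)) t =
      (mfderiv 𝓘(ℝ, ℝ) (𝓡∂ 2) γ (t + s)).comp (mfderiv 𝓘(ℝ, ℝ) 𝓘(ℝ, ℝ) (fun t : ℝ => t + s) t) :=
    mfderiv_comp t ((h.smooth _).mdifferentiableAt (by simp)) ((h1 t).mdifferentiableAt (by simp))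
  have h3 : mfderiv 𝓘(ℝ, ℝ) 𝓘(ℝ, ℝ) (fun t : ℝ => t + s) t = ContinuousLinearMap.id ℝ ℝ := by
    rw [mfderiv_eq_fderiv]
    exact ((hasFDerivAt_id t).add_const s).fderiv
  have h4 : mfderiv 𝓘(ℝ, ℝ) (𝓡∂ 2) (fun t => γ (t + s)) t (1 : ℝ) =
      mfderiv 𝓘(ℝ, ℝ) (𝓡∂ 2) γ (t + s) (1 : ℝ) := by
    rw [h2, h3]
    rfl
  rw [h4]
  exact h.hamiltonian (t + s) v

theorem IsFlowLine.velocity_eq {γ δ : ℝ → W} (hγ : A.IsFlowLine γ) (hδ : A.IsFlowLine δ)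
    {s t : ℝ} (hst : γ s = δ t) :
    (mfderiv 𝓘(ℝ, ℝ) (𝓡∂ 2) γ s (1 : ℝ) : EuclideanSpace ℝ (Fin 2)) =
      mfderiv 𝓘(ℝ, ℝ) (𝓡∂ 2) δ t (1 : ℝ) := by
  have key : ∀ (p q : W) (u : TangentSpace (𝓡∂ 2) p) (v : TangentSpace (𝓡∂ 2) q), p = q →
      (∀ x, S.form.d p u x = -(dFun (𝓡∂ 2) A.H p x)) →
      (∀ x, S.form.d q v x = -(dFun (𝓡∂ 2) A.H q x)) → (u : EuclideanSpace ℝ (Fin 2)) = v := by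
    rintro p _ u v rfl hu hv
    exact S.symplectic.eq_of_d_eq fun w => by rw [hu, hv]
  exact key _ _ _ _ hst (hγ.hamiltonian s) (hδ.hamiltonian t)

theorem IsFlowLine.hasDerivAt_chart {γ : ℝ → W} (hγ : A.IsFlowLine γ) (p : W) {t : ℝ}
    (ht : γ t ∈ (extChartAt (𝓡∂ 2) p).source) :
    HasDerivAt (extChartAt (𝓡∂ 2) p ∘ γ)
      (mfderiv (𝓡∂ 2) 𝓘(ℝ, EuclideanSpace ℝ (Fin 2)) (extChartAt (𝓡∂ 2) p) (γ t)
        (mfderiv 𝓘(ℝ, ℝ) (𝓡∂ 2) γ t (1 : ℝ))) t := by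
  have h1 : MDifferentiableAt (𝓡∂ 2) 𝓘(ℝ, EuclideanSpace ℝ (Fin 2)) (extChartAt (𝓡∂ 2) p) (γ t) :=
    mdifferentiableAt_extChartAt (by rwa [extChartAt_source] at ht)
  exact (h1.hasMFDerivAt.comp t
    ((hγ.smooth t).mdifferentiableAt (by simp)).hasMFDerivAt).hasDerivAt'

/-- Uniqueness for ordinary differential equations in a chart, also at boundary points. The vector
field is `C¹` within the convex set `R`, hence locally Lipschitz there, and flow lines stay in `R`.
-/
theorem IsFlowLine.eventuallyEq {γ δ : ℝ → W} (hγ : A.IsFlowLine γ) (hδ : A.IsFlowLine δ)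
    {t₀ : ℝ} (h0 : γ t₀ = δ t₀) : γ =ᶠ[𝓝 t₀] δ := by
  set p := γ t₀ with hp
  set c := extChartAt (𝓡∂ 2) p with hc
  let R := range (𝓡∂ 2)
  let G : ℝ × EuclideanSpace ℝ (Fin 2) → EuclideanSpace ℝ (Fin 2) :=
    fun q => c (A.flow (q.1, c.symm q.2))
  have hcp : c.symm (c p) = p := extChartAt_to_inv p
  have hcpR : c p ∈ R := extChartAt_target_subset_range p (mem_extChartAt_target p)
  have hG : ContDiffWithinAt ℝ ∞ G (univ ×ˢ R) (0, c p) := by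
    rw [← contMDiffWithinAt_iff_contDiffWithinAt]
    have h1 : ContMDiffWithinAt 𝓘(ℝ, EuclideanSpace ℝ (Fin 2)) (𝓡∂ 2) ∞ c.symm R (c p) :=
      contMDiffWithinAt_extChartAt_symm_range p (mem_extChartAt_target p)
    have h2 : ContMDiffWithinAt 𝓘(ℝ, ℝ × EuclideanSpace ℝ (Fin 2)) (𝓘(ℝ, ℝ).prod (𝓡∂ 2)) ∞
        (fun q : ℝ × EuclideanSpace ℝ (Fin 2) => (q.1, c.symm q.2)) (univ ×ˢ R) (0, c p) := by
      refine (contDiff_fst.contMDiff.contMDiffAt.contMDiffWithinAt).prodMk ?_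
      exact ContMDiffWithinAt.comp (0, c p) (g := c.symm) (f := Prod.snd) (t := R) h1
        contDiff_snd.contMDiff.contMDiffAt.contMDiffWithinAt (fun q hq => hq.2)
    have h3 := ContMDiffAt.comp_contMDiffWithinAt (0, c p) (A.smooth_flow _) h2
    have h4 : ContMDiffAt (𝓡∂ 2) 𝓘(ℝ, EuclideanSpace ℝ (Fin 2)) ∞ c (A.flow (0, c.symm (c p))) := by
      rw [hcp, A.flow_zero]
      exact contMDiffAt_extChartAt
    exact ContMDiffAt.comp_contMDiffWithinAt (0, c p) h4 h3
  have hu : UniqueDiffOn ℝ ((univ : Set ℝ) ×ˢ R) := uniqueDiffOn_univ.prod (𝓡∂ 2).uniqueDiffOn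
  -- `X_H` in the chart, obtained as the time derivative of the given smooth flow at time zero.
  -- Regularity up to the boundary is thereby inherited from the flow, without inverting `dλ`.
  let V : EuclideanSpace ℝ (Fin 2) → EuclideanSpace ℝ (Fin 2) :=
    fun y => fderivWithin ℝ G (univ ×ˢ R) (0, y) (1, 0)
  have hV : ContDiffWithinAt ℝ 1 V R (c p) := by
    have h1 := hG.fderivWithin_right (m := 1) hu (by exact WithTop.coe_le_coe.2 le_top)
      ⟨mem_univ _, hcpR⟩
    have h2 : ContDiffWithinAt ℝ 1 (fun y => fderivWithin ℝ G (univ ×ˢ R) (0, y)) R (c p) :=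
      ContDiffWithinAt.comp (c p) (g := fderivWithin ℝ G (univ ×ˢ R)) (f := fun y => ((0 : ℝ), y))
        h1 (contDiff_const.prodMk contDiff_id).contDiffWithinAt (fun y hy => ⟨mem_univ _, hy⟩)
    exact h2.clm_apply contDiffWithinAt_const
  obtain ⟨K, T, hT, hLip⟩ := hV.exists_lipschitzOnWith (𝓡∂ 2).convex_range
  have hdiff : ∀ᶠ y in 𝓝[R] (c p), DifferentiableWithinAt ℝ G (univ ×ˢ R) (0, y) := by
    have h1 := (hG.of_le (by simp : (1 : WithTop ℕ∞) ≤ ∞)).eventually (by simp)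
    rw [insert_eq_of_mem (show ((0 : ℝ), c p) ∈ univ ×ˢ R from ⟨mem_univ _, hcpR⟩)] at h1
    have h2 : Tendsto (fun y : EuclideanSpace ℝ (Fin 2) => ((0 : ℝ), y)) (𝓝[R] (c p))
        (𝓝[univ ×ˢ R] ((0 : ℝ), c p)) := by
      refine tendsto_nhdsWithin_iff.2 ⟨(Continuous.tendsto (by fun_prop) _).mono_left
        nhdsWithin_le_nhds, ?_⟩
      filter_upwards [self_mem_nhdsWithin] with y hy
      exact ⟨mem_univ _, hy⟩
    exact (h2.eventually h1).mono fun y hy => hy.differentiableWithinAt (by simp)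
  have hderiv : ∀ β : ℝ → W, A.IsFlowLine β → β t₀ = p →
      ∀ᶠ t in 𝓝 t₀, β t ∈ c.source ∧
        HasDerivAt (c ∘ β) (V ((c ∘ β) t)) t ∧ (c ∘ β) t ∈ T := by
    intro β hβ hβp
    have hs : ∀ᶠ t in 𝓝 t₀, β t ∈ c.source :=
      hβ.smooth.continuous.continuousAt.preimage_mem_nhds
        ((isOpen_extChartAt_source p).mem_nhds (by rw [hβp]; exact mem_extChartAt_source p))
    have ht : Tendsto (c ∘ β) (𝓝 t₀) (𝓝[R] (c p)) := by
      refine tendsto_nhdsWithin_iff.2 ⟨?_, ?_⟩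
      · have h1 := (hβ.hasDerivAt_chart p hs.self_of_nhds).continuousAt
        have h2 : (c ∘ β) t₀ = c p := by simp only [Function.comp, hβp]
        rw [← h2]
        exact h1
      · filter_upwards [hs] with t ht
        exact extChartAt_target_subset_range p (c.map_source ht)
    filter_upwards [hs, ht.eventually hT, ht.eventually hdiff] with t h1 h2 h3
    refine ⟨h1, ?_, h2⟩
    have h4 : c.symm ((c ∘ β) t) = β t := c.left_inv h1
    have h5 := A.isFlowLine_flow (β t)
    have h6 : A.flow (0, β t) = β t := A.flow_zero _
    have h7 := h5.hasDerivAt_chart p (t := 0) (by rw [h6]; exact h1)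
    have h8 : HasDerivAt (fun τ : ℝ => G (τ, (c ∘ β) t)) (V ((c ∘ β) t)) 0 := by
      have h9 : HasDerivWithinAt (fun τ : ℝ => (τ, (c ∘ β) t)) ((1 : ℝ), (0 : EuclideanSpace ℝ (Fin 2)))
          univ 0 := ((hasDerivAt_id (0 : ℝ)).prodMk (hasDerivAt_const _ _)).hasDerivWithinAt
      have hm : MapsTo (fun τ : ℝ => (τ, (c ∘ β) t)) univ (univ ×ˢ R) :=
        fun τ _ => ⟨mem_univ _, extChartAt_target_subset_range p (c.map_source h1)⟩
      have h10 := h3.hasFDerivWithinAt.comp_hasDerivWithinAt (0 : ℝ) h9 hm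
      exact hasDerivWithinAt_univ.1 h10
    have h9 : (fun τ : ℝ => G (τ, (c ∘ β) t)) = c ∘ fun τ => A.flow (τ, β t) := by
      funext τ
      simp only [G, Function.comp]
      rw [show c.symm (c (β t)) = β t from h4]
    rw [h9] at h8
    have h10 := h8.unique h7
    rw [h10]
    have h11 := hβ.hasDerivAt_chart p h1
    have h12 := hβ.velocity_eq h5 (s := t) (t := 0) h6.symm
    have key : ∀ (q r : W) (u : TangentSpace (𝓡∂ 2) q) (v : TangentSpace (𝓡∂ 2) r), q = r →
        (u : EuclideanSpace ℝ (Fin 2)) = v →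
        (mfderiv (𝓡∂ 2) 𝓘(ℝ, EuclideanSpace ℝ (Fin 2)) c q u : EuclideanSpace ℝ (Fin 2)) =
          mfderiv (𝓡∂ 2) 𝓘(ℝ, EuclideanSpace ℝ (Fin 2)) c r v := by
      rintro q _ u v rfl huv
      exact congrArg _ huv
    exact h11.congr_deriv (key _ _ _ _ h6 h12.symm).symm
  have hA := hderiv γ hγ rfl
  have hB := hderiv δ hδ h0.symm
  have hAB := ODE_solution_unique_of_eventually (v := fun _ => V) (s := fun _ => T) (K := K)
    (f := c ∘ γ) (g := c ∘ δ) (t₀ := t₀) (Eventually.of_forall fun _ => hLip)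
    (hA.mono fun t h => h.2) (hB.mono fun t h => h.2) (by simp only [Function.comp]; rw [← h0])
  filter_upwards [hA, hB, hAB] with t h1 h2 h3
  exact c.injOn h1.1 h2.1 h3

theorem IsFlowLine.eq_of_eq {γ δ : ℝ → W} (hγ : A.IsFlowLine γ) (hδ : A.IsFlowLine δ)
    {t₀ : ℝ} (h0 : γ t₀ = δ t₀) : γ = δ := by
  have hc : IsClopen {t | γ t = δ t} :=
    ⟨isClosed_eq hγ.smooth.continuous hδ.smooth.continuous,
      isOpen_iff_mem_nhds.2 fun t ht => hγ.eventuallyEq hδ ht⟩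
  have := hc.eq_univ ⟨t₀, h0⟩
  funext t
  exact (this ▸ mem_univ t : t ∈ {t | γ t = δ t})

variable (A)

/-- The group law is not part of the data; both sides are flow lines in `s` with the same value at
`s = 0`. It makes `ψ` invertible. -/
theorem flow_add (s t : ℝ) (w : W) : A.flow (s, A.flow (t, w)) = A.flow (s + t, w) := by
  have := (A.isFlowLine_flow (A.flow (t, w))).eq_of_eq ((A.isFlowLine_flow w).comp_add t)
    (t₀ := 0) (by simp [A.flow_zero])
  exact congrFun this s

/-- The inverse of the time-one map. -/
def ψinv : W → W := fun w => A.flow (-1, w)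

theorem ψinv_ψ (w : W) : A.ψinv (A.ψ w) = w := by
  simp [ψinv, ψ, A.flow_add, A.flow_zero]

theorem ψ_ψinv (w : W) : A.ψ (A.ψinv w) = w := by
  simp [ψinv, ψ, A.flow_add, A.flow_zero]

theorem contMDiff_flow_right (t : ℝ) : ContMDiff (𝓡∂ 2) (𝓡∂ 2) ∞ (fun w => A.flow (t, w)) :=
  A.smooth_flow.comp (contMDiff_const.prodMk contMDiff_id)

theorem contMDiff_ψ : ContMDiff (𝓡∂ 2) (𝓡∂ 2) ∞ A.ψ := A.contMDiff_flow_right 1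

theorem ψ_injective : Function.Injective A.ψ := Function.LeftInverse.injective A.ψinv_ψ

theorem ψ_collar (i : Fin k) {p : ℝ × ℝ} (hp : p ∈ collarStrip S.width) :
    A.ψ (S.collar i p) = S.collar i p := A.flow_one_collar _ ⟨i, p, hp, rfl⟩

/-- If `ψ w` is a fixed point then `ψ (ψ w) = ψ w`, and injectivity of `ψ` gives `ψ w = w`. -/
theorem ψ_mem_iff_of_fixed {O : Set W} (hO : ∀ w ∈ O, A.ψ w = w) (w : W) : A.ψ w ∈ O ↔ w ∈ O := by
  refine ⟨fun h => ?_, fun h => by rwa [hO w h]⟩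
  have := A.ψ_injective (hO _ h)
  rwa [this] at h

theorem ψ_mem_core_iff (w : W) : A.ψ w ∈ S.core ↔ w ∈ S.core := by
  have : ∀ w ∈ S.coreᶜ, A.ψ w = w := by
    intro w hw
    rw [LiouvilleSurface.core_eq, compl_compl] at hw
    obtain ⟨i, ⟨x, s⟩, ⟨-, hs⟩, rfl⟩ := mem_iUnion.1 hw
    exact A.ψ_collar i ⟨by simp only; linarith [hs.1, S.width_pos], hs.2⟩
  exact not_iff_not.1 (A.ψ_mem_iff_of_fixed this w)

theorem H_flow (t : ℝ) (w : W) : A.H (A.flow (t, w)) = A.H w := by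
  have hd : ∀ t, HasDerivAt (fun t => A.H (A.flow (t, w))) 0 t := by
    intro t
    have h1 := ((A.smooth_H (A.flow (t, w))).mdifferentiableAt (by simp)).hasMFDerivAt
    have h2 := ((A.contMDiff_flow_left w t).mdifferentiableAt (by simp)).hasMFDerivAt
    have h3 := (h1.comp t h2).hasDerivAt'
    have h4 := A.flow_hamiltonian t w
      (mfderiv 𝓘(ℝ, ℝ) (𝓡∂ 2) (fun τ : ℝ => A.flow (τ, w)) t (1 : ℝ))
    rw [OneForm.d_self] at h4
    have h5 : dFun (𝓡∂ 2) A.H (A.flow (t, w))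
      (mfderiv 𝓘(ℝ, ℝ) (𝓡∂ 2) (fun τ : ℝ => A.flow (τ, w)) t (1 : ℝ)) = 0 := by linarith
    exact h3.congr_deriv h5
  have := is_const_of_deriv_eq_zero (fun t => (hd t).differentiableAt) (fun t => (hd t).deriv) t 0
  simpa [A.flow_zero] using this

/-- `X_H` vanishes on the open set, so the times at which the flow line is at `w` form an open set;
it is also closed. This is why perturbing `H` there does not spoil invariance under `ψ`. -/
theorem flow_of_dH_zero {w : W} (hw : w ∈ interior {w | dFun (𝓡∂ 2) A.H w = 0}) (t : ℝ) :
    A.flow (t, w) = w := by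
  set O := interior {w | dFun (𝓡∂ 2) A.H w = 0} with hO
  set γ := fun t => A.flow (t, w) with hγ
  have hcont : Continuous γ := (A.contMDiff_flow_left w).continuous
  have hline := A.isFlowLine_flow w
  have hopen : IsOpen {t | γ t = w} := by
    rw [isOpen_iff_mem_nhds]
    intro t₀ ht₀
    set c := extChartAt (𝓡∂ 2) w with hc
    have h1 : ∀ᶠ t in 𝓝 t₀, γ t ∈ O ∩ c.source := by
      refine hcont.continuousAt.preimage_mem_nhds ?_
      rw [show γ t₀ = w from ht₀]
      exact inter_mem (isOpen_interior.mem_nhds hw) (extChartAt_source_mem_nhds w)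
    obtain ⟨r, hr, hball⟩ := Metric.eventually_nhds_iff_ball.1 h1
    have hder : ∀ t ∈ Metric.ball t₀ r, HasDerivAt (c ∘ γ) 0 t := by
      intro t ht
      have h2 := hline.hasDerivAt_chart w (hball t ht).2
      have h3 : mfderiv 𝓘(ℝ, ℝ) (𝓡∂ 2) γ t (1 : ℝ) = 0 := by
        refine S.symplectic _ _ fun v => ?_
        have h4 : γ t ∈ {w | dFun (𝓡∂ 2) A.H w = 0} := interior_subset (hball t ht).1
        rw [hline.hamiltonian t v, show dFun (𝓡∂ 2) A.H (γ t) = 0 from h4]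
        exact neg_zero
      exact h2.congr_deriv ((congrArg _ h3).trans (map_zero _))
    filter_upwards [Metric.ball_mem_nhds t₀ hr] with t ht
    have h4 : (c ∘ γ) t = (c ∘ γ) t₀ :=
      (convex_ball t₀ r).is_const_of_fderivWithin_eq_zero
        (fun x hx => (hder x hx).differentiableAt.differentiableWithinAt)
        (fun x hx => by
          rw [fderivWithin_of_isOpen Metric.isOpen_ball hx]
          ext
          simp [(hder x hx).hasFDerivAt.fderiv]) ht (Metric.mem_ball_self hr)
    have h5 := c.injOn (hball t ht).2 (hball t₀ (Metric.mem_ball_self hr)).2 h4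
    exact h5.trans ht₀
  have := (IsClopen.eq_univ ⟨isClosed_eq hcont continuous_const, hopen⟩ ⟨0, A.flow_zero w⟩)
  exact (this ▸ mem_univ t : t ∈ {t | γ t = w})

theorem ψ_of_dH_zero {w : W} (hw : w ∈ interior {w | dFun (𝓡∂ 2) A.H w = 0}) : A.ψ w = w :=
  A.flow_of_dH_zero hw 1

end AutonomousHamiltonian

end Flow
end

noncomputable section
open Filter Topology

/-! ### Smooth dependence of integrals on parameters -/

section ParametricIntegral

open MeasureTheory

variable {V : Type} [NormedAddCommGroup V] [NormedSpace ℝ V] [FiniteDimensional ℝ V]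

theorem hasFDerivAt_intervalIntegral_of_contDiffOn {F : Type} [NormedAddCommGroup F]
    [NormedSpace ℝ F] {O : Set V} (hO : IsOpen O) {f : V × ℝ → F}
    (hf : ContDiffOn ℝ 1 f (O ×ˢ univ)) {y : V} (hy : y ∈ O) :
    HasFDerivAt (fun y => ∫ t in (0 : ℝ)..1, f (y, t))
      (∫ t in (0 : ℝ)..1, (fderiv ℝ f (y, t)).comp (ContinuousLinearMap.inl ℝ V ℝ)) y := by
  have hOo : IsOpen (O ×ˢ (univ : Set ℝ)) := hO.prod isOpen_univ
  obtain ⟨r, hr, hrO⟩ := Metric.nhds_basis_closedBall.mem_iff.1 (hO.mem_nhds hy)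
  set f' : V → ℝ → V →L[ℝ] F := fun y t => (fderiv ℝ f (y, t)).comp (ContinuousLinearMap.inl ℝ V ℝ)
  have hf' : ContinuousOn (fun q : V × ℝ => f' q.1 q.2) (O ×ˢ univ) :=
    (hf.continuousOn_fderiv_of_isOpen hOo le_rfl).clm_comp continuousOn_const
  have hK : IsCompact (Metric.closedBall y r ×ˢ Icc (0 : ℝ) 1) :=
    (isCompact_closedBall y r).prod isCompact_Icc
  obtain ⟨C, hC⟩ := hK.exists_bound_of_continuousOn
    (hf'.mono fun q hq => ⟨hrO hq.1, mem_univ _⟩)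
  have hcont : ∀ x ∈ O, Continuous fun t => f (x, t) := fun x hx =>
    hf.continuousOn.comp_continuous (by fun_prop) fun t => ⟨hx, mem_univ _⟩
  have hcont' : ∀ x ∈ O, Continuous fun t => f' x t := fun x hx =>
    hf'.comp_continuous (f := fun t => (x, t)) (by fun_prop) fun t => ⟨hx, mem_univ _⟩
  refine (intervalIntegral.hasFDerivAt_integral_of_dominated_of_fderiv_le
    (F := fun x t => f (x, t)) (F' := f') (bound := fun _ => C) (s := Metric.ball y r)
    (Metric.ball_mem_nhds y hr) ?_ ?_ ?_ ?_ ?_ ?_)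
  · filter_upwards [hO.mem_nhds hy] with x hx
    exact (hcont x hx).aestronglyMeasurable
  · exact (hcont y hy).intervalIntegrable _ _
  · exact (hcont' y hy).aestronglyMeasurable
  · refine Eventually.of_forall fun t ht x hx => hC (x, t) ⟨Metric.ball_subset_closedBall hx, ?_⟩
    rw [uIoc_of_le zero_le_one] at ht
    exact Ioc_subset_Icc_self ht
  · exact intervalIntegrable_const
  · refine Eventually.of_forall fun t _ x hx => ?_
    have h1 : HasFDerivAt f (fderiv ℝ f (x, t)) (x, t) :=
      ((hf.contDiffAt (hOo.mem_nhds ⟨hrO (Metric.ball_subset_closedBall hx),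
        mem_univ _⟩)).differentiableAt (by simp)).hasFDerivAt
    exact h1.comp x (hasFDerivAt_prodMk_left x t)

/-- Induction on the order of differentiability. The target space must vary in the induction, since
the derivative is a parametric integral with values in a space of linear maps. -/
theorem contDiffOn_intervalIntegral {O : Set V} (hO : IsOpen O) {f : V × ℝ → ℝ}
    (hf : ContDiffOn ℝ ∞ f (O ×ˢ univ)) :
    ContDiffOn ℝ ∞ (fun y => ∫ t in (0 : ℝ)..1, f (y, t)) O := by
  have hOo : IsOpen (O ×ˢ (univ : Set ℝ)) := hO.prod isOpen_univ
  have key : ∀ (n : ℕ) (F : Type) [NormedAddCommGroup F] [NormedSpace ℝ F] (f : V × ℝ → F),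
      ContDiffOn ℝ ∞ f (O ×ˢ univ) → ContDiffOn ℝ n (fun y => ∫ t in (0 : ℝ)..1, f (y, t)) O := by
    intro n
    induction n with
    | zero =>
      intro F _ _ f hf
      refine contDiffOn_zero.2 fun y hy => ?_
      exact (hasFDerivAt_intervalIntegral_of_contDiffOn hO (hf.of_le (by simp))
        hy).continuousAt.continuousWithinAt
    | succ n ih =>
      intro F _ _ f hf
      have hd := fun y (hy : y ∈ O) =>
        hasFDerivAt_intervalIntegral_of_contDiffOn hO (hf.of_le (by simp)) hy
      refine (contDiffOn_succ_iff_fderiv_of_isOpen (n := n) hO).2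
        ⟨fun y hy => (hd y hy).differentiableAt.differentiableWithinAt, by simp, ?_⟩
      refine (ih (V →L[ℝ] F) (fun q => (fderiv ℝ f q).comp (ContinuousLinearMap.inl ℝ V ℝ))
        ?_).congr fun y hy => (hd y hy).fderiv
      exact (hf.fderiv_of_isOpen hOo (m := ∞) (by simp)).clm_comp contDiffOn_const
  exact contDiffOn_infty.2 fun n => key n ℝ f hf

end ParametricIntegral

/-! ### Constancy of `U` on the collar -/

section Surface

variable {W : Type u} [TopologicalSpace W] [T2Space W] [CompactSpace W]
    [ChartedSpace (EuclideanHalfSpace 2) W] [IsManifold (𝓡∂ 2) ∞ W] {k : ℕ}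
    {S : LiouvilleSurface W k}

namespace LiouvilleSurface

theorem eq_on_openCollar_of_dFun_eq_zero (S : LiouvilleSurface W k) {f : W → ℝ} (i : Fin k)
    (hd : ∀ p : ℝ × ℝ, -S.width < p.2 → p.2 < 0 →
      MDifferentiableAt (𝓡∂ 2) 𝓘(ℝ, ℝ) f (S.collar i p) ∧ dFun (𝓡∂ 2) f (S.collar i p) = 0)
    {p q : ℝ × ℝ} (hp : -S.width < p.2 ∧ p.2 < 0) (hq : -S.width < q.2 ∧ q.2 < 0) :
    f (S.collar i p) = f (S.collar i q) := by
  set O := {p : ℝ × ℝ | -S.width < p.2 ∧ p.2 < 0} with hO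
  have hOo : IsOpen O := isOpen_openStrip S.width
  have hOc : Convex ℝ O := by
    have : O = univ ×ˢ Ioo (-S.width) 0 := by ext q; simp [hO]
    rw [this]
    exact convex_univ.prod (convex_Ioo _ _)
  have hder : ∀ q ∈ O, HasFDerivAt (f ∘ S.collar i) (0 : ℝ × ℝ →L[ℝ] ℝ) q := by
    intro q hq
    have h1 := (hd q hq.1 hq.2).1.hasMFDerivAt.comp q
      (S.collar_isParamAt i hq.1 hq.2).mdiff.hasMFDerivAt
    refine h1.hasFDerivAt.congr_fderiv ?_
    refine ContinuousLinearMap.ext fun v => ?_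
    exact DFunLike.congr_fun (hd q hq.1 hq.2).2 _
  exact hOc.is_const_of_fderivWithin_eq_zero (𝕜 := ℝ) (f := f ∘ S.collar i)
    (fun x hx => (hder x hx).differentiableAt.differentiableWithinAt)
    (fun x hx => by rw [fderivWithin_of_isOpen hOo hx, (hder x hx).fderiv]) hp hq

theorem eq_on_collar_of_dFun_eq_zero (S : LiouvilleSurface W k) {f : W → ℝ} (hf : Continuous f)
    (i : Fin k)
    (hd : ∀ p : ℝ × ℝ, -S.width < p.2 → p.2 < 0 →
      MDifferentiableAt (𝓡∂ 2) 𝓘(ℝ, ℝ) f (S.collar i p) ∧ dFun (𝓡∂ 2) f (S.collar i p) = 0)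
    {p : ℝ × ℝ} (hp : p ∈ collarStrip S.width) : f (S.collar i p) = f (S.collar i (0, 0)) := by
  have hwp := S.width_pos
  set O := {p : ℝ × ℝ | -S.width < p.2 ∧ p.2 < 0} with hO
  have hq0 : ((0 : ℝ), -(S.width / 2)) ∈ O := ⟨by simp only; linarith, by simp only; linarith⟩
  have hext : ∀ p ∈ collarStrip S.width, f (S.collar i p) = f (S.collar i (0, -(S.width / 2))) := by
    intro p hp
    have hc : ContinuousWithinAt (f ∘ S.collar i) (collarStrip S.width) p :=
      hf.continuousAt.comp_continuousWithinAt ((S.collar_smooth i).continuousOn p hp)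
    have hcl : p ∈ closure O := by
      have h2 : Tendsto (fun t : ℝ => (p.1, p.2 - t)) (𝓝[>] 0) (𝓝 p) := by
        have : Tendsto (fun t : ℝ => (p.1, p.2 - t)) (𝓝 0) (𝓝 (p.1, p.2 - 0)) :=
          Continuous.tendsto (by fun_prop) _
        simp only [sub_zero] at this
        exact this.mono_left nhdsWithin_le_nhds
      refine mem_closure_of_tendsto h2 ?_
      have h3 : ∀ᶠ t : ℝ in 𝓝[>] 0, t < p.2 + S.width :=
        nhdsWithin_le_nhds (eventually_lt_nhds (by linarith [hp.1]))
      filter_upwards [h3, self_mem_nhdsWithin] with t h4 h5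
      have h5' : 0 < t := h5
      exact ⟨by simp only; linarith, by simp only; linarith [hp.2]⟩
    have hsub : O ⊆ collarStrip S.width := fun q hq => ⟨hq.1, hq.2.le⟩
    have h4 : Tendsto (f ∘ S.collar i) (𝓝[O] p) (𝓝 (f (S.collar i p))) := hc.mono hsub
    have h5 : Tendsto (f ∘ S.collar i) (𝓝[O] p) (𝓝 (f (S.collar i (0, -(S.width / 2))))) :=
      tendsto_const_nhds.congr' (by
        filter_upwards [self_mem_nhdsWithin] with q hq
        exact S.eq_on_openCollar_of_dFun_eq_zero i hd hq0 hq)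
    have : (𝓝[O] p).NeBot := mem_closure_iff_nhdsWithin_neBot.1 hcl
    exact tendsto_nhds_unique h4 h5
  rw [hext p hp, hext (0, 0) ⟨by simpa using hwp, le_rfl⟩]

end LiouvilleSurface

namespace AutonomousHamiltonian

variable (A : AutonomousHamiltonian S)

theorem ψ_eventuallyEq_id {w : W} (hw : w ∈ S.collarRegion) : A.ψ =ᶠ[𝓝 w] id :=
  mem_of_superset (S.isOpen_collarRegion.mem_nhds hw) fun _ h => A.flow_one_collar _ h

theorem form_ψ_of_mem_collarRegion {w : W} (hw : w ∈ S.collarRegion)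
    (v : TangentSpace (𝓡∂ 2) w) :
    S.form (A.ψ w) (mfderiv (𝓡∂ 2) (𝓡∂ 2) A.ψ w v) = S.form w v := by
  have h1 := (A.ψ_eventuallyEq_id hw).mfderiv_eq (I := 𝓡∂ 2) (I' := 𝓡∂ 2)
  have key : ∀ (q : W) (u : TangentSpace (𝓡∂ 2) q), q = w →
      (u : EuclideanSpace ℝ (Fin 2)) = v → S.form q u = S.form w v := by
    rintro q u rfl h
    exact congrArg _ h
  refine key _ _ (A.flow_one_collar w hw) ?_
  exact (DFunLike.congr_fun h1 v).trans (DFunLike.congr_fun (mfderiv_id (I := 𝓡∂ 2)) v)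

end AutonomousHamiltonian

namespace GirouxData

variable {A : AutonomousHamiltonian S} (D : GirouxData A)

/-- On the collar `ψ` is the identity, so `ψ^*λ = λ - dU` forces `dU = 0` there. -/
theorem U_collar (i : Fin k) {p : ℝ × ℝ} (hp : p ∈ collarStrip S.width) :
    D.U (S.collar i p) = D.U (S.collar i (0, 0)) := by
  refine S.eq_on_collar_of_dFun_eq_zero D.smooth_U.continuous i (fun p hp hp0 => ?_) hp
  refine ⟨(D.smooth_U _).mdifferentiableAt (by simp), ContinuousLinearMap.ext fun v => ?_⟩
  have h1 := D.pullback_form (S.collar i p) v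
  rw [A.form_ψ_of_mem_collarRegion ⟨i, p, ⟨hp, hp0.le⟩, rfl⟩] at h1
  have : dFun (𝓡∂ 2) D.U (S.collar i p) v = 0 := by linarith
  exact this

theorem slope_pos (i : Fin k) : 0 < D.slope i :=
  div_pos (neg_pos.2 (D.U_neg _)) (by positivity)

theorem U_collar_eq_slope (i : Fin k) {p : ℝ × ℝ} (hp : p ∈ collarStrip S.width) :
    D.U (S.collar i p) = -(2 * Real.pi * D.slope i) := by
  rw [D.U_collar i hp, slope]
  field_simp

end GirouxData

end Surface
end

noncomputable section
open Filter Topology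

theorem IsParamAt.contMDiffAt_of_comp {E : Type*} [NormedAddCommGroup E] [NormedSpace ℝ E]
    [CompleteSpace E] {B : Type*} [TopologicalSpace B] {I : ModelWithCorners ℝ E B}
    {M : Type*} [TopologicalSpace M] [ChartedSpace B M] [IsManifold I ∞ M]
    {V : Type*} [NormedAddCommGroup V] [NormedSpace ℝ V] [CompleteSpace V]
    {F : Type*} [NormedAddCommGroup F] [NormedSpace ℝ F]
    {Φ : V → M} {x : V} (hΦ : IsParamAt I Φ x)
    {f : M → F} (hf : ContDiffAt ℝ ∞ (f ∘ Φ) x) : ContMDiffAt I 𝓘(ℝ, F) ∞ f (Φ x) := by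
  obtain ⟨σ, hσ, hx, h1, -⟩ := hΦ.exists_localInverse
  have h2 : ContMDiffAt I 𝓘(ℝ, F) ∞ ((f ∘ Φ) ∘ σ) (Φ x) :=
    ContMDiffAt.comp (Φ x) (by rw [hx]; exact hf.contMDiffAt) hσ
  refine h2.congr_of_eventuallyEq ?_
  filter_upwards [h1] with y hy
  simp only [Function.comp, hy]

/-! ### The action as a primitive of `ψ^*λ - λ` -/

section Surface

variable {W : Type u} [TopologicalSpace W] [T2Space W] [CompactSpace W]
    [ChartedSpace (EuclideanHalfSpace 2) W] [IsManifold (𝓡∂ 2) ∞ W] {k : ℕ}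
    {S : LiouvilleSurface W k}

namespace AutonomousHamiltonian

variable (A : AutonomousHamiltonian S)

/-- The action `∫ (λ (X_H) - H) dt` of the flow line of length one which starts at `w`. -/
def action (w : W) : ℝ :=
  ∫ t in (0 : ℝ)..1, (S.form.pb (fun τ => A.flow (τ, w)) t 1 - A.H w)

/-- Cartan's formula: the time derivative of the pullback of `λ` under the flow is `d(λ(X_H) - H)`
pulled back, and `H` is constant along the flow; integrate over `[0, 1]`. In coordinates `(y, t)`
this says that the integrand differentiated along `v` equals `∂_t` of the pulled back form on `v`,
the difference of the two being `dβ(∂_t, v) = -dH(v)`. Interior points are required because the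
parametrization has to be defined on an open set of the plane. -/
theorem action_isPrimitive {w : W} (hw : (𝓡∂ 2).IsInteriorPoint w) :
    ContMDiffAt (𝓡∂ 2) 𝓘(ℝ, ℝ) ∞ A.action w ∧ ∀ v : TangentSpace (𝓡∂ 2) w,
      dFun (𝓡∂ 2) A.action w v =
        S.form (A.ψ w) (mfderiv (𝓡∂ 2) (𝓡∂ 2) A.ψ w v) - S.form w v := by
  set Φ := (extChartAt (𝓡∂ 2) w).symm with hΦdef
  set x₀ := extChartAt (𝓡∂ 2) w w with hx₀
  set O := interior (extChartAt (𝓡∂ 2) w).target with hO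
  have hOo : IsOpen O := isOpen_interior
  have hΦx : Φ x₀ = w := extChartAt_to_inv w
  have hΦ : ∀ y ∈ O, IsParamAt (𝓡∂ 2) Φ y := fun y hy =>
    isParamAt_extChartAt_symm w (interior_subset hy)
      (mem_of_superset (mem_interior_iff_mem_nhds.1 hy) (extChartAt_target_subset_range w))
  have hx₀O : x₀ ∈ O := by
    refine mem_interior_iff_mem_nhds.2 ?_
    have := extChartAt_target_mem_nhdsWithin (I := 𝓡∂ 2) w
    rwa [nhdsWithin_eq_nhds.2 (range_mem_nhds_isInteriorPoint hw)] at this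
  let Θ : EuclideanSpace ℝ (Fin 2) × ℝ → W := fun q => A.flow (q.2, Φ q.1)
  have hΘ : ∀ y ∈ O, ∀ t, ContMDiffAt 𝓘(ℝ, EuclideanSpace ℝ (Fin 2) × ℝ) (𝓡∂ 2) ∞ Θ (y, t) := by
    intro y hy t
    refine ContMDiffAt.comp (y, t) (A.smooth_flow _) ?_
    exact (contDiff_snd.contMDiff.contMDiffAt).prodMk
      (ContMDiffAt.comp (y, t) (g := Φ) (hΦ y hy).smooth contDiff_fst.contMDiff.contMDiffAt)
  set β := S.form.pb Θ with hβdef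
  have hβ : ∀ y ∈ O, ∀ t, ContDiffAt ℝ ∞ β (y, t) := fun y hy t =>
    S.smooth_form.contDiffAt_pb (hΘ y hy t)
  have hHΦ : ∀ y ∈ O, ContDiffAt ℝ ∞ (A.H ∘ Φ) y := fun y hy => by
    rw [← contMDiffAt_iff_contDiffAt]
    exact ContMDiffAt.comp y (A.smooth_H _) (hΦ y hy).smooth
  let f : EuclideanSpace ℝ (Fin 2) × ℝ → ℝ := fun q => β q (0, 1) - (A.H ∘ Φ) q.1
  have hf : ContDiffOn ℝ ∞ f (O ×ˢ univ) := by
    rintro ⟨y, t⟩ ⟨hy, -⟩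
    refine ContDiffAt.contDiffWithinAt ?_
    exact ((hβ y hy t).clm_apply contDiffAt_const).sub
      (ContDiffAt.comp (y, t) (g := A.H ∘ Φ) (hHΦ y hy) contDiffAt_fst)
  have hvel : ∀ y ∈ O, ∀ t, mfderiv 𝓘(ℝ, ℝ) (𝓡∂ 2) (fun τ => A.flow (τ, Φ y)) t (1 : ℝ) =
      mfderiv 𝓘(ℝ, EuclideanSpace ℝ (Fin 2) × ℝ) (𝓡∂ 2) Θ (y, t)
        ((0, 1) : EuclideanSpace ℝ (Fin 2) × ℝ) := by
    intro y hy t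
    have h1 := ((hΘ y hy t).mdifferentiableAt (by simp)).hasMFDerivAt.comp t
      (f := fun τ => (y, τ)) (hasFDerivAt_prodMk_right y t).hasMFDerivAt
    exact DFunLike.congr_fun h1.mfderiv (1 : ℝ)
  have hact : ∀ y ∈ O, A.action (Φ y) = ∫ t in (0 : ℝ)..1, f (y, t) := by
    intro y hy
    refine intervalIntegral.integral_congr fun t _ => ?_
    exact congrArg (fun a => a - A.H (Φ y))
      (congrArg (S.form (A.flow (t, Φ y))) (hvel y hy t))
  have hact' : A.action ∘ Φ =ᶠ[𝓝 x₀] fun y => ∫ t in (0 : ℝ)..1, f (y, t) := by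
    filter_upwards [hOo.mem_nhds hx₀O] with y hy using hact y hy
  have hsm : ContDiffAt ℝ ∞ (A.action ∘ Φ) x₀ :=
    ((contDiffOn_intervalIntegral hOo hf).contDiffAt (hOo.mem_nhds hx₀O)).congr_of_eventuallyEq hact'
  have hCM : ContMDiffAt (𝓡∂ 2) 𝓘(ℝ, ℝ) ∞ A.action w := by
    have := (hΦ x₀ hx₀O).contMDiffAt_of_comp hsm
    rwa [hΦx] at this
  refine ⟨hCM, ?_⟩
  -- the derivative of the integrand
  have hder : ∀ t (v : EuclideanSpace ℝ (Fin 2)),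
      fderiv ℝ f (x₀, t) (v, 0) = fderiv ℝ β (x₀, t) (0, 1) (v, 0) := by
    intro t v
    have h1 : HasFDerivAt (fun q => β q (0, 1)) _ (x₀, t) :=
      ((hβ x₀ hx₀O t).differentiableAt (by simp)).hasFDerivAt.clm_apply
        (hasFDerivAt_const ((0, 1) : EuclideanSpace ℝ (Fin 2) × ℝ) (x₀, t))
    have h2 : HasFDerivAt (fun q : EuclideanSpace ℝ (Fin 2) × ℝ => (A.H ∘ Φ) q.1) _ (x₀, t) :=
      HasFDerivAt.comp (x₀, t) (g := A.H ∘ Φ)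
        ((hHΦ x₀ hx₀O).differentiableAt (by simp)).hasFDerivAt hasFDerivAt_fst
    have h3 : fderiv ℝ f (x₀, t) (v, 0) =
        fderiv ℝ β (x₀, t) (v, 0) (0, 1) - fderiv ℝ (A.H ∘ Φ) x₀ v := by
      have h := (h1.sub h2).fderiv
      have h' := DFunLike.congr_fun h ((v, 0) : EuclideanSpace ℝ (Fin 2) × ℝ)
      refine Eq.trans h' ?_
      simp
    have h4 := OneForm.d_pullback S.smooth_form (hΘ x₀ hx₀O t)
      ((0, 1) : EuclideanSpace ℝ (Fin 2) × ℝ) (v, 0)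
    have h5 := A.flow_hamiltonian t (Φ x₀)
      (mfderiv 𝓘(ℝ, EuclideanSpace ℝ (Fin 2) × ℝ) (𝓡∂ 2) Θ (x₀, t)
        ((v, 0) : EuclideanSpace ℝ (Fin 2) × ℝ))
    have h6 := congrArg (fun u => S.form.d (A.flow (t, Φ x₀)) u
      (mfderiv 𝓘(ℝ, EuclideanSpace ℝ (Fin 2) × ℝ) (𝓡∂ 2) Θ (x₀, t)
        ((v, 0) : EuclideanSpace ℝ (Fin 2) × ℝ))) (hvel x₀ hx₀O t)
    have h7 := dFun_apply_mfderiv ((A.smooth_H (Θ (x₀, t))).mdifferentiableAt (by simp))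
      ((hΘ x₀ hx₀O t).mdifferentiableAt (by simp)) ((v, 0) : EuclideanSpace ℝ (Fin 2) × ℝ)
    have h8 : A.H ∘ Θ = fun q : EuclideanSpace ℝ (Fin 2) × ℝ => (A.H ∘ Φ) q.1 := by
      funext q
      exact A.H_flow _ _
    rw [h8, h2.fderiv] at h7
    have h9 : extD β (x₀, t) (0, 1) (v, 0) = -fderiv ℝ (A.H ∘ Φ) x₀ v :=
      h4.symm.trans (h6.symm.trans (h5.trans (congrArg Neg.neg h7)))
    rw [extD] at h9
    rw [h3]
    linarith
  intro v
  obtain ⟨v', hv'⟩ : ∃ v' : EuclideanSpace ℝ (Fin 2),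
      (mfderiv 𝓘(ℝ, EuclideanSpace ℝ (Fin 2)) (𝓡∂ 2) Φ x₀ v' : EuclideanSpace ℝ (Fin 2)) = v :=
    (hΦ x₀ hx₀O).bijective.2 (show TangentSpace (𝓡∂ 2) (Φ x₀) from v)
  have hftc : ∫ t in (0 : ℝ)..1, fderiv ℝ f (x₀, t) (v', 0) = β (x₀, 1) (v', 0) - β (x₀, 0) (v', 0) := by
    have h1 : ∀ t, HasDerivAt (fun t : ℝ => β (x₀, t) (v', 0)) (fderiv ℝ f (x₀, t) (v', 0)) t := by
      intro t
      rw [hder]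
      have h2 : HasFDerivAt (fun q => β q (v', 0)) _ (x₀, t) :=
        ((hβ x₀ hx₀O t).differentiableAt (by simp)).hasFDerivAt.clm_apply
          (hasFDerivAt_const ((v', 0) : EuclideanSpace ℝ (Fin 2) × ℝ) (x₀, t))
      have h3 := (h2.comp t (hasFDerivAt_prodMk_right x₀ t)).hasDerivAt
      refine h3.congr_deriv ?_
      simp
    refine intervalIntegral.integral_eq_sub_of_hasDerivAt (fun t _ => h1 t) ?_
    have h4 : ContinuousOn (fderiv ℝ f) (O ×ˢ univ) :=
      hf.continuousOn_fderiv_of_isOpen (hOo.prod isOpen_univ) (by simp)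
    have h5 : Continuous fun t : ℝ => fderiv ℝ f (x₀, t) :=
      h4.comp_continuous (by fun_prop) fun t => ⟨hx₀O, mem_univ _⟩
    exact (h5.clm_apply continuous_const).intervalIntegrable _ _
  have hβv : ∀ t, β (x₀, t) (v', 0) = S.form.pb (fun y => A.flow (t, Φ y)) x₀ v' := by
    intro t
    have h1 := ((hΘ x₀ hx₀O t).mdifferentiableAt (by simp)).hasMFDerivAt.comp x₀
      (f := fun y => (y, t)) (hasFDerivAt_prodMk_left x₀ t).hasMFDerivAt
    have h2 := DFunLike.congr_fun h1.mfderiv v'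
    exact congrArg (S.form (A.flow (t, Φ x₀))) h2.symm
  have h1 : fderiv ℝ (A.action ∘ Φ) x₀ v' = β (x₀, 1) (v', 0) - β (x₀, 0) (v', 0) := by
    have h2 := hasFDerivAt_intervalIntegral_of_contDiffOn hOo (hf.of_le (by simp)) hx₀O
    rw [hact'.fderiv_eq, h2.fderiv, ← hftc, ContinuousLinearMap.intervalIntegral_apply]
    · rfl
    · have h4 : ContinuousOn (fderiv ℝ f) (O ×ˢ univ) :=
        hf.continuousOn_fderiv_of_isOpen (hOo.prod isOpen_univ) (by simp)
      have h5 : Continuous fun t : ℝ => fderiv ℝ f (x₀, t) :=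
        h4.comp_continuous (by fun_prop) fun t => ⟨hx₀O, mem_univ _⟩
      exact (h5.clm_comp continuous_const).intervalIntegrable _ _
  have h0 : S.form.pb (fun y => A.flow (0, Φ y)) x₀ v' =
      S.form (Φ x₀) (mfderiv 𝓘(ℝ, EuclideanSpace ℝ (Fin 2)) (𝓡∂ 2) Φ x₀ v') := by
    have : (fun y => A.flow (0, Φ y)) = Φ := funext fun y => A.flow_zero _
    rw [this]
    rfl
  have h2 : S.form.pb (fun y => A.flow (1, Φ y)) x₀ v' = S.form (A.ψ (Φ x₀))
      (mfderiv (𝓡∂ 2) (𝓡∂ 2) A.ψ (Φ x₀)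
        (mfderiv 𝓘(ℝ, EuclideanSpace ℝ (Fin 2)) (𝓡∂ 2) Φ x₀ v')) := by
    have h := mfderiv_comp x₀ (g := A.ψ) ((A.contMDiff_ψ _).mdifferentiableAt (by simp))
      (hΦ x₀ hx₀O).mdiff
    exact congrArg (S.form (A.ψ (Φ x₀))) (DFunLike.congr_fun h v')
  have h3 := dFun_apply_mfderiv (f := A.action) (Φ := Φ) (x := x₀)
    (by rw [hΦx]; exact hCM.mdifferentiableAt (by simp)) (hΦ x₀ hx₀O).mdiff v'
  rw [h1, hβv, hβv, h0, h2] at h3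
  have key : ∀ (p q : W) (a : TangentSpace (𝓡∂ 2) p) (b : TangentSpace (𝓡∂ 2) q), p = q →
      (a : EuclideanSpace ℝ (Fin 2)) = b →
      dFun (𝓡∂ 2) A.action p a =
        S.form (A.ψ p) (mfderiv (𝓡∂ 2) (𝓡∂ 2) A.ψ p a) - S.form p a →
      dFun (𝓡∂ 2) A.action q b =
        S.form (A.ψ q) (mfderiv (𝓡∂ 2) (𝓡∂ 2) A.ψ q b) - S.form q b := by
    rintro p _ a b rfl hab h
    have : a = b := hab
    subst this
    exact h
  exact key _ _ _ _ hΦx hv' h3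

theorem exists_primitive : ∃ U : W → ℝ, ContMDiff (𝓡∂ 2) 𝓘(ℝ, ℝ) ∞ U ∧ (∀ w, U w < 0) ∧
    ∀ (w : W) (v : TangentSpace (𝓡∂ 2) w),
      S.form (A.ψ w) (mfderiv (𝓡∂ 2) (𝓡∂ 2) A.ψ w v) = S.form w v - dFun (𝓡∂ 2) U w v := by
  classical
  have hwp := S.width_pos
  have hcz : ∀ i, ∀ p : ℝ × ℝ, -S.width < p.2 → p.2 < 0 →
      MDifferentiableAt (𝓡∂ 2) 𝓘(ℝ, ℝ) A.action (S.collar i p) ∧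
        dFun (𝓡∂ 2) A.action (S.collar i p) = 0 := by
    intro i p hp hp0
    have h := A.action_isPrimitive (S.collar_isInteriorPoint i hp hp0)
    refine ⟨h.1.mdifferentiableAt (by simp), ContinuousLinearMap.ext fun v => ?_⟩
    refine (h.2 v).trans ?_
    rw [A.form_ψ_of_mem_collarRegion ⟨i, p, ⟨hp, hp0.le⟩, rfl⟩]
    exact sub_self _
  -- The action is known to be smooth at interior points only. On each open collar it is constant,
  -- so it is replaced on the whole collar by its value at depth `ε/2`; this extends it smoothly
  -- over `∂W`.
  let u : W → ℝ := fun w => if h : ∃ i, ∃ p ∈ collarStrip S.width, S.collar i p = w then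
    A.action (S.collar h.choose (0, -(S.width / 2))) else A.action w
  have hu : ∀ i, ∀ p ∈ collarStrip S.width,
      u (S.collar i p) = A.action (S.collar i (0, -(S.width / 2))) := by
    intro i p hp
    have h : ∃ j, ∃ q ∈ collarStrip S.width, S.collar j q = S.collar i p := ⟨i, p, hp, rfl⟩
    simp only [u, dif_pos h]
    obtain ⟨q, hq, hqp⟩ := h.choose_spec
    rw [((S.collar_eq_iff _ i q hq p hp).1 hqp).1]
  have hui : ∀ w, (𝓡∂ 2).IsInteriorPoint w → u w = A.action w := by
    intro w hw
    by_cases h : ∃ i, ∃ p ∈ collarStrip S.width, S.collar i p = w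
    · obtain ⟨i, p, hp, rfl⟩ := h
      rw [hu i p hp]
      have hp0 : p.2 < 0 := lt_of_le_of_ne hp.2 fun h0 =>
        (S.isInteriorPoint_iff _).1 hw i p.1 (by rw [← h0])
      exact S.eq_on_openCollar_of_dFun_eq_zero i (hcz i)
        ⟨by simp only; linarith, by simp only; linarith⟩ ⟨hp.1, hp0⟩
    · simp only [u, dif_neg h]
  have hucol : ∀ i, ∀ p ∈ collarStrip S.width, u =ᶠ[𝓝 (S.collar i p)]
      fun _ => A.action (S.collar i (0, -(S.width / 2))) := by
    intro i p hp
    filter_upwards [(S.isOpen_collar_image i le_rfl).mem_nhds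
      (⟨p, ⟨mem_univ _, hp⟩, rfl⟩ : S.collar i p ∈ S.collar i '' (univ ×ˢ Ioc (-S.width) 0))]
      with w hw
    obtain ⟨q, hq, rfl⟩ := hw
    exact hu i q hq.2
  have hint : ∀ w, w ∉ S.collarRegion → u =ᶠ[𝓝 w] A.action ∧ (𝓡∂ 2).IsInteriorPoint w := by
    intro w hw
    have hwc := S.mem_core_of_notMem_collarRegion hw
    refine ⟨?_, S.isInteriorPoint_of_mem_core hwc⟩
    filter_upwards [S.isOpen_core.mem_nhds hwc] with w' hw'
    exact hui w' (S.isInteriorPoint_of_mem_core hw')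
  have hus : ContMDiff (𝓡∂ 2) 𝓘(ℝ, ℝ) ∞ u := by
    intro w
    by_cases hw : w ∈ S.collarRegion
    · obtain ⟨i, p, hp, rfl⟩ := hw
      exact contMDiffAt_const.congr_of_eventuallyEq (hucol i p hp)
    · exact (A.action_isPrimitive (hint w hw).2).1.congr_of_eventuallyEq (hint w hw).1
  have hd : ∀ (w : W) (v : TangentSpace (𝓡∂ 2) w), dFun (𝓡∂ 2) u w v =
      S.form (A.ψ w) (mfderiv (𝓡∂ 2) (𝓡∂ 2) A.ψ w v) - S.form w v := by
    intro w v
    by_cases hw : w ∈ S.collarRegion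
    · rw [A.form_ψ_of_mem_collarRegion hw, sub_self]
      obtain ⟨i, p, hp, rfl⟩ := hw
      have h := (hucol i p hp).mfderiv_eq (I := 𝓡∂ 2) (I' := 𝓘(ℝ, ℝ))
      rw [mfderiv_const] at h
      exact DFunLike.congr_fun h v
    · have h := (hint w hw).1.mfderiv_eq (I := 𝓡∂ 2) (I' := 𝓘(ℝ, ℝ))
      exact (DFunLike.congr_fun h v).trans ((A.action_isPrimitive (hint w hw).2).2 v)
  -- A primitive may be shifted by a constant; a bound on the compact surface makes it negative.
  obtain ⟨C, hC⟩ := isCompact_univ.exists_bound_of_continuousOn (hus.continuous.continuousOn)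
  refine ⟨fun w => -u w - (C + 1), (hus.neg).sub contMDiff_const, fun w => ?_, fun w v => ?_⟩
  · have := hC w (mem_univ _)
    rw [Real.norm_eq_abs] at this
    have := neg_abs_le (u w)
    linarith
  · have h0 : HasFDerivAt (fun x : ℝ => -x - (C + 1)) (-ContinuousLinearMap.id ℝ ℝ) (u w) :=
      ((hasFDerivAt_id (u w)).neg).sub_const (C + 1)
    have h1 : HasMFDerivAt (𝓡∂ 2) 𝓘(ℝ, ℝ) (fun w => -u w - (C + 1)) w _ :=
      h0.hasMFDerivAt.comp w ((hus w).mdifferentiableAt (by simp)).hasMFDerivAt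
    have h2 : dFun (𝓡∂ 2) (fun w => -u w - (C + 1)) w v = -(dFun (𝓡∂ 2) u w v) :=
      DFunLike.congr_fun h1.mfderiv v
    rw [h2, hd]
    ring

end AutonomousHamiltonian

end Surface
end

noncomputable section
open Filter Topology

/-! ### Existence of the profile functions -/

section Profiles

/-- A smooth transition from `0` on `(-∞, 1/16]` to `1` on `[1/4, ∞)`. -/
def profileStep (s : ℝ) : ℝ := Real.smoothTransition ((s - 1 / 16) / (3 / 16))

theorem contDiff_profileStep : ContDiff ℝ ∞ profileStep :=
  Real.smoothTransition.contDiff.comp ((contDiff_id.sub contDiff_const).div_const _)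

theorem profileStep_of_le {s : ℝ} (hs : s ≤ 1 / 16) : profileStep s = 0 :=
  Real.smoothTransition.zero_of_nonpos
    (div_nonpos_of_nonpos_of_nonneg (by linarith) (by norm_num))

theorem profileStep_of_ge {s : ℝ} (hs : 1 / 4 ≤ s) : profileStep s = 1 :=
  Real.smoothTransition.one_of_one_le (by rw [le_div_iff₀ (by norm_num)]; linarith)

theorem profileStep_nonneg (s : ℝ) : 0 ≤ profileStep s := Real.smoothTransition.nonneg _

theorem profileStep_le_one (s : ℝ) : profileStep s ≤ 1 := Real.smoothTransition.le_one _

theorem profileStep_lt_one {s : ℝ} (hs : s < 1 / 4) : profileStep s < 1 :=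
  Real.smoothTransition.lt_one_of_lt_one (by rw [div_lt_iff₀ (by norm_num)]; linarith)

theorem deriv_profileStep_nonneg (s : ℝ) : 0 ≤ deriv profileStep s := by
  refine Monotone.deriv_nonneg fun a b hab => Real.smoothTransition.monotone ?_
  exact div_le_div_of_nonneg_right (by linarith) (by norm_num)

theorem profileStep_eventuallyEq {s : ℝ} (hs : s < 1 / 16) : profileStep =ᶠ[𝓝 s] fun _ => 0 := by
  filter_upwards [eventually_lt_nhds hs] with t ht using profileStep_of_le ht.le

theorem hasDerivAt_profileStep (s : ℝ) : HasDerivAt profileStep (deriv profileStep s) s :=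
  (contDiff_profileStep.differentiable (by simp) s).hasDerivAt

/-- With `s = r²`, interpolate on `[1/16, 1/4]` between `a(s) = 1 - δ + δ e^(-s/δ)`, which has value
`1` and slope `-1` at zero, and `e^(-ε√s)`. The choice of `δ` gives `1 - δ = e^(-ε/4)`, so `a` stays
above the second function once `√s ≥ 1/4`. The term from the derivative of the cutoff then has the
right sign and the interpolation decreases. -/
theorem exists_bindingProfile₁ {ε : ℝ} (hε : 0 < ε) : ∃ g : ℝ → ℝ, ContDiff ℝ ∞ g ∧ g 0 = 1 ∧
    deriv g 0 = -1 ∧ (∀ s, 0 < s → deriv g s < 0) ∧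
    ∀ s, 1 / 4 ≤ s → g s = Real.exp (-(ε * √s)) := by
  set δ := 1 - Real.exp (-(ε / 4)) with hδ
  have hδ0 : 0 < δ := sub_pos.2 (Real.exp_lt_one_iff.2 (by linarith))
  let a : ℝ → ℝ := fun s => 1 - δ + δ * Real.exp (-(s / δ))
  let e : ℝ → ℝ := fun s => Real.exp (-(ε * √s))
  have ha : ContDiff ℝ ∞ a := by fun_prop
  have had : ∀ s, HasDerivAt a (-Real.exp (-(s / δ))) s := by
    intro s
    have h := ((((hasDerivAt_id s).div_const δ).neg.exp).const_mul δ).const_add (1 - δ)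
    refine h.congr_deriv ?_
    simp only [Pi.neg_apply, id]
    field_simp
  have he : ∀ s, 0 < s → ContDiffAt ℝ ∞ e s := fun s hs =>
    ((contDiffAt_const.mul (Real.contDiffAt_sqrt hs.ne')).neg).exp
  have hed : ∀ s, 0 < s → HasDerivAt e (Real.exp (-(ε * √s)) * -(ε * (1 / (2 * √s)))) s :=
    fun s hs => ((Real.hasDerivAt_sqrt hs.ne').const_mul ε).neg.exp
  have hae : ∀ s, 1 / 16 ≤ s → e s ≤ a s := by
    intro s hs
    have h1 : 1 / 4 ≤ √s := Real.le_sqrt_of_sq_le (by norm_num; linarith)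
    have h2 : e s ≤ Real.exp (-(ε / 4)) := Real.exp_le_exp.2 (by nlinarith)
    have h3 : 0 ≤ δ * Real.exp (-(s / δ)) := by positivity
    simp only [a]
    linarith
  let g : ℝ → ℝ := fun s => (1 - profileStep s) * a s + profileStep s * e s
  have hnear : ∀ s, s < 1 / 16 → g =ᶠ[𝓝 s] a := by
    intro s hs
    filter_upwards [profileStep_eventuallyEq hs] with t ht
    simp [g, ht]
  have hgs : ContDiff ℝ ∞ g := by
    rw [contDiff_iff_contDiffAt]
    intro s
    rcases lt_or_ge s (1 / 16) with hs | hs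
    · exact ha.contDiffAt.congr_of_eventuallyEq (hnear s hs)
    · exact ((contDiffAt_const.sub contDiff_profileStep.contDiffAt).mul ha.contDiffAt).add
        (contDiff_profileStep.contDiffAt.mul (he s (by linarith)))
  refine ⟨g, hgs, ?_, ?_, fun s hs => ?_, fun s hs => ?_⟩
  · rw [(hnear 0 (by norm_num)).eq_of_nhds]
    simp [a]
  · rw [(hnear 0 (by norm_num)).deriv_eq, (had 0).deriv]
    simp
  · rcases lt_or_ge s (1 / 16) with hs' | hs'
    · rw [(hnear s hs').deriv_eq, (had s).deriv]
      exact neg_neg_of_pos (Real.exp_pos _)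
    · have hd : HasDerivAt g _ s := ((((hasDerivAt_const s (1 : ℝ)).sub
        (hasDerivAt_profileStep s)).mul (had s)).add ((hasDerivAt_profileStep s).mul (hed s hs)))
      rw [hd.deriv]
      have h1 := deriv_profileStep_nonneg s
      have h2 := hae s hs'
      have h3 := profileStep_nonneg s
      have h4 := profileStep_le_one s
      have h5 : 0 < Real.exp (-(s / δ)) := Real.exp_pos _
      have h6 : 0 < Real.exp (-(ε * √s)) * (ε * (1 / (2 * √s))) := by positivity
      have h7 : 0 < (1 - profileStep s) * Real.exp (-(s / δ)) +
          profileStep s * (Real.exp (-(ε * √s)) * (ε * (1 / (2 * √s)))) := by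
        rcases h4.lt_or_eq with h | h
        · have := mul_pos (sub_pos.2 h) h5
          have := mul_nonneg h3 h6.le
          linarith
        · rw [h]
          linarith
      have h8 := mul_nonneg h1 (sub_nonneg.2 h2)
      simp only [Pi.sub_apply]
      linarith
  · simp [g, e, profileStep_of_ge hs]

/-- The function `a (1 - e^(-s/a))` has slope `1` at zero, increases and stays below `a`; blending
it into the constant `a` adds only a nonnegative term to the derivative. -/
theorem exists_bindingProfile₂ {a : ℝ} (ha : 0 < a) : ∃ g : ℝ → ℝ, ContDiff ℝ ∞ g ∧ g 0 = 0 ∧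
    deriv g 0 = 1 ∧ (∀ s, 0 < s → s < 1 / 4 → 0 < deriv g s) ∧ ∀ s, 1 / 4 ≤ s → g s = a := by
  let g : ℝ → ℝ := fun s => a - (1 - profileStep s) * (a * Real.exp (-(s / a)))
  have hd : ∀ s, HasDerivAt g (deriv profileStep s * (a * Real.exp (-(s / a))) +
      (1 - profileStep s) * Real.exp (-(s / a))) s := by
    intro s
    have h := (((hasDerivAt_profileStep s).const_sub 1).mul
      (((hasDerivAt_id s).div_const a).neg.exp.const_mul a)).const_sub a
    refine h.congr_deriv ?_
    simp only [Pi.neg_apply, id]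
    field_simp
    ring
  refine ⟨g, ?_, ?_, ?_, fun s hs hs' => ?_, fun s hs => ?_⟩
  · have := contDiff_profileStep
    fun_prop
  · simp [g, profileStep_of_le (show (0 : ℝ) ≤ 1 / 16 by norm_num)]
  · rw [(hd 0).deriv, (profileStep_eventuallyEq (show (0 : ℝ) < 1 / 16 by norm_num)).deriv_eq]
    simp [profileStep_of_le (show (0 : ℝ) ≤ 1 / 16 by norm_num)]
  · rw [(hd s).deriv]
    have h1 := mul_nonneg (deriv_profileStep_nonneg s) (mul_pos ha (Real.exp_pos (-(s / a)))).le
    have h2 := mul_pos (sub_pos.2 (profileStep_lt_one hs')) (Real.exp_pos (-(s / a)))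
    linarith
  · simp [g, profileStep_of_ge hs]

theorem exists_bindingProfile {ε a : ℝ} (hε : 0 < ε) (ha : 0 < a) :
    ∃ h₁ h₂ : ℝ → ℝ, IsBindingProfile ε a h₁ h₂ := by
  obtain ⟨g₁, s₁, z₁, d₁, n₁, t₁⟩ := exists_bindingProfile₁ hε
  obtain ⟨g₂, s₂, z₂, d₂, n₂, t₂⟩ := exists_bindingProfile₂ ha
  have hd : ∀ g : ℝ → ℝ, ContDiff ℝ ∞ g → ∀ r,
      deriv (fun r => g (r ^ 2)) r = deriv g (r ^ 2) * (2 * r) := by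
    intro g hg r
    have h := (hg.differentiable (by simp) (r ^ 2)).hasDerivAt.comp r (hasDerivAt_pow 2 r)
    exact h.deriv.trans (by simp)
  refine ⟨fun r => g₁ (r ^ 2), fun r => g₂ (r ^ 2), ⟨g₁, s₁, z₁, d₁, fun _ _ => rfl⟩,
    ⟨g₂, s₂, z₂, d₂, fun _ _ => rfl⟩, fun r hr => ?_, fun r hr => ?_, fun r hr => ?_, fun r hr => ?_⟩
  · rw [hd g₁ s₁]
    exact mul_neg_of_neg_of_pos (n₁ _ (pow_pos hr.1 2)) (by linarith [hr.1])
  · rw [hd g₂ s₂]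
    exact mul_pos (n₂ _ (pow_pos hr.1 2) (by nlinarith [hr.1, hr.2])) (by linarith [hr.1])
  · rw [t₁ _ (by nlinarith [hr.1]), Real.sqrt_sq (by linarith [hr.1])]
  · exact t₂ _ (by nlinarith [hr.1])

end Profiles

section Surface

variable {W : Type u} [TopologicalSpace W] [T2Space W] [CompactSpace W]
    [ChartedSpace (EuclideanHalfSpace 2) W] [IsManifold (𝓡∂ 2) ∞ W] {k : ℕ}
    {S : LiouvilleSurface W k}

theorem nonempty_girouxData (A : AutonomousHamiltonian S) : Nonempty (GirouxData A) := by
  obtain ⟨U, h1, h2, h3⟩ := A.exists_primitive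
  have h : ∀ i, ∃ g : (ℝ → ℝ) × (ℝ → ℝ),
      IsBindingProfile S.width (-U (S.collar i (0, 0)) / (2 * Real.pi)) g.1 g.2 := by
    intro i
    obtain ⟨g₁, g₂, hg⟩ := exists_bindingProfile S.width_pos
      (a := -U (S.collar i (0, 0)) / (2 * Real.pi)) (div_pos (neg_pos.2 (h2 _)) (by positivity))
    exact ⟨(g₁, g₂), hg⟩
  choose g hg using h
  exact ⟨⟨U, h1, h2, h3, fun i => (g i).1, fun i => (g i).2, hg⟩⟩

end Surface
end

noncomputable section
open Filter Topology

/-! ### Conformal rescaling, and rotation invariant contact forms on `ℝ × ℂ` -/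

section Conformal

variable {V : Type*} [NormedAddCommGroup V] [NormedSpace ℝ V]

theorem extD_smul {m : V → ℝ} {β : V → V →L[ℝ] ℝ} {x : V} (hm : DifferentiableAt ℝ m x)
    (hβ : DifferentiableAt ℝ β x) (v w : V) :
    extD (fun y => m y • β y) x v w =
      m x * extD β x v w + (fderiv ℝ m x v * β x w - fderiv ℝ m x w * β x v) := by
  have h : HasFDerivAt (fun y => m y • β y) _ x := hm.hasFDerivAt.smul hβ.hasFDerivAt
  simp only [extD, h.fderiv, add_apply, smul_apply, ContinuousLinearMap.smulRight_apply,
    smul_eq_mul]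
  ring

/-- In `d(mβ) = m dβ + dm ∧ β` the second term vanishes on `ker β`. -/
theorem ContactAt.smul {m : V → ℝ} {β : V → V →L[ℝ] ℝ} {x : V} (h : ContactAt β x)
    (hm : DifferentiableAt ℝ m x) (hβ : DifferentiableAt ℝ β x) (h0 : m x ≠ 0) :
    ContactAt (fun y => m y • β y) x := by
  refine ⟨smul_ne_zero h0 h.ne_zero, fun v hv hw => ?_⟩
  have hv' : β x v = 0 := by simpa [h0] using hv
  refine h.nondegenerate v hv' fun w hw' => ?_
  have := hw w (by simp [hw'])
  rw [extD_smul hm hβ, hv', hw'] at this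
  simpa [h0] using this

end Conformal

section RotationInvariant

/-- The one-form `r² dφ` on the plane. -/
def angForm (z : ℂ) : ℂ →L[ℝ] ℝ := z.re • Complex.imCLM - z.im • Complex.reCLM

theorem angForm_apply (z v : ℂ) : angForm z v = z.re * v.im - z.im * v.re := rfl

theorem angForm_eq (z v : ℂ) : angForm z v = ((starRingEnd ℂ) z * v).im := by
  simp [angForm_apply]
  ring

/-- The differential of `r²`. -/
def radForm (z : ℂ) : ℂ →L[ℝ] ℝ := (2 * z.re) • Complex.reCLM + (2 * z.im) • Complex.imCLM

theorem radForm_apply (z v : ℂ) : radForm z v = 2 * z.re * v.re + 2 * z.im * v.im := rfl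

theorem hasFDerivAt_normSq (z : ℂ) : HasFDerivAt (fun z : ℂ => Complex.normSq z) (radForm z) z := by
  have h1 : HasFDerivAt (fun z : ℂ => z.re) Complex.reCLM z := Complex.reCLM.hasFDerivAt
  have h2 : HasFDerivAt (fun z : ℂ => z.im) Complex.imCLM z := Complex.imCLM.hasFDerivAt
  have h := (h1.mul h1).add (h2.mul h2)
  refine (h.congr_of_eventuallyEq (Eventually.of_forall fun z => ?_)).congr_fderiv ?_
  · simp [Complex.normSq_apply]
  · ext <;> (simp [radForm]; ring)

theorem contDiff_normSq : ContDiff ℝ ∞ (fun z : ℂ => Complex.normSq z) := by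
  have h1 : ContDiff ℝ ∞ (fun z : ℂ => z.re) := Complex.reCLM.contDiff
  have h2 : ContDiff ℝ ∞ (fun z : ℂ => z.im) := Complex.imCLM.contDiff
  have : (fun z : ℂ => Complex.normSq z) = fun z : ℂ => z.re * z.re + z.im * z.im := by
    funext z; exact Complex.normSq_apply z
  rw [this]
  exact (h1.mul h1).add (h2.mul h2)

theorem hasFDerivAt_angForm (z : ℂ) : HasFDerivAt angForm
    (Complex.reCLM.smulRight Complex.imCLM - Complex.imCLM.smulRight Complex.reCLM) z :=
  HasFDerivAt.sub (f := fun z : ℂ => z.re • Complex.imCLM) (g := fun z : ℂ => z.im • Complex.reCLM)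
    (Complex.reCLM.hasFDerivAt.smul_const Complex.imCLM)
    (Complex.imCLM.hasFDerivAt.smul_const Complex.reCLM)

theorem contDiff_angForm : ContDiff ℝ ∞ angForm :=
  (Complex.reCLM.contDiff.smul contDiff_const).sub (Complex.imCLM.contDiff.smul contDiff_const)

/-- The rotation invariant one-form `P (r²) dx + Q (r²) r² dφ` on `ℝ × ℂ`. -/
def rotForm (P Q : ℝ → ℝ) (p : ℝ × ℂ) : ℝ × ℂ →L[ℝ] ℝ :=
  P (Complex.normSq p.2) • ContinuousLinearMap.fst ℝ ℝ ℂ +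
    Q (Complex.normSq p.2) • (angForm p.2).comp (ContinuousLinearMap.snd ℝ ℝ ℂ)

variable {P Q : ℝ → ℝ}

theorem rotForm_apply (p v : ℝ × ℂ) : rotForm P Q p v =
    P (Complex.normSq p.2) * v.1 + Q (Complex.normSq p.2) * angForm p.2 v.2 := rfl

theorem contDiff_rotForm (hP : ContDiff ℝ ∞ P) (hQ : ContDiff ℝ ∞ Q) :
    ContDiff ℝ ∞ (rotForm P Q) := by
  have h : ContDiff ℝ ∞ fun p : ℝ × ℂ => Complex.normSq p.2 := contDiff_normSq.comp contDiff_snd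
  exact ((hP.comp h).smul contDiff_const).add
    ((hQ.comp h).smul ((contDiff_angForm.comp contDiff_snd).clm_comp contDiff_const))

theorem hasFDerivAt_comp_normSq_snd {p : ℝ × ℂ} (hP : DifferentiableAt ℝ P (Complex.normSq p.2)) :
    HasFDerivAt (fun p : ℝ × ℂ => P (Complex.normSq p.2))
      (deriv P (Complex.normSq p.2) • (radForm p.2).comp (ContinuousLinearMap.snd ℝ ℝ ℂ)) p :=
  hP.hasDerivAt.comp_hasFDerivAt p (f := fun p : ℝ × ℂ => Complex.normSq p.2)
    (HasFDerivAt.comp p (g := fun z : ℂ => Complex.normSq z) (hasFDerivAt_normSq p.2)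
      hasFDerivAt_snd)

theorem extD_rotForm {p : ℝ × ℂ} (hP : DifferentiableAt ℝ P (Complex.normSq p.2))
    (hQ : DifferentiableAt ℝ Q (Complex.normSq p.2)) (v w : ℝ × ℂ) :
    extD (rotForm P Q) p v w =
      deriv P (Complex.normSq p.2) * (radForm p.2 v.2 * w.1 - radForm p.2 w.2 * v.1) +
      deriv Q (Complex.normSq p.2) *
        (radForm p.2 v.2 * angForm p.2 w.2 - radForm p.2 w.2 * angForm p.2 v.2) +
      Q (Complex.normSq p.2) * (2 * (v.2.re * w.2.im - v.2.im * w.2.re)) := by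
  have h3 : HasFDerivAt (fun p : ℝ × ℂ => angForm p.2) _ p :=
    HasFDerivAt.comp p (hasFDerivAt_angForm p.2) hasFDerivAt_snd
  have h4 : HasFDerivAt (rotForm P Q) _ p :=
    ((hasFDerivAt_comp_normSq_snd hP).smul_const (ContinuousLinearMap.fst ℝ ℝ ℂ)).add
      ((hasFDerivAt_comp_normSq_snd hQ).smul
        (h3.clm_comp (hasFDerivAt_const (ContinuousLinearMap.snd ℝ ℝ ℂ) p)))
  rw [extD, h4.fderiv]
  simp [radForm_apply, angForm_apply]
  ring

/-- With `K(s) = s Q(s)` the form is `P dx + K dφ`, and it is contact exactly where the Wronskian `P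
K' - P' K` is nonzero. On the axis, where polar coordinates fail, the condition reads `P(0) Q(0) ≠
0`. -/
theorem contactAt_rotForm {p : ℝ × ℂ} (hP : DifferentiableAt ℝ P (Complex.normSq p.2))
    (hQ : DifferentiableAt ℝ Q (Complex.normSq p.2))
    (hW : P (Complex.normSq p.2) * (Q (Complex.normSq p.2) +
        Complex.normSq p.2 * deriv Q (Complex.normSq p.2)) -
      deriv P (Complex.normSq p.2) * (Complex.normSq p.2 * Q (Complex.normSq p.2)) ≠ 0) :
    ContactAt (rotForm P Q) p := by
  obtain ⟨x, z⟩ := p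
  simp only at hP hQ hW
  have hs : Complex.normSq z = z.re * z.re + z.im * z.im := Complex.normSq_apply z
  set s := Complex.normSq z with hsdef
  set iz : ℂ := ⟨-z.im, z.re⟩ with hiz
  constructor
  · intro h0
    have h1 : P s = 0 := by
      have := DFunLike.congr_fun h0 ((1, 0) : ℝ × ℂ)
      simpa [rotForm_apply, ← hsdef] using this
    have h2 : Q s * s = 0 := by
      have := DFunLike.congr_fun h0 ((0, iz) : ℝ × ℂ)
      rw [rotForm_apply, angForm_apply] at this
      simp only [hiz, ← hsdef, mul_zero, zero_add] at this
      have h3 : Q s * (z.re * z.re - z.im * -z.im) = 0 := this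
      linear_combination h3 + Q s * hs
    apply hW
    rw [h1]
    linear_combination (-deriv P s) * h2
  · rintro ⟨v1, v2⟩ hv hw
    rw [rotForm_apply] at hv
    simp only [← hsdef] at hv
    have hd := fun w => extD_rotForm (p := (x, z)) hP hQ (v1, v2) w
    simp only [← hsdef] at hd
    by_cases hz : z = 0
    · subst hz
      have hs0 : s = 0 := by simp [hsdef]
      have hang : ∀ u : ℂ, angForm 0 u = 0 := fun u => by simp [angForm_apply]
      have hrad : ∀ u : ℂ, radForm 0 u = 0 := fun u => by simp [radForm_apply]
      rw [hang, mul_zero, add_zero] at hv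
      rw [hs0] at hW hv hd
      simp only [zero_mul, add_zero, mul_zero, sub_zero] at hW
      have hP0 : P 0 ≠ 0 := left_ne_zero_of_mul hW
      have hQ0 : Q 0 ≠ 0 := right_ne_zero_of_mul hW
      have hv1 : v1 = 0 := by simpa [hP0] using hv
      have h1 := (hd (0, 1)).symm.trans (hw (0, 1) (by rw [rotForm_apply]; simp [hang]))
      have h2 := (hd (0, Complex.I)).symm.trans
        (hw (0, Complex.I) (by rw [rotForm_apply]; simp [hang]))
      simp [hang, hrad, hQ0] at h1 h2
      exact Prod.ext hv1 (Complex.ext h2 h1)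
    · have hspos : s ≠ 0 := by rw [hsdef]; exact (Complex.normSq_pos.2 hz).ne'
      have h1 := (hd (-(Q s * s), P s • iz)).symm.trans
        (hw (-(Q s * s), P s • iz) (by
          rw [rotForm_apply, angForm_apply]
          simp only [← hsdef, hiz, Complex.smul_re, Complex.smul_im, smul_eq_mul]
          linear_combination (-(Q s * P s)) * hs))
      have h2 := (hd (0, z)).symm.trans (hw (0, z) (by
          rw [rotForm_apply, angForm_apply]
          ring))
      simp only [radForm_apply, angForm_apply, hiz, Complex.smul_re, Complex.smul_im,
        smul_eq_mul] at h1 h2 hv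
      -- Cramer's rule: `h1` is `D` times the radial part of `v`, and `hv`, `h2` form a linear
      -- system for `v1` and the angular part with determinant `D`.
      set D := P s * (Q s + s * deriv Q s) - deriv P s * (s * Q s) with hD
      have e1 : (z.re * v2.re + z.im * v2.im) * D = 0 := by
        rw [hD]
        linear_combination (1 / 2) * h1 +
          (deriv Q s * P s * (z.re * v2.re + z.im * v2.im)) * hs
      have e2 : v1 * D = 0 := by
        rw [hD]
        linear_combination (Q s + s * deriv Q s) * hv + (Q s / 2) * h2 -
          deriv P s * v1 * Q s * hs - (deriv Q s * Q s * (z.re * v2.im - z.im * v2.re)) * hs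
      have e3 : (z.re * v2.im - z.im * v2.re) * D = 0 := by
        rw [hD]
        linear_combination (-(P s) / 2) * h2 - (s * deriv P s) * hv +
          P s * deriv P s * v1 * hs + (P s * deriv Q s * (z.re * v2.im - z.im * v2.re)) * hs
      have e1' : z.re * v2.re + z.im * v2.im = 0 := (mul_eq_zero.1 e1).resolve_right hW
      have e2' : v1 = 0 := (mul_eq_zero.1 e2).resolve_right hW
      have e3' : z.re * v2.im - z.im * v2.re = 0 := (mul_eq_zero.1 e3).resolve_right hW
      refine Prod.ext e2' (Complex.ext ?_ ?_)
      · have : s * v2.re = 0 := by rw [hs]; linear_combination z.re * e1' - z.im * e3'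
        exact (mul_eq_zero.1 this).resolve_left hspos
      · have : s * v2.im = 0 := by rw [hs]; linear_combination z.im * e1' + z.re * e3'
        exact (mul_eq_zero.1 this).resolve_left hspos

/-- A vector in the kernel of the exterior derivative of a rotation invariant one-form is tangent
to the level sets of `r² Q (r²)`. -/
theorem radForm_eq_zero_of_extD_rotForm {p : ℝ × ℂ}
    (hP : DifferentiableAt ℝ P (Complex.normSq p.2))
    (hQ : DifferentiableAt ℝ Q (Complex.normSq p.2)) {v : ℝ × ℂ}
    (hv : ∀ w, extD (rotForm P Q) p v w = 0) :
    (Q (Complex.normSq p.2) + Complex.normSq p.2 * deriv Q (Complex.normSq p.2)) *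
      radForm p.2 v.2 = 0 := by
  -- Pairing with the rotation field gives the derivative of `s Q(s)`, the value of the form on that
  -- field.
  have h := hv (0, ⟨-p.2.im, p.2.re⟩)
  rw [extD_rotForm hP hQ] at h
  have hs := Complex.normSq_apply p.2
  simp only [radForm_apply, angForm_apply] at h ⊢
  linear_combination h +
    deriv Q (Complex.normSq p.2) * (2 * p.2.re * v.2.re + 2 * p.2.im * v.2.im) * hs

end RotationInvariant

section Gluing

/-- The gluing construction, for parametrizations which are only locally injective. -/
theorem exists_contact_gluing_of_locallyInjective {V : Type*} [NormedAddCommGroup V]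
    [NormedSpace ℝ V] (L : V ≃L[ℝ] EuclideanSpace ℝ (Fin 3)) {Y : Type*} {ι : Type*}
    (Ω : ι → Set V) (hΩ : ∀ a, IsOpen (Ω a)) (Φ : ι → V → Y)
    (hinj : ∀ a, ∀ x ∈ Ω a, ∃ U ∈ 𝓝 x, InjOn (Φ a) U)
    (hcover : ∀ y, ∃ a, ∃ x ∈ Ω a, Φ a x = y) (β : ι → V → V →L[ℝ] ℝ)
    (hβ : ∀ a, ContDiffOn ℝ ∞ (β a) (Ω a)) (hc : ∀ a, ∀ x ∈ Ω a, ContactAt (β a) x)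
    (hg : ∀ a b x y, x ∈ Ω a → y ∈ Ω b → Φ a x = Φ b y →
      ContactGerm (Φ a) (Φ b) (β a) (β b) x y ∨ ContactGerm (Φ b) (Φ a) (β b) (β a) y x) :
    ∃ (_ : TopologicalSpace Y) (_ : ChartedSpace (EuclideanSpace ℝ (Fin 3)) Y)
      (_ : IsManifold (𝓡 3) ∞ Y) (α : OneForm (𝓡 3) Y), IsContactForm α ∧
      ∀ a, ∀ x ∈ Ω a, IsParamAt (𝓡 3) (Φ a) x ∧ α.pb (Φ a) x = β a x := by
  choose! N hN hNinj using hinj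
  obtain ⟨t, c, i, α, hα, h⟩ := exists_contact_gluing L (ι := Σ a, Ω a)
    (fun j => Ω j.1 ∩ interior (N j.1 j.2)) (fun j => (hΩ j.1).inter isOpen_interior)
    (fun j => Φ j.1)
    (fun j => (hNinj j.1 j.2 j.2.2).mono fun x hx => interior_subset hx.2)
    (fun y => by
      obtain ⟨a, x, hx, hy⟩ := hcover y
      exact ⟨⟨a, x, hx⟩, x, ⟨hx, mem_interior_iff_mem_nhds.2 (hN a x hx)⟩, hy⟩)
    (fun j => β j.1) (fun j => (hβ j.1).mono inter_subset_left) (fun j x hx => hc j.1 x hx.1)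
    (fun j l x y hx hy hxy => hg j.1 l.1 x y hx.1 hy.1 hxy)
  exact ⟨t, c, i, α, hα, fun a x hx =>
    h ⟨a, x, hx⟩ x ⟨hx, mem_interior_iff_mem_nhds.2 (hN a x hx)⟩⟩

end Gluing
end

/-! ### Binding profiles in the variable `s = r²` -/

noncomputable section
open Filter Topology

/-- Hadamard's lemma, with quotient `∫₀¹ g'(ts) dt`. Applied to `h₂` it shows that `h₂ dφ = (h₂ /
r²) r² dφ` is smooth across the binding. -/
theorem exists_contDiff_eq_mul {g : ℝ → ℝ} (hg : ContDiff ℝ ∞ g) (h0 : g 0 = 0) :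
    ∃ q : ℝ → ℝ, ContDiff ℝ ∞ q ∧ ∀ s, g s = s * q s := by
  have hg' : ContDiff ℝ ∞ (deriv g) := ContDiff.deriv' (n := ∞) hg
  refine ⟨fun s => ∫ t in (0 : ℝ)..1, deriv g (t * s), ?_, fun s => ?_⟩
  · rw [← contDiffOn_univ]
    refine contDiffOn_intervalIntegral isOpen_univ (f := fun p : ℝ × ℝ => deriv g (p.2 * p.1)) ?_
    exact (hg'.comp (contDiff_snd.mul contDiff_fst)).contDiffOn
  · have h1 : ∀ t ∈ uIcc (0 : ℝ) 1, HasDerivAt (fun t => g (t * s)) (s * deriv g (t * s)) t := by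
      intro t _
      have h := (hg.differentiable (by simp) (t * s)).hasDerivAt.comp t
        ((hasDerivAt_id t).mul_const s)
      exact h.congr_deriv (by ring)
    have h2 := intervalIntegral.integral_eq_sub_of_hasDerivAt h1
      ((continuous_const.mul (hg'.continuous.comp (by fun_prop))).intervalIntegrable _ _)
    rw [intervalIntegral.integral_const_mul] at h2
    simpa [h0] using h2.symm

section Profiles

/-- Binding profiles as functions of `s = r²`. -/
structure IsRadialProfile (ε a : ℝ) (h₁ h₂ P Q : ℝ → ℝ) : Prop where
  contDiff_P : ContDiff ℝ ∞ P
  contDiff_Q : ContDiff ℝ ∞ Q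
  h₁_eq : ∀ r, 0 ≤ r → r < 1 → h₁ r = P (r ^ 2)
  h₂_eq : ∀ r, 0 ≤ r → r < 1 → h₂ r = r ^ 2 * Q (r ^ 2)
  P_zero : P 0 = 1
  Q_zero : Q 0 = 1
  P_pos : ∀ s, 0 ≤ s → s < 1 → 0 < P s
  deriv_P_neg : ∀ s, 0 < s → s < 1 → deriv P s < 0
  K_pos : ∀ s, 0 < s → s < 1 → 0 < s * Q s
  deriv_K_pos : ∀ s, 0 ≤ s → s < 1 / 4 → 0 < Q s + s * deriv Q s
  deriv_K_nonneg : ∀ s, 0 ≤ s → s < 1 → 0 ≤ Q s + s * deriv Q s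

theorem IsRadialProfile.wronskian_pos {ε a : ℝ} {h₁ h₂ P Q : ℝ → ℝ}
    (h : IsRadialProfile ε a h₁ h₂ P Q) {s : ℝ} (hs : 0 ≤ s) (hs1 : s < 1) :
    0 < P s * (Q s + s * deriv Q s) - deriv P s * (s * Q s) := by
  rcases hs.eq_or_lt with rfl | hs0
  · simp [h.P_zero, h.Q_zero]
  · have h1 := mul_nonneg (h.P_pos s hs hs1).le (h.deriv_K_nonneg s hs hs1)
    have h2 := mul_pos (neg_pos.2 (h.deriv_P_neg s hs0 hs1)) (h.K_pos s hs0 hs1)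
    linarith

theorem hasDerivAt_mul_self {Q : ℝ → ℝ} (hQ : ContDiff ℝ ∞ Q) (s : ℝ) :
    HasDerivAt (fun s => s * Q s) (Q s + s * deriv Q s) s := by
  have h := (hasDerivAt_id s).mul (hQ.differentiable (by simp) s).hasDerivAt
  exact h.congr_deriv (by simp)

/-- Since `h(r) = g(r²)` has derivative `2r g'(r²)`, the sign conditions in `r > 0` carry over to
`s`. Positivity follows by comparing, through monotonicity, with the explicit values for `s ≥ 1/4`
and, for `s Q(s)`, with its zero at the origin. -/
theorem IsBindingProfile.exists_radialProfile {ε a : ℝ} {h₁ h₂ : ℝ → ℝ}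
    (h : IsBindingProfile ε a h₁ h₂) (ha : 0 < a) : ∃ P Q, IsRadialProfile ε a h₁ h₂ P Q := by
  obtain ⟨P, hP, hP0, -, hPh⟩ := h.near_zero₁
  obtain ⟨g, hg, hg0, hg1, hgh⟩ := h.near_zero₂
  obtain ⟨Q, hQ, hgQ⟩ := exists_contDiff_eq_mul hg hg0
  have hsq : ∀ s : ℝ, 0 < s → s < 1 → 0 < √s ∧ √s < 1 ∧ √s ^ 2 = s := fun s h0 h1 =>
    ⟨Real.sqrt_pos.2 h0, by rw [Real.sqrt_lt' one_pos]; linarith, Real.sq_sqrt h0.le⟩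
  have hder : ∀ (f k : ℝ → ℝ), ContDiff ℝ ∞ f → (∀ r ∈ Ico (0 : ℝ) 1, k r = f (r ^ 2)) →
      ∀ r, 0 < r → r < 1 → deriv k r = deriv f (r ^ 2) * (2 * r) := by
    intro f k hf hk r h0 h1
    have he : k =ᶠ[𝓝 r] fun r => f (r ^ 2) := by
      filter_upwards [Ioo_mem_nhds h0 h1] with t ht using hk t ⟨ht.1.le, ht.2⟩
    rw [he.deriv_eq]
    have h := (hf.differentiable (by simp) (r ^ 2)).hasDerivAt.comp r (hasDerivAt_pow 2 r)
    exact h.deriv.trans (by simp)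
  have hP' : ∀ s, 0 < s → s < 1 → deriv P s < 0 := by
    intro s h0 h1
    obtain ⟨h2, h3, h4⟩ := hsq s h0 h1
    have h5 := h.decreasing₁ _ ⟨h2, h3⟩
    rw [hder P h₁ hP hPh _ h2 h3, h4] at h5
    exact neg_of_mul_neg_left h5 (by linarith)
  have hg' : ∀ s, 0 < s → s < 1 / 4 → 0 < deriv g s := by
    intro s h0 h1
    obtain ⟨h2, h3, h4⟩ := hsq s h0 (by linarith)
    have h6 : √s < 1 / 2 := by rw [Real.sqrt_lt' (by norm_num)]; linarith
    have h5 := h.increasing₂ _ ⟨h2, h6⟩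
    rw [hder g h₂ hg hgh _ h2 h3, h4] at h5
    exact pos_of_mul_pos_left h5 (by linarith)
  have hga : ∀ s, 1 / 4 ≤ s → s < 1 → g s = a := by
    intro s h0 h1
    obtain ⟨h2, h3, h4⟩ := hsq s (by linarith) h1
    have h6 : 1 / 2 ≤ √s := Real.le_sqrt_of_sq_le (by linarith)
    rw [← h.tail₂ _ ⟨h6, h3⟩, hgh _ ⟨h2.le, h3⟩, h4]
  have hgK : ∀ s, deriv g s = Q s + s * deriv Q s := fun s => by
    rw [← (hasDerivAt_mul_self hQ s).deriv]
    congr 1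
    exact funext hgQ
  have hga' : ∀ s, 1 / 4 ≤ s → s < 1 → deriv g s = 0 := by
    intro s h0 h1
    -- At `s = 1/4` the function is known to be constant only to the right, so the derivative is
    -- computed one-sidedly.
    have h2 : HasDerivWithinAt g (deriv g s) (Ico s 1) s :=
      (hg.differentiable (by simp) s).hasDerivAt.hasDerivWithinAt
    have h3 : HasDerivWithinAt g 0 (Ico s 1) s :=
      (hasDerivWithinAt_const s (Ico s 1) a).congr (fun t ht => hga t (h0.trans ht.1) ht.2)
        (hga s h0 h1)
    exact ((uniqueDiffOn_Ico s 1) s ⟨le_rfl, h1⟩).eq_deriv _ h2 h3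
  have hPanti : StrictAntiOn P (Ico 0 1) := by
    refine strictAntiOn_of_deriv_neg (convex_Ico 0 1) hP.continuous.continuousOn fun s hs => ?_
    rw [interior_Ico] at hs
    exact hP' s hs.1 hs.2
  have hPpos1 : ∀ s, 1 / 4 ≤ s → s < 1 → 0 < P s := by
    intro s h0 h1
    obtain ⟨h2, h3, h4⟩ := hsq s (by linarith) h1
    have h6 : 1 / 2 ≤ √s := Real.le_sqrt_of_sq_le (by linarith)
    have h7 := hPh _ ⟨h2.le, h3⟩
    rw [h4, h.tail₁ _ ⟨h6, h3⟩] at h7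
    rw [← h7]
    exact Real.exp_pos _
  have hgmono : StrictMonoOn g (Icc 0 (1 / 4)) := by
    refine strictMonoOn_of_deriv_pos (convex_Icc _ _) hg.continuous.continuousOn fun s hs => ?_
    rw [interior_Icc] at hs
    exact hg' s hs.1 hs.2
  refine ⟨P, Q, hP, hQ, fun r h0 h1 => hPh r ⟨h0, h1⟩, fun r h0 h1 => ?_, hP0, ?_, ?_, hP', ?_, ?_, ?_⟩
  · rw [hgh r ⟨h0, h1⟩, hgQ]
  · rw [hgK] at hg1
    simpa using hg1
  · intro s h0 h1
    rcases lt_or_ge s (1 / 4) with h2 | h2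
    · exact (hPpos1 (1 / 4) le_rfl (by norm_num)).trans
        (hPanti ⟨h0, h1⟩ ⟨by norm_num, by norm_num⟩ h2)
    · exact hPpos1 s h2 h1
  · intro s h0 h1
    rw [← hgQ]
    rcases lt_or_ge s (1 / 4) with h2 | h2
    · have := hgmono ⟨le_rfl, by norm_num⟩ ⟨h0.le, h2.le⟩ h0
      rwa [hg0] at this
    · rwa [hga s h2 h1]
  · intro s h0 h1
    rw [← hgK]
    rcases h0.eq_or_lt with rfl | h0
    · rw [hg1]; exact one_pos
    · exact hg' s h0 h1
  · intro s h0 h1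
    rw [← hgK]
    rcases lt_or_ge s (1 / 4) with h2 | h2
    · rcases h0.eq_or_lt with rfl | h0
      · rw [hg1]; exact zero_le_one
      · exact (hg' s h0 h2).le
    · rw [hga' s h2 h1]

end Profiles

section Surface

variable {W : Type u} [TopologicalSpace W] [T2Space W] [CompactSpace W]
    [ChartedSpace (EuclideanHalfSpace 2) W] [IsManifold (𝓡∂ 2) ∞ W] {k : ℕ}
    {S : LiouvilleSurface W k}

namespace GirouxData

variable {A : AutonomousHamiltonian S} (D : GirouxData A)

theorem exists_radialProfile (i : Fin k) :
    ∃ P Q, IsRadialProfile S.width (D.slope i) (D.h₁ i) (D.h₂ i) P Q :=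
  (D.profile i).exists_radialProfile (D.slope_pos i)

/-- The profile `h₁` as a function of `r²`. -/
def P (i : Fin k) : ℝ → ℝ := (D.exists_radialProfile i).choose

/-- The profile `h₂ / r²` as a function of `r²`. -/
def Q (i : Fin k) : ℝ → ℝ := (D.exists_radialProfile i).choose_spec.choose

theorem radialProfile (i : Fin k) :
    IsRadialProfile S.width (D.slope i) (D.h₁ i) (D.h₂ i) (D.P i) (D.Q i) :=
  (D.exists_radialProfile i).choose_spec.choose_spec

theorem h₁_norm (i : Fin k) {z : ℂ} (hz : ‖z‖ < 1) : D.h₁ i ‖z‖ = D.P i (Complex.normSq z) := by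
  rw [(D.radialProfile i).h₁_eq _ (norm_nonneg z) hz, Complex.normSq_eq_norm_sq]

theorem h₂_norm (i : Fin k) {z : ℂ} (hz : ‖z‖ < 1) :
    D.h₂ i ‖z‖ = Complex.normSq z * D.Q i (Complex.normSq z) := by
  rw [(D.radialProfile i).h₂_eq _ (norm_nonneg z) hz, Complex.normSq_eq_norm_sq]

theorem normSq_lt_one {z : ℂ} (hz : ‖z‖ < 1) : Complex.normSq z < 1 := by
  rw [Complex.normSq_eq_norm_sq]
  exact pow_lt_one₀ (norm_nonneg z) hz (by norm_num)

/-- The contact form near the `i`-th binding component. -/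
def bindingForm (i : Fin k) : ℝ × ℂ → ℝ × ℂ →L[ℝ] ℝ := rotForm (D.P i) (D.Q i)

theorem contDiff_bindingForm (i : Fin k) : ContDiff ℝ ∞ (D.bindingForm i) :=
  contDiff_rotForm (D.radialProfile i).contDiff_P (D.radialProfile i).contDiff_Q

theorem bindingForm_apply (i : Fin k) {x : ℝ} {z : ℂ} (hz : ‖z‖ < 1) (v : ℝ × ℂ) :
    D.bindingForm i (x, z) v =
      D.h₁ i ‖z‖ * v.1 + D.h₂ i ‖z‖ * (((starRingEnd ℂ) z * v.2).im / ‖z‖ ^ 2) := by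
  rw [bindingForm, rotForm_apply, D.h₁_norm i hz, D.h₂_norm i hz, ← angForm_eq,
    ← Complex.normSq_eq_norm_sq]
  simp only
  by_cases h : z = 0
  · subst h
    simp [angForm_apply]
  · have : Complex.normSq z ≠ 0 := (Complex.normSq_pos.2 h).ne'
    field_simp

theorem contactAt_bindingForm (i : Fin k) {p : ℝ × ℂ} (hp : ‖p.2‖ < 1) :
    ContactAt (D.bindingForm i) p :=
  contactAt_rotForm ((D.radialProfile i).contDiff_P.differentiable (by simp) _)
    ((D.radialProfile i).contDiff_Q.differentiable (by simp) _)
    ((D.radialProfile i).wronskian_pos (Complex.normSq_nonneg _) (normSq_lt_one hp)).ne'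

end GirouxData

end Surface
end

noncomputable section
open Filter Topology

/-! ### The deck transformation and the form `dφ + λ` -/

section Surface

variable {W : Type u} [TopologicalSpace W] [T2Space W] [CompactSpace W]
    [ChartedSpace (EuclideanHalfSpace 2) W] [IsManifold (𝓡∂ 2) ∞ W] {k : ℕ}
    {S : LiouvilleSurface W k}

namespace AutonomousHamiltonian

variable (A : AutonomousHamiltonian S)

theorem contMDiff_ψ_iterate (n : ℕ) : ContMDiff (𝓡∂ 2) (𝓡∂ 2) ∞ A.ψ^[n] := by
  induction n with
  | zero => exact contMDiff_id
  | succ n ih =>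
    rw [Function.iterate_succ']
    exact A.contMDiff_ψ.comp ih

theorem ψ_iterate_mem_core_iff (n : ℕ) (w : W) : A.ψ^[n] w ∈ S.core ↔ w ∈ S.core := by
  induction n with
  | zero => rfl
  | succ n ih => rw [Function.iterate_succ_apply', A.ψ_mem_core_iff, ih]

theorem ψ_iterate_collar (n : ℕ) (i : Fin k) {p : ℝ × ℝ} (hp : p ∈ collarStrip S.width) :
    A.ψ^[n] (S.collar i p) = S.collar i p :=
  Function.iterate_fixed (A.ψ_collar i hp) n

end AutonomousHamiltonian

namespace GirouxData

variable {A : AutonomousHamiltonian S} (D : GirouxData A)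

/-- The shift of the angle under the `n`-th iterate of the deck transformation. -/
def Usum (n : ℕ) (w : W) : ℝ := ∑ j ∈ Finset.range n, D.U (A.ψ^[j] w)

theorem Usum_zero (w : W) : D.Usum 0 w = 0 := by simp [Usum]

theorem Usum_succ (n : ℕ) (w : W) : D.Usum (n + 1) w = D.Usum n w + D.U (A.ψ^[n] w) :=
  Finset.sum_range_succ _ _

theorem deck_iterate (n : ℕ) (p : W × ℝ) :
    D.deck^[n] p = (A.ψ^[n] p.1, p.2 + D.Usum n p.1) := by
  induction n with
  | zero => simp [Usum_zero]
  | succ n ih =>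
    rw [Function.iterate_succ_apply', ih, Usum_succ, Function.iterate_succ_apply']
    simp only [deck, add_assoc]

/-- Each deck step lowers the angle by at least a fixed `m`. Local injectivity, Hausdorffness and
compactness of the mapping torus all rest on this. -/
theorem exists_U_le : ∃ m : ℝ, 0 < m ∧ ∀ w, D.U w ≤ -m := by
  rcases isEmpty_or_nonempty W with h | h
  · exact ⟨1, one_pos, fun w => h.elim w⟩
  · obtain ⟨w, -, hw⟩ := isCompact_univ.exists_isMaxOn univ_nonempty
      D.smooth_U.continuous.continuousOn
    refine ⟨-D.U w, neg_pos.2 (D.U_neg w), fun w' => ?_⟩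
    rw [neg_neg]
    exact hw (mem_univ w')

theorem exists_le_U : ∃ M : ℝ, ∀ w, -M ≤ D.U w := by
  obtain ⟨C, hC⟩ := isCompact_univ.exists_bound_of_continuousOn
    (f := D.U) D.smooth_U.continuous.continuousOn
  exact ⟨C, fun w => (abs_le.1 (hC w (mem_univ w))).1⟩

theorem Usum_le {m : ℝ} (hm : ∀ w, D.U w ≤ -m) (n : ℕ) (w : W) : D.Usum n w ≤ -(n * m) := by
  induction n with
  | zero => simp [Usum_zero]
  | succ n ih =>
    rw [Usum_succ]
    push_cast
    linarith [hm (A.ψ^[n] w)]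

theorem contMDiff_Usum (n : ℕ) : ContMDiff (𝓡∂ 2) 𝓘(ℝ, ℝ) ∞ (D.Usum n) := by
  induction n with
  | zero => exact contMDiff_const.congr fun w => D.Usum_zero w
  | succ n ih =>
    exact (ih.add (D.smooth_U.comp (A.contMDiff_ψ_iterate n))).congr fun w => D.Usum_succ n w

theorem continuous_deck_iterate (n : ℕ) : Continuous D.deck^[n] := by
  have : D.deck^[n] = fun p => (A.ψ^[n] p.1, p.2 + D.Usum n p.1) := funext (D.deck_iterate n)
  rw [this]
  have h1 := (A.contMDiff_ψ_iterate n).continuous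
  have h2 := (D.contMDiff_Usum n).continuous
  fun_prop

theorem deck_injective : Function.Injective D.deck := by
  rintro ⟨w, φ⟩ ⟨w', φ'⟩ h
  simp only [deck, Prod.mk.injEq] at h
  have h1 := A.ψ_injective h.1
  subst h1
  exact Prod.ext rfl (add_right_cancel h.2)

/-- On the collar `ψ` is the identity and `U = -2π a_i`. So there the mapping torus is a product,
and one deck step is one full turn around the binding. -/
theorem deck_iterate_collar (n : ℕ) (i : Fin k) {p : ℝ × ℝ} (hp : p ∈ collarStrip S.width)
    (φ : ℝ) : D.deck^[n] (S.collar i p, φ) =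
      (S.collar i p, φ - n * (2 * Real.pi * D.slope i)) := by
  induction n with
  | zero => simp
  | succ n ih =>
    rw [Function.iterate_succ_apply', ih]
    simp only [deck, A.ψ_collar i hp, D.U_collar_eq_slope i hp]
    refine Prod.ext rfl ?_
    push_cast
    ring

/-- Two points of `W × ℝ` are related if some iterate of the deck transformation takes one of
them to the other. -/
def DeckRel (p q : W × ℝ) : Prop := ∃ n : ℕ, D.deck^[n] p = q ∨ D.deck^[n] q = p

variable {D}

theorem DeckRel.symm {p q : W × ℝ} (h : D.DeckRel p q) : D.DeckRel q p := by
  obtain ⟨n, h⟩ := h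
  exact ⟨n, h.symm⟩

theorem deckRel_iterate_left (m : ℕ) {p q : W × ℝ} (h : D.DeckRel p q) :
    D.DeckRel (D.deck^[m] p) q := by
  obtain ⟨n, h | h⟩ := h
  · subst h
    rcases le_total m n with hmn | hmn
    · refine ⟨n - m, Or.inl ?_⟩
      rw [← Function.iterate_add_apply, Nat.sub_add_cancel hmn]
    · refine ⟨m - n, Or.inr ?_⟩
      rw [← Function.iterate_add_apply, Nat.sub_add_cancel hmn]
  · subst h
    exact ⟨m + n, Or.inr (Function.iterate_add_apply _ _ _ _)⟩

theorem DeckRel.trans {p q r : W × ℝ} (h : D.DeckRel p q) (h' : D.DeckRel q r) :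
    D.DeckRel p r := by
  obtain ⟨n, h | h⟩ := h
  · subst h
    obtain ⟨l, h' | h'⟩ := h'
    · subst h'
      exact ⟨l + n, Or.inl (Function.iterate_add_apply _ _ _ _)⟩
    · rcases le_total l n with hl | hl
      · refine ⟨n - l, Or.inl ((D.deck_injective.iterate l) ?_)⟩
        rw [← Function.iterate_add_apply, Nat.add_sub_cancel' hl, h']
      · refine ⟨l - n, Or.inr ((D.deck_injective.iterate n) ?_)⟩
        rw [← Function.iterate_add_apply, Nat.add_sub_cancel' hl, h']
  · subst h
    exact deckRel_iterate_left n h'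

variable (D)

theorem deckRel_equivalence : Equivalence D.DeckRel :=
  ⟨fun _ => ⟨0, Or.inl rfl⟩, DeckRel.symm, DeckRel.trans⟩

variable {V : Type*} [NormedAddCommGroup V] [NormedSpace ℝ V]

theorem pb_ψ_comp {χ : V → W} {ζ : V} (hχ : MDifferentiableAt 𝓘(ℝ, V) (𝓡∂ 2) χ ζ) :
    S.form.pb (A.ψ ∘ χ) ζ = S.form.pb χ ζ - fderiv ℝ (D.U ∘ χ) ζ := by
  ext v
  rw [OneForm.pb_apply, mfderiv_comp ζ ((A.contMDiff_ψ _).mdifferentiableAt (by simp)) hχ]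
  refine (D.pullback_form (χ ζ) (mfderiv 𝓘(ℝ, V) (𝓡∂ 2) χ ζ v)).trans ?_
  rw [dFun_apply_mfderiv ((D.smooth_U _).mdifferentiableAt (by simp)) hχ]
  rfl

/-- The loss `d(Usum)` in `λ` is exactly what the shift of the angle by `Usum` returns in `dφ`, so
the deck iterates preserve `dφ + λ`. -/
theorem pb_ψ_iterate_comp (n : ℕ) {χ : V → W} {ζ : V}
    (hχ : MDifferentiableAt 𝓘(ℝ, V) (𝓡∂ 2) χ ζ) :
    S.form.pb (A.ψ^[n] ∘ χ) ζ = S.form.pb χ ζ - fderiv ℝ (D.Usum n ∘ χ) ζ := by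
  have hd : ∀ f : W → ℝ, ContMDiff (𝓡∂ 2) 𝓘(ℝ, ℝ) ∞ f → DifferentiableAt ℝ (f ∘ χ) ζ :=
    fun f hf => (((hf _).mdifferentiableAt (by simp)).comp ζ hχ).differentiableAt
  induction n with
  | zero =>
    have : D.Usum 0 ∘ χ = fun _ => 0 := funext fun y => D.Usum_zero _
    rw [this]
    simp
  | succ n ih =>
    have h1 : MDifferentiableAt 𝓘(ℝ, V) (𝓡∂ 2) (A.ψ^[n] ∘ χ) ζ :=
      ((A.contMDiff_ψ_iterate n _).mdifferentiableAt (by simp)).comp ζ hχ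
    have h2 : A.ψ^[n + 1] ∘ χ = A.ψ ∘ (A.ψ^[n] ∘ χ) := by
      rw [Function.iterate_succ', Function.comp_assoc]
    have h3 : D.Usum (n + 1) ∘ χ = D.Usum n ∘ χ + (D.U ∘ A.ψ^[n]) ∘ χ :=
      funext fun y => D.Usum_succ n _
    rw [h2, D.pb_ψ_comp h1, ih, h3, fderiv_add (hd _ (D.contMDiff_Usum n))
      (hd _ (D.smooth_U.comp (A.contMDiff_ψ_iterate n))), sub_sub]
    rfl

end GirouxData

section PageForm

variable {V : Type*} [NormedAddCommGroup V] [NormedSpace ℝ V]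
  {V' : Type*} [NormedAddCommGroup V'] [NormedSpace ℝ V']

/-- The contact form `dφ + λ` on `ℝ × W`, in a parametrization of `W`. -/
def pageForm (S : LiouvilleSurface W k) (χ : V → W) (p : ℝ × V) : ℝ × V →L[ℝ] ℝ :=
  ContinuousLinearMap.fst ℝ ℝ V + (S.form.pb χ p.2).comp (ContinuousLinearMap.snd ℝ ℝ V)

theorem pageForm_apply (χ : V → W) (p v : ℝ × V) :
    pageForm S χ p v = v.1 + S.form.pb χ p.2 v.2 := rfl

theorem contDiffAt_pageForm {χ : V → W} {p : ℝ × V}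
    (hχ : ContMDiffAt 𝓘(ℝ, V) (𝓡∂ 2) ∞ χ p.2) : ContDiffAt ℝ ∞ (pageForm S χ) p := by
  have h : ContDiffAt ℝ ∞ (fun p : ℝ × V => S.form.pb χ p.2) p :=
    ContDiffAt.comp p (g := S.form.pb χ) (S.smooth_form.contDiffAt_pb hχ) contDiffAt_snd
  exact contDiffAt_const.add (h.clm_comp contDiffAt_const)

theorem extD_pageForm {χ : V → W} {p : ℝ × V} (hχ : ContMDiffAt 𝓘(ℝ, V) (𝓡∂ 2) ∞ χ p.2)
    (v w : ℝ × V) : extD (pageForm S χ) p v w = extD (S.form.pb χ) p.2 v.2 w.2 := by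
  have h1 : HasFDerivAt (fun p : ℝ × V => S.form.pb χ p.2) _ p :=
    HasFDerivAt.comp p (g := S.form.pb χ)
      ((S.smooth_form.contDiffAt_pb hχ).differentiableAt (by simp)).hasFDerivAt hasFDerivAt_snd
  have h2 : HasFDerivAt (pageForm S χ) _ p :=
    (hasFDerivAt_const (ContinuousLinearMap.fst ℝ ℝ V) p).add
      (h1.clm_comp (hasFDerivAt_const (ContinuousLinearMap.snd ℝ ℝ V) p))
  rw [extD, h2.fderiv, extD]
  simp

/-- A vector in the kernel of `d (dφ + λ)` is a multiple of `∂_φ`. -/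
theorem snd_eq_zero_of_extD_pageForm {χ : V → W} {p : ℝ × V} (hχ : IsParamAt (𝓡∂ 2) χ p.2)
    {v : ℝ × V} (hv : ∀ w : V, extD (pageForm S χ) p v (0, w) = 0) : v.2 = 0 := by
  refine hχ.bijective.1 (Eq.trans ?_ (map_zero (mfderiv 𝓘(ℝ, V) (𝓡∂ 2) χ p.2)).symm)
  refine S.symplectic (χ p.2) _ fun u => ?_
  obtain ⟨w, rfl⟩ := hχ.bijective.2 u
  have h := hv w
  rw [extD_pageForm hχ.smooth] at h
  exact (OneForm.d_pullback S.smooth_form hχ.smooth v.2 w).trans h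

/-- Every vector of the page lifts to the kernel of `dφ + λ`, so a degenerate kernel vector has zero
page component because `dλ` is symplectic; then `dφ` must vanish on it too. -/
theorem contactAt_pageForm {χ : V → W} {p : ℝ × V} (hχ : IsParamAt (𝓡∂ 2) χ p.2) :
    ContactAt (pageForm S χ) p := by
  refine ⟨fun h => ?_, fun v hv hw => ?_⟩
  · have := DFunLike.congr_fun h ((1, 0) : ℝ × V)
    simp [pageForm_apply] at this
  · have h1 : v.2 = 0 := by
      refine snd_eq_zero_of_extD_pageForm (S := S) hχ fun w => ?_
      have h := hw (-(S.form.pb χ p.2 w), w) (by rw [pageForm_apply]; ring)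
      rw [extD_pageForm hχ.smooth] at h ⊢
      exact h
    rw [pageForm_apply, h1, map_zero, add_zero] at hv
    exact Prod.ext hv h1

end PageForm

end Surface
end

noncomputable section
open Filter Topology

/-! ### The open book as a set -/

section Surface

variable {W : Type u} [TopologicalSpace W] [T2Space W] [CompactSpace W]
    [ChartedSpace (EuclideanHalfSpace 2) W] [IsManifold (𝓡∂ 2) ∞ W] {k : ℕ}
    {S : LiouvilleSurface W k} {A : AutonomousHamiltonian S}

/-- The set underlying a contact open book. -/
structure OpenBookModel (D : GirouxData A) (Y : Type u) where
  page : W × ℝ → Y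
  page_eq_iff : ∀ p ∈ S.core ×ˢ (univ : Set ℝ), ∀ q ∈ S.core ×ˢ (univ : Set ℝ),
    (page p = page q ↔ D.DeckRel p q)
  binding : Fin k → ℝ × ℂ → Y
  binding_eq_iff : ∀ i j (x x' : ℝ) (z z' : ℂ), ‖z‖ < 1 → ‖z'‖ < 1 →
    (binding i (x, z) = binding j (x', z') ↔ i = j ∧ z = z' ∧ ∃ n : ℤ, x - x' = n * S.len i)
  cover : ∀ y : Y, (∃ p ∈ S.core ×ˢ (univ : Set ℝ), page p = y) ∨
    ∃ i x, ∃ z : ℂ, ‖z‖ < 1 ∧ binding i (x, z) = y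
  glue : ∀ i (x r φ : ℝ), 1 / 2 < r → r < 1 →
    binding i (x, r * Complex.exp (φ * Complex.I))
      = page (S.collar i (x, -(S.width * r)), D.slope i * φ)
  overlap : ∀ i (x : ℝ) (z : ℂ), ‖z‖ < 1 → ∀ p ∈ S.core ×ˢ (univ : Set ℝ),
    binding i (x, z) = page p → 1 / 2 < ‖z‖

namespace GirouxData

variable (D : GirouxData A)

theorem radius_mem_collarStrip {x r : ℝ} (h0 : 0 ≤ r) (h1 : r < 1) :
    (x, -(S.width * r)) ∈ collarStrip S.width :=
  ⟨by simp only; nlinarith [S.width_pos], by simp only; nlinarith [S.width_pos]⟩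

theorem radius_mem_core (i : Fin k) {x r : ℝ} (h0 : 1 / 2 < r) (h1 : r < 1) :
    S.collar i (x, -(S.width * r)) ∈ S.core :=
  (S.collar_mem_core_iff i (radius_mem_collarStrip (by linarith) h1)).2
    (by simp only; nlinarith [S.width_pos])

theorem deckRel_collar_iff (i j : Fin k) {p q : ℝ × ℝ} (hp : p ∈ collarStrip S.width)
    (hq : q ∈ collarStrip S.width) (φ φ' : ℝ) :
    D.DeckRel (S.collar i p, φ) (S.collar j q, φ') ↔
      S.collar i p = S.collar j q ∧ ∃ n : ℤ, φ - φ' = n * (2 * Real.pi * D.slope i) := by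
  simp only [DeckRel, D.deck_iterate_collar _ i hp, D.deck_iterate_collar _ j hq, Prod.mk.injEq]
  constructor
  · rintro ⟨n, ⟨h1, h2⟩ | ⟨h1, h2⟩⟩
    · exact ⟨h1, n, by push_cast; linarith⟩
    · have := ((S.collar_eq_iff j i q hq p hp).1 h1).1
      subst this
      exact ⟨h1.symm, -n, by push_cast; linarith⟩
  · rintro ⟨h1, n, h2⟩
    have := ((S.collar_eq_iff i j p hp q hq).1 h1).1
    subst this
    obtain ⟨l, rfl | rfl⟩ := n.eq_nat_or_neg
    · exact ⟨l, Or.inl ⟨h1, by push_cast at h2; linarith⟩⟩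
    · exact ⟨l, Or.inr ⟨h1.symm, by push_cast at h2; linarith⟩⟩

/-- The orbits of the deck transformation. -/
def deckSetoid : Setoid (W × ℝ) := ⟨D.DeckRel, D.deckRel_equivalence⟩

/-- The binding, with its closed tubular neighbourhood `r ≤ 1/2` added to the orbit space of the
deck transformation. -/
def bindingMap (i : Fin k) (p : ℝ × ℂ) : Quotient D.deckSetoid ⊕ (Fin k × ℝ × ℂ) :=
  if ‖p.2‖ ≤ 1 / 2 then Sum.inr (i, Int.fract (p.1 / S.len i), p.2)
  else Sum.inl (Quotient.mk _ (S.collar i (p.1, -(S.width * ‖p.2‖)), D.slope i * Complex.arg p.2))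

/-- `φ` and the principal argument differ by a multiple of `2π`, which after multiplication by the
slope is a deck translation. This is where the normalization `a = -U / 2π` is needed. -/
theorem bindingMap_glue (i : Fin k) (x r φ : ℝ) (h0 : 1 / 2 < r) (h1 : r < 1) :
    D.bindingMap i (x, r * Complex.exp (φ * Complex.I)) =
      Sum.inl (Quotient.mk _ (S.collar i (x, -(S.width * r)), D.slope i * φ)) := by
  have hr : ‖(r : ℂ) * Complex.exp (φ * Complex.I)‖ = r := by
    rw [norm_mul, Complex.norm_exp_ofReal_mul_I, mul_one, Complex.norm_real, Real.norm_eq_abs,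
      abs_of_pos (by linarith)]
  rw [bindingMap, if_neg (by simp only [hr]; exact not_le.2 h0)]
  simp only [hr]
  refine congrArg Sum.inl (Quotient.sound ?_)
  have hm := radius_mem_collarStrip (S := S) (x := x) (by linarith : 0 ≤ r) h1
  refine (D.deckRel_collar_iff i i hm hm _ _).2 ⟨rfl, ?_⟩
  have h2 := Complex.norm_mul_exp_arg_mul_I ((r : ℂ) * Complex.exp (φ * Complex.I))
  rw [hr] at h2
  have h3 := mul_left_cancel₀ (by exact_mod_cast (by linarith : r ≠ 0)) h2
  obtain ⟨n, hn⟩ := Complex.exp_eq_exp_iff_exists_int.1 h3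
  refine ⟨n, ?_⟩
  have h4 : (Complex.arg ((r : ℂ) * Complex.exp (φ * Complex.I)) : ℂ) * Complex.I =
      ((φ + n * (2 * Real.pi) : ℝ) : ℂ) * Complex.I := by
    rw [hn]
    push_cast
    ring
  have h5 := mul_right_cancel₀ Complex.I_ne_zero h4
  have h6 := Complex.ofReal_injective h5
  rw [h6]
  ring

theorem bindingMap_eq_iff (i j : Fin k) (x x' : ℝ) (z z' : ℂ) (hz : ‖z‖ < 1) (hz' : ‖z'‖ < 1) :
    D.bindingMap i (x, z) = D.bindingMap j (x', z') ↔
      i = j ∧ z = z' ∧ ∃ n : ℤ, x - x' = n * S.len i := by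
  have hl := S.len_pos i
  have hm := radius_mem_collarStrip (S := S) (x := x) (norm_nonneg z) hz
  have hm' := radius_mem_collarStrip (S := S) (x := x') (norm_nonneg z') hz'
  by_cases h : ‖z‖ ≤ 1 / 2 <;> by_cases h' : ‖z'‖ ≤ 1 / 2
  · simp only [bindingMap, h, h', if_true, Sum.inr.injEq, Prod.mk.injEq]
    constructor
    · rintro ⟨rfl, h1, h2⟩
      obtain ⟨n, hn⟩ := Int.fract_eq_fract.1 h1
      refine ⟨rfl, h2, n, ?_⟩
      rw [← hn]
      field_simp
    · rintro ⟨rfl, h2, n, hn⟩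
      refine ⟨rfl, Int.fract_eq_fract.2 ⟨n, ?_⟩, h2⟩
      rw [← sub_div, hn]
      field_simp
  · simp only [bindingMap, h, h', if_true, if_false, reduceCtorEq, false_iff]
    rintro ⟨-, rfl, -⟩
    exact h' h
  · simp only [bindingMap, h, h', if_true, if_false, reduceCtorEq, false_iff]
    rintro ⟨-, rfl, -⟩
    exact h h'
  · simp only [bindingMap, h, h', if_false, Sum.inl.injEq]
    rw [Quotient.eq]
    refine Iff.trans (D.deckRel_collar_iff i j hm hm' _ _) ?_
    rw [S.collar_eq_iff i j _ hm _ hm']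
    constructor
    · rintro ⟨⟨rfl, h1, n, hn⟩, l, hl⟩
      refine ⟨rfl, Complex.ext_norm_arg ?_ ?_, n, hn⟩
      · simp only [neg_inj] at h1
        exact mul_left_cancel₀ S.width_pos.ne' h1
      · have h2 : Complex.arg z - Complex.arg z' = l * (2 * Real.pi) := by
          have := (D.slope_pos i).ne'
          field_simp at hl ⊢
          linarith
        -- Both arguments lie in `(-π, π]`, so a difference in `2πℤ` is zero.
        have h3 : |(l : ℝ)| < 1 := by
          have h4 : |(l : ℝ)| * (2 * Real.pi) < 2 * Real.pi := by
            rw [← abs_of_pos Real.two_pi_pos, ← abs_mul, abs_of_pos Real.two_pi_pos, ← h2, abs_lt]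
            constructor <;> linarith [Complex.neg_pi_lt_arg z, Complex.arg_le_pi z,
              Complex.neg_pi_lt_arg z', Complex.arg_le_pi z']
          nlinarith [Real.pi_pos]
        have h5 : l = 0 := Int.abs_lt_one_iff.1 (by exact_mod_cast h3)
        rw [h5] at h2
        simp at h2
        linarith
    · rintro ⟨rfl, rfl, n, hn⟩
      exact ⟨⟨rfl, rfl, n, hn⟩, 0, by simp⟩

theorem exists_openBookModel : ∃ Y : Type u, Nonempty (OpenBookModel D Y) := by
  let Y := {y : Quotient D.deckSetoid ⊕ (Fin k × ℝ × ℂ) //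
    (∃ p ∈ S.core ×ˢ (univ : Set ℝ), Sum.inl (Quotient.mk _ p) = y) ∨
      ∃ i x, ∃ z : ℂ, ‖z‖ < 1 ∧ D.bindingMap i (x, z) = y}
  -- `page` and `binding` are total functions and need a default value off their domains. A binding
  -- point serves: if some point lies outside the core, there is a boundary circle.
  have hb0 : ∀ i : Fin k, ∃ y : Y, y.1 = D.bindingMap i (0, 0) := fun i =>
    ⟨⟨_, Or.inr ⟨i, 0, 0, by simp, rfl⟩⟩, rfl⟩
  have hpage : ∀ p : W × ℝ, ∃ y : Y, p ∈ S.core ×ˢ (univ : Set ℝ) →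
      y.1 = Sum.inl (Quotient.mk D.deckSetoid p) := by
    intro p
    by_cases hp : p ∈ S.core ×ˢ (univ : Set ℝ)
    · exact ⟨⟨_, Or.inl ⟨p, hp, rfl⟩⟩, fun _ => rfl⟩
    · have h1 : p.1 ∉ S.core := fun h => hp ⟨h, mem_univ _⟩
      simp only [LiouvilleSurface.core, mem_ofPred_eq, not_forall] at h1
      obtain ⟨i, -⟩ := h1
      exact ⟨(hb0 i).choose, fun h => absurd h hp⟩
  have hbinding : ∀ (i : Fin k) (p : ℝ × ℂ), ∃ y : Y, ‖p.2‖ < 1 → y.1 = D.bindingMap i p := by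
    intro i p
    by_cases hp : ‖p.2‖ < 1
    · exact ⟨⟨_, Or.inr ⟨i, p.1, p.2, hp, rfl⟩⟩, fun _ => rfl⟩
    · exact ⟨(hb0 i).choose, fun h => absurd h hp⟩
  choose page hpage using hpage
  choose binding hbinding using hbinding
  refine ⟨Y, ⟨⟨page, fun p hp q hq => ?_, binding, fun i j x x' z z' hz hz' => ?_, fun y => ?_,
    fun i x r φ h0 h1 => ?_, fun i x z hz p hp h => ?_⟩⟩⟩
  · rw [← Subtype.val_inj, hpage p hp, hpage q hq, Sum.inl.injEq]
    exact Quotient.eq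
  · rw [← Subtype.val_inj, hbinding i _ hz, hbinding j _ hz', D.bindingMap_eq_iff i j _ _ _ _ hz hz']
  · rcases y.2 with ⟨p, hp, h⟩ | ⟨i, x, z, hz, h⟩
    · exact Or.inl ⟨p, hp, Subtype.ext ((hpage p hp).trans h)⟩
    · exact Or.inr ⟨i, x, z, hz, Subtype.ext ((hbinding i _ hz).trans h)⟩
  · have hr : ‖(r : ℂ) * Complex.exp (φ * Complex.I)‖ = r := by
      rw [norm_mul, Complex.norm_exp_ofReal_mul_I, mul_one, Complex.norm_real, Real.norm_eq_abs,
        abs_of_pos (by linarith)]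
    rw [← Subtype.val_inj, hbinding i _ (by simp only [hr]; exact h1),
      D.bindingMap_glue i x r φ h0 h1, hpage _ ⟨radius_mem_core i h0 h1, mem_univ _⟩]
  · rw [← Subtype.val_inj, hbinding i _ hz, hpage p hp, bindingMap] at h
    by_contra h1
    rw [if_pos (not_lt.1 h1)] at h
    exact absurd h (by simp)

end GirouxData

end Surface
end

noncomputable section
open Filter Topology

/-- The complex plane as a euclidean space. -/
def planeEquiv : ℂ ≃L[ℝ] EuclideanSpace ℝ (Fin 2) :=
  Complex.orthonormalBasisOneI.repr.toContinuousLinearEquiv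

/-- A linear isomorphism between `ℝ × ℂ` and the model space of three-manifolds. -/
def spaceEquiv : (ℝ × ℂ) ≃L[ℝ] EuclideanSpace ℝ (Fin 3) :=
  ContinuousLinearEquiv.ofFinrankEq (by simp)

/-! ### Charts of the open book and the contact form in them -/

section Surface

variable {W : Type u} [TopologicalSpace W] [T2Space W] [CompactSpace W]
    [ChartedSpace (EuclideanHalfSpace 2) W] [IsManifold (𝓡∂ 2) ∞ W] {k : ℕ}

/-- The inverse of the preferred chart at `a`, as a map from the complex plane. -/
def surfParam (a : W) : ℂ → W := fun ζ => (extChartAt (𝓡∂ 2) a).symm (planeEquiv ζ)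

/-- The preferred chart at `a`, as a map to the complex plane. -/
def surfCoord (a : W) : W → ℂ := fun w => planeEquiv.symm (extChartAt (𝓡∂ 2) a w)

/-- The part of the preferred chart at `a` which lies in the core. -/
def surfDom (S : LiouvilleSurface W k) (a : W) : Set ℂ :=
  {ζ | planeEquiv ζ ∈ interior (extChartAt (𝓡∂ 2) a).target ∧ surfParam a ζ ∈ S.core}

variable {S : LiouvilleSurface W k} {a : W} {ζ : ℂ}

theorem isParamAt_surfParam_of_mem_interior
    (hζ : planeEquiv ζ ∈ interior (extChartAt (𝓡∂ 2) a).target) :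
    IsParamAt (𝓡∂ 2) (surfParam a) ζ := by
  have h := isParamAt_extChartAt_symm a (interior_subset hζ)
    (mem_of_superset (mem_interior_iff_mem_nhds.1 hζ) (extChartAt_target_subset_range a))
  refine IsParamAt.comp (τ := planeEquiv) h planeEquiv.contDiff.contDiffAt ?_
  rw [planeEquiv.fderiv]
  exact planeEquiv.bijective

theorem isParamAt_surfParam (hζ : ζ ∈ surfDom S a) : IsParamAt (𝓡∂ 2) (surfParam a) ζ :=
  isParamAt_surfParam_of_mem_interior hζ.1

theorem surfCoord_surfParam (hζ : ζ ∈ surfDom S a) : surfCoord a (surfParam a ζ) = ζ := by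
  rw [surfCoord, surfParam, (extChartAt (𝓡∂ 2) a).right_inv (interior_subset hζ.1),
    planeEquiv.symm_apply_apply]

theorem surfParam_mem_source (hζ : ζ ∈ surfDom S a) :
    surfParam a ζ ∈ (extChartAt (𝓡∂ 2) a).source :=
  (extChartAt (𝓡∂ 2) a).map_target (interior_subset hζ.1)

theorem surfParam_surfCoord {w : W} (hw : w ∈ (extChartAt (𝓡∂ 2) a).source) :
    surfParam a (surfCoord a w) = w := by
  rw [surfCoord, surfParam, planeEquiv.apply_symm_apply, (extChartAt (𝓡∂ 2) a).left_inv hw]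

theorem contMDiffAt_surfCoord {w : W} (hw : w ∈ (extChartAt (𝓡∂ 2) a).source) :
    ContMDiffAt (𝓡∂ 2) 𝓘(ℝ, ℂ) ∞ (surfCoord a) w :=
  ContMDiffAt.comp w planeEquiv.symm.contDiff.contMDiff.contMDiffAt
    (contMDiffAt_extChartAt' (by rwa [extChartAt_source] at hw))

theorem isOpen_surfDom : IsOpen (surfDom S a) := by
  rw [isOpen_iff_mem_nhds]
  intro ζ hζ
  filter_upwards [planeEquiv.continuous.continuousAt.preimage_mem_nhds (isOpen_interior.mem_nhds hζ.1),
    (isParamAt_surfParam hζ).smooth.continuousAt.preimage_mem_nhds (S.isOpen_core.mem_nhds hζ.2)]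
    with ζ' h1 h2 using ⟨h1, h2⟩

theorem surfCoord_self_mem_surfDom (ha : a ∈ S.core) : surfCoord a a ∈ surfDom S a := by
  have h := extChartAt_target_mem_nhdsWithin (I := 𝓡∂ 2) a
  rw [nhdsWithin_eq_nhds.2 (range_mem_nhds_isInteriorPoint (S.isInteriorPoint_of_mem_core ha))] at h
  refine ⟨?_, ?_⟩
  · rw [surfCoord, planeEquiv.apply_symm_apply]
    exact mem_interior_iff_mem_nhds.2 h
  · rw [surfParam_surfCoord (mem_extChartAt_source a)]
    exact ha

/-- Maps to the surface in coordinates. -/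
theorem surfCoord_comp {V : Type*} [NormedAddCommGroup V] [NormedSpace ℝ V] {g : V → W} {x : V}
    (hg : ContMDiffAt 𝓘(ℝ, V) (𝓡∂ 2) ∞ g x) (hζ : ζ ∈ surfDom S a) (hx : g x = surfParam a ζ) :
    ContDiffAt ℝ ∞ (fun y => surfCoord a (g y)) x ∧ surfCoord a (g x) = ζ ∧
      ∀ᶠ y in 𝓝 x, surfParam a (surfCoord a (g y)) = g y ∧
        (S.form.pb (surfParam a) (surfCoord a (g y))).comp (fderiv ℝ (fun y => surfCoord a (g y)) y) =
          S.form.pb g y := by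
  have hxs : g x ∈ (extChartAt (𝓡∂ 2) a).source := hx ▸ surfParam_mem_source hζ
  have h1 : ContDiffAt ℝ ∞ (fun y => surfCoord a (g y)) x := by
    rw [← contMDiffAt_iff_contDiffAt]
    exact ContMDiffAt.comp x (g := surfCoord a) (f := g) (contMDiffAt_surfCoord hxs) hg
  have h2 : surfCoord a (g x) = ζ := by rw [hx, surfCoord_surfParam hζ]
  refine ⟨h1, h2, ?_⟩
  have h3 : ∀ᶠ y in 𝓝 x, surfParam a (surfCoord a (g y)) = g y := by
    filter_upwards [hg.continuousAt.preimage_mem_nhds ((isOpen_extChartAt_source a).mem_nhds hxs)]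
      with y hy using surfParam_surfCoord hy
  have h4 : ∀ᶠ y in 𝓝 x, surfCoord a (g y) ∈ surfDom S a :=
    h1.continuousAt.preimage_mem_nhds (isOpen_surfDom.mem_nhds (by rwa [h2]))
  filter_upwards [h3.eventually_nhds, h4, eventually_differentiableAt h1] with y h3 h4 h5
  refine ⟨h3.self_of_nhds, ?_⟩
  rw [← OneForm.pb_comp S.form (Φ := surfParam a) (τ := fun y => surfCoord a (g y))
    (isParamAt_surfParam h4).mdiff h5]
  exact (OneForm.pb_congr S.form h3).eq_of_nhds

variable {A : AutonomousHamiltonian S} {D : GirouxData A} {Y : Type u}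

namespace OpenBookModel

variable (M : OpenBookModel D Y)

/-- The pieces of the open book which are parametrized by open subsets of `ℝ × ℂ`. -/
def param : W ⊕ Fin k → ℝ × ℂ → Y
  | Sum.inl a => fun p => M.page (surfParam a p.2, p.1)
  | Sum.inr i => M.binding i

/-- The domains of the parametrizations `param`. -/
def dom (S : LiouvilleSurface W k) : W ⊕ Fin k → Set (ℝ × ℂ)
  | Sum.inl a => univ ×ˢ surfDom S a
  | Sum.inr _ => univ ×ˢ Metric.ball 0 1

/-- The contact form in the parametrizations `param`. -/
def paramForm (D : GirouxData A) : W ⊕ Fin k → ℝ × ℂ → ℝ × ℂ →L[ℝ] ℝ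
  | Sum.inl a => pageForm S (surfParam a)
  | Sum.inr i => D.bindingForm i

theorem isOpen_dom (j : W ⊕ Fin k) : IsOpen (dom S j) := by
  cases j with
  | inl a => exact isOpen_univ.prod isOpen_surfDom
  | inr i => exact isOpen_univ.prod Metric.isOpen_ball

theorem norm_lt_of_mem_dom {i : Fin k} {p : ℝ × ℂ} (hp : p ∈ dom S (Sum.inr i : W ⊕ Fin k)) :
    ‖p.2‖ < 1 := mem_ball_zero_iff.1 hp.2

theorem mem_core_of_mem_dom {a : W} {p : ℝ × ℂ} (hp : p ∈ dom S (Sum.inl a : W ⊕ Fin k)) :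
    (surfParam a p.2, p.1) ∈ S.core ×ˢ (univ : Set ℝ) := ⟨hp.2.2, mem_univ _⟩

theorem contDiffOn_paramForm (j : W ⊕ Fin k) : ContDiffOn ℝ ∞ (paramForm D j) (dom S j) := by
  cases j with
  | inl a =>
    exact fun p hp => (contDiffAt_pageForm (isParamAt_surfParam hp.2).smooth).contDiffWithinAt
  | inr i => exact (D.contDiff_bindingForm i).contDiffOn

theorem contactAt_paramForm (j : W ⊕ Fin k) (p : ℝ × ℂ) (hp : p ∈ dom S j) :
    ContactAt (paramForm D j) p := by
  cases j with
  | inl a => exact contactAt_pageForm (isParamAt_surfParam hp.2)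
  | inr i => exact D.contactAt_bindingForm i (norm_lt_of_mem_dom hp)

theorem exists_param_eq (y : Y) : ∃ j, ∃ p ∈ dom S j, M.param j p = y := by
  rcases M.cover y with ⟨⟨w, φ⟩, hp, rfl⟩ | ⟨i, x, z, hz, rfl⟩
  · refine ⟨Sum.inl w, (φ, surfCoord w w), ⟨mem_univ _, surfCoord_self_mem_surfDom hp.1⟩, ?_⟩
    simp only [param, surfParam_surfCoord (mem_extChartAt_source (I := 𝓡∂ 2) w)]
  · exact ⟨Sum.inr i, (x, z), ⟨mem_univ _, mem_ball_zero_iff.2 hz⟩, rfl⟩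

/-- The first coordinate is the angle on the page and the length parameter near the binding. A
nontrivial deck iterate moves the former by at least `m`, a nontrivial period moves the latter by at
least the length of the circle; windows of half these sizes on either side exclude both. -/
theorem locallyInjective_param (j : W ⊕ Fin k) (p : ℝ × ℂ) (hp : p ∈ dom S j) :
    ∃ U ∈ 𝓝 p, InjOn (M.param j) U := by
  have hstrip : ∀ r : ℝ, 0 < r → {q : ℝ × ℂ | |q.1 - p.1| < r} ∈ 𝓝 p := fun r hr => by
    refine (isOpen_lt (by fun_prop) continuous_const).mem_nhds ?_
    simpa using hr
  cases j with
  | inl a =>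
    obtain ⟨m, hm, hU⟩ := D.exists_U_le
    refine ⟨{q | |q.1 - p.1| < m / 2} ∩ dom S (Sum.inl a),
      inter_mem (hstrip _ (by linarith)) ((isOpen_dom _).mem_nhds hp), ?_⟩
    have key : ∀ q ∈ {q | |q.1 - p.1| < m / 2} ∩ dom S (Sum.inl a : W ⊕ Fin k),
        ∀ q' ∈ {q | |q.1 - p.1| < m / 2} ∩ dom S (Sum.inl a : W ⊕ Fin k), ∀ n : ℕ,
        D.deck^[n] (surfParam a q.2, q.1) = (surfParam a q'.2, q'.1) → q = q' := by
      rintro ⟨φ, ζ⟩ ⟨h1, h2⟩ ⟨φ', ζ'⟩ ⟨h1', h2'⟩ n h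
      rw [D.deck_iterate] at h
      simp only [Prod.mk.injEq] at h
      obtain ⟨h3, h4⟩ := h
      have h5 := D.Usum_le hU n (surfParam a ζ)
      simp only [mem_ofPred_eq, abs_lt] at h1 h1'
      have h6 : n = 0 := by
        by_contra hn
        have : (1 : ℝ) ≤ n := by exact_mod_cast Nat.one_le_iff_ne_zero.2 hn
        nlinarith
      subst h6
      simp only [Function.iterate_zero, id, D.Usum_zero, add_zero] at h3 h4
      have h7 := congrArg (surfCoord a) h3
      rw [surfCoord_surfParam h2.2, surfCoord_surfParam h2'.2] at h7
      exact Prod.ext h4 h7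
    intro q hq q' hq' h
    obtain ⟨n, h | h⟩ := (M.page_eq_iff _ (mem_core_of_mem_dom hq.2) _
      (mem_core_of_mem_dom hq'.2)).1 h
    · exact key q hq q' hq' n h
    · exact (key q' hq' q hq n h).symm
  | inr i =>
    have hl := S.len_pos i
    refine ⟨{q | |q.1 - p.1| < S.len i / 2} ∩ dom S (Sum.inr i),
      inter_mem (hstrip _ (by linarith)) ((isOpen_dom _).mem_nhds hp), ?_⟩
    rintro ⟨x, z⟩ ⟨h1, h2⟩ ⟨x', z'⟩ ⟨h1', h2'⟩ h
    obtain ⟨-, h3, n, hn⟩ := (M.binding_eq_iff i i x x' z z' (norm_lt_of_mem_dom h2)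
      (norm_lt_of_mem_dom h2')).1 h
    simp only [mem_ofPred_eq, abs_lt] at h1 h1'
    have h4 : |(n : ℝ)| < 1 := by
      have : |(n : ℝ)| * S.len i < S.len i := by
        rw [← abs_of_pos hl, ← abs_mul, abs_of_pos hl, ← hn, abs_lt]
        constructor <;> linarith
      nlinarith
    have h5 : n = 0 := Int.abs_lt_one_iff.1 (by exact_mod_cast h4)
    rw [h5] at hn
    simp at hn
    exact Prod.ext (by simp only; linarith) h3

/-- The transition map is the `n`-th deck iterate read in charts; it preserves the form by
`GirouxData.pb_ψ_iterate_comp`. -/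
theorem contactGerm_page {a b : W} {p q : ℝ × ℂ} (hp : p ∈ dom S (Sum.inl a : W ⊕ Fin k))
    (hq : q ∈ dom S (Sum.inl b : W ⊕ Fin k)) (n : ℕ)
    (h : D.deck^[n] (surfParam a p.2, p.1) = (surfParam b q.2, q.1)) :
    ContactGerm (M.param (Sum.inl a)) (M.param (Sum.inl b)) (paramForm D (Sum.inl a))
      (paramForm D (Sum.inl b)) p q := by
  rw [D.deck_iterate] at h
  simp only [Prod.mk.injEq] at h
  have hpa := isParamAt_surfParam hp.2
  set g : ℂ → W := A.ψ^[n] ∘ surfParam a with hgdef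
  have hg : ContMDiffAt 𝓘(ℝ, ℂ) (𝓡∂ 2) ∞ g p.2 :=
    ContMDiffAt.comp p.2 (A.contMDiff_ψ_iterate n _) hpa.smooth
  obtain ⟨h1, h2, h3⟩ := surfCoord_comp hg hq.2 h.1
  have hu : ContDiffAt ℝ ∞ (D.Usum n ∘ surfParam a) p.2 := by
    rw [← contMDiffAt_iff_contDiffAt]
    exact ContMDiffAt.comp p.2 (D.contMDiff_Usum n _) hpa.smooth
  have hsnd : ContinuousAt (Prod.snd : ℝ × ℂ → ℂ) p := continuousAt_snd
  refine ⟨fun x => (x.1 + (D.Usum n ∘ surfParam a) x.2, surfCoord b (g x.2)),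
    (contDiffAt_fst.add (ContDiffAt.comp p (g := D.Usum n ∘ surfParam a) hu contDiffAt_snd)).prodMk
      (ContDiffAt.comp p (g := fun y => surfCoord b (g y)) h1 contDiffAt_snd), Prod.ext h.2 h2, ?_⟩
  filter_upwards [hsnd.eventually h3, hsnd.eventually (eventually_differentiableAt h1),
    hsnd.eventually (eventually_differentiableAt hu), (isOpen_dom _).mem_nhds hp] with x h3 h4 h5 h6
  have hx := isParamAt_surfParam h6.2
  refine ⟨?_, ?_⟩
  · simp only [param, h3.1]
    refine ((M.page_eq_iff _ (mem_core_of_mem_dom h6) _ ?_).2 ⟨n, Or.inl ?_⟩).symm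
    · exact ⟨(A.ψ_iterate_mem_core_iff n _).2 h6.2.2, mem_univ _⟩
    · rw [D.deck_iterate]
      rfl
  · have e1 : HasFDerivAt (fun x : ℝ × ℂ => (D.Usum n ∘ surfParam a) x.2)
        ((fderiv ℝ (D.Usum n ∘ surfParam a) x.2).comp (ContinuousLinearMap.snd ℝ ℝ ℂ)) x :=
      HasFDerivAt.comp x (g := D.Usum n ∘ surfParam a) h5.hasFDerivAt hasFDerivAt_snd
    have e2 : HasFDerivAt (fun x : ℝ × ℂ => surfCoord b (g x.2))
        ((fderiv ℝ (fun y => surfCoord b (g y)) x.2).comp (ContinuousLinearMap.snd ℝ ℝ ℂ)) x :=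
      HasFDerivAt.comp x (g := fun y => surfCoord b (g y)) h4.hasFDerivAt hasFDerivAt_snd
    have e0 : HasFDerivAt
        (fun x : ℝ × ℂ => (x.1 + (D.Usum n ∘ surfParam a) x.2, surfCoord b (g x.2))) _ x :=
      (hasFDerivAt_fst.add e1).prodMk e2
    rw [e0.fderiv]
    refine ContinuousLinearMap.ext fun v => ?_
    have e3 := DFunLike.congr_fun h3.2 v.2
    rw [D.pb_ψ_iterate_comp n hx.mdiff] at e3
    simp only [ContinuousLinearMap.comp_apply, sub_apply] at e3
    simp only [paramForm, ContinuousLinearMap.comp_apply, pageForm_apply,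
      ContinuousLinearMap.prod_apply, add_apply, ContinuousLinearMap.coe_fst',
      ContinuousLinearMap.coe_snd']
    rw [e3]
    ring

/-- The contact form in polar coordinates, in the region where the pieces are glued. -/
def polarForm (D : GirouxData A) (i : Fin k) (p : ℝ × ℝ × ℝ) : ℝ × ℝ × ℝ →L[ℝ] ℝ :=
  Real.exp (-(S.width * p.2.1)) • ContinuousLinearMap.fst ℝ ℝ (ℝ × ℝ) +
    D.slope i • (ContinuousLinearMap.snd ℝ ℝ ℝ).comp (ContinuousLinearMap.snd ℝ ℝ (ℝ × ℝ))

theorem polarForm_apply (i : Fin k) (p v : ℝ × ℝ × ℝ) : polarForm D i p v =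
    Real.exp (-(S.width * p.2.1)) * v.1 + D.slope i * v.2.2 := rfl

theorem contactAt_polarForm (i : Fin k) (p : ℝ × ℝ × ℝ) : ContactAt (polarForm D i) p := by
  have ha := D.slope_pos i
  have hw := S.width_pos
  have he := Real.exp_pos (-(S.width * p.2.1))
  have h1 : HasFDerivAt (fun p : ℝ × ℝ × ℝ => -(S.width * p.2.1))
      (-(S.width • (ContinuousLinearMap.fst ℝ ℝ ℝ).comp (ContinuousLinearMap.snd ℝ ℝ (ℝ × ℝ)))) p :=
    ((HasFDerivAt.comp p (g := Prod.fst) hasFDerivAt_fst hasFDerivAt_snd).const_mul S.width).neg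
  have h2 : HasFDerivAt (polarForm D i) _ p := ((h1.exp).smul_const _).add_const _
  have h3 : ∀ v w, extD (polarForm D i) p v w =
      -(S.width * Real.exp (-(S.width * p.2.1))) * (v.2.1 * w.1 - w.2.1 * v.1) := by
    intro v w
    rw [extD, h2.fderiv]
    simp
    ring
  refine ⟨fun h => ?_, fun v hv hw' => ?_⟩
  · have := DFunLike.congr_fun h ((0, 0, 1) : ℝ × ℝ × ℝ)
    simp [polarForm_apply] at this
    exact ha.ne' this
  · have e1 := hw' (0, 1, 0) (by simp [polarForm_apply])
    have e2 := hw' (D.slope i, 0, -Real.exp (-(S.width * p.2.1)))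
      (by rw [polarForm_apply]; ring)
    rw [h3] at e1 e2
    have hne : -(S.width * Real.exp (-(S.width * p.2.1))) ≠ 0 := by
      have := mul_pos hw he
      linarith
    have e1' := (mul_eq_zero.1 e1).resolve_left hne
    have e2' := (mul_eq_zero.1 e2).resolve_left hne
    simp only [mul_zero, one_mul, zero_sub, neg_eq_zero, zero_mul, sub_zero] at e1' e2'
    have e3 := (mul_eq_zero.1 e2').resolve_right ha.ne'
    rw [polarForm_apply, e1', mul_zero, zero_add] at hv
    exact Prod.ext e1' (Prod.ext e3 ((mul_eq_zero.1 hv).resolve_left ha.ne'))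

theorem hasFDerivAt_polar (p : ℝ × ℝ × ℝ) :
    HasFDerivAt (fun p : ℝ × ℝ × ℝ => ((p.2.1 * Real.cos p.2.2 : ℝ) : ℂ) +
      ((p.2.1 * Real.sin p.2.2 : ℝ) : ℂ) * Complex.I)
      (((Real.cos p.2.2 • (ContinuousLinearMap.fst ℝ ℝ ℝ).comp (ContinuousLinearMap.snd ℝ ℝ (ℝ × ℝ)) -
        (p.2.1 * Real.sin p.2.2) •
          (ContinuousLinearMap.snd ℝ ℝ ℝ).comp (ContinuousLinearMap.snd ℝ ℝ (ℝ × ℝ))).smulRight (1 : ℂ)) +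
       ((Real.sin p.2.2 • (ContinuousLinearMap.fst ℝ ℝ ℝ).comp (ContinuousLinearMap.snd ℝ ℝ (ℝ × ℝ)) +
        (p.2.1 * Real.cos p.2.2) •
          (ContinuousLinearMap.snd ℝ ℝ ℝ).comp (ContinuousLinearMap.snd ℝ ℝ (ℝ × ℝ))).smulRight Complex.I)) p := by
  have hr : HasFDerivAt (fun p : ℝ × ℝ × ℝ => p.2.1)
      ((ContinuousLinearMap.fst ℝ ℝ ℝ).comp (ContinuousLinearMap.snd ℝ ℝ (ℝ × ℝ))) p :=
    HasFDerivAt.comp p (g := Prod.fst) hasFDerivAt_fst hasFDerivAt_snd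
  have hφ : HasFDerivAt (fun p : ℝ × ℝ × ℝ => p.2.2)
      ((ContinuousLinearMap.snd ℝ ℝ ℝ).comp (ContinuousLinearMap.snd ℝ ℝ (ℝ × ℝ))) p :=
    HasFDerivAt.comp p (g := Prod.snd) hasFDerivAt_snd hasFDerivAt_snd
  have h1 := ((hr.mul hφ.cos).smul_const (1 : ℂ)).add ((hr.mul hφ.sin).smul_const Complex.I)
  refine (h1.congr_of_eventuallyEq (Eventually.of_forall fun q => ?_)).congr_fderiv ?_
  · simp
  · refine ContinuousLinearMap.ext fun v => ?_
    simp
    ring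

theorem polar_eq (r φ : ℝ) : (r : ℂ) * Complex.exp (φ * Complex.I) =
    ((r * Real.cos φ : ℝ) : ℂ) + ((r * Real.sin φ : ℝ) : ℂ) * Complex.I := by
  rw [Complex.exp_mul_I]
  push_cast
  ring

end OpenBookModel

end Surface
end

noncomputable section
open Filter Topology

/-! ### Gluing the binding to the mapping torus -/

section Surface

variable {W : Type u} [TopologicalSpace W] [T2Space W] [CompactSpace W]
    [ChartedSpace (EuclideanHalfSpace 2) W] [IsManifold (𝓡∂ 2) ∞ W] {k : ℕ}
    {S : LiouvilleSurface W k} {A : AutonomousHamiltonian S} {D : GirouxData A} {Y : Type u}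

theorem norm_polar {r φ : ℝ} (hr : 0 ≤ r) :
    ‖(r : ℂ) * Complex.exp (φ * Complex.I)‖ = r := by
  rw [norm_mul, Complex.norm_exp_ofReal_mul_I, mul_one, Complex.norm_real, Real.norm_eq_abs,
    abs_of_nonneg hr]

namespace OpenBookModel

variable (M : OpenBookModel D Y)

/-- The relation between the two pieces of the open book, on the level of points. -/
theorem exists_angle {i : Fin k} {x : ℝ} {z : ℂ} (hz : ‖z‖ < 1) {w : W} {φ : ℝ} (hw : w ∈ S.core)
    (h : M.binding i (x, z) = M.page (w, φ)) :
    1 / 2 < ‖z‖ ∧ S.collar i (x, -(S.width * ‖z‖)) = w ∧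
      ∃ θ : ℝ, D.slope i * θ = φ ∧ (‖z‖ : ℂ) * Complex.exp (θ * Complex.I) = z := by
  have hw' : (w, φ) ∈ S.core ×ˢ (univ : Set ℝ) := ⟨hw, mem_univ _⟩
  have h1 := M.overlap i x z hz (w, φ) hw' h
  refine ⟨h1, ?_⟩
  have h2 := M.glue i x ‖z‖ (Complex.arg z) h1 hz
  rw [Complex.norm_mul_exp_arg_mul_I] at h2
  have hm := GirouxData.radius_mem_collarStrip (S := S) (x := x) (norm_nonneg z) hz
  have hc : (S.collar i (x, -(S.width * ‖z‖)), D.slope i * Complex.arg z) ∈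
      S.core ×ˢ (univ : Set ℝ) := ⟨GirouxData.radius_mem_core i h1 hz, mem_univ _⟩
  obtain ⟨n, h3⟩ := (M.page_eq_iff _ hc _ hw').1 (h2.symm.trans h)
  have h4 : ∃ l : ℤ, S.collar i (x, -(S.width * ‖z‖)) = w ∧
      D.slope i * Complex.arg z + l * (2 * Real.pi * D.slope i) = φ := by
    rcases h3 with h3 | h3
    · rw [D.deck_iterate_collar n i hm] at h3
      exact ⟨-n, congrArg Prod.fst h3, by
        have := congrArg Prod.snd h3
        simp only at this
        push_cast
        linarith⟩
    · have h5 := h3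
      rw [D.deck_iterate, Prod.mk.injEq] at h5
      have h6 : A.ψ^[n] w = A.ψ^[n] (S.collar i (x, -(S.width * ‖z‖))) := by
        rw [A.ψ_iterate_collar n i hm]
        exact h5.1
      have h7 := (A.ψ_injective.iterate n) h6
      subst h7
      rw [D.deck_iterate_collar n i hm] at h3
      refine ⟨n, rfl, ?_⟩
      have := congrArg Prod.snd h3
      simp only at this
      push_cast
      linarith
  obtain ⟨l, h5, h6⟩ := h4
  refine ⟨h5, Complex.arg z + l * (2 * Real.pi), by rw [← h6]; ring, ?_⟩
  have h7 : Complex.exp (((Complex.arg z + l * (2 * Real.pi) : ℝ) : ℂ) * Complex.I) =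
      Complex.exp (Complex.arg z * Complex.I) := by
    rw [Complex.exp_eq_exp_iff_exists_int]
    exact ⟨l, by push_cast; ring⟩
  rw [h7, Complex.norm_mul_exp_arg_mul_I]

/-- Polar coordinates near the binding, in the region where the pieces are glued. -/
def polarParam (i : Fin k) (p : ℝ × ℝ × ℝ) : Y :=
  M.binding i (p.1, ((p.2.1 * Real.cos p.2.2 : ℝ) : ℂ) +
      ((p.2.1 * Real.sin p.2.2 : ℝ) : ℂ) * Complex.I)

theorem polarParam_eq (i : Fin k) (p : ℝ × ℝ × ℝ) (h0 : 1 / 2 < p.2.1) (h1 : p.2.1 < 1) :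
    M.polarParam i p = M.page (S.collar i (p.1, -(S.width * p.2.1)), D.slope i * p.2.2) := by
  rw [← M.glue i p.1 p.2.1 p.2.2 h0 h1, polar_eq]
  rfl

theorem eventually_radius (p : ℝ × ℝ × ℝ) (h0 : 1 / 2 < p.2.1) (h1 : p.2.1 < 1) :
    ∀ᶠ q : ℝ × ℝ × ℝ in 𝓝 p, 1 / 2 < q.2.1 ∧ q.2.1 < 1 :=
  (isOpen_Ioo.preimage (continuous_fst.comp continuous_snd)).mem_nhds
    (⟨h0, h1⟩ : p ∈ (Prod.fst ∘ Prod.snd : ℝ × ℝ × ℝ → ℝ) ⁻¹' Ioo (1 / 2) 1)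

/-- For `r > 1/2` the profiles are `e^(-εr)` and `a`, so the binding form in polar coordinates is
`e^(-εr) dx + a dφ`. -/
theorem contactGerm_polar_binding (i : Fin k) (p : ℝ × ℝ × ℝ) (h0 : 1 / 2 < p.2.1)
    (h1 : p.2.1 < 1) {q : ℝ × ℂ} (hq1 : q.1 = p.1)
    (hq2 : (p.2.1 : ℂ) * Complex.exp (p.2.2 * Complex.I) = q.2) :
    ContactGerm (M.polarParam i) (M.param (Sum.inr i)) (polarForm D i)
      (paramForm D (Sum.inr i)) p q := by
  have hsm : ContDiff ℝ ∞ (fun p : ℝ × ℝ × ℝ => ((p.2.1 * Real.cos p.2.2 : ℝ) : ℂ) +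
      ((p.2.1 * Real.sin p.2.2 : ℝ) : ℂ) * Complex.I) := by
    have hr : ContDiff ℝ ∞ (fun p : ℝ × ℝ × ℝ => p.2.1) := contDiff_fst.comp contDiff_snd
    have hφ : ContDiff ℝ ∞ (fun p : ℝ × ℝ × ℝ => p.2.2) := contDiff_snd.comp contDiff_snd
    exact (Complex.ofRealCLM.contDiff.comp (hr.mul hφ.cos)).add
      ((Complex.ofRealCLM.contDiff.comp (hr.mul hφ.sin)).mul contDiff_const)
  refine ⟨_, (contDiff_fst.prodMk hsm).contDiffAt, Prod.ext hq1.symm ?_, ?_⟩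
  · rw [← hq2, polar_eq]
  filter_upwards [eventually_radius p h0 h1] with x hx
  refine ⟨rfl, ?_⟩
  have e : HasFDerivAt (fun p : ℝ × ℝ × ℝ => (p.1, ((p.2.1 * Real.cos p.2.2 : ℝ) : ℂ) +
      ((p.2.1 * Real.sin p.2.2 : ℝ) : ℂ) * Complex.I)) _ x :=
    hasFDerivAt_fst.prodMk (hasFDerivAt_polar x)
  rw [e.fderiv]
  refine ContinuousLinearMap.ext fun v => ?_
  have hn : ‖(((x.2.1 * Real.cos x.2.2 : ℝ) : ℂ) +
      ((x.2.1 * Real.sin x.2.2 : ℝ) : ℂ) * Complex.I)‖ = x.2.1 := by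
    rw [← polar_eq, norm_polar (by linarith [hx.1])]
  have hne : x.2.1 ≠ 0 := by linarith [hx.1]
  rw [ContinuousLinearMap.comp_apply, paramForm, D.bindingForm_apply i (by rw [hn]; exact hx.2), hn,
    (D.profile i).tail₁ _ ⟨hx.1.le, hx.2⟩, (D.profile i).tail₂ _ ⟨hx.1.le, hx.2⟩, polarForm_apply,
    ← angForm_eq, angForm_apply]
  have hcs := Real.sin_sq_add_cos_sq x.2.2
  simp
  rw [← GirouxData.slope]
  field_simp
  simp only [Complex.cos_ofReal_re, Complex.sin_ofReal_re]
  linear_combination (D.slope i * x.2.1 * v.2.2) * hcs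

/-- On the collar `λ = e^s dx`; substituting `s = -εr` and the page angle `aφ` into `dφ + λ` gives
the same polar form. -/
theorem contactGerm_polar_page (i : Fin k) (p : ℝ × ℝ × ℝ) (h0 : 1 / 2 < p.2.1)
    (h1 : p.2.1 < 1) {b : W} {q : ℝ × ℂ} (hq : q ∈ dom S (Sum.inl b : W ⊕ Fin k))
    (hq1 : D.slope i * p.2.2 = q.1)
    (hq2 : S.collar i (p.1, -(S.width * p.2.1)) = surfParam b q.2) :
    ContactGerm (M.polarParam i) (M.param (Sum.inl b)) (polarForm D i)
      (paramForm D (Sum.inl b)) p q := by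
  have hw := S.width_pos
  let ρ : ℝ × ℝ × ℝ → ℝ × ℝ := fun p => (p.1, -(S.width * p.2.1))
  have hρ : ContDiff ℝ ∞ ρ := by fun_prop
  have hin : ∀ x : ℝ × ℝ × ℝ, 1 / 2 < x.2.1 → x.2.1 < 1 → -S.width < (ρ x).2 ∧ (ρ x).2 < 0 :=
    fun x h0 h1 => ⟨by simp only [ρ]; nlinarith, by simp only [ρ]; nlinarith⟩
  have hcol := hin p h0 h1
  have hg : ContMDiffAt 𝓘(ℝ, ℝ × ℝ × ℝ) (𝓡∂ 2) ∞ (S.collar i ∘ ρ) p :=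
    ContMDiffAt.comp p (S.collar_contMDiffAt i hcol.1 hcol.2) hρ.contMDiff.contMDiffAt
  obtain ⟨g1, g2, g3⟩ := surfCoord_comp hg hq.2 hq2
  refine ⟨fun x => (D.slope i * x.2.2, surfCoord b ((S.collar i ∘ ρ) x)),
    (contDiffAt_const.mul (contDiffAt_snd.comp p contDiffAt_snd)).prodMk g1, Prod.ext hq1 g2, ?_⟩
  filter_upwards [eventually_radius p h0 h1, g3, eventually_differentiableAt g1] with x hx g3 g4
  refine ⟨?_, ?_⟩
  · rw [M.polarParam_eq i x hx.1 hx.2]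
    simp only [param, g3.1]
    rfl
  · have e1 : HasFDerivAt (fun x : ℝ × ℝ × ℝ => D.slope i * x.2.2)
        (D.slope i • (ContinuousLinearMap.snd ℝ ℝ ℝ).comp (ContinuousLinearMap.snd ℝ ℝ (ℝ × ℝ))) x :=
      ((ContinuousLinearMap.snd ℝ ℝ ℝ).comp
        (ContinuousLinearMap.snd ℝ ℝ (ℝ × ℝ))).hasFDerivAt.const_mul _
    have e0 : HasFDerivAt
        (fun x : ℝ × ℝ × ℝ => (D.slope i * x.2.2, surfCoord b ((S.collar i ∘ ρ) x))) _ x :=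
      e1.prodMk g4.hasFDerivAt
    rw [e0.fderiv]
    refine ContinuousLinearMap.ext fun v => ?_
    have hc := hin x hx.1 hx.2
    have e3 := DFunLike.congr_fun g3.2 v
    have e4 := OneForm.pb_comp S.form (Φ := S.collar i) (τ := ρ) (x := x)
      (S.collar_isParamAt i hc.1 hc.2).mdiff (hρ.differentiable (by simp) x)
    rw [e4, S.collar_pb i hc.1 hc.2] at e3
    have e5 : HasFDerivAt ρ _ x := hasFDerivAt_fst.prodMk
      (((ContinuousLinearMap.fst ℝ ℝ ℝ).comp
        (ContinuousLinearMap.snd ℝ ℝ (ℝ × ℝ))).hasFDerivAt.const_mul S.width).neg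
    rw [e5.fderiv] at e3
    simp only [paramForm, ContinuousLinearMap.comp_apply, pageForm_apply,
      ContinuousLinearMap.prod_apply] at e3 ⊢
    rw [e3, polarForm_apply]
    simp [ρ]
    ring

/-- Both pieces are reached from polar coordinates by smooth maps, and one of the two germs is
inverted abstractly. No branch of the argument has to be differentiated. -/
theorem contactGerm_binding_page {i : Fin k} {b : W} {p q : ℝ × ℂ}
    (hp : p ∈ dom S (Sum.inr i : W ⊕ Fin k)) (hq : q ∈ dom S (Sum.inl b : W ⊕ Fin k))
    (h : M.param (Sum.inr i) p = M.param (Sum.inl b) q) :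
    ContactGerm (M.param (Sum.inr i)) (M.param (Sum.inl b)) (paramForm D (Sum.inr i))
      (paramForm D (Sum.inl b)) p q := by
  obtain ⟨x, z⟩ := p
  have hz : ‖z‖ < 1 := norm_lt_of_mem_dom hp
  obtain ⟨h1, h2, θ, h3, h4⟩ := M.exists_angle hz hq.2.2 h
  have h5 := M.contactGerm_polar_binding i (x, ‖z‖, θ) h1 hz (q := (x, z)) rfl h4
  have h6 := M.contactGerm_polar_page i (x, ‖z‖, θ) h1 hz hq h3 h2
  refine (h5.symm (by simp) (contactAt_polarForm i _) ?_).trans h6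
  exact (D.contDiff_bindingForm i).differentiable (by simp) _

theorem contactGerm_binding {i : Fin k} {p q : ℝ × ℂ}
    (h2 : p.2 = q.2) (n : ℤ) (hn : p.1 - q.1 = n * S.len i)
    (hp : p ∈ dom S (Sum.inr i : W ⊕ Fin k)) :
    ContactGerm (M.param (Sum.inr i)) (M.param (Sum.inr i)) (paramForm D (Sum.inr i))
      (paramForm D (Sum.inr i)) p q := by
  refine ⟨fun x => (x.1 - n * S.len i, x.2), by fun_prop,
    Prod.ext (by simp only; linarith) h2, ?_⟩
  filter_upwards [(isOpen_dom _).mem_nhds hp] with x hx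
  have hz := norm_lt_of_mem_dom hx
  refine ⟨(M.binding_eq_iff i i _ _ _ _ hz hz).2 ⟨rfl, rfl, -n, by push_cast; ring⟩, ?_⟩
  have e : HasFDerivAt (fun x : ℝ × ℂ => (x.1 - n * S.len i, x.2))
      ((ContinuousLinearMap.fst ℝ ℝ ℂ).prod (ContinuousLinearMap.snd ℝ ℝ ℂ)) x :=
    (hasFDerivAt_fst.sub_const _).prodMk hasFDerivAt_snd
  rw [e.fderiv]
  rfl

/-- Deck iterates are indexed by natural numbers, so two page charts are related in one direction
only, which depends on the points; hence the disjunction. -/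
theorem contactGerm_param (j l : W ⊕ Fin k) (p q : ℝ × ℂ) (hp : p ∈ dom S j) (hq : q ∈ dom S l)
    (h : M.param j p = M.param l q) :
    ContactGerm (M.param j) (M.param l) (paramForm D j) (paramForm D l) p q ∨
      ContactGerm (M.param l) (M.param j) (paramForm D l) (paramForm D j) q p := by
  rcases j with a | i <;> rcases l with b | i'
  · obtain ⟨n, h | h⟩ := (M.page_eq_iff _ (mem_core_of_mem_dom hp) _ (mem_core_of_mem_dom hq)).1 h
    · exact Or.inl (M.contactGerm_page hp hq n h)
    · exact Or.inr (M.contactGerm_page hq hp n h)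
  · exact Or.inr (M.contactGerm_binding_page hq hp h.symm)
  · exact Or.inl (M.contactGerm_binding_page hp hq h)
  · obtain ⟨rfl, h2, n, hn⟩ := (M.binding_eq_iff i i' p.1 q.1 p.2 q.2 (norm_lt_of_mem_dom hp)
      (norm_lt_of_mem_dom hq)).1 h
    exact Or.inl (M.contactGerm_binding h2 n hn hp)

theorem exists_contactStructure :
    ∃ (_ : TopologicalSpace Y) (_ : ChartedSpace (EuclideanSpace ℝ (Fin 3)) Y)
      (_ : IsManifold (𝓡 3) ∞ Y) (α : OneForm (𝓡 3) Y), IsContactForm α ∧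
      ∀ j, ∀ p ∈ dom S j, IsParamAt (𝓡 3) (M.param j) p ∧ α.pb (M.param j) p = paramForm D j p :=
  exists_contact_gluing_of_locallyInjective spaceEquiv (dom S) isOpen_dom M.param
    M.locallyInjective_param M.exists_param_eq (paramForm D) contDiffOn_paramForm
    contactAt_paramForm M.contactGerm_param

end OpenBookModel

end Surface
end

noncomputable section
open Filter Topology

/-! ### Hausdorffness and compactness of the open book -/

section Surface

variable {W : Type u} [TopologicalSpace W] [T2Space W] [CompactSpace W]
    [ChartedSpace (EuclideanHalfSpace 2) W] [IsManifold (𝓡∂ 2) ∞ W] {k : ℕ}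
    {S : LiouvilleSurface W k} {A : AutonomousHamiltonian S} {D : GirouxData A} {Y : Type u}

/-- The deck relation is closed. Between small neighbourhoods only finitely many iterates matter, as
the angle drops by `m` at every step, and each single iterate is continuous. -/
theorem GirouxData.eventually_not_deckRel (D : GirouxData A) {p q : W × ℝ}
    (h : ¬ D.DeckRel p q) : ∀ᶠ z in 𝓝 p ×ˢ 𝓝 q, ¬ D.DeckRel z.1 z.2 := by
  obtain ⟨m, hm, hU⟩ := D.exists_U_le
  have key : ∀ p q : W × ℝ, (∀ n : ℕ, D.deck^[n] p ≠ q) →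
      ∀ᶠ z in 𝓝 p ×ˢ 𝓝 q, ∀ n : ℕ, D.deck^[n] z.1 ≠ z.2 := by
    intro p q h
    obtain ⟨K, hK⟩ := exists_nat_gt ((p.2 - q.2 + 2) / m)
    rw [div_lt_iff₀ hm] at hK
    rw [← nhds_prod_eq]
    have h1 : ∀ᶠ z : (W × ℝ) × (W × ℝ) in 𝓝 (p, q), ∀ n ∈ Finset.range K, D.deck^[n] z.1 ≠ z.2 := by
      rw [Filter.eventually_all_finset]
      intro n _
      exact (isOpen_ne_fun ((D.continuous_deck_iterate n).comp continuous_fst)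
        continuous_snd).mem_nhds (h n)
    have h2 : ∀ᶠ z : (W × ℝ) × (W × ℝ) in 𝓝 (p, q), z.1.2 < p.2 + 1 :=
      (isOpen_lt (by fun_prop) continuous_const).mem_nhds (by simp)
    have h3 : ∀ᶠ z : (W × ℝ) × (W × ℝ) in 𝓝 (p, q), q.2 - 1 < z.2.2 :=
      (isOpen_lt continuous_const (by fun_prop)).mem_nhds (by simp)
    filter_upwards [h1, h2, h3] with z h1 h2 h3 n hn
    by_cases hnK : n < K
    · exact h1 n (Finset.mem_range.2 hnK) hn
    · rw [D.deck_iterate] at hn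
      have h4 : z.1.2 + D.Usum n z.1.1 = z.2.2 := congrArg Prod.snd hn
      have h5 := D.Usum_le hU n z.1.1
      have h6 : (K : ℝ) ≤ n := by exact_mod_cast not_lt.1 hnK
      nlinarith
  have h1 := key p q fun n hn => h ⟨n, Or.inl hn⟩
  have h2 : ∀ᶠ z in 𝓝 p ×ˢ 𝓝 q, ∀ n : ℕ, D.deck^[n] z.2 ≠ z.1 := by
    have := key q p fun n hn => h ⟨n, Or.inr hn⟩
    rw [← nhds_prod_eq] at this ⊢
    exact (continuous_swap.tendsto (p, q)).eventually this
  filter_upwards [h1, h2] with z h1 h2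
  rintro ⟨n, h | h⟩
  · exact h1 n h
  · exact h2 n h

namespace OpenBookModel

variable (M : OpenBookModel D Y)
  [TopologicalSpace Y] [ChartedSpace (EuclideanSpace ℝ (Fin 3)) Y]

/-- The condition that the contact manifold `(Y, α)` is parametrized by the maps `param`. -/
def IsParametrized (α : OneForm (𝓡 3) Y) : Prop :=
  ∀ j, ∀ p ∈ dom S j, IsParamAt (𝓡 3) (M.param j) p ∧ α.pb (M.param j) p = paramForm D j p

variable {M} [IsManifold (𝓡 3) ∞ Y] {α : OneForm (𝓡 3) Y}

theorem IsParametrized.page_image_mem_nhds (h : M.IsParametrized α) {p : W × ℝ} (hp : p ∈ S.core ×ˢ (univ : Set ℝ))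
    {N : Set (W × ℝ)} (hN : N ∈ 𝓝 p) : M.page '' N ∈ 𝓝 (M.page p) := by
  have hd := surfCoord_self_mem_surfDom hp.1
  have hc := surfParam_surfCoord (mem_extChartAt_source (I := 𝓡∂ 2) p.1)
  have h1 := (h (Sum.inl p.1) (p.2, surfCoord p.1 p.1) ⟨mem_univ _, hd⟩).1.map_nhds_eq
  have h2 : M.param (Sum.inl p.1) (p.2, surfCoord p.1 p.1) = M.page p := by
    simp only [param, hc]
  rw [h2] at h1
  rw [← h1]
  have h3 : ContinuousAt (fun q : ℝ × ℂ => (surfParam p.1 q.2, q.1)) (p.2, surfCoord p.1 p.1) :=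
    (ContinuousAt.comp (x := (p.2, surfCoord p.1 p.1)) (g := surfParam p.1) (f := Prod.snd)
      (isParamAt_surfParam hd).smooth.continuousAt continuousAt_snd).prodMk continuousAt_fst
  refine mem_of_superset (image_mem_map (h3.preimage_mem_nhds (t := N) ?_)) ?_
  · simp only [hc]
    exact hN
  · rintro _ ⟨q, hq, rfl⟩
    exact ⟨_, hq, rfl⟩

theorem IsParametrized.binding_image_mem_nhds (h : M.IsParametrized α) (i : Fin k) {p : ℝ × ℂ} (hp : ‖p.2‖ < 1)
    {N : Set (ℝ × ℂ)} (hN : N ∈ 𝓝 p) : M.binding i '' N ∈ 𝓝 (M.binding i p) := by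
  have h1 := (h (Sum.inr i) p ⟨mem_univ _, mem_ball_zero_iff.2 hp⟩).1.map_nhds_eq
  rw [show M.binding i p = M.param (Sum.inr i) p from rfl, ← h1]
  exact image_mem_map hN

theorem IsParametrized.contMDiffAt_binding (h : M.IsParametrized α) (i : Fin k) {p : ℝ × ℂ} (hp : ‖p.2‖ < 1) :
    ContMDiffAt 𝓘(ℝ, ℝ × ℂ) (𝓡 3) ∞ (M.binding i) p :=
  (h (Sum.inr i) p ⟨mem_univ _, mem_ball_zero_iff.2 hp⟩).1.smooth

theorem IsParametrized.contMDiffAt_page (h : M.IsParametrized α) {p : W × ℝ} (hp : p ∈ S.core ×ˢ (univ : Set ℝ)) :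
    ContMDiffAt ((𝓡∂ 2).prod 𝓘(ℝ, ℝ)) (𝓡 3) ∞ M.page p := by
  have hd := surfCoord_self_mem_surfDom hp.1
  have hs : p.1 ∈ (extChartAt (𝓡∂ 2) p.1).source := mem_extChartAt_source p.1
  have h1 := (h (Sum.inl p.1) (p.2, surfCoord p.1 p.1) ⟨mem_univ _, hd⟩).1.smooth
  have h2 : ContMDiffAt ((𝓡∂ 2).prod 𝓘(ℝ, ℝ)) 𝓘(ℝ, ℝ × ℂ) ∞
      (fun q : W × ℝ => (q.2, surfCoord p.1 q.1)) p :=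
    contMDiffAt_snd.prodMk_space
      (ContMDiffAt.comp p (g := surfCoord p.1) (f := Prod.fst) (contMDiffAt_surfCoord hs)
        contMDiffAt_fst)
  refine (ContMDiffAt.comp p (g := M.param (Sum.inl p.1)) h1 h2).congr_of_eventuallyEq ?_
  filter_upwards [continuousAt_fst.preimage_mem_nhds
    ((isOpen_extChartAt_source p.1).mem_nhds hs)] with q hq
  simp only [param, Function.comp, surfParam_surfCoord hq]

theorem hasMFDerivAt_pageParam {χ : ℂ → W} {q : ℝ × ℂ}
    (hP : MDifferentiableAt 𝓘(ℝ, ℂ) (𝓡∂ 2) χ q.2) :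
    HasMFDerivAt 𝓘(ℝ, ℝ × ℂ) ((𝓡∂ 2).prod 𝓘(ℝ, ℝ)) (fun q : ℝ × ℂ => (χ q.2, q.1)) q
      (((mfderiv 𝓘(ℝ, ℂ) (𝓡∂ 2) χ q.2).comp (ContinuousLinearMap.snd ℝ ℝ ℂ)).prod
        (ContinuousLinearMap.fst ℝ ℝ ℂ)) :=
  (HasMFDerivAt.comp q (g := χ) hP.hasMFDerivAt
      hasFDerivAt_snd.hasMFDerivAt).prodMk hasFDerivAt_fst.hasMFDerivAt

theorem IsParametrized.page_pullback_param (h : M.IsParametrized α) {w : W} {q : ℝ × ℂ}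
    (hq : q ∈ dom S (Sum.inl w : W ⊕ Fin k)) (u : ℂ) (r : ℝ) :
    α (M.page (surfParam w q.2, q.1))
      (mfderiv ((𝓡∂ 2).prod 𝓘(ℝ, ℝ)) (𝓡 3) M.page (surfParam w q.2, q.1)
        ((mfderiv 𝓘(ℝ, ℂ) (𝓡∂ 2) (surfParam w) q.2 u, r) : EuclideanSpace ℝ (Fin 2) × ℝ)) =
      r + S.form (surfParam w q.2) (mfderiv 𝓘(ℝ, ℂ) (𝓡∂ 2) (surfParam w) q.2 u) := by
  have hθ := hasMFDerivAt_pageParam (isParamAt_surfParam hq.2).mdiff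
  have hpage : MDifferentiableAt ((𝓡∂ 2).prod 𝓘(ℝ, ℝ)) (𝓡 3) M.page
      (surfParam w q.2, q.1) :=
    (h.contMDiffAt_page (mem_core_of_mem_dom hq)).mdifferentiableAt (by simp)
  have h1 := (HasMFDerivAt.comp q (g := M.page) hpage.hasMFDerivAt hθ).mfderiv
  have h2 := DFunLike.congr_fun (h (Sum.inl w) q hq).2 ((r, u) : ℝ × ℂ)
  have h4 := DFunLike.congr_fun h1 ((r, u) : ℝ × ℂ)
  exact (congrArg (α (M.page (surfParam w q.2, q.1))) h4).symm.trans h2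

theorem IsParametrized.page_pullback (h : M.IsParametrized α) {p : W × ℝ}
    (hp : p ∈ S.core ×ˢ (univ : Set ℝ)) (v : TangentSpace ((𝓡∂ 2).prod 𝓘(ℝ, ℝ)) p) :
    α (M.page p) (mfderiv ((𝓡∂ 2).prod 𝓘(ℝ, ℝ)) (𝓡 3) M.page p v) = v.2 + S.form p.1 v.1 := by
  have hd := surfCoord_self_mem_surfDom hp.1
  have hc : surfParam p.1 (surfCoord p.1 p.1) = p.1 :=
    surfParam_surfCoord (mem_extChartAt_source (I := 𝓡∂ 2) p.1)
  have hq : (p.2, surfCoord p.1 p.1) ∈ dom S (Sum.inl p.1 : W ⊕ Fin k) := ⟨mem_univ _, hd⟩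
  have key : ∀ w : W, surfParam p.1 (surfCoord p.1 p.1) = w →
      ∀ (v1 : EuclideanSpace ℝ (Fin 2)) (v2 : ℝ), α (M.page (w, p.2))
        (mfderiv ((𝓡∂ 2).prod 𝓘(ℝ, ℝ)) (𝓡 3) M.page (w, p.2)
          ((v1, v2) : EuclideanSpace ℝ (Fin 2) × ℝ)) = v2 + S.form w v1 := by
    rintro _ rfl v1 v2
    obtain ⟨u, rfl⟩ : ∃ u : ℂ, (mfderiv 𝓘(ℝ, ℂ) (𝓡∂ 2) (surfParam p.1) (surfCoord p.1 p.1) u :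
      EuclideanSpace ℝ (Fin 2)) = v1 := (isParamAt_surfParam hd).bijective.2 _
    exact h.page_pullback_param hq u v2
  exact key p.1 hc v.1 v.2

/-- Points with `1/2 < r < 1` already lie on the mapping torus, so in later case distinctions only
the closed tube is left. -/
theorem exists_page_or_binding (M : OpenBookModel D Y) (y : Y) :
    (∃ p ∈ S.core ×ˢ (univ : Set ℝ), M.page p = y) ∨
      ∃ i x, ∃ z : ℂ, ‖z‖ ≤ 1 / 2 ∧ M.binding i (x, z) = y := by
  rcases M.cover y with h | ⟨i, x, z, hz, h⟩
  · exact Or.inl h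
  · rcases le_or_gt ‖z‖ (1 / 2) with h1 | h1
    · exact Or.inr ⟨i, x, z, h1, h⟩
    · refine Or.inl ⟨(S.collar i (x, -(S.width * ‖z‖)), D.slope i * Complex.arg z),
        ⟨GirouxData.radius_mem_core i h1 hz, mem_univ _⟩, ?_⟩
      rw [← M.glue i x ‖z‖ (Complex.arg z) h1 hz, Complex.norm_mul_exp_arg_mul_I, h]

theorem IsParametrized.disjoint_page_page (h : M.IsParametrized α) {p q : W × ℝ}
    (hp : p ∈ S.core ×ˢ (univ : Set ℝ)) (hq : q ∈ S.core ×ˢ (univ : Set ℝ))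
    (hpq : M.page p ≠ M.page q) : Disjoint (𝓝 (M.page p)) (𝓝 (M.page q)) := by
  have h1 := D.eventually_not_deckRel fun hr => hpq ((M.page_eq_iff p hp q hq).2 hr)
  obtain ⟨N, hN, N', hN', hNN⟩ := Filter.mem_prod_iff.1 h1
  have hc : S.core ×ˢ (univ : Set ℝ) ∈ 𝓝 p := (S.isOpen_core.prod isOpen_univ).mem_nhds hp
  have hc' : S.core ×ˢ (univ : Set ℝ) ∈ 𝓝 q := (S.isOpen_core.prod isOpen_univ).mem_nhds hq
  refine Filter.disjoint_iff.2 ⟨_, h.page_image_mem_nhds hp (inter_mem hN hc), _,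
    h.page_image_mem_nhds hq (inter_mem hN' hc'), ?_⟩
  rw [Set.disjoint_left]
  rintro _ ⟨p', hp', rfl⟩ ⟨q', hq', he⟩
  exact hNN (⟨hp'.1, hq'.1⟩ : (p', q') ∈ N ×ˢ N') ((M.page_eq_iff _ hp'.2 _ hq'.2).1 he.symm)

/-- A point of the open core is either off the collar or at a radius greater than `1/2`. Choose `r >
1/2` below that radius, or `3/4` off the collar: the tube of radius `r` and the pages off the collar
part `[-εr, 0]` are disjoint neighbourhoods. -/
theorem IsParametrized.disjoint_page_binding (h : M.IsParametrized α) {p : W × ℝ}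
    (hp : p ∈ S.core ×ˢ (univ : Set ℝ)) {i : Fin k} {x : ℝ} {z : ℂ} (hz : ‖z‖ ≤ 1 / 2) :
    Disjoint (𝓝 (M.page p)) (𝓝 (M.binding i (x, z))) := by
  have hw := S.width_pos
  obtain ⟨r, hr0, hr1, hr⟩ : ∃ r : ℝ, 1 / 2 < r ∧ r < 1 ∧
      ∀ j, p.1 ∉ S.collar j '' (univ ×ˢ Icc (-(S.width * r)) 0) := by
    by_cases hpc : p.1 ∈ S.collarRegion
    · obtain ⟨j, ⟨x', s⟩, hs, hps⟩ := hpc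
      have h1 : s < -(S.width / 2) := (S.collar_mem_core_iff j hs).1 (hps ▸ hp.1)
      have h2 : -S.width < s := hs.1
      obtain ⟨r, h3, h4⟩ := exists_between (show 1 / 2 < -s / S.width by
        rw [lt_div_iff₀ hw]; linarith)
      rw [lt_div_iff₀ hw] at h4
      have h5 : r < 1 := by nlinarith
      refine ⟨r, h3, h5, fun l hl => ?_⟩
      obtain ⟨⟨x'', s'⟩, ⟨-, hs'⟩, he⟩ := hl
      have h6 := ((S.collar_eq_iff l j _ ⟨by nlinarith [hs'.1], hs'.2⟩ _ hs).1 (he.trans hps.symm)).2.1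
      simp only at h6
      rw [h6] at hs'
      linarith [hs'.1]
    · refine ⟨3 / 4, by norm_num, by norm_num, fun l hl => hpc ?_⟩
      obtain ⟨⟨x'', s'⟩, ⟨-, hs'⟩, he⟩ := hl
      exact ⟨l, _, ⟨by nlinarith [hs'.1], hs'.2⟩, he⟩
  set K := ⋃ j, S.collar j '' (univ ×ˢ Icc (-(S.width * r)) 0) with hK
  have hKc : IsClosed K := isClosed_iUnion_of_finite fun j =>
    (S.isCompact_collar_image j (fun s hs => ⟨by nlinarith [hs.1], hs.2⟩) isCompact_Icc).isClosed
  have hN : (S.core ∩ Kᶜ) ×ˢ (univ : Set ℝ) ∈ 𝓝 p :=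
    ((S.isOpen_core.inter hKc.isOpen_compl).prod isOpen_univ).mem_nhds
      ⟨⟨hp.1, fun h => by
        obtain ⟨j, hj⟩ := mem_iUnion.1 h
        exact hr j hj⟩, mem_univ _⟩
  have hN' : {q : ℝ × ℂ | ‖q.2‖ < r} ∈ 𝓝 (x, z) :=
    (isOpen_lt (by fun_prop) continuous_const).mem_nhds (by simp only [mem_ofPred_eq]; linarith)
  refine Filter.disjoint_iff.2 ⟨_, h.page_image_mem_nhds hp hN, _,
    h.binding_image_mem_nhds i (by simp only; linarith) hN', ?_⟩
  rw [Set.disjoint_left]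
  rintro _ ⟨⟨w, φ⟩, hp', rfl⟩ ⟨⟨x', z'⟩, hz', he⟩
  have hz'' : ‖z'‖ < r := hz'
  obtain ⟨-, h2, -⟩ := M.exists_angle (hz''.trans hr1) hp'.1.1 he
  refine hp'.1.2 (mem_iUnion.2 ⟨i, _, ⟨mem_univ _, ?_, ?_⟩, h2⟩)
  · simp only
    nlinarith
  · simp only
    nlinarith [norm_nonneg z']

theorem IsParametrized.disjoint_binding_binding (h : M.IsParametrized α) {i j : Fin k}
    {p q : ℝ × ℂ} (hp : ‖p.2‖ < 1) (hq : ‖q.2‖ < 1) (hpq : M.binding i p ≠ M.binding j q) :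
    Disjoint (𝓝 (M.binding i p)) (𝓝 (M.binding j q)) := by
  have hball : ∀ p : ℝ × ℂ, ‖p.2‖ < 1 → {q : ℝ × ℂ | ‖q.2‖ < 1} ∈ 𝓝 p := fun p hp =>
    (isOpen_lt (by fun_prop) continuous_const).mem_nhds hp
  by_cases hij : i = j
  · subst hij
    let g : ℝ × ℂ → AddCircle (S.len i) × ℂ := fun p => ((p.1 : AddCircle (S.len i)), p.2)
    have hg : Continuous g := ((AddCircle.continuous_mk' _).comp continuous_fst).prodMk continuous_snd
    have hgb : ∀ p q : ℝ × ℂ, ‖p.2‖ < 1 → ‖q.2‖ < 1 →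
        (M.binding i p = M.binding i q ↔ g p = g q) := by
      intro p q hp hq
      rw [M.binding_eq_iff i i p.1 q.1 p.2 q.2 hp hq, Prod.mk.injEq, ← sub_eq_zero (b := (q.1 : AddCircle (S.len i))),
        ← AddCircle.coe_sub, AddCircle.coe_eq_zero_iff]
      simp only [true_and, zsmul_eq_mul]
      constructor
      · rintro ⟨h1, n, hn⟩
        exact ⟨⟨n, hn.symm⟩, h1⟩
      · rintro ⟨⟨n, hn⟩, h1⟩
        exact ⟨h1, n, hn.symm⟩
    have hlen : Fact (0 < S.len i) := ⟨S.len_pos i⟩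
    obtain ⟨U, V, hU, hV, hpU, hqV, hUV⟩ := t2_separation (fun he => hpq ((hgb p q hp hq).2 he))
    refine Filter.disjoint_iff.2
      ⟨_, h.binding_image_mem_nhds i hp (inter_mem ((hU.preimage hg).mem_nhds hpU) (hball p hp)),
       _, h.binding_image_mem_nhds i hq (inter_mem ((hV.preimage hg).mem_nhds hqV) (hball q hq)), ?_⟩
    rw [Set.disjoint_left]
    rintro _ ⟨p', hp', rfl⟩ ⟨q', hq', he⟩
    have h1 := (hgb _ _ hq'.2 hp'.2).1 he
    refine Set.disjoint_left.1 hUV hp'.1 ?_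
    rw [← h1]
    exact hq'.1
  · refine Filter.disjoint_iff.2 ⟨_, h.binding_image_mem_nhds i hp (hball p hp), _,
      h.binding_image_mem_nhds j hq (hball q hq), ?_⟩
    rw [Set.disjoint_left]
    rintro _ ⟨p', hp', rfl⟩ ⟨q', hq', he⟩
    exact hij ((M.binding_eq_iff j i q'.1 p'.1 q'.2 p'.2 hq' hp').1 he).1.symm

theorem IsParametrized.t2Space (h : M.IsParametrized α) : T2Space Y := by
  rw [t2Space_iff_disjoint_nhds]
  intro y y' hy
  have hh : ∀ z : ℂ, ‖z‖ ≤ 1 / 2 → ‖z‖ < 1 := fun z hz => by linarith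
  rcases exists_page_or_binding M y with ⟨p, hp, rfl⟩ | ⟨i, x, z, hz, rfl⟩ <;>
  rcases exists_page_or_binding M y' with ⟨p', hp', rfl⟩ | ⟨i', x', z', hz', rfl⟩
  · exact h.disjoint_page_page hp hp' hy
  · exact h.disjoint_page_binding hp hz'
  · exact (h.disjoint_page_binding hp' hz).symm
  · exact h.disjoint_binding_binding (hh z hz) (hh z' hz') hy

/-- A deck step changes the angle by at least `m` and at most `B`, so repeated steps reach the slab
`[0, B]` without jumping over it. -/
theorem exists_deckRel_mem_Icc (D : GirouxData A) {C : Set W} (hC : ∀ w, A.ψ w ∈ C ↔ w ∈ C) {m B : ℝ}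
    (hm : 0 < m) (hU : ∀ w, D.U w ≤ -m) (hB : ∀ w, -B ≤ D.U w) {w : W} (hw : w ∈ C) (φ : ℝ) :
    ∃ q ∈ C ×ˢ Icc 0 B, D.DeckRel (w, φ) q := by
  have key : ∀ n : ℕ, ∀ w ∈ C, ∀ φ : ℝ, -(n * m) ≤ φ → φ ≤ B + n * m →
      ∃ q ∈ C ×ˢ Icc 0 B, D.DeckRel (w, φ) q := by
    intro n
    induction n with
    | zero =>
      intro w hw φ h0 h1
      exact ⟨(w, φ), ⟨hw, by simpa using h0, by simpa using h1⟩, D.deckRel_equivalence.refl _⟩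
    | succ n ih =>
      intro w hw φ h0 h1
      push_cast at h0 h1
      have hn : 0 ≤ n * m := by positivity
      rcases lt_or_ge φ 0 with h2 | h2
      · have hw' : A.ψinv w ∈ C := by rwa [← hC, A.ψ_ψinv]
        have h3 := hU (A.ψinv w)
        have h4 := hB (A.ψinv w)
        obtain ⟨q, hq, hr⟩ := ih (A.ψinv w) hw' (φ - D.U (A.ψinv w)) (by linarith) (by linarith)
        refine ⟨q, hq, GirouxData.DeckRel.trans ⟨1, Or.inr ?_⟩ hr⟩
        simp [GirouxData.deck, A.ψ_ψinv]
      · rcases le_or_gt φ B with h3 | h3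
        · exact ⟨(w, φ), ⟨hw, h2, h3⟩, D.deckRel_equivalence.refl _⟩
        · have h4 := hU w
          have h5 := hB w
          obtain ⟨q, hq, hr⟩ := ih (A.ψ w) ((hC w).2 hw) (φ + D.U w) (by linarith) (by linarith)
          exact ⟨q, hq, GirouxData.DeckRel.trans ⟨1, Or.inl rfl⟩ hr⟩
  obtain ⟨n, hn⟩ := exists_nat_gt ((|φ| + |B|) / m)
  rw [div_lt_iff₀ hm] at hn
  exact key n w hw φ (by linarith [neg_abs_le φ, abs_nonneg B])
    (by linarith [le_abs_self φ, neg_abs_le B])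

/-- Enlarge the tubes to `r ≤ 3/4`. What is left of the core is a compact `ψ`-invariant set `C`,
over which the slab of angles `[0, B]` meets every deck orbit; one period of `x` suffices for the
tubes. -/
theorem IsParametrized.compactSpace (h : M.IsParametrized α) : CompactSpace Y := by
  have hw := S.width_pos
  obtain ⟨m, hm, hU⟩ := D.exists_U_le
  obtain ⟨B, hB⟩ := D.exists_le_U
  set C : Set W := (⋃ i, S.collar i '' (univ ×ˢ Ioc (-(3 / 4 * S.width)) 0))ᶜ with hCdef
  have hCc : IsCompact C := (isOpen_iUnion fun i =>
    S.isOpen_collar_image i (by linarith)).isClosed_compl.isCompact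
  have hCcore : C ⊆ S.core := by
    intro w hwC
    rw [S.core_eq]
    refine compl_subset_compl.2 (iUnion_mono fun i => image_mono (prod_mono_right fun s hs => ?_)) hwC
    exact ⟨by linarith [hs.1], hs.2⟩
  have hCψ : ∀ w, A.ψ w ∈ C ↔ w ∈ C := by
    intro w
    refine not_iff_not.2 (A.ψ_mem_iff_of_fixed (fun w hw' => ?_) w)
    obtain ⟨i, p, hp, rfl⟩ := mem_iUnion.1 hw'
    exact A.ψ_collar i ⟨by linarith [hp.2.1], hp.2.2⟩
  have h1 : IsCompact (M.page '' (C ×ˢ Icc 0 B)) := by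
    refine (hCc.prod isCompact_Icc).image_of_continuousOn fun p hp => ?_
    exact (h.contMDiffAt_page ⟨hCcore hp.1, mem_univ _⟩).continuousAt.continuousWithinAt
  have h2 : ∀ i, IsCompact (M.binding i '' (Icc 0 (S.len i) ×ˢ Metric.closedBall 0 (3 / 4))) := by
    intro i
    refine (isCompact_Icc.prod (isCompact_closedBall _ _)).image_of_continuousOn fun p hp => ?_
    refine (h.contMDiffAt_binding i ?_).continuousAt.continuousWithinAt
    have := mem_closedBall_zero_iff.1 hp.2
    linarith
  have hbind : ∀ i x (z : ℂ), ‖z‖ ≤ 3 / 4 → M.binding i (x, z) ∈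
      M.binding i '' (Icc 0 (S.len i) ×ˢ Metric.closedBall 0 (3 / 4)) := by
    intro i x z hz
    have hl := S.len_pos i
    have h3 := Int.floor_le (x / S.len i)
    have h4 := Int.lt_floor_add_one (x / S.len i)
    rw [le_div_iff₀ hl] at h3
    rw [div_lt_iff₀ hl] at h4
    refine ⟨(x - ⌊x / S.len i⌋ * S.len i, z), ⟨⟨by simp only; linarith, by simp only; linarith⟩,
      mem_closedBall_zero_iff.2 hz⟩, ?_⟩
    exact (M.binding_eq_iff i i _ _ _ _ (by linarith) (by linarith)).2
      ⟨rfl, rfl, -⌊x / S.len i⌋, by push_cast; ring⟩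
  refine ⟨?_⟩
  convert h1.union (isCompact_iUnion h2) using 1
  refine (eq_univ_of_forall fun y => ?_).symm
  rcases exists_page_or_binding M y with ⟨⟨w, φ⟩, hp, rfl⟩ | ⟨i, x, z, hz, rfl⟩
  · by_cases hwC : w ∈ C
    · obtain ⟨q, hq, hr⟩ := exists_deckRel_mem_Icc D hCψ hm hU hB hwC φ
      exact Or.inl ⟨q, hq, ((M.page_eq_iff _ hp _ ⟨hCcore hq.1, mem_univ _⟩).2 hr).symm⟩
    · obtain ⟨i, ⟨x, s⟩, ⟨-, hs⟩, rfl⟩ := mem_iUnion.1 (notMem_compl_iff.1 hwC)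
      have hs2 := (S.collar_mem_core_iff i (p := (x, s))
        ⟨by simp only; linarith [hs.1], hs.2⟩).1 hp.1
      simp only at hs2
      have hs1 := hs.1
      have e1 : 1 / 2 < -s / S.width := by rw [lt_div_iff₀ hw]; linarith
      have e2 : -s / S.width < 3 / 4 := by rw [div_lt_iff₀ hw]; linarith
      have e3 := M.glue i x (-s / S.width) (φ / D.slope i) e1 (by linarith)
      rw [mul_div_cancel₀ _ hw.ne', neg_neg, mul_div_cancel₀ _ (D.slope_pos i).ne'] at e3
      rw [← e3]
      refine Or.inr (mem_iUnion.2 ⟨i, hbind i _ _ ?_⟩)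
      rw [norm_polar (by linarith)]
      exact e2.le
  · exact Or.inr (mem_iUnion.2 ⟨i, hbind i x z (by linarith)⟩)

end OpenBookModel

theorem exists_openBook (D : GirouxData A) : ∃ (Y : Type u) (_ : TopologicalSpace Y)
    (_ : T2Space Y) (_ : CompactSpace Y) (_ : ChartedSpace (EuclideanSpace ℝ (Fin 3)) Y)
    (_ : IsManifold (𝓡 3) ∞ Y), Nonempty (OpenBook D Y) := by
  obtain ⟨Y, ⟨M⟩⟩ := D.exists_openBookModel
  obtain ⟨_, _, _, α, hα, h⟩ := M.exists_contactStructure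
  have h : M.IsParametrized α := h
  refine ⟨Y, _, h.t2Space, h.compactSpace, _, ‹_›, ⟨?_⟩⟩
  exact {
    form := α
    contact := hα
    page := M.page
    page_smooth := fun p hp => (h.contMDiffAt_page hp).contMDiffWithinAt
    page_eq_iff := M.page_eq_iff
    page_pullback := fun p hp v => h.page_pullback hp v
    binding := M.binding
    binding_smooth := fun i p hp =>
      (h.contMDiffAt_binding i (mem_ball_zero_iff.1 hp.2)).contMDiffWithinAt
    binding_eq_iff := M.binding_eq_iff
    binding_pullback := fun i x z hz v => by
      rw [← D.bindingForm_apply i hz]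
      exact DFunLike.congr_fun (h (Sum.inr i) (x, z) ⟨mem_univ _, mem_ball_zero_iff.2 hz⟩).2 v
    cover := M.cover
    glue := M.glue
    overlap := M.overlap }

end Surface
end

/-! ### Perturbing a function to have dense noncritical set -/

noncomputable section
open Filter Topology

/-- Baire's theorem in the dual space: the functionals that do not vanish at a given nonzero vector
form an open dense set. -/
theorem exists_dual_ne_zero_of_countable {V : Type*} [NormedAddCommGroup V] [NormedSpace ℝ V]
    {T : Set V} (hT : T.Countable) (h0 : ∀ u ∈ T, u ≠ 0) : ∃ ℓ : V →L[ℝ] ℝ, ∀ u ∈ T, ℓ u ≠ 0 := by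
  have hd : Dense (⋂ u ∈ T, {ℓ : V →L[ℝ] ℝ | ℓ u ≠ 0}) := by
    refine dense_biInter_of_isOpen (fun u _ => ?_) hT fun u hu => ?_
    · exact isOpen_ne.preimage (ContinuousLinearMap.apply ℝ ℝ u).continuous
    · obtain ⟨m, -, hm⟩ := exists_dual_vector ℝ u (norm_ne_zero_iff.2 (h0 u hu))
      have hm0 : m u ≠ 0 := by
        rw [hm]
        exact_mod_cast norm_ne_zero_iff.2 (h0 u hu)
      intro ℓ
      by_cases hℓ : ℓ u = 0
      · have ht : Tendsto (fun t : ℝ => ℓ + t • m) (𝓝[≠] 0) (𝓝 ℓ) := by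
          have : Continuous fun t : ℝ => ℓ + t • m := by fun_prop
          simpa using (this.tendsto 0).mono_left nhdsWithin_le_nhds
        refine mem_closure_of_tendsto ht ?_
        filter_upwards [self_mem_nhdsWithin] with t ht'
        simpa [hℓ] using ⟨ht', hm0⟩
      · exact subset_closure hℓ
  obtain ⟨ℓ, hℓ⟩ := hd.nonempty
  exact ⟨ℓ, fun u hu => mem_iInter₂.1 hℓ u hu⟩

section Perturb

variable {E : Type*} [NormedAddCommGroup E] [NormedSpace ℝ E] [FiniteDimensional ℝ E]
  [Nontrivial E]
  {B : Type*} [TopologicalSpace B] {I : ModelWithCorners ℝ E B}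
  {M : Type*} [TopologicalSpace M] [ChartedSpace B M] [T2Space M] [CompactSpace M]
  [IsManifold I ∞ M]

theorem dFun_congr {f g : M → ℝ} {p : M} (h : f =ᶠ[𝓝 p] g) : dFun I f p = dFun I g p :=
  h.mfderiv_eq

/-- On the open set `G` where `df` vanishes identically inside `O`, add a linear function of a map
`Q` that is immersive on `G` and zero off it. A generic functional is nonzero on the derivatives of
`Q` along one fixed direction at countably many points dense in `G`, and density of the noncritical
set requires no more. -/
theorem exists_smooth_perturbation {f : M → ℝ} (hf : ContMDiff I 𝓘(ℝ, ℝ) ∞ f) {O : Set M}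
    (hO : IsOpen O) :
    ∃ ρ : M → ℝ, ContMDiff I 𝓘(ℝ, ℝ) ∞ ρ ∧
      (∀ p, p ∉ O ∩ interior {p | dFun I f p = 0} → ρ p = 0) ∧
      O ⊆ closure {p | dFun I (fun p => f p + ρ p) p ≠ 0} := by
  have : SecondCountableTopology B := I.secondCountableTopology
  have : SecondCountableTopology M := ChartedSpace.secondCountable_of_sigmaCompact B M
  set G := O ∩ interior {p | dFun I f p = 0} with hGdef
  have hG : IsOpen G := hO.inter isOpen_interior
  obtain ⟨g, hgs, hg, -⟩ := hG.exists_contMDiff_support_eq I (n := (⊤ : ℕ∞))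
  obtain ⟨n, e, he, -, hi⟩ := exists_embedding_euclidean_of_compact (I := I) (M := M)
  set V := ℝ × EuclideanSpace ℝ (Fin n)
  -- The support of `g` is `G`, and `e` is an immersion recovered from `Q` by division, so `Q` is
  -- immersive on `G`.
  set Q : M → V := fun p => (g p, g p • e p) with hQ
  have hQs : ContMDiff I 𝓘(ℝ, V) ∞ Q := hg.prodMk_space (hg.smul he)
  have hQi : ∀ p ∈ G, ∀ v : E, (mfderiv I 𝓘(ℝ, V) Q p : E → V) v = 0 → v = 0 := by
    intro p hp v hv
    have hgp : g p ≠ 0 := by rw [← Function.mem_support, hgs]; exact hp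
    set R : V → EuclideanSpace ℝ (Fin n) := fun q => q.1⁻¹ • q.2 with hR
    have hRd : DifferentiableAt ℝ R (Q p) :=
      (DifferentiableAt.fun_inv (h := fun q : V => q.1) (z := Q p) differentiableAt_fst hgp).fun_smul
        differentiableAt_snd
    have h1 := hRd.hasFDerivAt.hasMFDerivAt.comp p
      ((hQs p).mdifferentiableAt (by simp)).hasMFDerivAt
    have h2 : R ∘ Q =ᶠ[𝓝 p] e := by
      filter_upwards [hG.mem_nhds hp] with q hq
      have hgq : g q ≠ 0 := by rw [← Function.mem_support, hgs]; exact hq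
      simp [hR, hQ, smul_smul, hgq]
    have h3 := (h1.congr_of_eventuallyEq h2.symm).mfderiv
    refine hi p ?_
    refine (DFunLike.congr_fun h3 v).trans ?_
    refine (congrArg (fderiv ℝ R (Q p)) hv).trans ?_
    exact (map_zero (fderiv ℝ R (Q p))).trans (map_zero (mfderiv I (𝓡 n) e p)).symm
  obtain ⟨T, hTc, hTd⟩ := TopologicalSpace.exists_countable_dense M
  obtain ⟨v₀, hv₀⟩ := exists_ne (0 : E)
  set u : M → V := fun p => (mfderiv I 𝓘(ℝ, V) Q p : E → V) v₀ with hu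
  obtain ⟨ℓ, hℓ⟩ := exists_dual_ne_zero_of_countable
    (T := u '' (G ∩ T)) ((hTc.mono inter_subset_right).image u) (by
      rintro _ ⟨p, hp, rfl⟩ h
      exact hv₀ (hQi p hp.1 v₀ h))
  have hρ : ContMDiff I 𝓘(ℝ, ℝ) ∞ (ℓ ∘ Q) := ℓ.contDiff.contMDiff.comp hQs
  have hρ0 : ∀ p, p ∉ G → (ℓ ∘ Q) p = 0 := by
    intro p hp
    have : g p = 0 := by rwa [← hgs, Function.notMem_support] at hp
    change ℓ (g p, g p • e p) = 0
    rw [this, zero_smul, ← Prod.zero_eq_mk, map_zero]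
  refine ⟨ℓ ∘ Q, hρ, hρ0, fun p hp => ?_⟩
  have hne : G ∩ T ⊆ {p | dFun I (fun p => f p + (ℓ ∘ Q) p) p ≠ 0} := by
    rintro q ⟨hq, hqT⟩ h
    have h1 := ((hf q).mdifferentiableAt (by simp)).hasMFDerivAt
    have h2 := ℓ.hasMFDerivAt.comp q ((hQs q).mdifferentiableAt (by simp)).hasMFDerivAt
    have h3 := (h1.add h2).mfderiv
    have h4 : mfderiv I 𝓘(ℝ, ℝ) f q = 0 :=
      interior_subset (s := {p | dFun I f p = 0}) hq.2
    refine hℓ _ ⟨q, ⟨hq, hqT⟩, rfl⟩ ?_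
    have h5 := (DFunLike.congr_fun h3 v₀).symm.trans (DFunLike.congr_fun h v₀)
    rw [h4] at h5
    exact (zero_add _).symm.trans h5
  -- Away from the closure of `G` the perturbation vanishes, and there points with `df ≠ 0` already
  -- accumulate at `p`.
  by_cases hpG : p ∈ closure G
  · refine closure_minimal ?_ isClosed_closure hpG
    exact (hTd.open_subset_closure_inter hG).trans (closure_mono hne)
  · have hpc : p ∈ closure {p | dFun I f p ≠ 0} := by
      by_contra h
      refine hpG (subset_closure ⟨hp, ?_⟩)
      rw [← mem_compl_iff, ← interior_compl] at h
      convert h using 2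
      ext q
      simp
    rw [mem_closure_iff_nhds] at hpc ⊢
    intro N hN
    obtain ⟨q, ⟨hqN, hqG⟩, hq⟩ := hpc _ (inter_mem hN (isClosed_closure.isOpen_compl.mem_nhds hpG))
    refine ⟨q, hqN, fun h => hq ((dFun_congr ?_).trans h)⟩
    filter_upwards [isClosed_closure.isOpen_compl.mem_nhds hqG] with r hr
    rw [hρ0 r fun h => hr (subset_closure h), add_zero]

end Perturb

/-! ### The modified Hamiltonian on the page -/

section Surface

variable {W : Type u} [TopologicalSpace W] [T2Space W] [CompactSpace W]
  [ChartedSpace (EuclideanHalfSpace 2) W] [IsManifold (𝓡∂ 2) ∞ W] {k : ℕ}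
  {S : LiouvilleSurface W k}

/-- Cut `H` off to `c i` inside the collar, then perturb where the result is locally constant within
the core. The flow preserves `H`, and `ψ` fixes the collar and the interior of `{dH = 0}` pointwise,
so neither change affects invariance. Points off the collar are perturbed only if `H` is locally
constant there, and the outer half collar, being outside the core, keeps the value `c i`. -/
theorem AutonomousHamiltonian.exists_page_function (A : AutonomousHamiltonian S) (c : Fin k → ℝ) :
    ∃ f : W → ℝ, ContMDiff (𝓡∂ 2) 𝓘(ℝ, ℝ) ∞ f ∧ (∀ w, f (A.ψ w) = f w) ∧
      (∀ w, w ∉ S.collarRegion → w ∉ interior {w | dFun (𝓡∂ 2) A.H w = 0} → f w = A.H w) ∧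
      (∀ i x s, -(S.width / 2) ≤ s → s ≤ 0 → f (S.collar i (x, s)) = c i) ∧
      S.core ⊆ closure {w | dFun (𝓡∂ 2) f w ≠ 0} := by
  have hw := S.width_pos
  have hχ : ∀ i, ∃ χ : W → ℝ, ContMDiff (𝓡∂ 2) 𝓘(ℝ, ℝ) ∞ χ ∧
      (∀ w, w ∉ S.collar i '' (univ ×ˢ Icc (-(3 / 4 * S.width)) 0) → χ w = 0) ∧
      ∀ x s, -(S.width / 2) ≤ s → s ≤ 0 → χ (S.collar i (x, s)) = 1 := by
    intro i
    have h1 : IsOpen (S.collar i '' (univ ×ˢ Ioc (-(3 / 4 * S.width)) 0)) :=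
      S.isOpen_collar_image i (by linarith)
    have h2 : IsClosed (S.collar i '' (univ ×ˢ Icc (-(S.width / 2)) 0)) :=
      (S.isCompact_collar_image i (fun s hs => ⟨by linarith [hs.1], hs.2⟩) isCompact_Icc).isClosed
    have h3 : S.collar i '' (univ ×ˢ Icc (-(S.width / 2)) 0) ⊆
        S.collar i '' (univ ×ˢ Ioc (-(3 / 4 * S.width)) 0) :=
      image_mono (prod_mono_right fun s hs => ⟨by linarith [hs.1], hs.2⟩)
    obtain ⟨χ, h0, hχ1, -⟩ := exists_contMDiffMap_zero_one_of_isClosed (𝓡∂ 2) (n := (⊤ : ℕ∞))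
      h1.isClosed_compl h2 (disjoint_left.2 fun w hw hw' => hw (h3 hw'))
    refine ⟨χ, χ.contMDiff, fun w hw' => h0 fun h => hw' ?_, fun x s hs hs0 =>
      hχ1 ⟨(x, s), ⟨mem_univ _, hs, hs0⟩, rfl⟩⟩
    exact image_mono (prod_mono_right Ioc_subset_Icc_self) h
  choose χ hχs hχ0 hχ1 using hχ
  set f₀ : W → ℝ := fun w => A.H w + ∑ i, χ i w * (c i - A.H w) with hf₀
  have hf₀s : ContMDiff (𝓡∂ 2) 𝓘(ℝ, ℝ) ∞ f₀ := by
    refine A.smooth_H.add (ContMDiff.sum fun i _ => (hχs i).mul ?_)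
    exact contMDiff_const.sub A.smooth_H
  set K : Set W := ⋃ i, S.collar i '' (univ ×ˢ Icc (-(3 / 4 * S.width)) 0) with hK
  have hKc : IsClosed K := isClosed_iUnion_of_finite fun i =>
    (S.isCompact_collar_image i (fun s hs => ⟨by linarith [hs.1], hs.2⟩) isCompact_Icc).isClosed
  have hKr : K ⊆ S.collarRegion := by
    rw [S.collarRegion_eq]
    exact iUnion_mono fun i =>
      image_mono (prod_mono_right fun s hs => ⟨by linarith [hs.1], hs.2⟩)
  have hf₀K : ∀ w, w ∉ K → f₀ w = A.H w := by
    intro w hwK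
    simp only [hf₀]
    rw [Finset.sum_eq_zero, add_zero]
    intro i _
    rw [hχ0 i w fun h => hwK (mem_iUnion.2 ⟨i, h⟩), zero_mul]
  have hint : ∀ w, w ∉ S.collarRegion → w ∈ interior {w | dFun (𝓡∂ 2) f₀ w = 0} →
      w ∈ interior {w | dFun (𝓡∂ 2) A.H w = 0} := by
    intro w hwr hwi
    have h1 : ∀ᶠ w' in 𝓝 w, f₀ =ᶠ[𝓝 w'] A.H :=
      eventually_eventuallyEq_nhds.2 (mem_of_superset
        (hKc.isOpen_compl.mem_nhds fun h => hwr (hKr h)) hf₀K)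
    rw [mem_interior_iff_mem_nhds] at hwi ⊢
    filter_upwards [h1, hwi] with w' h2 h3
    exact (dFun_congr (I := 𝓡∂ 2) h2).symm.trans h3
  have hfψ : ∀ w, f₀ (A.ψ w) = f₀ w := by
    intro w
    by_cases hwr : w ∈ S.collarRegion
    · rw [show A.ψ w = w from A.flow_one_collar w hwr]
    · have h1 : A.ψ w ∉ S.collarRegion := fun h =>
        hwr ((A.ψ_mem_iff_of_fixed A.flow_one_collar w).1 h)
      rw [hf₀K _ fun h => hwr (hKr h), hf₀K _ fun h => h1 (hKr h)]
      exact A.H_flow 1 w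
  obtain ⟨ρ, hρ, hρ0, hd⟩ := exists_smooth_perturbation (I := 𝓡∂ 2) hf₀s S.isOpen_core
  have hfix : ∀ w ∈ S.core ∩ interior {w | dFun (𝓡∂ 2) f₀ w = 0}, A.ψ w = w := by
    rintro w ⟨-, hwi⟩
    by_cases hwr : w ∈ S.collarRegion
    · exact A.flow_one_collar w hwr
    · exact A.ψ_of_dH_zero (hint w hwr hwi)
  refine ⟨fun w => f₀ w + ρ w, hf₀s.add hρ, fun w => ?_, fun w h1 h2 => ?_,
    fun i x s h1 h2 => ?_, hd⟩
  · simp only [hfψ]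
    by_cases hwG : w ∈ S.core ∩ interior {w | dFun (𝓡∂ 2) f₀ w = 0}
    · rw [hfix w hwG]
    · rw [hρ0 w hwG, hρ0 _ fun h => hwG ((A.ψ_mem_iff_of_fixed hfix w).1 h)]
  · simp only
    rw [hρ0 w fun h => h2 (hint w h1 h.2), hf₀K w fun h => h1 (hKr h), add_zero]
  · have hs : (x, s) ∈ collarStrip S.width := ⟨by simp only; linarith, h2⟩
    have hcore : S.collar i (x, s) ∉ S.core := fun h =>
      absurd ((S.collar_mem_core_iff i hs).1 h) (not_lt.2 h1)
    simp only
    rw [hρ0 _ fun h => hcore h.1, add_zero]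
    simp only [hf₀]
    rw [Finset.sum_eq_single i, hχ1 i x s h1 h2]
    · ring
    · intro j _ hj
      rw [hχ0 j, zero_mul]
      rintro ⟨⟨y, t⟩, ⟨-, ht⟩, h⟩
      exact hj ((S.collar_eq_iff j i _ ⟨by simp only; linarith [ht.1], ht.2⟩ _ hs).1 h).1
    · simp

end Surface
end

noncomputable section
open Filter Topology

/-! ### Reeb integrals in parametrizations -/

section Integral

variable {V : Type*} [NormedAddCommGroup V] [NormedSpace ℝ V] [FiniteDimensional ℝ V]
  {Y : Type*} [TopologicalSpace Y] [ChartedSpace (EuclideanSpace ℝ (Fin 3)) Y]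

/-- A smooth function which is invariant under the Reeb flow of `α`, and whose differential is
nonzero on a dense subset. -/
structure IsReebIntegral (α : OneForm (𝓡 3) Y) (f : Y → ℝ) : Prop where
  smooth : ContMDiff (𝓡 3) 𝓘(ℝ, ℝ) ∞ f
  invariant : ∀ (y : Y) (v : TangentSpace (𝓡 3) y),
    (∀ w, α.d y v w = 0) → dFun (𝓡 3) f y v = 0
  dense : Dense {y : Y | dFun (𝓡 3) f y ≠ 0}

variable [IsManifold (𝓡 3) ∞ Y]

theorem dFun_eq_zero_iff {f : Y → ℝ} (hf : ContMDiff (𝓡 3) 𝓘(ℝ, ℝ) ∞ f) {Φ : V → Y} {p : V}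
    (h : IsParamAt (𝓡 3) Φ p) : dFun (𝓡 3) f (Φ p) = 0 ↔ fderiv ℝ (f ∘ Φ) p = 0 := by
  have key := dFun_apply_mfderiv ((hf (Φ p)).mdifferentiableAt (by simp)) h.mdiff
  constructor
  · intro h0
    ext v
    exact (key v).symm.trans (DFunLike.congr_fun h0 _)
  · intro h0
    ext v
    obtain ⟨u, rfl⟩ := h.bijective.2 v
    exact (key u).trans (DFunLike.congr_fun h0 u)

theorem reebInvariant_of_param {α : OneForm (𝓡 3) Y} (hα : IsContactForm α) {f : Y → ℝ}
    (hf : ContMDiff (𝓡 3) 𝓘(ℝ, ℝ) ∞ f) {Φ : V → Y} {p : V} (h : IsParamAt (𝓡 3) Φ p)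
    (hR : ∀ u, (∀ w, extD (α.pb Φ) p u w = 0) → fderiv ℝ (f ∘ Φ) p u = 0)
    (v : TangentSpace (𝓡 3) (Φ p)) (hv : ∀ w, α.d (Φ p) v w = 0) : dFun (𝓡 3) f (Φ p) v = 0 := by
  obtain ⟨u, rfl⟩ := h.bijective.2 v
  refine (dFun_apply_mfderiv ((hf (Φ p)).mdifferentiableAt (by simp)) h.mdiff u).trans
    (hR u fun w => ?_)
  exact (OneForm.d_pullback hα.smooth h.smooth u w).symm.trans (hv _)

theorem IsReebIntegral.of_param {α : OneForm (𝓡 3) Y} (hα : IsContactForm α) {f : Y → ℝ}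
    (hf : IsReebIntegral α f) {Φ : V → Y} {p : V} (h : IsParamAt (𝓡 3) Φ p) (u : V)
    (hu : ∀ w, extD (α.pb Φ) p u w = 0) : fderiv ℝ (f ∘ Φ) p u = 0 := by
  rw [← dFun_apply_mfderiv ((hf.smooth (Φ p)).mdifferentiableAt (by simp)) h.mdiff]
  refine hf.invariant _ _ fun w => ?_
  obtain ⟨w, rfl⟩ := h.bijective.2 w
  exact (OneForm.d_pullback hα.smooth h.smooth u w).trans (hu w)

end Integral

/-! ### The Reeb integral of an open book -/

section Surface

variable {W : Type u} [TopologicalSpace W] [T2Space W] [CompactSpace W]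
    [ChartedSpace (EuclideanHalfSpace 2) W] [IsManifold (𝓡∂ 2) ∞ W] {k : ℕ}
    {S : LiouvilleSurface W k} {A : AutonomousHamiltonian S} {D : GirouxData A} {Y : Type u}

namespace OpenBookModel

variable (M : OpenBookModel D Y)

theorem _root_.GirouxData.DeckRel.apply_eq {f : W → ℝ} (hf : ∀ w, f (A.ψ w) = f w) {p q : W × ℝ}
    (h : D.DeckRel p q) : f p.1 = f q.1 := by
  have h1 : ∀ n w, f (A.ψ^[n] w) = f w := by
    intro n w
    induction n with
    | zero => rfl
    | succ n ih => rw [Function.iterate_succ_apply', hf, ih]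
  obtain ⟨n, h | h⟩ := h
  · rw [← h, D.deck_iterate, h1]
  · rw [← h, D.deck_iterate, h1]

/-- One formula serves the whole binding piece: for `r ≥ 1/2` one has `h₂ = a_i` and it reduces to
the page function, for `r ≤ 1/2` the page function is the constant `c i`. -/
theorem exists_extension {f : W → ℝ} (hf : ∀ w, f (A.ψ w) = f w) (c : Fin k → ℝ)
    (hc : ∀ i x s, -(S.width / 2) ≤ s → s ≤ 0 → f (S.collar i (x, s)) = c i) :
    ∃ F : Y → ℝ, (∀ p ∈ S.core ×ˢ (univ : Set ℝ), F (M.page p) = f p.1) ∧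
      ∀ i x, ∀ z : ℂ, ‖z‖ < 1 → F (M.binding i (x, z)) =
        D.h₂ i ‖z‖ - D.slope i + f (S.collar i (x, -(S.width * ‖z‖))) := by
  classical
  set F : Y → ℝ := fun y =>
    if h : ∃ p ∈ S.core ×ˢ (univ : Set ℝ), M.page p = y then f h.choose.1
    else if h : ∃ q : Fin k × ℝ × ℂ, ‖q.2.2‖ < 1 ∧ M.binding q.1 q.2 = y then
      D.h₂ h.choose.1 ‖h.choose.2.2‖ - D.slope h.choose.1 + c h.choose.1
    else 0 with hF
  have h1 : ∀ p ∈ S.core ×ˢ (univ : Set ℝ), F (M.page p) = f p.1 := by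
    intro p hp
    have h : ∃ q ∈ S.core ×ˢ (univ : Set ℝ), M.page q = M.page p := ⟨p, hp, rfl⟩
    simp only [hF, dif_pos h]
    exact ((M.page_eq_iff _ h.choose_spec.1 _ hp).1 h.choose_spec.2).apply_eq hf
  refine ⟨F, h1, fun i x z hz => ?_⟩
  have hw := S.width_pos
  rcases le_or_gt ‖z‖ (1 / 2) with h2 | h2
  · rw [hc i x _ (by nlinarith) (by nlinarith [norm_nonneg z])]
    have h3 : ¬ ∃ p ∈ S.core ×ˢ (univ : Set ℝ), M.page p = M.binding i (x, z) := by
      rintro ⟨p, hp, h⟩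
      exact absurd (M.overlap i x z hz p hp h.symm) (not_lt.2 h2)
    have h : ∃ q : Fin k × ℝ × ℂ, ‖q.2.2‖ < 1 ∧ M.binding q.1 q.2 = M.binding i (x, z) :=
      ⟨(i, x, z), hz, rfl⟩
    simp only [hF, dif_neg h3, dif_pos h]
    obtain ⟨e1, e2, -⟩ := (M.binding_eq_iff _ i _ x _ z h.choose_spec.1 hz).1 h.choose_spec.2
    rw [e2, e1]
  · have h3 := M.glue i x ‖z‖ (Complex.arg z) h2 hz
    rw [Complex.norm_mul_exp_arg_mul_I] at h3
    rw [h3, h1 _ ⟨GirouxData.radius_mem_core i h2 hz, mem_univ _⟩, (D.profile i).tail₂ ‖z‖ ⟨h2.le, hz⟩,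
      GirouxData.slope]
    ring

end OpenBookModel

/-- The norm is not smooth at the origin, but the function is constant for `‖z‖ < 1/2`; elsewhere it
is a composition of smooth maps. -/
theorem exists_contDiffAt_collar {f : W → ℝ} (hf : ContMDiff (𝓡∂ 2) 𝓘(ℝ, ℝ) ∞ f) {c : ℝ} (i : Fin k)
    (hc : ∀ x s, -(S.width / 2) ≤ s → s ≤ 0 → f (S.collar i (x, s)) = c) {p : ℝ × ℂ}
    (hp : ‖p.2‖ < 1) :
    ContDiffAt ℝ ∞ (fun p : ℝ × ℂ => f (S.collar i (p.1, -(S.width * ‖p.2‖)))) p ∧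
      (‖p.2‖ ≤ 1 / 2 →
        fderiv ℝ (fun p : ℝ × ℂ => f (S.collar i (p.1, -(S.width * ‖p.2‖)))) p = 0) := by
  set g : ℝ × ℂ → ℝ := fun p => f (S.collar i (p.1, -(S.width * ‖p.2‖))) with hg
  have hw := S.width_pos
  have h1 : ∀ p : ℝ × ℂ, ‖p.2‖ < 1 / 2 → g =ᶠ[𝓝 p] fun _ => c := by
    intro p hp
    filter_upwards [(continuous_norm.comp continuous_snd).continuousAt.eventually_lt
      continuousAt_const hp] with q hq
    have hq' : ‖q.2‖ < 1 / 2 := hq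
    exact hc _ _ (by nlinarith) (by nlinarith [norm_nonneg q.2])
  have h2 : ContDiffAt ℝ ∞ g p := by
    rcases lt_or_ge ‖p.2‖ (1 / 2) with h | h
    · exact contDiffAt_const.congr_of_eventuallyEq (h1 p h)
    · have h0 : p.2 ≠ 0 := by rw [← norm_pos_iff]; linarith
      rw [← contMDiffAt_iff_contDiffAt]
      have e1 : ContDiffAt ℝ ∞ (fun p : ℝ × ℂ => (p.1, -(S.width * ‖p.2‖))) p :=
        contDiffAt_fst.prodMk (contDiffAt_const.mul (contDiffAt_snd.norm ℝ h0)).neg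
      have e2 : ContMDiffAt 𝓘(ℝ, ℝ × ℝ) (𝓡∂ 2) ∞ (S.collar i) (p.1, -(S.width * ‖p.2‖)) :=
        S.collar_contMDiffAt i (by simp only; nlinarith) (by simp only; nlinarith)
      exact (hf _).comp p (e2.comp p e1.contMDiffAt)
  refine ⟨h2, fun h => ?_⟩
  rcases h.lt_or_eq with h | h
  · rw [(h1 p h).fderiv_eq]
    exact fderiv_const_apply c
  · have h3 : ContinuousAt (fderiv ℝ g) p := (h2.fderiv_right (m := ∞) (by simp)).continuousAt
    -- On the torus `‖z‖ = 1/2` itself the derivative is the limit of derivatives at interior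
    -- points, which are zero.
    have h4 : Tendsto (fun r : ℝ => (p.1, (r : ℂ) * p.2)) (𝓝[<] 1) (𝓝 p) := by
      have : Continuous fun r : ℝ => (p.1, (r : ℂ) * p.2) := by fun_prop
      simpa using (this.tendsto 1).mono_left nhdsWithin_le_nhds
    refine tendsto_nhds_unique (h3.tendsto.comp h4) (tendsto_const_nhds.congr' ?_)
    filter_upwards [Ioo_mem_nhdsLT (show (0 : ℝ) < 1 by norm_num)] with r hr
    have : ‖((r : ℂ) * p.2)‖ < 1 / 2 := by
      rw [norm_mul, Complex.norm_real, Real.norm_of_nonneg hr.1.le, h]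
      linarith [hr.2]
    simp only [Function.comp]
    rw [(h1 (p.1, (r : ℂ) * p.2) this).fderiv_eq]
    exact (fderiv_const_apply c).symm

namespace OpenBookModel

variable {M : OpenBookModel D Y} [TopologicalSpace Y] [ChartedSpace (EuclideanSpace ℝ (Fin 3)) Y]
  [IsManifold (𝓡 3) ∞ Y] {α : OneForm (𝓡 3) Y}

/-- The kernel of the differential of the contact form is spanned by `∂_φ` on the mapping torus,
where `F` depends on the page only; near the binding the kernel is tangent to the tori on which `F`
is constant. Noncritical points are dense over the core by assumption, and in the tube because `(s
Q(s))' > 0` for `s < 1/4`. -/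
theorem IsParametrized.isReebIntegral (h : M.IsParametrized α) (hα : IsContactForm α) {f : W → ℝ}
    (hf : ContMDiff (𝓡∂ 2) 𝓘(ℝ, ℝ) ∞ f) {c : Fin k → ℝ}
    (hc : ∀ i x s, -(S.width / 2) ≤ s → s ≤ 0 → f (S.collar i (x, s)) = c i)
    (hd : S.core ⊆ closure {w | dFun (𝓡∂ 2) f w ≠ 0}) {F : Y → ℝ}
    (hF₁ : ∀ p ∈ S.core ×ˢ (univ : Set ℝ), F (M.page p) = f p.1)
    (hF₂ : ∀ i x, ∀ z : ℂ, ‖z‖ < 1 → F (M.binding i (x, z)) =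
        D.h₂ i ‖z‖ - D.slope i + f (S.collar i (x, -(S.width * ‖z‖)))) :
    IsReebIntegral α F := by
  have hpage : ∀ a, ∀ p ∈ dom S (Sum.inl a : W ⊕ Fin k),
      F ∘ M.param (Sum.inl a) =ᶠ[𝓝 p] fun q => f (surfParam a q.2) := by
    intro a p hp
    filter_upwards [(isOpen_dom _).mem_nhds hp] with q hq
    exact hF₁ _ (mem_core_of_mem_dom hq)
  set K : Fin k → ℝ → ℝ := fun i s => s * D.Q i s with hK
  have hbind : ∀ i, ∀ p ∈ dom S (Sum.inr i : W ⊕ Fin k), F ∘ M.param (Sum.inr i) =ᶠ[𝓝 p]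
      fun q => K i (Complex.normSq q.2) - D.slope i +
        f (S.collar i (q.1, -(S.width * ‖q.2‖))) := by
    intro i p hp
    filter_upwards [(isOpen_dom _).mem_nhds hp] with q hq
    have := hF₂ i q.1 q.2 (norm_lt_of_mem_dom hq)
    rw [D.h₂_norm i (norm_lt_of_mem_dom hq)] at this
    exact this
  have hKd : ∀ i s, HasDerivAt (K i) (D.Q i s + s * deriv (D.Q i) s) s := fun i s =>
    hasDerivAt_mul_self (D.radialProfile i).contDiff_Q s
  have hKs : ∀ i, ContDiff ℝ ∞ (K i) := fun i => contDiff_id.mul (D.radialProfile i).contDiff_Q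
  have hns : ContDiff ℝ ∞ fun p : ℝ × ℂ => Complex.normSq p.2 := contDiff_normSq.comp contDiff_snd
  have hbinds : ∀ i, ∀ p ∈ dom S (Sum.inr i : W ⊕ Fin k),
      ContDiffAt ℝ ∞ (F ∘ M.param (Sum.inr i)) p ∧ (‖p.2‖ ≤ 1 / 2 →
        fderiv ℝ (F ∘ M.param (Sum.inr i)) p =
          (D.Q i (Complex.normSq p.2) + Complex.normSq p.2 * deriv (D.Q i) (Complex.normSq p.2)) •
            (radForm p.2).comp (ContinuousLinearMap.snd ℝ ℝ ℂ)) := by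
    intro i p hp
    obtain ⟨h1, h2⟩ := exists_contDiffAt_collar hf i (hc i) (norm_lt_of_mem_dom hp)
    have h3 : ContDiff ℝ ∞ fun p : ℝ × ℂ => K i (Complex.normSq p.2) - D.slope i :=
      ((hKs i).comp hns).sub contDiff_const
    refine ⟨(h3.contDiffAt.add h1).congr_of_eventuallyEq (hbind i p hp), fun h4 => ?_⟩
    rw [(hbind i p hp).fderiv_eq]
    have h5 := (hasFDerivAt_comp_normSq_snd (P := K i) (p := p)
      (hKd i _).differentiableAt).sub_const (D.slope i)
    have h6 := h5.add (h1.differentiableAt (by simp)).hasFDerivAt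
    rw [h2 h4, add_zero, (hKd i _).deriv] at h6
    exact h6.fderiv
  have hFs : ContMDiff (𝓡 3) 𝓘(ℝ, ℝ) ∞ F := by
    intro y
    obtain ⟨j, p, hp, rfl⟩ := M.exists_param_eq y
    refine (h j p hp).1.contMDiffAt_of_comp ?_
    cases j with
    | inl a =>
      refine ContDiffAt.congr_of_eventuallyEq ?_ (hpage a p hp)
      rw [← contMDiffAt_iff_contDiffAt]
      exact (hf _).comp p (ContMDiffAt.comp p (g := surfParam a) (f := Prod.snd)
        (isParamAt_surfParam hp.2).smooth contDiffAt_snd.contMDiffAt)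
    | inr i => exact (hbinds i p hp).1
  have hpb : ∀ j, ∀ p ∈ dom S j, α.pb (M.param j) =ᶠ[𝓝 p] paramForm D j := by
    intro j p hp
    filter_upwards [(isOpen_dom j).mem_nhds hp] with q hq using (h j q hq).2
  have hpaged : ∀ a, ∀ p ∈ dom S (Sum.inl a : W ⊕ Fin k), ∀ v : ℝ × ℂ,
      fderiv ℝ (F ∘ M.param (Sum.inl a)) p v =
        dFun (𝓡∂ 2) f (surfParam a p.2) (mfderiv 𝓘(ℝ, ℂ) (𝓡∂ 2) (surfParam a) p.2 v.2) := by
    intro a p hp v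
    rw [(hpage a p hp).fderiv_eq, dFun_apply_mfderiv ((hf _).mdifferentiableAt (by simp))
      (isParamAt_surfParam hp.2).mdiff]
    have h1 : DifferentiableAt ℝ (f ∘ surfParam a) p.2 := by
      have : ContMDiffAt 𝓘(ℝ, ℂ) 𝓘(ℝ, ℝ) ∞ (f ∘ surfParam a) p.2 :=
        (hf _).comp p.2 (isParamAt_surfParam hp.2).smooth
      exact this.contDiffAt.differentiableAt (by simp)
    exact DFunLike.congr_fun (HasFDerivAt.comp p (g := f ∘ surfParam a) (f := Prod.snd)
      h1.hasFDerivAt hasFDerivAt_snd).fderiv v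
  refine ⟨hFs, fun y => ?_, fun y => ?_⟩
  -- The tube is used only for `r ≤ 1/2`, where `F` is a function of `r` alone; beyond that radius
  -- the point is treated on the page.
  · have hcase : (∃ a, ∃ p ∈ dom S (Sum.inl a : W ⊕ Fin k), M.param (Sum.inl a) p = y) ∨
        ∃ i, ∃ p ∈ dom S (Sum.inr i : W ⊕ Fin k), ‖p.2‖ ≤ 1 / 2 ∧ M.param (Sum.inr i) p = y := by
      rcases M.exists_page_or_binding y with ⟨p, hp, rfl⟩ | ⟨i, x, z, hz, rfl⟩
      · refine Or.inl ⟨p.1, (p.2, surfCoord p.1 p.1),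
          ⟨mem_univ _, surfCoord_self_mem_surfDom hp.1⟩, ?_⟩
        simp only [param, surfParam_surfCoord (mem_extChartAt_source (I := 𝓡∂ 2) p.1)]
      · exact Or.inr ⟨i, (x, z), ⟨mem_univ _, mem_ball_zero_iff.2 (by linarith)⟩, hz, rfl⟩
    rcases hcase with ⟨a, p, hp, rfl⟩ | ⟨i, p, hp, hz, rfl⟩
    · refine reebInvariant_of_param hα hFs (h _ p hp).1 fun u hu => ?_
      rw [extD_congr (hpb _ p hp)] at hu
      have hu2 : u.2 = 0 := snd_eq_zero_of_extD_pageForm (isParamAt_surfParam hp.2) fun w => hu _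
      rw [hpaged a p hp, hu2]
      exact (congrArg (dFun (𝓡∂ 2) f (surfParam a p.2)) (map_zero _)).trans (map_zero _)
    · refine reebInvariant_of_param hα hFs (h _ p hp).1 fun u hu => ?_
      rw [extD_congr (hpb _ p hp)] at hu
      rw [(hbinds i p hp).2 hz]
      exact radForm_eq_zero_of_extD_rotForm
        ((D.radialProfile i).contDiff_P.differentiable (by simp) _)
        ((D.radialProfile i).contDiff_Q.differentiable (by simp) _) hu
  · rw [mem_closure_iff_nhds]
    intro N hN
    rcases M.exists_page_or_binding y with ⟨p, hp, rfl⟩ | ⟨i, x, z, hz, rfl⟩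
    · have h1 : ContinuousAt (fun w => M.page (w, p.2)) p.1 :=
        ContinuousAt.comp (x := p.1) (g := M.page) (f := fun w => (w, p.2))
          (h.contMDiffAt_page hp).continuousAt (continuous_id.prodMk continuous_const).continuousAt
      obtain ⟨w, ⟨hwN, hwc⟩, hw⟩ := mem_closure_iff_nhds.1 (hd hp.1) _
        (inter_mem (h1.preimage_mem_nhds hN) (S.isOpen_core.mem_nhds hp.1))
      refine ⟨M.page (w, p.2), hwN, fun h0 => hw ?_⟩
      have hq : (p.2, surfCoord w w) ∈ dom S (Sum.inl w : W ⊕ Fin k) :=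
        ⟨mem_univ _, surfCoord_self_mem_surfDom hwc⟩
      have hcw : surfParam w (surfCoord w w) = w :=
        surfParam_surfCoord (mem_extChartAt_source (I := 𝓡∂ 2) w)
      have e : M.param (Sum.inl w) (p.2, surfCoord w w) = M.page (w, p.2) := by
        simp only [param, hcw]
      rw [← e] at h0
      have h2 := (dFun_eq_zero_iff hFs (h _ _ hq).1).1 h0
      have h3 : dFun (𝓡∂ 2) f (surfParam w (surfCoord w w)) = 0 := by
        ext v
        obtain ⟨u, rfl⟩ := (isParamAt_surfParam hq.2).bijective.2 v
        exact (hpaged w _ hq ((0, u) : ℝ × ℂ)).symm.trans (DFunLike.congr_fun h2 _)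
      rwa [hcw] at h3
    · have hp : ((x, z) : ℝ × ℂ) ∈ dom S (Sum.inr i : W ⊕ Fin k) :=
        ⟨mem_univ _, mem_ball_zero_iff.2 (by linarith)⟩
      have h1 : ContinuousAt (M.param (Sum.inr i)) ((x, z) : ℝ × ℂ) :=
        (h _ _ hp).1.smooth.continuousAt
      have h2 : ContinuousAt (fun z' : ℂ => M.param (Sum.inr i) (x, z')) z :=
        ContinuousAt.comp (x := z) (g := M.param (Sum.inr i)) (f := fun z' : ℂ => (x, z')) h1
          (continuous_const.prodMk continuous_id).continuousAt
      -- The core circle and the torus `r = 1/2` are critical or may be, so `z` is approximated by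
      -- points with `0 < ‖z'‖ < 1/2`, where the radial derivative is nonzero.
      have h3 : z ∈ closure (Metric.ball (0 : ℂ) (1 / 2) ∩ {0}ᶜ) := by
        have h4 : closure (Metric.ball (0 : ℂ) (1 / 2)) ⊆
            closure (Metric.ball (0 : ℂ) (1 / 2) ∩ {0}ᶜ) :=
          closure_minimal ((dense_compl_singleton (0 : ℂ)).open_subset_closure_inter
            Metric.isOpen_ball) isClosed_closure
        refine h4 ?_
        rw [closure_ball _ (by norm_num)]
        exact mem_closedBall_zero_iff.2 hz
      obtain ⟨z', hz'N, hz'b, hz'0⟩ := mem_closure_iff_nhds.1 h3 _ (h2.preimage_mem_nhds hN)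
      have hz'0 : z' ≠ 0 := hz'0
      have hz'b : ‖z'‖ < 1 / 2 := mem_ball_zero_iff.1 hz'b
      have hp' : ((x, z') : ℝ × ℂ) ∈ dom S (Sum.inr i : W ⊕ Fin k) :=
        ⟨mem_univ _, mem_ball_zero_iff.2 (by linarith)⟩
      refine ⟨_, hz'N, fun h0 => ?_⟩
      have h5 := (dFun_eq_zero_iff hFs (h _ _ hp').1).1 h0
      rw [(hbinds i _ hp').2 hz'b.le] at h5
      have h6 := DFunLike.congr_fun h5 ((0, z') : ℝ × ℂ)
      have hs : Complex.normSq z' = z'.re * z'.re + z'.im * z'.im := Complex.normSq_apply z'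
      have hs0 : 0 < Complex.normSq z' := Complex.normSq_pos.2 hz'0
      have hs1 : Complex.normSq z' < 1 / 4 := by
        rw [Complex.normSq_eq_norm_sq]; nlinarith [norm_nonneg z']
      have h7 := (D.radialProfile i).deriv_K_pos (Complex.normSq z') hs0.le hs1
      have h8 : (D.Q i (Complex.normSq z') +
          Complex.normSq z' * deriv (D.Q i) (Complex.normSq z')) * radForm z' z' = 0 := h6
      rw [radForm_apply] at h8
      rcases mul_eq_zero.1 h8 with h9 | h9
      · exact h7.ne' h9
      · linarith

end OpenBookModel

end Surface
end

noncomputable section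
open Filter Topology

/-! ### Arbitrary open books; integrability of their symplectizations -/

section Surface

variable {W : Type u} [TopologicalSpace W] [T2Space W] [CompactSpace W]
    [ChartedSpace (EuclideanHalfSpace 2) W] [IsManifold (𝓡∂ 2) ∞ W] {k : ℕ}
    {S : LiouvilleSurface W k} {A : AutonomousHamiltonian S} {D : GirouxData A}
    {Y : Type u} [TopologicalSpace Y] [ChartedSpace (EuclideanSpace ℝ (Fin 3)) Y]

namespace OpenBook

/-- The underlying set of an open book. -/
def toModel (O : OpenBook D Y) : OpenBookModel D Y where
  page := O.page
  page_eq_iff := O.page_eq_iff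
  binding := O.binding
  binding_eq_iff := O.binding_eq_iff
  cover := O.cover
  glue := O.glue
  overlap := O.overlap

variable [IsManifold (𝓡 3) ∞ Y] (O : OpenBook D Y)

theorem contMDiffAt_page {p : W × ℝ} (hp : p ∈ S.core ×ˢ (univ : Set ℝ)) :
    ContMDiffAt ((𝓡∂ 2).prod 𝓘(ℝ, ℝ)) (𝓡 3) ∞ O.page p :=
  O.page_smooth.contMDiffAt ((S.isOpen_core.prod isOpen_univ).mem_nhds hp)

theorem contMDiffAt_binding (i : Fin k) {p : ℝ × ℂ} (hp : ‖p.2‖ < 1) :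
    ContMDiffAt 𝓘(ℝ, ℝ × ℂ) (𝓡 3) ∞ (O.binding i) p :=
  (O.binding_smooth i).contMDiffAt ((isOpen_univ.prod Metric.isOpen_ball).mem_nhds
    ⟨mem_univ _, mem_ball_zero_iff.2 hp⟩)

theorem isParamAt_of_pb {Φ : ℝ × ℂ → Y} {p : ℝ × ℂ} (h : ContMDiffAt 𝓘(ℝ, ℝ × ℂ) (𝓡 3) ∞ Φ p)
    {β : ℝ × ℂ → ℝ × ℂ →L[ℝ] ℝ} (hpb : O.form.pb Φ =ᶠ[𝓝 p] β) (hβ : ContactAt β p) :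
    IsParamAt (𝓡 3) Φ p :=
  isParamAt_of_injective spaceEquiv.toLinearEquiv.finrank_eq h
    (injective_mfderiv_of_contactAt O.contact.smooth h (hβ.congr hpb.symm))

theorem pb_page {a : W} {q : ℝ × ℂ}
    (hq : q ∈ OpenBookModel.dom S (Sum.inl a : W ⊕ Fin k)) :
    O.form.pb (O.toModel.param (Sum.inl a)) q = pageForm S (surfParam a) q := by
  have hθ := OpenBookModel.hasMFDerivAt_pageParam (isParamAt_surfParam hq.2).mdiff
  have hpage : MDifferentiableAt ((𝓡∂ 2).prod 𝓘(ℝ, ℝ)) (𝓡 3) O.page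
      (surfParam a q.2, q.1) :=
    (O.contMDiffAt_page (OpenBookModel.mem_core_of_mem_dom hq)).mdifferentiableAt (by simp)
  have h1 := (HasMFDerivAt.comp q (g := O.page) hpage.hasMFDerivAt hθ).mfderiv
  refine ContinuousLinearMap.ext fun v => ?_
  rw [pageForm_apply]
  have h4 := DFunLike.congr_fun h1 v
  exact (congrArg (O.form (O.page (surfParam a q.2, q.1))) h4).trans
    (O.page_pullback _ (OpenBookModel.mem_core_of_mem_dom hq) _)

theorem pb_binding (i : Fin k) {p : ℝ × ℂ} (hp : ‖p.2‖ < 1) :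
    O.form.pb (O.binding i) p = D.bindingForm i p := by
  refine ContinuousLinearMap.ext fun v => ?_
  rw [D.bindingForm_apply i hp v]
  exact O.binding_pullback i p.1 p.2 hp v

/-- For any open book the pullback formulas give contact forms, so `page` and `binding` are
automatically local diffeomorphisms in charts. Thus every result about the model applies to it. -/
theorem isParametrized : O.toModel.IsParametrized O.form := by
  have hpb : ∀ j, ∀ p ∈ OpenBookModel.dom S j,
      O.form.pb (O.toModel.param j) p = OpenBookModel.paramForm D j p := by
    intro j p hp
    cases j with
    | inl a => exact O.pb_page hp
    | inr i => exact O.pb_binding i (OpenBookModel.norm_lt_of_mem_dom hp)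
  intro j p hp
  refine ⟨O.isParamAt_of_pb ?_ (mem_of_superset ((OpenBookModel.isOpen_dom j).mem_nhds hp) (hpb j))
    (OpenBookModel.contactAt_paramForm j p hp), hpb j p hp⟩
  cases j with
  | inl a =>
    have h2 : ContMDiffAt 𝓘(ℝ, ℝ × ℂ) ((𝓡∂ 2).prod 𝓘(ℝ, ℝ)) ∞
        (fun q : ℝ × ℂ => (surfParam a q.2, q.1)) p :=
      (ContMDiffAt.comp p (g := surfParam a) (f := Prod.snd) (isParamAt_surfParam hp.2).smooth
        contDiffAt_snd.contMDiffAt).prodMk contDiffAt_fst.contMDiffAt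
    exact ContMDiffAt.comp p (g := O.page)
      (O.contMDiffAt_page (OpenBookModel.mem_core_of_mem_dom hp)) h2
  | inr i => exact O.contMDiffAt_binding i (OpenBookModel.norm_lt_of_mem_dom hp)

theorem isParamAt_binding (i : Fin k) {p : ℝ × ℂ} (hp : ‖p.2‖ < 1) :
    IsParamAt (𝓡 3) (O.binding i) p :=
  (O.isParametrized (Sum.inr i) p ⟨mem_univ _, mem_ball_zero_iff.2 hp⟩).1

theorem compactSpace (O : OpenBook D Y) : CompactSpace Y := O.isParametrized.compactSpace

/-- The constants stay free: the boundary values of `H` give the extension formula, while `c i =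
slope i` makes the integral equal to `h₂` near one binding circle, as the connected sum requires. -/
theorem exists_isReebIntegral (c : Fin k → ℝ) : ∃ f : Y → ℝ, IsReebIntegral O.form f ∧
    (∀ φ : ℝ, ∀ w, w ∉ S.collarRegion → w ∉ interior {w | dFun (𝓡∂ 2) A.H w = 0} →
      f (O.page (w, φ)) = A.H w) ∧
    ∀ i x, ∀ z : ℂ, ‖z‖ ≤ 1 / 2 → f (O.binding i (x, z)) = D.h₂ i ‖z‖ - D.slope i + c i := by
  obtain ⟨f, h1, h2, h3, h4, h5⟩ := A.exists_page_function c
  obtain ⟨F, hF1, hF2⟩ := O.toModel.exists_extension h2 c h4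
  refine ⟨F, O.isParametrized.isReebIntegral O.contact h1 h4 h5 hF1 hF2, fun φ w hw hw' => ?_,
    fun i x z hz => ?_⟩
  · exact (hF1 (w, φ) ⟨S.mem_core_of_notMem_collarRegion hw, mem_univ _⟩).trans (h3 w hw hw')
  · have hw := S.width_pos
    refine (hF2 i x z (by linarith)).trans ?_
    rw [h4 i x _ (by nlinarith) (by nlinarith [norm_nonneg z])]

theorem exists_isCompletelyIntegrable : ∃ F : ℝ × Y → ℝ,
    IsCompletelyIntegrable (symplectizationForm O.form) ![Prod.fst, F] ∧
      O.ExtendsHamiltonian univ id F := by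
  obtain ⟨f, h1, h2, h3⟩ := O.exists_isReebIntegral fun i => A.H (S.collar i (0, 0))
  refine ⟨fun p => f p.2, isCompletelyIntegrable_of_reebInvariant O.contact h1.smooth h1.invariant
    h1.dense, fun t φ w hw hw' => h2 φ w hw hw', fun i _ _ t x z hz => ?_⟩
  simp only [id, h3 i x z hz]
  ring

end OpenBook

end Surface
end

/-! ### Rotationally symmetric Darboux balls at the binding -/

noncomputable section
open Filter Topology

/-- A local inverse `r` of the function `s Q(s) / P(s)` near the origin. -/
structure IsRadialInverse (P Q r : ℝ → ℝ) (η : ℝ) : Prop where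
  contDiffAt : ∀ y, |y| < η → ContDiffAt ℝ ∞ r y
  eq : ∀ y, |y| < η → r y * Q (r y) = y * P (r y)
  lt : ∀ y, |y| < η → r y < 1 / 4
  Q_pos : ∀ y, |y| < η → 0 < Q (r y)
  P_gt : ∀ y, |y| < η → 1 / 2 < P (r y)
  P_lt : ∀ y, |y| < η → P (r y) < 2
  deriv_pos : ∀ y, |y| < η → 0 < P (r y) + y * deriv (fun y => P (r y)) y

theorem ContDiffAt.continuousAt_deriv {q : ℝ → ℝ} {x : ℝ} (h : ContDiffAt ℝ ∞ q x) :
    ContinuousAt (deriv q) x :=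
  ((h.fderiv_right (m := ∞) (by simp)).continuousAt).clm_apply
    (continuousAt_const (y := (1 : ℝ)))

/-- `s Q(s) / P(s)` has value `0` and derivative `1` at zero, so it is locally invertible. All the
inequalities are open conditions that hold at zero, where `P = Q = 1`. -/
theorem IsRadialProfile.exists_isRadialInverse {ε a : ℝ} {h₁ h₂ P Q : ℝ → ℝ}
    (h : IsRadialProfile ε a h₁ h₂ P Q) : ∃ r η, 0 < η ∧ IsRadialInverse P Q r η := by
  set q : ℝ → ℝ := fun s => s * (Q s / P s) with hq
  have hP0 : ∀ᶠ s in 𝓝 (0 : ℝ), P s ≠ 0 :=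
    h.contDiff_P.continuous.continuousAt.eventually_ne (by rw [h.P_zero]; norm_num)
  have hqs : ∀ᶠ s in 𝓝 (0 : ℝ), ContDiffAt ℝ ∞ q s := hP0.mono fun s hs =>
    contDiffAt_id.mul (h.contDiff_Q.contDiffAt.div h.contDiff_P.contDiffAt hs)
  have hq0 : ContDiffAt ℝ ∞ q 0 := hqs.self_of_nhds
  have hq1 : HasDerivAt q 1 0 := by
    have h1 : DifferentiableAt ℝ (fun s => Q s / P s) 0 :=
      (h.contDiff_Q.contDiffAt.div h.contDiff_P.contDiffAt hP0.self_of_nhds).differentiableAt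
        (by simp)
    have h2 := (hasDerivAt_id (0 : ℝ)).mul h1.hasDerivAt
    simp only [id, zero_mul, add_zero, one_mul, h.P_zero, h.Q_zero, div_one] at h2
    exact h2
  have hqd : ∀ᶠ s in 𝓝 (0 : ℝ), deriv q s ≠ 0 := by
    refine hq0.continuousAt_deriv.eventually_ne ?_
    rw [hq1.deriv]
    norm_num
  have hbij : ∀ s, deriv q s ≠ 0 → Function.Bijective (fderiv ℝ q s) := by
    intro s hs
    have h1 : ∀ v, fderiv ℝ q s v = deriv q s * v := by
      intro v
      change _ = fderiv ℝ q s 1 * v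
      rw [mul_comm, ← smul_eq_mul, ← map_smul, smul_eq_mul, mul_one]
    refine ⟨fun v w hvw => ?_, fun w => ⟨(deriv q s)⁻¹ * w, ?_⟩⟩
    · rw [h1, h1] at hvw
      exact mul_left_cancel₀ hs hvw
    · rw [h1, mul_inv_cancel_left₀ hs]
  obtain ⟨r, hr, hr0, hr1, -⟩ := exists_contDiffAt_localInverse hq0 (hbij 0 hqd.self_of_nhds)
  have hq00 : q 0 = 0 := by simp [hq]
  rw [hq00] at hr hr0 hr1
  have hrc : ∀ {p : ℝ → Prop}, (∀ᶠ s in 𝓝 0, p s) → ∀ᶠ y in 𝓝 0, p (r y) := fun hp =>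
    hr.continuousAt.eventually (by rwa [hr0])
  -- The inverse function theorem gives smoothness at `0` only; at nearby `y` the local inverse
  -- based at `r y` is smooth and coincides with `r`.
  have hrs : ∀ᶠ y in 𝓝 (0 : ℝ), ContDiffAt ℝ ∞ r y := by
    filter_upwards [hrc hqs, hrc hqd, hr1.eventually_nhds, eventually_differentiableAt hr]
      with y h1 h2 h3 h4
    obtain ⟨r', k1, -, -, k4⟩ := exists_contDiffAt_localInverse h1 (hbij _ h2)
    rw [h3.self_of_nhds] at k1
    refine k1.congr_of_eventuallyEq ?_
    filter_upwards [h3, h4.continuousAt.eventually k4] with y' h5 h6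
    rw [← h6, h5]
  have hPr : ContDiffAt ℝ ∞ (fun y => P (r y)) 0 := h.contDiff_P.contDiffAt.comp 0 hr
  have hd : ∀ᶠ y in 𝓝 (0 : ℝ), 0 < P (r y) + y * deriv (fun y => P (r y)) y := by
    have h1 : ContinuousAt (fun y => P (r y) + y * deriv (fun y => P (r y)) y) 0 :=
      hPr.continuousAt.add (continuousAt_id.mul hPr.continuousAt_deriv)
    refine h1.eventually_const_lt ?_
    simp only [hr0, h.P_zero]
    norm_num
  have hQ0 : ∀ᶠ s in 𝓝 (0 : ℝ), 0 < Q s :=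
    h.contDiff_Q.continuous.continuousAt.eventually_const_lt (by rw [h.Q_zero]; norm_num)
  have hP1 : ∀ᶠ s in 𝓝 (0 : ℝ), 1 / 2 < P s :=
    h.contDiff_P.continuous.continuousAt.eventually_const_lt (by rw [h.P_zero]; norm_num)
  have hP2 : ∀ᶠ s in 𝓝 (0 : ℝ), P s < 2 :=
    h.contDiff_P.continuous.continuousAt.eventually_lt_const (by rw [h.P_zero]; norm_num)
  have hs4 : ∀ᶠ s in 𝓝 (0 : ℝ), s < 1 / 4 := eventually_lt_nhds (by norm_num)
  obtain ⟨η, hη, hall⟩ := Metric.eventually_nhds_iff.1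
    (hrs.and (hr1.and ((hrc hs4).and ((hrc hQ0).and ((hrc hP1).and ((hrc hP2).and
      (hd.and (hrc hP0))))))))
  have hall' : ∀ y, |y| < η → _ := fun y hy => hall (y := y) (by simpa [Real.dist_eq] using hy)
  refine ⟨r, η, hη, fun y hy => (hall' y hy).1, fun y hy => ?_, fun y hy => (hall' y hy).2.2.1,
    fun y hy => (hall' y hy).2.2.2.1, fun y hy => (hall' y hy).2.2.2.2.1,
    fun y hy => (hall' y hy).2.2.2.2.2.1, fun y hy => (hall' y hy).2.2.2.2.2.2.1⟩
  have h1 := (hall' y hy).2.1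
  have h2 := (hall' y hy).2.2.2.2.2.2.2
  simp only [hq] at h1
  field_simp at h1
  linarith

/-- The standard contact form `dt + r² dφ`. -/
def stdForm : ℝ × ℂ → ℝ × ℂ →L[ℝ] ℝ := rotForm (fun _ => 1) fun _ => 1

theorem stdForm_apply (p v : ℝ × ℂ) : stdForm p v = standardContactForm p v := by
  rw [stdForm, rotForm_apply, standardContactForm, angForm_eq, one_mul, one_mul]

theorem contDiff_stdForm : ContDiff ℝ ∞ stdForm := contDiff_rotForm contDiff_const contDiff_const

theorem gaugePow_eq (p : ℝ × ℂ) : gaugePow p = Complex.normSq p.2 ^ 2 + 4 * p.1 ^ 2 := by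
  rw [gaugePow, Complex.normSq_eq_norm_sq]
  ring

theorem contDiff_gaugePow : ContDiff ℝ ∞ gaugePow := by
  have h : ContDiff ℝ ∞ fun p : ℝ × ℂ => Complex.normSq p.2 ^ 2 + 4 * p.1 ^ 2 :=
    ((contDiff_normSq.comp contDiff_snd).pow 2).add (contDiff_const.mul (contDiff_fst.pow 2))
  exact (funext gaugePow_eq : gaugePow = _) ▸ h

theorem isOpen_standardBall (R : ℝ) : IsOpen (standardBall R) :=
  isOpen_lt contDiff_gaugePow.continuous continuous_const

theorem normSq_lt_two {p : ℝ × ℂ} (hp : p ∈ standardBall 2) : |Complex.normSq p.2| < 2 := by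
  have h : gaugePow p < 2 := hp
  rw [gaugePow_eq] at h
  rw [abs_of_nonneg (Complex.normSq_nonneg _)]
  nlinarith [sq_nonneg p.1, Complex.normSq_nonneg p.2]

theorem abs_fst_lt_one {p : ℝ × ℂ} (hp : p ∈ standardBall 2) : |p.1| < 1 := by
  have h : gaugePow p < 2 := hp
  rw [gaugePow_eq] at h
  exact abs_lt_of_sq_lt_sq (by nlinarith [sq_nonneg (Complex.normSq p.2)]) zero_le_one

/-- A Darboux ball on which the function `f` is the value of `α` on the rotation field. -/
structure IsReebBall {Y : Type*} [TopologicalSpace Y] [ChartedSpace (EuclideanSpace ℝ (Fin 3)) Y]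
    (α : OneForm (𝓡 3) Y) (f : Y → ℝ) (e : ℝ × ℂ → Y) (c : ℝ → ℝ) : Prop where
  smooth : ∀ p ∈ standardBall 2, ContMDiffAt 𝓘(ℝ, ℝ × ℂ) (𝓡 3) ∞ e p
  injOn : InjOn e (standardBall 2)
  contDiffAt : ∀ σ, |σ| < 2 → ContDiffAt ℝ ∞ c σ
  pos : ∀ σ, |σ| < 2 → 0 < c σ
  deriv_pos : ∀ σ, |σ| < 2 → 0 < c σ + σ * deriv c σ
  pb : ∀ p ∈ standardBall 2, α.pb e p = c (Complex.normSq p.2) • stdForm p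
  apply : ∀ p ∈ standardBall 2, f (e p) = c (Complex.normSq p.2) * Complex.normSq p.2

section Twist

variable {P Q r : ℝ → ℝ} {η δ : ℝ}

/-- The coordinates of a Darboux ball in a solid torus with a rotationally invariant contact
form. -/
def twist (P Q r : ℝ → ℝ) (x δ : ℝ) (p : ℝ × ℂ) : ℝ × ℂ :=
  (x + δ ^ 2 * p.1, (δ * √(P (r (δ ^ 2 * Complex.normSq p.2)) / Q (r (δ ^ 2 * Complex.normSq p.2)))) •
    p.2)

theorem normSq_twist (h : IsRadialInverse P Q r η) (x : ℝ) {p : ℝ × ℂ}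
    (hp : |δ ^ 2 * Complex.normSq p.2| < η) :
    Complex.normSq (twist P Q r x δ p).2 = r (δ ^ 2 * Complex.normSq p.2) := by
  have h1 := h.Q_pos _ hp
  have h2 := h.P_gt _ hp
  have h3 := h.eq _ hp
  rw [twist, Complex.real_smul, Complex.normSq_mul, Complex.normSq_ofReal, ← sq, mul_pow,
    Real.sq_sqrt (div_nonneg (by linarith) h1.le)]
  field_simp
  linarith

/-- With `y = δ²|ζ|²` and `s = r(y)` the relation `s Q(s) = y P(s)` turns `P dx + sQ dφ` into `P (dx
+ y dφ) = δ² P (dt + |ζ|² dφ)`. The scaling factor of `ζ` is the one that makes the squared radius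
in the torus equal to `s`. -/
theorem hasFDerivAt_twist (hP : ContDiff ℝ ∞ P) (hQ : ContDiff ℝ ∞ Q)
    (h : IsRadialInverse P Q r η) (x : ℝ) {p : ℝ × ℂ} (hp : |δ ^ 2 * Complex.normSq p.2| < η) :
    ContDiffAt ℝ ∞ (twist P Q r x δ) p ∧
    (rotForm P Q (twist P Q r x δ p)).comp (fderiv ℝ (twist P Q r x δ) p) =
      (δ ^ 2 * P (r (δ ^ 2 * Complex.normSq p.2))) • stdForm p := by
  set s := r (δ ^ 2 * Complex.normSq p.2) with hs
  have h1 := h.Q_pos _ hp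
  have h2 := h.P_gt _ hp
  set g : ℝ → ℝ := fun σ => δ * √(P (r (δ ^ 2 * σ)) / Q (r (δ ^ 2 * σ))) with hg
  have hr : ContDiffAt ℝ ∞ (fun σ => r (δ ^ 2 * σ)) (Complex.normSq p.2) :=
    ContDiffAt.comp (Complex.normSq p.2) (g := r) (h.contDiffAt _ hp)
      (contDiffAt_const.mul contDiffAt_id)
  have hgs : ContDiffAt ℝ ∞ g (Complex.normSq p.2) := by
    refine contDiffAt_const.mul (ContDiffAt.sqrt ?_ ?_)
    · exact (hP.contDiffAt.comp _ hr).div (hQ.contDiffAt.comp _ hr) h1.ne'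
    · exact (div_pos (by linarith) h1).ne'
  have hn : ContDiff ℝ ∞ fun p : ℝ × ℂ => Complex.normSq p.2 := contDiff_normSq.comp contDiff_snd
  have hG : ContDiffAt ℝ ∞ (fun p : ℝ × ℂ => g (Complex.normSq p.2)) p :=
    ContDiffAt.comp p (g := g) hgs hn.contDiffAt
  have e1 : HasFDerivAt (fun p : ℝ × ℂ => g (Complex.normSq p.2) • p.2) _ p :=
    (hG.differentiableAt (by simp)).hasFDerivAt.smul hasFDerivAt_snd
  have e2 : HasFDerivAt (fun p : ℝ × ℂ => x + δ ^ 2 * p.1)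
      (δ ^ 2 • ContinuousLinearMap.fst ℝ ℝ ℂ) p :=
    (hasFDerivAt_fst.const_mul (δ ^ 2)).const_add x
  have e3 : HasFDerivAt (twist P Q r x δ) _ p := e2.prodMk e1
  refine ⟨(contDiffAt_const.add (contDiffAt_const.mul contDiffAt_fst)).prodMk
    (hG.smul contDiffAt_snd), ContinuousLinearMap.ext fun v => ?_⟩
  have hg2 : g (Complex.normSq p.2) ^ 2 * Q s = δ ^ 2 * P s := by
    change 0 < Q s at h1
    change 1 / 2 < P s at h2
    simp only [hg, mul_pow]
    rw [← hs, Real.sq_sqrt (div_nonneg (by linarith) h1.le)]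
    field_simp
  have hnt := normSq_twist (δ := δ) h x hp
  rw [e3.fderiv, ContinuousLinearMap.comp_apply, rotForm_apply, hnt, ← hs]
  have ha : angForm (twist P Q r x δ p).2 =
      g (Complex.normSq p.2) • angForm p.2 := by
    ext w <;> simp [twist, angForm_apply, hg, mul_assoc] <;> ring
  rw [ha]
  simp only [ContinuousLinearMap.prod_apply, add_apply, smul_apply,
    ContinuousLinearMap.smulRight_apply, ContinuousLinearMap.coe_fst', ContinuousLinearMap.coe_snd',
    map_add, map_smul, smul_eq_mul]
  have h0 : angForm p.2 p.2 = 0 := by rw [angForm_apply]; ring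
  rw [h0, stdForm, rotForm_apply]
  linear_combination (angForm p.2 v.2) * hg2

end Twist

section Surface

variable {W : Type u} [TopologicalSpace W] [T2Space W] [CompactSpace W]
    [ChartedSpace (EuclideanHalfSpace 2) W] [IsManifold (𝓡∂ 2) ∞ W] {k : ℕ}
    {S : LiouvilleSurface W k} {A : AutonomousHamiltonian S} {D : GirouxData A}
    {Y : Type u} [TopologicalSpace Y] [ChartedSpace (EuclideanSpace ℝ (Fin 3)) Y]
    [IsManifold (𝓡 3) ∞ Y]

/-- The ball is `binding i ∘ twist` with conformal factor `c(σ) = δ² P(r(δ²σ))`; then `h₂ = sQ(s) =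
δ²σ P(s) = c(σ) σ`. The bounds on `c` in terms of `δ` are for making one ball much smaller than the
other. -/
theorem OpenBook.exists_isReebBall (O : OpenBook D Y) (i : Fin k) (x : ℝ) {f : Y → ℝ}
    (hf : ∀ x, ∀ z : ℂ, ‖z‖ ≤ 1 / 2 → f (O.binding i (x, z)) = D.h₂ i ‖z‖) :
    ∃ δ₀ : ℝ, 0 < δ₀ ∧ ∀ δ : ℝ, 0 < δ → δ < δ₀ → ∃ e c, IsReebBall O.form f e c ∧
      e 0 = O.binding i (x, 0) ∧ e '' standardBall 2 ⊆ O.bindingRegion i ∧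
      ∀ σ, |σ| < 2 → δ ^ 2 / 2 < c σ ∧ c σ < 2 * δ ^ 2 := by
  have hp := D.radialProfile i
  obtain ⟨r, η, hη, hr⟩ := hp.exists_isRadialInverse
  have hL := S.len_pos i
  -- In the standard ball `|ζ|² < 2` and `|t| < 1`. So `2δ² < η` keeps `δ²|ζ|²` in the domain of
  -- `r`, and `2δ² < len` prevents the ball from wrapping around the circle.
  refine ⟨min 1 (min η (S.len i) / 2), by positivity, fun δ hδ hδ0 => ?_⟩
  have hδ1 : δ < 1 := hδ0.trans_le (min_le_left _ _)
  have hδ2 : δ < min η (S.len i) / 2 := hδ0.trans_le (min_le_right _ _)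
  have hδη : 2 * δ ^ 2 < η := by nlinarith [min_le_left η (S.len i)]
  have hδL : 2 * δ ^ 2 < S.len i := by nlinarith [min_le_right η (S.len i)]
  have hσ : ∀ σ, |σ| < 2 → |δ ^ 2 * σ| < η := by
    intro σ h
    rw [abs_mul, abs_of_nonneg (sq_nonneg δ)]
    nlinarith [sq_nonneg δ]
  set T := twist (D.P i) (D.Q i) r x δ with hT
  set c : ℝ → ℝ := fun σ => δ ^ 2 * D.P i (r (δ ^ 2 * σ)) with hc
  have hTn : ∀ p ∈ standardBall 2, Complex.normSq (T p).2 = r (δ ^ 2 * Complex.normSq p.2) :=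
    fun p hp => normSq_twist hr x (hσ _ (normSq_lt_two hp))
  have hTlt : ∀ p ∈ standardBall 2, ‖(T p).2‖ < 1 / 2 := by
    intro p hp
    have h1 := hr.lt _ (hσ _ (normSq_lt_two hp))
    rw [← hTn p hp, Complex.normSq_eq_norm_sq] at h1
    nlinarith [norm_nonneg (T p).2]
  have hTd : ∀ p ∈ standardBall 2, ContDiffAt ℝ ∞ T p ∧ (D.bindingForm i (T p)).comp (fderiv ℝ T p) =
      c (Complex.normSq p.2) • stdForm p := fun p hp' =>
    hasFDerivAt_twist hp.contDiff_P hp.contDiff_Q hr x (hσ _ (normSq_lt_two hp'))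
  have hPc : ∀ y, |y| < η → ContDiffAt ℝ ∞ (fun y => D.P i (r y)) y := fun y hy =>
    hp.contDiff_P.contDiffAt.comp y (hr.contDiffAt y hy)
  refine ⟨O.binding i ∘ T, c, ⟨fun p hp' => ?_, ?_, fun σ h => ?_, fun σ h => ?_, fun σ h => ?_,
    fun p hp' => ?_, fun p hp' => ?_⟩, ?_, ?_, fun σ h => ?_⟩
  · exact (O.contMDiffAt_binding i (by linarith [hTlt p hp'])).comp p (hTd p hp').1.contMDiffAt
  · intro p hp' q hq' hpq
    obtain ⟨-, h2, n, h3⟩ := (O.binding_eq_iff i i (T p).1 (T q).1 (T p).2 (T q).2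
      ((hTlt p hp').trans (by norm_num)) ((hTlt q hq').trans (by norm_num))).1 hpq
    have h4 := congrArg Complex.normSq h2
    have h5 := hTn p hp'
    have h6 := hTn q hq'
    have hrr : r (δ ^ 2 * Complex.normSq p.2) = r (δ ^ 2 * Complex.normSq q.2) := by
      rw [← h5, ← h6]; exact h4
    have hpos : δ * √(D.P i (r (δ ^ 2 * Complex.normSq q.2)) /
        D.Q i (r (δ ^ 2 * Complex.normSq q.2))) ≠ 0 := by
      have k1 := hr.P_gt _ (hσ _ (normSq_lt_two hq'))
      have k2 := hr.Q_pos _ (hσ _ (normSq_lt_two hq'))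
      have : 0 < D.P i (r (δ ^ 2 * Complex.normSq q.2)) := by linarith
      positivity
    have h2' : (T p).2 = (T q).2 := h2
    simp only [hT, twist] at h2'
    rw [hrr] at h2'
    have h3' : x + δ ^ 2 * p.1 - (x + δ ^ 2 * q.1) = n * S.len i := h3
    have hn : n = 0 := by
      have k1 := abs_lt.1 (abs_fst_lt_one hp')
      have k2 := abs_lt.1 (abs_fst_lt_one hq')
      have k3 : |(n : ℝ) * S.len i| < 1 * S.len i := by
        rw [← h3', abs_lt]
        constructor <;> nlinarith [sq_nonneg δ]
      rw [abs_mul, abs_of_pos hL] at k3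
      have k4 : |(n : ℝ)| < 1 := lt_of_mul_lt_mul_right k3 hL.le
      exact Int.abs_lt_one_iff.1 (by exact_mod_cast k4)
    rw [hn] at h3'
    refine Prod.ext ?_ (smul_right_injective ℂ hpos h2')
    have : δ ^ 2 * (p.1 - q.1) = 0 := by push_cast at h3'; linarith
    rcases mul_eq_zero.1 this with h | h
    · exact absurd h (by positivity)
    · linarith
  · exact contDiffAt_const.mul ((hPc _ (hσ σ h)).comp σ (contDiffAt_const.mul contDiffAt_id))
  · have := hr.P_gt _ (hσ σ h)
    exact mul_pos (by positivity) (by linarith)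
  · have h1 := hr.deriv_pos _ (hσ σ h)
    have h2 : HasDerivAt c (δ ^ 2 * (deriv (fun y => D.P i (r y)) (δ ^ 2 * σ) * (δ ^ 2 * 1))) σ :=
      (HasDerivAt.comp σ (h₂ := fun y => D.P i (r y))
        ((hPc _ (hσ σ h)).differentiableAt (by simp)).hasDerivAt
        ((hasDerivAt_id σ).const_mul (δ ^ 2))).const_mul (δ ^ 2)
    rw [h2.deriv]
    have h3 : 0 < δ ^ 2 := by positivity
    simp only [hc]
    nlinarith
  · have h1 := O.isParamAt_binding i (p := T p) (by linarith [hTlt p hp'])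
    rw [OneForm.pb_comp O.form h1.mdiff ((hTd p hp').1.differentiableAt (by simp)),
      O.pb_binding i (by linarith [hTlt p hp']), (hTd p hp').2]
  · have h1 := hf (T p).1 (T p).2 (hTlt p hp').le
    rw [D.h₂_norm i (by linarith [hTlt p hp']), hTn p hp', hr.eq _ (hσ _ (normSq_lt_two hp'))] at h1
    refine Eq.trans h1 ?_
    simp only [hc]
    ring
  · simp [hT, twist]
  · rintro _ ⟨p, hp', rfl⟩
    exact ⟨(T p).1, (T p).2, hTlt p hp', rfl⟩
  · have h1 := hr.P_gt _ (hσ σ h)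
    have h2 := hr.P_lt _ (hσ σ h)
    have h3 : 0 < δ ^ 2 := by positivity
    simp only [hc]
    constructor <;> nlinarith

end Surface
end

noncomputable section
open Filter Topology

/-! ### The contact inversion -/

section Inversion

theorem gaugePow_eq_coord (p : ℝ × ℂ) :
    gaugePow p = (p.2.re * p.2.re + p.2.im * p.2.im) ^ 2 + 4 * p.1 ^ 2 := by
  rw [gaugePow_eq, Complex.normSq_apply]

/-- Rationalize the denominator with `(|ζ|² - 2it)(|ζ|² + 2it) = N`; the result is polynomial up to
the factor `1/N`, which suits differentiation. -/
theorem contactInversion_eq {p : ℝ × ℂ} (hp : gaugePow p ≠ 0) :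
    contactInversion p = (gaugePow p)⁻¹ •
      ((-p.1, ((Complex.normSq p.2 : ℂ) + 2 * (p.1 : ℂ) * Complex.I) * p.2) : ℝ × ℂ) := by
  have hw : ((Complex.normSq p.2 : ℂ) - 2 * (p.1 : ℂ) * Complex.I) *
      ((Complex.normSq p.2 : ℂ) + 2 * (p.1 : ℂ) * Complex.I) = (gaugePow p : ℂ) := by
    rw [gaugePow_eq]
    push_cast
    linear_combination (-4 * (p.1 : ℂ) ^ 2) * Complex.I_sq
  have hN : (gaugePow p : ℂ) ≠ 0 := by exact_mod_cast hp
  have hw0 : ((Complex.normSq p.2 : ℂ) - 2 * (p.1 : ℂ) * Complex.I) ≠ 0 := by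
    intro h
    rw [h, zero_mul] at hw
    exact hN hw.symm
  refine Prod.ext ?_ ?_
  · simp only [contactInversion, Prod.smul_fst, smul_eq_mul]
    ring
  · have h1 : ((‖p.2‖ : ℂ) ^ 2) = (Complex.normSq p.2 : ℂ) := by
      rw [Complex.normSq_eq_norm_sq]
      push_cast
      rfl
    simp only [contactInversion, Prod.smul_snd, Complex.real_smul, h1]
    push_cast
    rw [div_eq_iff hw0]
    have h2 : ((gaugePow p : ℂ)⁻¹ * (((Complex.normSq p.2 : ℂ) + 2 * (p.1 : ℂ) * Complex.I) * p.2)) *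
        ((Complex.normSq p.2 : ℂ) - 2 * (p.1 : ℂ) * Complex.I) = (gaugePow p : ℂ)⁻¹ *
        (((Complex.normSq p.2 : ℂ) - 2 * (p.1 : ℂ) * Complex.I) *
          ((Complex.normSq p.2 : ℂ) + 2 * (p.1 : ℂ) * Complex.I)) * p.2 := by ring
    rw [h2, hw, inv_mul_cancel₀ hN, one_mul]

theorem normSq_contactInversion {p : ℝ × ℂ} (hp : gaugePow p ≠ 0) :
    Complex.normSq (contactInversion p).2 = Complex.normSq p.2 / gaugePow p := by
  rw [contactInversion_eq hp]
  have h := gaugePow_eq_coord p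
  simp only [Prod.smul_snd, Complex.normSq_apply, Complex.real_smul, Complex.mul_re, Complex.mul_im,
    Complex.add_re, Complex.add_im, Complex.ofReal_re, Complex.ofReal_im, Complex.I_re,
    Complex.I_im, Complex.re_ofNat, Complex.im_ofNat]
  field_simp
  rw [h]
  ring

theorem gaugePow_contactInversion {p : ℝ × ℂ} (hp : gaugePow p ≠ 0) :
    gaugePow (contactInversion p) = (gaugePow p)⁻¹ := by
  rw [gaugePow_eq, normSq_contactInversion hp, contactInversion]
  have h := gaugePow_eq p
  field_simp
  linarith

theorem contactInversion_contactInversion {p : ℝ × ℂ} (hp : gaugePow p ≠ 0) :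
    contactInversion (contactInversion p) = p := by
  have h0 : gaugePow (contactInversion p) ≠ 0 := by
    rw [gaugePow_contactInversion hp]; exact inv_ne_zero hp
  rw [contactInversion_eq h0, gaugePow_contactInversion hp, normSq_contactInversion hp,
    contactInversion_eq hp]
  have h := gaugePow_eq_coord p
  have hs := Complex.normSq_apply p.2
  refine Prod.ext ?_ (Complex.ext ?_ ?_)
  · simp [hp]
  all_goals
    simp only [Prod.smul_snd, Prod.smul_fst, Complex.real_smul, Complex.mul_re, Complex.mul_im,
      Complex.add_re, Complex.add_im, Complex.ofReal_re, Complex.ofReal_im, Complex.I_re,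
      Complex.I_im, Complex.re_ofNat, Complex.im_ofNat, smul_eq_mul, inv_inv]
    field_simp
    rw [h, hs]
    ring

theorem contDiffAt_contactInversion {p : ℝ × ℂ} (hp : gaugePow p ≠ 0) :
    ContDiffAt ℝ ∞ contactInversion p ∧
      (stdForm (contactInversion p)).comp (fderiv ℝ contactInversion p) =
        (gaugePow p)⁻¹ • stdForm p := by
  set B : ℝ × ℂ → ℝ × ℂ := fun p =>
    (-p.1, ((Complex.normSq p.2 : ℂ) + 2 * (p.1 : ℂ) * Complex.I) * p.2) with hB
  have hev : contactInversion =ᶠ[𝓝 p] fun p => (gaugePow p)⁻¹ • B p := by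
    filter_upwards [contDiff_gaugePow.continuous.continuousAt.eventually_ne hp] with q hq
      using contactInversion_eq hq
  have e0 : HasFDerivAt (fun p : ℝ × ℂ => Complex.normSq p.2)
      ((radForm p.2).comp (ContinuousLinearMap.snd ℝ ℝ ℂ)) p :=
    HasFDerivAt.comp p (g := fun z : ℂ => Complex.normSq z) (hasFDerivAt_normSq p.2) hasFDerivAt_snd
  have e1 : HasFDerivAt (fun p : ℝ × ℂ => (Complex.normSq p.2 : ℂ))
      (Complex.ofRealCLM.comp ((radForm p.2).comp (ContinuousLinearMap.snd ℝ ℝ ℂ))) p :=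
    Complex.ofRealCLM.hasFDerivAt.comp p e0
  have e2 : HasFDerivAt (fun p : ℝ × ℂ => 2 * (p.1 : ℂ) * Complex.I) _ p :=
    ((Complex.ofRealCLM.hasFDerivAt.comp p (hasFDerivAt_fst (𝕜 := ℝ) (E := ℝ) (F := ℂ))).const_mul
      (2 : ℂ)).mul_const Complex.I
  have e3 : HasFDerivAt B _ p :=
    (hasFDerivAt_fst (𝕜 := ℝ) (E := ℝ) (F := ℂ)).neg.prodMk ((e1.add e2).mul hasFDerivAt_snd)
  have e4 : HasFDerivAt gaugePow
      ((2 * Complex.normSq p.2) • (radForm p.2).comp (ContinuousLinearMap.snd ℝ ℝ ℂ) +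
        (8 * p.1) • ContinuousLinearMap.fst ℝ ℝ ℂ) p := by
    have h1 := (e0.pow 2).add (((hasFDerivAt_fst (𝕜 := ℝ) (E := ℝ) (F := ℂ) (p := p)).pow 2).const_mul 4)
    refine (h1.congr_of_eventuallyEq (Eventually.of_forall gaugePow_eq)).congr_fderiv ?_
    ext <;> simp <;> ring
  have e5 : HasFDerivAt (fun p => (gaugePow p)⁻¹) _ p :=
    (hasDerivAt_inv hp).comp_hasFDerivAt p e4
  have e6 : HasFDerivAt (fun p => (gaugePow p)⁻¹ • B p) _ p := e5.smul e3
  have hsm : ContDiff ℝ ∞ B := by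
    have h1 : ContDiff ℝ ∞ fun p : ℝ × ℂ => (Complex.normSq p.2 : ℂ) :=
      Complex.ofRealCLM.contDiff.comp (contDiff_normSq.comp contDiff_snd)
    have h2 : ContDiff ℝ ∞ fun p : ℝ × ℂ => (p.1 : ℂ) := Complex.ofRealCLM.contDiff.comp contDiff_fst
    exact contDiff_fst.neg.prodMk ((h1.add ((contDiff_const.mul h2).mul contDiff_const)).mul
      contDiff_snd)
  refine ⟨((contDiff_gaugePow.contDiffAt.inv hp).smul hsm.contDiffAt).congr_of_eventuallyEq hev, ?_⟩
  rw [hev.fderiv_eq, e6.fderiv]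
  refine ContinuousLinearMap.ext fun v => ?_
  rw [ContinuousLinearMap.comp_apply, contactInversion_eq hp, stdForm, rotForm_apply]
  have hs := Complex.normSq_apply p.2
  have h := gaugePow_eq_coord p
  simp only [hB, smul_apply, rotForm_apply, angForm_apply, add_apply, ContinuousLinearMap.smulRight_apply,
    ContinuousLinearMap.prod_apply, ContinuousLinearMap.comp_apply, Complex.ofRealCLM_apply,
    ContinuousLinearMap.coe_fst', ContinuousLinearMap.coe_snd', neg_apply, radForm_apply,
    Complex.real_smul, Complex.mul_re, Complex.mul_im,
      Complex.add_re, Complex.add_im, Complex.ofReal_re, Complex.ofReal_im, Complex.I_re,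
      Complex.I_im, Complex.re_ofNat, Complex.im_ofNat, smul_eq_mul, Pi.add_apply, Prod.fst_add, Prod.snd_add,
      Prod.smul_mk, hs]
  clear e6 e5 e4 e3 e2 e1 e0 hev hsm
  clear_value B
  clear hB B
  generalize gaugePow p = N at *
  field_simp
  linear_combination N * (-(2 * v.1) - (p.2.re * v.2.im - p.2.im * v.2.re)) * h

end Inversion

/-! ### Interpolation of conformal factors in the shell -/

section Interpolation

/-- A form `m (dt + r² dφ)` with `m` a function of `r²` and `t`. -/
theorem hasFDerivAt_comp_normSq_fst {m : ℝ × ℝ → ℝ} {p : ℝ × ℂ}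
    (hm : DifferentiableAt ℝ m (Complex.normSq p.2, p.1)) :
    HasFDerivAt (fun p : ℝ × ℂ => m (Complex.normSq p.2, p.1))
      ((fderiv ℝ m (Complex.normSq p.2, p.1)).comp
        (((radForm p.2).comp (ContinuousLinearMap.snd ℝ ℝ ℂ)).prod
          (ContinuousLinearMap.fst ℝ ℝ ℂ))) p :=
  HasFDerivAt.comp p (g := m) (f := fun p : ℝ × ℂ => (Complex.normSq p.2, p.1)) hm.hasFDerivAt
    ((HasFDerivAt.comp p (g := fun z : ℂ => Complex.normSq z) (hasFDerivAt_normSq p.2)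
      hasFDerivAt_snd).prodMk hasFDerivAt_fst)

theorem contDiffAt_comp_normSq_fst {m : ℝ × ℝ → ℝ} {p : ℝ × ℂ}
    (hm : ContDiffAt ℝ ∞ m (Complex.normSq p.2, p.1)) :
    ContDiffAt ℝ ∞ (fun p : ℝ × ℂ => m (Complex.normSq p.2, p.1)) p :=
  ContDiffAt.comp p (g := m) (f := fun p : ℝ × ℂ => (Complex.normSq p.2, p.1)) hm
    ((contDiff_normSq.comp contDiff_snd).prodMk contDiff_fst).contDiffAt

theorem contactAt_stdForm (p : ℝ × ℂ) : ContactAt stdForm p :=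
  contactAt_rotForm (differentiableAt_const _) (differentiableAt_const _) (by simp)

/-- The value of a rotationally invariant form `m (dt + r² dφ)` on the rotation field is invariant
under its Reeb flow. -/
theorem fderiv_eq_zero_of_extD_smul_stdForm {m : ℝ × ℝ → ℝ} {p : ℝ × ℂ}
    (hm : DifferentiableAt ℝ m (Complex.normSq p.2, p.1)) {u : ℝ × ℂ}
    (hu : ∀ w, extD (fun p : ℝ × ℂ => m (Complex.normSq p.2, p.1) • stdForm p) p u w = 0) :
    fderiv ℝ (fun p : ℝ × ℂ => m (Complex.normSq p.2, p.1) * Complex.normSq p.2) p u = 0 := by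
  have h1 := hasFDerivAt_comp_normSq_fst hm
  -- Clairaut's relation: the form is rotation invariant, so pairing `u` with the rotation field
  -- yields the derivative along `u` of the value on that field.
  have h2 := hu (0, ⟨-p.2.im, p.2.re⟩)
  rw [extD_smul h1.differentiableAt (contDiff_stdForm.differentiable (by simp) p), h1.fderiv,
    stdForm, extD_rotForm (differentiableAt_const _) (differentiableAt_const _)] at h2
  have h3 : HasFDerivAt (fun p : ℝ × ℂ => Complex.normSq p.2)
      ((radForm p.2).comp (ContinuousLinearMap.snd ℝ ℝ ℂ)) p :=
    HasFDerivAt.comp p (g := fun z : ℂ => Complex.normSq z) (hasFDerivAt_normSq p.2) hasFDerivAt_snd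
  have h4 : radForm p.2 (⟨-p.2.im, p.2.re⟩ : ℂ) = 0 := by rw [radForm_apply]; ring
  have h5 : angForm p.2 (⟨-p.2.im, p.2.re⟩ : ℂ) = Complex.normSq p.2 := by
    rw [angForm_apply, Complex.normSq_apply]; ring
  have h6 : HasFDerivAt (fun p : ℝ × ℂ => m (Complex.normSq p.2, p.1) * Complex.normSq p.2) _ p :=
    h1.mul h3
  rw [h6.fderiv]
  simp only [ContinuousLinearMap.comp_apply, ContinuousLinearMap.prod_apply, add_apply, smul_apply,
    ContinuousLinearMap.coe_fst', ContinuousLinearMap.coe_snd', rotForm_apply, h4, h5,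
    smul_eq_mul, deriv_const, ← Prod.zero_eq_mk, map_zero, one_mul, mul_zero, zero_mul, sub_zero,
    zero_add] at h2 ⊢
  rw [← h2, radForm_apply]
  ring

/-- A smooth cutoff function on the shell. -/
def shellCutoff (n : ℝ) : ℝ := Real.smoothTransition (2 * n - 3 / 2)

theorem contDiff_shellCutoff : ContDiff ℝ ∞ shellCutoff :=
  Real.smoothTransition.contDiff.comp ((contDiff_const.mul contDiff_id).sub contDiff_const)

theorem shellCutoff_eq_one {n : ℝ} (h : 5 / 4 ≤ n) : shellCutoff n = 1 :=
  Real.smoothTransition.one_of_one_le (by linarith)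

theorem shellCutoff_eq_zero {n : ℝ} (h : n ≤ 3 / 4) : shellCutoff n = 0 :=
  Real.smoothTransition.zero_of_nonpos (by linarith)

theorem deriv_shellCutoff_nonneg (n : ℝ) : 0 ≤ deriv shellCutoff n :=
  Monotone.deriv_nonneg fun _ _ h => Real.smoothTransition.monotone (by linarith)

/-- The interpolation of the conformal factors `c₁` and `c₂` in a shell. -/
def shellFactor (c₁ c₂ : ℝ → ℝ) (q : ℝ × ℝ) : ℝ :=
  shellCutoff (q.1 ^ 2 + 4 * q.2 ^ 2) * c₁ q.1 + (1 - shellCutoff (q.1 ^ 2 + 4 * q.2 ^ 2)) *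
    (c₂ (q.1 / (q.1 ^ 2 + 4 * q.2 ^ 2)) / (q.1 ^ 2 + 4 * q.2 ^ 2))

/-- The factor in the shell, as seen from the other side. -/
def shellFactorInv (c₁ c₂ : ℝ → ℝ) (q : ℝ × ℝ) : ℝ :=
  shellFactor c₁ c₂ (q.1 / (q.1 ^ 2 + 4 * q.2 ^ 2), -q.2 / (q.1 ^ 2 + 4 * q.2 ^ 2)) /
    (q.1 ^ 2 + 4 * q.2 ^ 2)

variable {c₁ c₂ : ℝ → ℝ} {q : ℝ × ℝ}

theorem abs_lt_two_of_shell (h : q.1 ^ 2 + 4 * q.2 ^ 2 < 2) : |q.1| < 2 :=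
  abs_lt_of_sq_lt_sq (by nlinarith [sq_nonneg q.2]) (by norm_num)

theorem abs_div_lt_two_of_shell (h : 1 / 2 < q.1 ^ 2 + 4 * q.2 ^ 2) :
    |q.1 / (q.1 ^ 2 + 4 * q.2 ^ 2)| < 2 := by
  set n := q.1 ^ 2 + 4 * q.2 ^ 2 with hn
  refine abs_lt_of_sq_lt_sq ?_ (by norm_num)
  rw [div_pow, div_lt_iff₀ (by positivity)]
  nlinarith [sq_nonneg q.2]

theorem shell_inv (h : 0 < q.1 ^ 2 + 4 * q.2 ^ 2) :
    (q.1 / (q.1 ^ 2 + 4 * q.2 ^ 2)) ^ 2 + 4 * (-q.2 / (q.1 ^ 2 + 4 * q.2 ^ 2)) ^ 2 =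
      (q.1 ^ 2 + 4 * q.2 ^ 2)⁻¹ := by
  field_simp

theorem contDiffAt_shellFactor (h1 : ∀ σ, |σ| < 2 → ContDiffAt ℝ ∞ c₁ σ)
    (h2 : ∀ σ, |σ| < 2 → ContDiffAt ℝ ∞ c₂ σ) (hq : 1 / 2 < q.1 ^ 2 + 4 * q.2 ^ 2)
    (hq' : q.1 ^ 2 + 4 * q.2 ^ 2 < 2) : ContDiffAt ℝ ∞ (shellFactor c₁ c₂) q := by
  have hn : ContDiff ℝ ∞ fun q : ℝ × ℝ => q.1 ^ 2 + 4 * q.2 ^ 2 := by fun_prop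
  have hκ : ContDiffAt ℝ ∞ (fun q : ℝ × ℝ => shellCutoff (q.1 ^ 2 + 4 * q.2 ^ 2)) q :=
    (contDiff_shellCutoff.comp hn).contDiffAt
  have h0 : q.1 ^ 2 + 4 * q.2 ^ 2 ≠ 0 := by linarith
  refine (hκ.mul ((h1 _ (abs_lt_two_of_shell hq')).comp q contDiffAt_fst)).add
    ((contDiffAt_const.sub hκ).mul (ContDiffAt.div ?_ hn.contDiffAt h0))
  exact ContDiffAt.comp q (g := c₂) (h2 _ (abs_div_lt_two_of_shell hq))
    (contDiffAt_fst.div hn.contDiffAt h0)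

theorem shellFactor_pos (h1 : ∀ σ, |σ| < 2 → 0 < c₁ σ)
    (h2 : ∀ σ, |σ| < 2 → 0 < c₂ σ) (hq : 1 / 2 < q.1 ^ 2 + 4 * q.2 ^ 2)
    (hq' : q.1 ^ 2 + 4 * q.2 ^ 2 < 2) : 0 < shellFactor c₁ c₂ q := by
  have k1 := h1 _ (abs_lt_two_of_shell hq')
  have k2 := div_pos (h2 _ (abs_div_lt_two_of_shell hq)) (by linarith : 0 < q.1 ^ 2 + 4 * q.2 ^ 2)
  have k3 : 0 ≤ shellCutoff (q.1 ^ 2 + 4 * q.2 ^ 2) := Real.smoothTransition.nonneg _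
  have k4 : shellCutoff (q.1 ^ 2 + 4 * q.2 ^ 2) ≤ 1 := Real.smoothTransition.le_one _
  rw [shellFactor]
  rcases k3.eq_or_lt with h | h
  · rw [← h]; linarith
  · nlinarith [mul_pos h k1, mul_nonneg (sub_nonneg.2 k4) k2.le]

theorem shellFactor_eq (hq : 5 / 4 ≤ q.1 ^ 2 + 4 * q.2 ^ 2) : shellFactor c₁ c₂ q = c₁ q.1 := by
  rw [shellFactor, shellCutoff_eq_one hq]
  ring

theorem contDiffAt_shellFactorInv (h1 : ∀ σ, |σ| < 2 → ContDiffAt ℝ ∞ c₁ σ)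
    (h2 : ∀ σ, |σ| < 2 → ContDiffAt ℝ ∞ c₂ σ) (hq : 1 / 2 < q.1 ^ 2 + 4 * q.2 ^ 2)
    (hq' : q.1 ^ 2 + 4 * q.2 ^ 2 < 2) : ContDiffAt ℝ ∞ (shellFactorInv c₁ c₂) q := by
  have hn : ContDiff ℝ ∞ fun q : ℝ × ℝ => q.1 ^ 2 + 4 * q.2 ^ 2 := by fun_prop
  have h0 : q.1 ^ 2 + 4 * q.2 ^ 2 ≠ 0 := by linarith
  have h0' : 0 < q.1 ^ 2 + 4 * q.2 ^ 2 := by linarith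
  refine ContDiffAt.div (ContDiffAt.comp q (g := shellFactor c₁ c₂)
    (contDiffAt_shellFactor h1 h2 ?_ ?_) ((contDiffAt_fst.div hn.contDiffAt h0).prodMk
      (contDiffAt_snd.neg.div hn.contDiffAt h0))) hn.contDiffAt h0
  · simp only [shell_inv h0']
    rw [← one_div, div_lt_div_iff_of_pos_left] <;> linarith
  · simp only [shell_inv h0']
    rw [inv_lt_comm₀ h0' (by norm_num)]
    linarith

theorem shellFactorInv_pos (h1 : ∀ σ, |σ| < 2 → 0 < c₁ σ)
    (h2 : ∀ σ, |σ| < 2 → 0 < c₂ σ) (hq : 1 / 2 < q.1 ^ 2 + 4 * q.2 ^ 2)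
    (hq' : q.1 ^ 2 + 4 * q.2 ^ 2 < 2) : 0 < shellFactorInv c₁ c₂ q := by
  have h0' : 0 < q.1 ^ 2 + 4 * q.2 ^ 2 := by linarith
  refine div_pos (shellFactor_pos h1 h2 ?_ ?_) h0'
  · simp only [shell_inv h0']
    rw [← one_div, div_lt_div_iff_of_pos_left] <;> linarith
  · simp only [shell_inv h0']
    rw [inv_lt_comm₀ h0' (by norm_num)]
    linarith

/-- The bound `4/3` is the reciprocal of `3/4`, below which the cutoff vanishes; inversion takes `N`
to `1/N`. -/
theorem shellFactorInv_eq (hq : 4 / 3 ≤ q.1 ^ 2 + 4 * q.2 ^ 2) :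
    shellFactorInv c₁ c₂ q = c₂ q.1 := by
  have h0 : 0 < q.1 ^ 2 + 4 * q.2 ^ 2 := by linarith
  rw [shellFactorInv, shellFactor]
  simp only [shell_inv h0]
  rw [shellCutoff_eq_zero]
  · rw [div_inv_eq_mul, div_inv_eq_mul, div_mul_cancel₀ _ h0.ne', zero_mul, zero_add, sub_zero,
      one_mul, mul_div_cancel_right₀ _ h0.ne']
  · rw [inv_le_comm₀ h0 (by norm_num)]
    linarith

/-- In the shell the function `shellFactor` is strictly monotone in `t²`, where `c₁` has been
cut off. -/
theorem fderiv_shellFactor_ne_zero (h1 : ∀ σ, |σ| < 2 → ContDiffAt ℝ ∞ c₁ σ)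
    (h2 : ∀ σ, |σ| < 2 → ContDiffAt ℝ ∞ c₂ σ)
    (h3 : ∀ σ, |σ| < 2 → 0 < c₂ σ + σ * deriv c₂ σ)
    (h4 : ∀ σ τ, |σ| < 2 → |τ| < 2 → c₁ σ ≤ c₂ τ / 2)
    (h5 : ∀ σ, |σ| < 2 → 0 < c₂ σ)
    (hq : 1 / 2 < q.1 ^ 2 + 4 * q.2 ^ 2) (hq' : q.1 ^ 2 + 4 * q.2 ^ 2 < 5 / 4) (hq2 : q.2 ≠ 0) :
    fderiv ℝ (shellFactor c₁ c₂) q (0, 1) ≠ 0 := by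
  obtain ⟨σ, t⟩ := q
  simp only at hq hq' hq2
  set n := σ ^ 2 + 4 * t ^ 2 with hn
  have hn0 : 0 < n := by linarith
  have hσ : |σ| < 2 := abs_lt_two_of_shell (q := (σ, t)) (by simp only; linarith)
  have hσn : |σ / n| < 2 := abs_div_lt_two_of_shell (q := (σ, t)) hq
  have e1 : HasDerivAt (fun t : ℝ => σ ^ 2 + 4 * t ^ 2) (8 * t) t := by
    have := ((hasDerivAt_pow 2 t).const_mul 4).const_add (σ ^ 2)
    refine this.congr_deriv ?_
    norm_num
    ring
  have e2 : HasDerivAt (fun t : ℝ => shellCutoff (σ ^ 2 + 4 * t ^ 2)) (deriv shellCutoff n * (8 * t)) t :=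
    HasDerivAt.comp t (h₂ := shellCutoff)
      (contDiff_shellCutoff.differentiable (by simp) n).hasDerivAt e1
  have e3 : HasDerivAt (fun t : ℝ => σ / (σ ^ 2 + 4 * t ^ 2)) _ t :=
    (hasDerivAt_const t σ).div e1 hn0.ne'
  have e4 : HasDerivAt (fun t : ℝ => c₂ (σ / (σ ^ 2 + 4 * t ^ 2))) _ t :=
    HasDerivAt.comp t (h₂ := c₂) ((h2 _ hσn).differentiableAt (by simp)).hasDerivAt e3
  have e5 : HasDerivAt (fun t : ℝ => shellFactor c₁ c₂ (σ, t)) _ t :=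
    (e2.mul_const (c₁ σ)).add ((e2.const_sub 1).mul (e4.div e1 hn0.ne'))
  have e6 : HasDerivAt (fun t : ℝ => shellFactor c₁ c₂ (σ, t))
      (fderiv ℝ (shellFactor c₁ c₂) (σ, t) (0, 1)) t :=
    HasFDerivAt.comp_hasDerivAt (f := fun t : ℝ => (σ, t)) t
      ((contDiffAt_shellFactor (q := (σ, t)) h1 h2 hq (by simp only; linarith)).differentiableAt
        (by simp)).hasFDerivAt ((hasDerivAt_const t σ).prodMk (hasDerivAt_id t))
  rw [e6.unique e5, ← hn]
  set κ := shellCutoff n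
  have hκ : κ < 1 := Real.smoothTransition.lt_one_of_lt_one (by linarith)
  have hκ' := deriv_shellCutoff_nonneg n
  set κ' := deriv shellCutoff n
  -- Here `n < 5/4 < 2`, so the factor `1/2` in the comparison of `c₁` and `c₂` absorbs the division
  -- by `n`.
  have k1 : c₁ σ ≤ c₂ (σ / n) / n := by
    refine (h4 _ _ hσ hσn).trans ?_
    exact div_le_div_of_nonneg_left (h5 _ hσn).le hn0 (by linarith)
  have k2 := h3 _ hσn
  -- The derivative in `t` is `8t` times this bracket. Its first term is nonpositive by `k1`; the
  -- second is strictly negative because `σ c₂(σ)` increases and the cutoff is below `1` for `n <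
  -- 5/4`.
  have k3 : κ' * (c₁ σ - c₂ (σ / n) / n) -
      (1 - κ) * ((c₂ (σ / n) + σ / n * deriv c₂ (σ / n)) / n ^ 2) < 0 := by
    have h6 : κ' * (c₁ σ - c₂ (σ / n) / n) ≤ 0 := mul_nonpos_of_nonneg_of_nonpos hκ' (by linarith)
    have h7 : 0 < (1 - κ) * ((c₂ (σ / n) + σ / n * deriv c₂ (σ / n)) / n ^ 2) :=
      mul_pos (by linarith) (by positivity)
    linarith
  have k4 : (8 * t) * (κ' * (c₁ σ - c₂ (σ / n) / n) -
      (1 - κ) * ((c₂ (σ / n) + σ / n * deriv c₂ (σ / n)) / n ^ 2)) ≠ 0 :=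
    mul_ne_zero (mul_ne_zero (by norm_num) hq2) k3.ne
  convert k4 using 1
  field_simp
  ring

end Interpolation
end

noncomputable section
open Filter Topology

/-! ### Parametrizations by `ℝ × ℂ`, and shell factors -/

section Params

variable {V V' : Type*} [NormedAddCommGroup V] [NormedSpace ℝ V] [CompleteSpace V]
  [NormedAddCommGroup V'] [NormedSpace ℝ V'] [CompleteSpace V']
  {Y : Type*} [TopologicalSpace Y] [ChartedSpace (EuclideanSpace ℝ (Fin 3)) Y]
  [IsManifold (𝓡 3) ∞ Y]

theorem exists_eventually_isParamAt (y : Y) :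
    ∃ (Φ : ℝ × ℂ → Y) (x : ℝ × ℂ), Φ x = y ∧ ∀ᶠ x' in 𝓝 x, IsParamAt (𝓡 3) Φ x' := by
  have hs : spaceEquiv (spaceEquiv.symm (extChartAt (𝓡 3) y y)) = extChartAt (𝓡 3) y y :=
    spaceEquiv.apply_symm_apply _
  refine ⟨(extChartAt (𝓡 3) y).symm ∘ spaceEquiv, spaceEquiv.symm (extChartAt (𝓡 3) y y), ?_, ?_⟩
  · rw [Function.comp_apply, hs, extChartAt_to_inv]
  · have h1 : ∀ᶠ x' in 𝓝 (spaceEquiv.symm (extChartAt (𝓡 3) y y)),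
        spaceEquiv x' ∈ (extChartAt (𝓡 3) y).target :=
      spaceEquiv.continuous.continuousAt.preimage_mem_nhds
        (by rw [hs]; exact extChartAt_target_mem_nhds y)
    filter_upwards [h1] with x' hx'
    refine (isParamAt_extChartAt_symm (I := 𝓡 3) y hx' (by simp)).comp
      spaceEquiv.contDiff.contDiffAt ?_
    rw [spaceEquiv.fderiv]
    exact spaceEquiv.bijective

/-- The transition between two parametrizations of a manifold preserves one-forms. -/
theorem IsParamAt.contactGerm {Φ : V → Y} {Φ' : V' → Y} {x : V} {y : V'} (h' : IsParamAt (𝓡 3) Φ' y)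
    (h : ContMDiffAt 𝓘(ℝ, V) (𝓡 3) ∞ Φ x) (he : Φ x = Φ' y)
    (hev : ∀ᶠ y' in 𝓝 y, MDifferentiableAt 𝓘(ℝ, V') (𝓡 3) Φ' y') (α : OneForm (𝓡 3) Y) :
    ContactGerm Φ Φ' (α.pb Φ) (α.pb Φ') x y := by
  obtain ⟨σ, h1, h2, h3, -⟩ := h'.exists_localInverse
  rw [← he] at h1 h2 h3
  have hτ : ContDiffAt ℝ ∞ (σ ∘ Φ) x := (h1.comp x h).contDiffAt
  refine ⟨σ ∘ Φ, hτ, h2, ?_⟩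
  have h4 : ∀ᶠ x' in 𝓝 x, Φ' (σ (Φ x')) = Φ x' := h.continuousAt.eventually h3
  filter_upwards [h4.eventually_nhds, eventually_differentiableAt hτ,
    hτ.continuousAt.eventually (by rw [Function.comp_apply, h2]; exact hev)] with x' h5 h6 h7
  refine ⟨h5.self_of_nhds, ?_⟩
  rw [← OneForm.pb_comp α h7 h6]
  exact (OneForm.pb_congr α h5).eq_of_nhds

theorem ContactGerm.map {Y Z : Type*} {Φ : V → Y} {Φ' : V' → Y} {β : V → V →L[ℝ] ℝ}
    {β' : V' → V' →L[ℝ] ℝ} {x : V} {y : V'} (h : ContactGerm Φ Φ' β β' x y) (j : Y → Z) :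
    ContactGerm (j ∘ Φ) (j ∘ Φ') β β' x y := by
  obtain ⟨τ, h1, h2, h3⟩ := h
  exact ⟨τ, h1, h2, h3.mono fun x' hx' => ⟨congrArg j hx'.1, hx'.2⟩⟩

end Params

theorem isCompact_gaugePow_le {r : ℝ} (hr : r < 2) : IsCompact {p : ℝ × ℂ | gaugePow p ≤ r} := by
  refine Metric.isCompact_of_isClosed_isBounded
    (isClosed_le contDiff_gaugePow.continuous continuous_const)
    ((Metric.isBounded_closedBall (x := (0 : ℝ × ℂ)) (r := 2)).subset fun p hp => ?_)
  have hp2 : p ∈ standardBall 2 := lt_of_le_of_lt hp hr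
  rw [mem_closedBall_zero_iff]
  refine max_le ?_ ?_
  · rw [Real.norm_eq_abs]
    linarith [abs_fst_lt_one hp2]
  · have := normSq_lt_two hp2
    rw [abs_of_nonneg (Complex.normSq_nonneg _), Complex.normSq_eq_norm_sq] at this
    nlinarith [norm_nonneg p.2]

theorem isOpen_shell : IsOpen {p : ℝ × ℂ | 1 / 2 < gaugePow p ∧ gaugePow p < 2} :=
  (isOpen_lt continuous_const contDiff_gaugePow.continuous).inter (isOpen_standardBall 2)

/-- A function which interpolates in the shell between the conformal factor `c` of a Darboux ball
and another conformal factor. -/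
structure IsShellFactor (c : ℝ → ℝ) (m : ℝ × ℝ → ℝ) : Prop where
  contDiffAt : ∀ q : ℝ × ℝ, 1 / 2 < q.1 ^ 2 + 4 * q.2 ^ 2 → q.1 ^ 2 + 4 * q.2 ^ 2 < 2 →
    ContDiffAt ℝ ∞ m q
  pos : ∀ q : ℝ × ℝ, 1 / 2 < q.1 ^ 2 + 4 * q.2 ^ 2 → q.1 ^ 2 + 4 * q.2 ^ 2 < 2 → 0 < m q
  eq : ∀ q : ℝ × ℝ, 4 / 3 ≤ q.1 ^ 2 + 4 * q.2 ^ 2 → m q = c q.1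

theorem isShellFactor_shellFactor {c₁ c₂ : ℝ → ℝ} (h1 : ∀ σ, |σ| < 2 → ContDiffAt ℝ ∞ c₁ σ)
    (h2 : ∀ σ, |σ| < 2 → ContDiffAt ℝ ∞ c₂ σ) (h3 : ∀ σ, |σ| < 2 → 0 < c₁ σ)
    (h4 : ∀ σ, |σ| < 2 → 0 < c₂ σ) : IsShellFactor c₁ (shellFactor c₁ c₂) :=
  ⟨fun _ => contDiffAt_shellFactor h1 h2, fun _ => shellFactor_pos h3 h4,
    fun _ h => shellFactor_eq (by linarith)⟩

theorem isShellFactor_shellFactorInv {c₁ c₂ : ℝ → ℝ} (h1 : ∀ σ, |σ| < 2 → ContDiffAt ℝ ∞ c₁ σ)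
    (h2 : ∀ σ, |σ| < 2 → ContDiffAt ℝ ∞ c₂ σ) (h3 : ∀ σ, |σ| < 2 → 0 < c₁ σ)
    (h4 : ∀ σ, |σ| < 2 → 0 < c₂ σ) : IsShellFactor c₂ (shellFactorInv c₁ c₂) :=
  ⟨fun _ => contDiffAt_shellFactorInv h1 h2, fun _ => shellFactorInv_pos h3 h4,
    fun _ h => shellFactorInv_eq h⟩

/-! ### One side of the connected sum: the rescaled form and integral -/

section Piece

variable {Y : Type*} [TopologicalSpace Y] [T2Space Y] [ChartedSpace (EuclideanSpace ℝ (Fin 3)) Y]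
  [IsManifold (𝓡 3) ∞ Y] {α : OneForm (𝓡 3) Y} {f : Y → ℝ} {e : ℝ × ℂ → Y} {c : ℝ → ℝ}
  {m : ℝ × ℝ → ℝ}

open Classical in
/-- The conformal factor of the contact form of the connected sum. -/
def ballFactor (e : ℝ × ℂ → Y) (c : ℝ → ℝ) (m : ℝ × ℝ → ℝ) (y : Y) : ℝ :=
  if h : ∃ p ∈ standardBall 2, e p = y then
    m (Complex.normSq h.choose.2, h.choose.1) / c (Complex.normSq h.choose.2)
  else 1

/-- The manifold without the inner ball. -/
def ballCompl (e : ℝ × ℂ → Y) : Set Y := (e '' {p | gaugePow p ≤ 1 / 2})ᶜ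

namespace IsReebBall

theorem isCompact_image (hb : IsReebBall α f e c)
    {r : ℝ} (hr : r < 2) : IsCompact (e '' {p | gaugePow p ≤ r}) :=
  (isCompact_gaugePow_le hr).image_of_continuousOn fun p hp =>
    (hb.smooth p (lt_of_le_of_lt hp hr)).continuousAt.continuousWithinAt

theorem isOpen_compl_image (hb : IsReebBall α f e c)
    {r : ℝ} (hr : r < 2) : IsOpen (e '' {p | gaugePow p ≤ r})ᶜ :=
  (hb.isCompact_image hr).isClosed.isOpen_compl

theorem isOpen_ballCompl (hb : IsReebBall α f e c)
    : IsOpen (ballCompl e) := hb.isOpen_compl_image (by norm_num)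

theorem mem_ballCompl_iff (hb : IsReebBall α f e c) {p : ℝ × ℂ} (hp : p ∈ standardBall 2) :
    e p ∈ ballCompl e ↔ 1 / 2 < gaugePow p := by
  refine ⟨fun h => not_le.1 fun h' => h ⟨p, h', rfl⟩, fun h => ?_⟩
  rintro ⟨q, hq, he⟩
  have hq' : gaugePow q ≤ 1 / 2 := hq
  have := hb.injOn (show gaugePow q < 2 by linarith) hp he
  subst this
  linarith

/-- Either the point is in the shell, where everything is explicit, or it is off the compact ball `N
≤ 4/3`, near which form and function are unchanged. -/
theorem mem_ballCompl_cases (hb : IsReebBall α f e c) {y : Y} (hy : y ∈ ballCompl e) :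
    (∃ p ∈ standardBall 2, 1 / 2 < gaugePow p ∧ e p = y) ∨ y ∉ e '' {p | gaugePow p ≤ 4 / 3} := by
  by_cases h : ∃ p ∈ standardBall 2, e p = y
  · obtain ⟨p, hp, rfl⟩ := h
    exact Or.inl ⟨p, hp, (hb.mem_ballCompl_iff hp).1 hy, rfl⟩
  · refine Or.inr ?_
    rintro ⟨p, hp, rfl⟩
    exact h ⟨p, lt_of_le_of_lt hp (by norm_num : (4 / 3 : ℝ) < 2), rfl⟩

theorem isParamAt (hb : IsReebBall α f e c)
    (hα : IsContactForm α) {p : ℝ × ℂ} (hp : p ∈ standardBall 2) :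
    IsParamAt (𝓡 3) e p := by
  refine isParamAt_of_injective spaceEquiv.toLinearEquiv.finrank_eq (hb.smooth p hp)
    (injective_mfderiv_of_contactAt hα.smooth (hb.smooth p hp) ?_)
  have hn : ContDiffAt ℝ ∞ (fun p : ℝ × ℂ => c (Complex.normSq p.2)) p :=
    ContDiffAt.comp p (g := c) (hb.contDiffAt _ (normSq_lt_two hp))
      (contDiff_normSq.comp contDiff_snd).contDiffAt
  refine ((contactAt_stdForm p).smul (hn.differentiableAt (by simp))
    (contDiff_stdForm.differentiable (by simp) p) (hb.pos _ (normSq_lt_two hp)).ne').congr ?_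
  filter_upwards [(isOpen_standardBall 2).mem_nhds hp] with q hq using (hb.pb q hq).symm

theorem ballFactor_apply (hb : IsReebBall α f e c) {p : ℝ × ℂ} (hp : p ∈ standardBall 2) :
    ballFactor e c m (e p) = m (Complex.normSq p.2, p.1) / c (Complex.normSq p.2) := by
  have h : ∃ q ∈ standardBall 2, e q = e p := ⟨p, hp, rfl⟩
  rw [ballFactor, dif_pos h, hb.injOn h.choose_spec.1 hp h.choose_spec.2]

theorem ballFactor_eq_one (hb : IsReebBall α f e c)
    (hm : IsShellFactor c m) {y : Y} (hy : y ∉ e '' {p | gaugePow p ≤ 4 / 3}) :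
    ballFactor e c m y = 1 := by
  by_cases h : ∃ p ∈ standardBall 2, e p = y
  · obtain ⟨p, hp, rfl⟩ := h
    have hp' : 4 / 3 ≤ gaugePow p := not_lt.1 fun h => hy ⟨p, h.le, rfl⟩
    rw [gaugePow_eq] at hp'
    rw [hb.ballFactor_apply hp, hm.eq _ hp']
    exact div_self (hb.pos _ (normSq_lt_two hp)).ne'
  · rw [ballFactor, dif_neg h]

theorem eventually_ballFactor_eq_one (hb : IsReebBall α f e c) (hm : IsShellFactor c m) {y : Y}
    (hy : y ∉ e '' {p | gaugePow p ≤ 4 / 3}) : ∀ᶠ y' in 𝓝 y, ballFactor e c m y' = 1 := by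
  filter_upwards [(hb.isOpen_compl_image (r := 4 / 3) (by norm_num)).mem_nhds hy] with y' hy'
    using hb.ballFactor_eq_one hm hy'

theorem ballFactor_pos (hb : IsReebBall α f e c)
    (hm : IsShellFactor c m) {y : Y} (hy : y ∈ ballCompl e) :
    0 < ballFactor e c m y := by
  rcases hb.mem_ballCompl_cases hy with ⟨p, hp, hp', rfl⟩ | h
  · have hp2 : gaugePow p < 2 := hp
    rw [gaugePow_eq] at hp' hp2
    rw [hb.ballFactor_apply hp]
    exact div_pos (hm.pos _ hp' hp2) (hb.pos _ (normSq_lt_two hp))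
  · rw [hb.ballFactor_eq_one hm h]
    exact one_pos

theorem contMDiffAt_ballFactor (hb : IsReebBall α f e c)
    (hα : IsContactForm α) (hm : IsShellFactor c m) {y : Y}
    (hy : y ∈ ballCompl e) : ContMDiffAt (𝓡 3) 𝓘(ℝ, ℝ) ∞ (ballFactor e c m) y := by
  rcases hb.mem_ballCompl_cases hy with ⟨p, hp, hp', rfl⟩ | h
  · refine (hb.isParamAt hα hp).contMDiffAt_of_comp ?_
    have hp2 : gaugePow p < 2 := hp
    rw [gaugePow_eq] at hp' hp2
    have h1 : ContDiffAt ℝ ∞ (fun p : ℝ × ℂ => m (Complex.normSq p.2, p.1) /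
        c (Complex.normSq p.2)) p :=
      (contDiffAt_comp_normSq_fst (hm.contDiffAt _ hp' hp2)).div
        (ContDiffAt.comp p (g := c) (hb.contDiffAt _ (normSq_lt_two hp))
          (contDiff_normSq.comp contDiff_snd).contDiffAt) (hb.pos _ (normSq_lt_two hp)).ne'
    refine h1.congr_of_eventuallyEq ?_
    filter_upwards [(isOpen_standardBall 2).mem_nhds hp] with q hq using hb.ballFactor_apply hq
  · exact contMDiffAt_const.congr_of_eventuallyEq (hb.eventually_ballFactor_eq_one hm h)

/-- In the shell the new contact form is `m (dt + r² dφ)`. -/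
theorem ballFactor_smul_pb (hb : IsReebBall α f e c) {p : ℝ × ℂ} (hp : p ∈ standardBall 2) :
    ballFactor e c m (e p) • α.pb e p = m (Complex.normSq p.2, p.1) • stdForm p := by
  rw [hb.ballFactor_apply hp, hb.pb p hp, smul_smul,
    div_mul_cancel₀ _ (hb.pos _ (normSq_lt_two hp)).ne']

/-- In the ball `f` is the value of the contact form on the rotation field, so it has to be rescaled
by the same factor as the form. -/
theorem ballFactor_mul_apply (hb : IsReebBall α f e c) {p : ℝ × ℂ} (hp : p ∈ standardBall 2) :
    ballFactor e c m (e p) * f (e p) = m (Complex.normSq p.2, p.1) * Complex.normSq p.2 := by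
  rw [hb.ballFactor_apply hp, hb.apply p hp]
  have := (hb.pos _ (normSq_lt_two hp)).ne'
  field_simp

/-- The new function is invariant under the Reeb flow of the new contact form. -/
theorem exists_param_reebInvariant (hb : IsReebBall α f e c)
    (hα : IsContactForm α) (hf : IsReebIntegral α f)
    (hm : IsShellFactor c m) {y : Y} (hy : y ∈ ballCompl e) :
    ∃ (Φ : ℝ × ℂ → Y) (x : ℝ × ℂ), Φ x = y ∧ (∀ᶠ x' in 𝓝 x, IsParamAt (𝓡 3) Φ x') ∧
      ∀ u, (∀ w, extD (fun x => ballFactor e c m (Φ x) • α.pb Φ x) x u w = 0) →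
        fderiv ℝ (fun x => ballFactor e c m (Φ x) * f (Φ x)) x u = 0 := by
  rcases hb.mem_ballCompl_cases hy with ⟨p, hp, hp', rfl⟩ | h
  · have hev := (isOpen_standardBall 2).mem_nhds hp
    refine ⟨e, p, rfl, mem_of_superset hev fun q hq => hb.isParamAt hα hq, fun u hu => ?_⟩
    have h1 : (fun x => ballFactor e c m (e x) • α.pb e x) =ᶠ[𝓝 p]
        fun p => m (Complex.normSq p.2, p.1) • stdForm p := by
      filter_upwards [hev] with q hq using hb.ballFactor_smul_pb hq
    have h2 : (fun x => ballFactor e c m (e x) * f (e x)) =ᶠ[𝓝 p]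
        fun p => m (Complex.normSq p.2, p.1) * Complex.normSq p.2 := by
      filter_upwards [hev] with q hq using hb.ballFactor_mul_apply hq
    rw [extD_congr h1] at hu
    rw [h2.fderiv_eq]
    have hp2 : gaugePow p < 2 := hp
    rw [gaugePow_eq] at hp' hp2
    exact fderiv_eq_zero_of_extD_smul_stdForm
      ((hm.contDiffAt _ hp' hp2).differentiableAt (by simp)) hu
  · obtain ⟨Φ, x, rfl, hΦ⟩ := exists_eventually_isParamAt y
    refine ⟨Φ, x, rfl, hΦ, fun u hu => ?_⟩
    have h0 : ∀ᶠ x' in 𝓝 x, ballFactor e c m (Φ x') = 1 :=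
      hΦ.self_of_nhds.smooth.continuousAt.eventually (hb.eventually_ballFactor_eq_one hm h)
    have h1 : (fun x => ballFactor e c m (Φ x) • α.pb Φ x) =ᶠ[𝓝 x] α.pb Φ := by
      filter_upwards [h0] with q hq
      rw [hq, one_smul]
    have h2 : (fun x => ballFactor e c m (Φ x) * f (Φ x)) =ᶠ[𝓝 x] f ∘ Φ := by
      filter_upwards [h0] with q hq
      rw [hq, one_mul, Function.comp_apply]
    rw [extD_congr h1] at hu
    rw [h2.fderiv_eq]
    exact hf.of_param hα hΦ.self_of_nhds u hu

end IsReebBall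

end Piece
end

noncomputable section
open Filter Topology

/-! ### Gluing sets along a partial bijection -/

section Pushout

variable {Y₁ Y₂ : Type u} {U₁ : Set Y₁} {U₂ : Set Y₂}

open Classical in
/-- Two sets can be glued along a partial bijection. -/
theorem exists_partial_pushout (h0 : U₁.Nonempty) (G : Y₁ → Y₂ → Prop)
    (hG : ∀ a b, G a b → a ∈ U₁) (hr : ∀ a b b', G a b → G a b' → b = b')
    (hl : ∀ a a' b, G a b → G a' b → a = a') :
    ∃ (Z : Type u) (j₁ : Y₁ → Z) (j₂ : Y₂ → Z), InjOn j₁ U₁ ∧ InjOn j₂ U₂ ∧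
      (∀ z, (∃ y ∈ U₁, j₁ y = z) ∨ ∃ y ∈ U₂, j₂ y = z) ∧
      ∀ a ∈ U₁, ∀ b ∈ U₂, (j₁ a = j₂ b ↔ G a b) := by
  obtain ⟨a₀, ha₀⟩ := h0
  -- All of `U₁`, together with the points of `U₂` that have no partner; `z₀` is the default value
  -- off the domains.
  let Z := {a : Y₁ // a ∈ U₁} ⊕ {b : Y₂ // b ∈ U₂ ∧ ¬ ∃ a, G a b}
  let z₀ : Z := Sum.inl ⟨a₀, ha₀⟩
  let j₁ : Y₁ → Z := fun a => if h : a ∈ U₁ then Sum.inl ⟨a, h⟩ else z₀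
  let j₂ : Y₂ → Z := fun b =>
    if h : ∃ a, G a b then Sum.inl ⟨h.choose, hG _ _ h.choose_spec⟩
    else if h' : b ∈ U₂ then Sum.inr ⟨b, h', h⟩ else z₀
  have e1 : ∀ a (h : a ∈ U₁), j₁ a = Sum.inl ⟨a, h⟩ := fun a h => dif_pos h
  have e2 : ∀ a b (h : G a b), j₂ b = Sum.inl ⟨a, hG _ _ h⟩ := fun a b h => by
    have hh : ∃ a, G a b := ⟨a, h⟩
    have : j₂ b = Sum.inl ⟨hh.choose, hG _ _ hh.choose_spec⟩ := dif_pos hh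
    rw [this]
    congr 2
    exact hl _ _ _ hh.choose_spec h
  have e3 : ∀ b (h : b ∈ U₂) (h' : ¬ ∃ a, G a b), j₂ b = Sum.inr ⟨b, h, h'⟩ := fun b h h' =>
    (dif_neg h').trans (dif_pos h)
  refine ⟨Z, j₁, j₂, ?_, ?_, ?_, ?_⟩
  · intro a ha a' ha' h
    rw [e1 a ha, e1 a' ha'] at h
    exact congrArg Subtype.val (Sum.inl.inj h)
  · intro b hb b' hb' h
    by_cases h1 : ∃ a, G a b
    · obtain ⟨a, h1⟩ := h1
      rw [e2 a b h1] at h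
      by_cases h2 : ∃ a, G a b'
      · obtain ⟨a', h2⟩ := h2
        rw [e2 a' b' h2] at h
        have : a = a' := congrArg Subtype.val (Sum.inl.inj h)
        subst this
        exact hr _ _ _ h1 h2
      · rw [e3 b' hb' h2] at h
        cases h
    · rw [e3 b hb h1] at h
      by_cases h2 : ∃ a, G a b'
      · obtain ⟨a', h2⟩ := h2
        rw [e2 a' b' h2] at h
        cases h
      · rw [e3 b' hb' h2] at h
        exact congrArg Subtype.val (Sum.inr.inj h)
  · rintro (⟨a, ha⟩ | ⟨b, hb, hb'⟩)
    · exact Or.inl ⟨a, ha, e1 a ha⟩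
    · exact Or.inr ⟨b, hb, e3 b hb hb'⟩
  · intro a ha b hb
    rw [e1 a ha]
    refine ⟨fun h => ?_, fun h => (e2 a b h).symm⟩
    by_cases h1 : ∃ a, G a b
    · obtain ⟨a', h1⟩ := h1
      rw [e2 a' b h1] at h
      have : a = a' := congrArg Subtype.val (Sum.inl.inj h)
      rwa [this]
    · rw [e3 b hb h1] at h
      cases h

open Classical in
theorem exists_descend {Z : Type*} {j₁ : Y₁ → Z} {j₂ : Y₂ → Z} (h1 : InjOn j₁ U₁)
    (h2 : InjOn j₂ U₂) (f₁ : Y₁ → ℝ) (f₂ : Y₂ → ℝ)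
    (h : ∀ a ∈ U₁, ∀ b ∈ U₂, j₁ a = j₂ b → f₁ a = f₂ b) :
    ∃ f : Z → ℝ, (∀ a ∈ U₁, f (j₁ a) = f₁ a) ∧ ∀ b ∈ U₂, f (j₂ b) = f₂ b := by
  have key : ∀ z, ∃ r : ℝ, (∀ a ∈ U₁, j₁ a = z → r = f₁ a) ∧ ∀ b ∈ U₂, j₂ b = z → r = f₂ b := by
    intro z
    by_cases hz : ∃ a ∈ U₁, j₁ a = z
    · obtain ⟨a, ha, rfl⟩ := hz
      exact ⟨f₁ a, fun a' ha' e => by rw [h1 ha' ha e], fun b hb e => h a ha b hb e.symm⟩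
    · by_cases hz' : ∃ b ∈ U₂, j₂ b = z
      · obtain ⟨b, hb, rfl⟩ := hz'
        exact ⟨f₂ b, fun a ha e => (hz ⟨a, ha, e⟩).elim, fun b' hb' e => by rw [h2 hb' hb e]⟩
      · exact ⟨0, fun a ha e => (hz ⟨a, ha, e⟩).elim, fun b hb e => (hz' ⟨b, hb, e⟩).elim⟩
  choose f hf using key
  exact ⟨f, fun a ha => (hf _).1 a ha rfl, fun b hb => (hf _).2 b hb rfl⟩

end Pushout

/-! ### Local contact diffeomorphisms and transport of integrals -/

section Piece

variable {Y Z : Type*}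
  [TopologicalSpace Y] [ChartedSpace (EuclideanSpace ℝ (Fin 3)) Y] [IsManifold (𝓡 3) ∞ Y]
  [TopologicalSpace Z] [ChartedSpace (EuclideanSpace ℝ (Fin 3)) Z] [IsManifold (𝓡 3) ∞ Z]
  {α : OneForm (𝓡 3) Y} {β : OneForm (𝓡 3) Z} {U : Set Y} {g : Y → ℝ} {j : Y → Z} {y : Y}

/-- The map `j` is a local diffeomorphism on `U` which pulls `β` back to `g α`, expressed in terms
of parametrizations. -/
def IsContactPiece (α : OneForm (𝓡 3) Y) (β : OneForm (𝓡 3) Z) (U : Set Y) (g : Y → ℝ)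
    (j : Y → Z) : Prop :=
  ∀ (Φ : ℝ × ℂ → Y) (x : ℝ × ℂ), (∀ᶠ x' in 𝓝 x, IsParamAt (𝓡 3) Φ x') → Φ x ∈ U →
    IsParamAt (𝓡 3) (j ∘ Φ) x ∧ β.pb (j ∘ Φ) x = g (Φ x) • α.pb Φ x

namespace IsContactPiece

theorem contMDiffAt (h : IsContactPiece α β U g j) (hy : y ∈ U) :
    ContMDiffAt (𝓡 3) (𝓡 3) ∞ j y := by
  obtain ⟨Φ, x, rfl, hΦ⟩ := exists_eventually_isParamAt y
  obtain ⟨σ, h1, h2, h3, -⟩ := hΦ.self_of_nhds.exists_localInverse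
  have h4 := (h Φ x hΦ hy).1.smooth
  rw [← h2] at h4
  refine (ContMDiffAt.comp (Φ x) h4 h1).congr_of_eventuallyEq ?_
  filter_upwards [h3] with y' hy'
  exact (congrArg j hy').symm

theorem map_nhds_eq (h : IsContactPiece α β U g j) (hy : y ∈ U) : map j (𝓝 y) = 𝓝 (j y) := by
  obtain ⟨Φ, x, rfl, hΦ⟩ := exists_eventually_isParamAt y
  rw [← hΦ.self_of_nhds.map_nhds_eq, Filter.map_map, (h Φ x hΦ hy).1.map_nhds_eq]
  rfl

theorem isOpen_image (h : IsContactPiece α β U g j) {s : Set Y} (hs : IsOpen s) (hsU : s ⊆ U) :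
    IsOpen (j '' s) := by
  rw [isOpen_iff_mem_nhds]
  rintro _ ⟨y, hy, rfl⟩
  rw [← h.map_nhds_eq (hsU hy)]
  exact image_mem_map (hs.mem_nhds hy)

theorem pullback (h : IsContactPiece α β U g j) (hy : y ∈ U) (v : TangentSpace (𝓡 3) y) :
    β (j y) (mfderiv (𝓡 3) (𝓡 3) j y v) = g y * α y v := by
  have hj := (h.contMDiffAt hy).mdifferentiableAt (by simp)
  obtain ⟨Φ, x, rfl, hΦ⟩ := exists_eventually_isParamAt y
  obtain ⟨u, rfl⟩ := hΦ.self_of_nhds.bijective.2 v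
  have h1 := DFunLike.congr_fun (h Φ x hΦ hy).2 u
  have h2 := mfderiv_comp x hj hΦ.self_of_nhds.mdiff
  refine Eq.trans ?_ h1
  exact congrArg (fun T : (ℝ × ℂ) →L[ℝ] TangentSpace (𝓡 3) (j (Φ x)) => β (j (Φ x)) (T u)) h2.symm

theorem contMDiffAt_of_comp (h : IsContactPiece α β U g j) (hy : y ∈ U) {f : Z → ℝ} {f₁ : Y → ℝ}
    (hf : f ∘ j =ᶠ[𝓝 y] f₁) (hf₁ : ContMDiffAt (𝓡 3) 𝓘(ℝ, ℝ) ∞ f₁ y) :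
    ContMDiffAt (𝓡 3) 𝓘(ℝ, ℝ) ∞ f (j y) := by
  obtain ⟨Φ, x, rfl, hΦ⟩ := exists_eventually_isParamAt y
  refine (h Φ x hΦ hy).1.contMDiffAt_of_comp ?_
  have h1 : ContDiffAt ℝ ∞ (f₁ ∘ Φ) x := (hf₁.comp x hΦ.self_of_nhds.smooth).contDiffAt
  exact h1.congr_of_eventuallyEq (hΦ.self_of_nhds.smooth.continuousAt.eventually hf)

theorem reebInvariant (h : IsContactPiece α β U g j) (hU : IsOpen U) (hβ : IsContactForm β)
    {f : Z → ℝ} (hf : ContMDiff (𝓡 3) 𝓘(ℝ, ℝ) ∞ f) {f₁ : Y → ℝ} (he : ∀ y ∈ U, f (j y) = f₁ y)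
    {Φ : ℝ × ℂ → Y} {x : ℝ × ℂ} (hΦ : ∀ᶠ x' in 𝓝 x, IsParamAt (𝓡 3) Φ x') (hx : Φ x ∈ U)
    (hR : ∀ u, (∀ w, extD (fun x => g (Φ x) • α.pb Φ x) x u w = 0) →
      fderiv ℝ (f₁ ∘ Φ) x u = 0)
    (v : TangentSpace (𝓡 3) (j (Φ x))) (hv : ∀ w, β.d (j (Φ x)) v w = 0) :
    dFun (𝓡 3) f (j (Φ x)) v = 0 := by
  have hUx : ∀ᶠ x' in 𝓝 x, Φ x' ∈ U :=
    hΦ.self_of_nhds.smooth.continuousAt.eventually (hU.mem_nhds hx)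
  have h1 : β.pb (j ∘ Φ) =ᶠ[𝓝 x] fun x => g (Φ x) • α.pb Φ x := by
    filter_upwards [hΦ.eventually_nhds, hUx] with x' h1 h2 using (h Φ x' h1 h2).2
  have h2 : f ∘ (j ∘ Φ) =ᶠ[𝓝 x] f₁ ∘ Φ := by
    filter_upwards [hUx] with x' hx' using he _ hx'
  refine reebInvariant_of_param hβ hf (h Φ x hΦ hx).1 (fun u hu => ?_) v hv
  rw [h2.fderiv_eq]
  rw [extD_congr h1] at hu
  exact hR u hu

theorem dFun_ne_zero_iff (h : IsContactPiece α β U g j) {f : Z → ℝ}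
    (hf : ContMDiff (𝓡 3) 𝓘(ℝ, ℝ) ∞ f) {f₁ : Y → ℝ} {Φ : ℝ × ℂ → Y} {x : ℝ × ℂ}
    (he : f ∘ j =ᶠ[𝓝 (Φ x)] f₁) (hΦ : ∀ᶠ x' in 𝓝 x, IsParamAt (𝓡 3) Φ x') (hx : Φ x ∈ U) :
    dFun (𝓡 3) f (j (Φ x)) ≠ 0 ↔ fderiv ℝ (f₁ ∘ Φ) x ≠ 0 := by
  have h2 : f ∘ (j ∘ Φ) =ᶠ[𝓝 x] f₁ ∘ Φ := hΦ.self_of_nhds.smooth.continuousAt.eventually he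
  have := dFun_eq_zero_iff hf (h Φ x hΦ hx).1
  rw [h2.fderiv_eq] at this
  exact not_congr this

end IsContactPiece

theorem contDiffAt_smul_pb (hα : IsContactForm α) {Φ : ℝ × ℂ → Y} {x : ℝ × ℂ}
    (hΦ : IsParamAt (𝓡 3) Φ x) (hg : ContMDiffAt (𝓡 3) 𝓘(ℝ, ℝ) ∞ g (Φ x)) :
    ContDiffAt ℝ ∞ (fun x => g (Φ x) • α.pb Φ x) x :=
  (hg.comp x hΦ.smooth).contDiffAt.smul (hα.smooth.contDiffAt_pb hΦ.smooth)

theorem contactAt_smul_pb (hα : IsContactForm α) {Φ : ℝ × ℂ → Y} {x : ℝ × ℂ}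
    (hΦ : IsParamAt (𝓡 3) Φ x) (hg : ContMDiffAt (𝓡 3) 𝓘(ℝ, ℝ) ∞ g (Φ x)) (h0 : g (Φ x) ≠ 0) :
    ContactAt (fun x => g (Φ x) • α.pb Φ x) x :=
  (hα.contactAt_pb hΦ).smul ((hg.comp x hΦ.smooth).contDiffAt.differentiableAt (by simp))
    ((hα.smooth.contDiffAt_pb hΦ.smooth).differentiableAt (by simp)) h0

end Piece
end

noncomputable section
open Filter Topology

/-! ### Gluing two contact manifolds -/

section Pieces

variable {Y Y₁ Y₂ Z : Type*}
  [TopologicalSpace Y] [ChartedSpace (EuclideanSpace ℝ (Fin 3)) Y] [IsManifold (𝓡 3) ∞ Y]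
  [TopologicalSpace Y₁] [ChartedSpace (EuclideanSpace ℝ (Fin 3)) Y₁] [IsManifold (𝓡 3) ∞ Y₁]
  [TopologicalSpace Y₂] [ChartedSpace (EuclideanSpace ℝ (Fin 3)) Y₂] [IsManifold (𝓡 3) ∞ Y₂]
  {α : OneForm (𝓡 3) Y} {α₁ : OneForm (𝓡 3) Y₁} {α₂ : OneForm (𝓡 3) Y₂}

theorem contactGerm_smul_pb {Φ Φ' : ℝ × ℂ → Y} {x y : ℝ × ℂ}
    (h : ∀ᶠ x' in 𝓝 x, IsParamAt (𝓡 3) Φ x') (h' : ∀ᶠ y' in 𝓝 y, IsParamAt (𝓡 3) Φ' y')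
    (he : Φ x = Φ' y) (α : OneForm (𝓡 3) Y) (g : Y → ℝ) :
    ContactGerm Φ Φ' (fun x => g (Φ x) • α.pb Φ x) (fun x => g (Φ' x) • α.pb Φ' x) x y :=
  h'.self_of_nhds.contactGerm h.self_of_nhds.smooth he (h'.mono fun _ h => h.mdiff)
    (fun y => g y • α y)

/-- The part of the domain of `Φ` where it parametrizes an open piece of `U`. -/
def paramDomain (U : Set Y) (Φ : ℝ × ℂ → Y) : Set (ℝ × ℂ) :=
  {x | ∀ᶠ x' in 𝓝 x, IsParamAt (𝓡 3) Φ x' ∧ Φ x' ∈ U}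

theorem mem_paramDomain {U : Set Y} (hU : IsOpen U) {Φ : ℝ × ℂ → Y} {x : ℝ × ℂ}
    (h : ∀ᶠ x' in 𝓝 x, IsParamAt (𝓡 3) Φ x') (hx : Φ x ∈ U) : x ∈ paramDomain U Φ :=
  h.and (h.self_of_nhds.smooth.continuousAt.eventually (hU.mem_nhds hx))

theorem exists_injOn_of_mem_paramDomain {U : Set Y} {j : Y → Z} (hj : InjOn j U) {Φ : ℝ × ℂ → Y}
    {x : ℝ × ℂ} (h : x ∈ paramDomain U Φ) : ∃ N ∈ 𝓝 x, InjOn (j ∘ Φ) N := by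
  obtain ⟨σ, -, -, -, h4⟩ := h.self_of_nhds.1.exists_localInverse
  refine ⟨_, h.and h4, fun a ha b hb hab => ?_⟩
  rw [← ha.2, ← hb.2, hj ha.1.2 hb.1.2 hab]

/-- Gluing of two contact manifolds along a contact correspondence. -/
theorem exists_contact_pieces (hα₁ : IsContactForm α₁) (hα₂ : IsContactForm α₂)
    {U₁ : Set Y₁} {U₂ : Set Y₂} (hU₁ : IsOpen U₁) (hU₂ : IsOpen U₂) {g₁ : Y₁ → ℝ} {g₂ : Y₂ → ℝ}
    (hg₁ : ∀ y ∈ U₁, ContMDiffAt (𝓡 3) 𝓘(ℝ, ℝ) ∞ g₁ y) (hg₂ : ∀ y ∈ U₂, ContMDiffAt (𝓡 3) 𝓘(ℝ, ℝ) ∞ g₂ y)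
    (h0₁ : ∀ y ∈ U₁, 0 < g₁ y) (h0₂ : ∀ y ∈ U₂, 0 < g₂ y) {j₁ : Y₁ → Z} {j₂ : Y₂ → Z}
    (hj₁ : InjOn j₁ U₁) (hj₂ : InjOn j₂ U₂)
    (hcover : ∀ z, (∃ y ∈ U₁, j₁ y = z) ∨ ∃ y ∈ U₂, j₂ y = z)
    (hcross : ∀ a ∈ U₁, ∀ b ∈ U₂, j₁ a = j₂ b → ∃ (Φ₁ : ℝ × ℂ → Y₁) (x₁ : ℝ × ℂ) (Φ₂ : ℝ × ℂ → Y₂)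
      (x₂ : ℝ × ℂ), Φ₁ x₁ = a ∧ Φ₂ x₂ = b ∧ (∀ᶠ x in 𝓝 x₁, IsParamAt (𝓡 3) Φ₁ x) ∧
      (∀ᶠ x in 𝓝 x₂, IsParamAt (𝓡 3) Φ₂ x) ∧
      ContactGerm (j₁ ∘ Φ₁) (j₂ ∘ Φ₂) (fun x => g₁ (Φ₁ x) • α₁.pb Φ₁ x)
        (fun x => g₂ (Φ₂ x) • α₂.pb Φ₂ x) x₁ x₂) :
    ∃ (_ : TopologicalSpace Z) (_ : ChartedSpace (EuclideanSpace ℝ (Fin 3)) Z)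
      (_ : IsManifold (𝓡 3) ∞ Z) (β : OneForm (𝓡 3) Z), IsContactForm β ∧
      IsContactPiece α₁ β U₁ g₁ j₁ ∧ IsContactPiece α₂ β U₂ g₂ j₂ := by
  have hX : ∀ (Φ : ℝ × ℂ → Y₁) (Ψ : ℝ × ℂ → Y₂) (x y : ℝ × ℂ), x ∈ paramDomain U₁ Φ →
      y ∈ paramDomain U₂ Ψ → j₁ (Φ x) = j₂ (Ψ y) →
      ContactGerm (j₁ ∘ Φ) (j₂ ∘ Ψ) (fun x => g₁ (Φ x) • α₁.pb Φ x)
        (fun x => g₂ (Ψ x) • α₂.pb Ψ x) x y := by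
    intro Φ Ψ x y hx hy he
    obtain ⟨Φ₁, x₁, Φ₂, x₂, h1, h2, h3, h4, h5⟩ :=
      hcross _ hx.self_of_nhds.2 _ hy.self_of_nhds.2 he
    exact (((contactGerm_smul_pb (hx.mono fun _ h => h.1) h3 h1.symm α₁ g₁).map j₁).trans h5).trans
      ((contactGerm_smul_pb h4 (hy.mono fun _ h => h.1) h2 α₂ g₂).map j₂)
  -- The index set consists of all maps from `ℝ × ℂ` into either manifold, restricted to the open
  -- set where they are parametrizations with values in the piece; no atlas has to be chosen.
  obtain ⟨t, cs, mf, β, hβ, h⟩ := exists_contact_gluing_of_locallyInjective spaceEquiv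
    (ι := (ℝ × ℂ → Y₁) ⊕ (ℝ × ℂ → Y₂)) (Y := Z)
    (Sum.elim (paramDomain U₁) (paramDomain U₂))
    (by rintro (Φ | Φ) <;> exact isOpen_setOfPred_eventually_nhds)
    (Sum.elim (fun Φ => j₁ ∘ Φ) (fun Φ => j₂ ∘ Φ))
    (by
      rintro (Φ | Φ) x hx
      · exact exists_injOn_of_mem_paramDomain hj₁ hx
      · exact exists_injOn_of_mem_paramDomain hj₂ hx)
    (fun z => by
      rcases hcover z with ⟨y, hy, rfl⟩ | ⟨y, hy, rfl⟩
      · obtain ⟨Φ, x, rfl, hΦ⟩ := exists_eventually_isParamAt y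
        exact ⟨Sum.inl Φ, x, mem_paramDomain hU₁ hΦ hy, rfl⟩
      · obtain ⟨Φ, x, rfl, hΦ⟩ := exists_eventually_isParamAt y
        exact ⟨Sum.inr Φ, x, mem_paramDomain hU₂ hΦ hy, rfl⟩)
    (Sum.elim (fun Φ x => g₁ (Φ x) • α₁.pb Φ x) (fun Φ x => g₂ (Φ x) • α₂.pb Φ x))
    (by
      rintro (Φ | Φ) x hx
      · exact (contDiffAt_smul_pb hα₁ (Eventually.self_of_nhds hx).1
          (hg₁ _ (Eventually.self_of_nhds hx).2)).contDiffWithinAt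
      · exact (contDiffAt_smul_pb hα₂ (Eventually.self_of_nhds hx).1
          (hg₂ _ (Eventually.self_of_nhds hx).2)).contDiffWithinAt)
    (by
      rintro (Φ | Φ) x hx
      · exact contactAt_smul_pb hα₁ (Eventually.self_of_nhds hx).1
          (hg₁ _ (Eventually.self_of_nhds hx).2) (h0₁ _ (Eventually.self_of_nhds hx).2).ne'
      · exact contactAt_smul_pb hα₂ (Eventually.self_of_nhds hx).1
          (hg₂ _ (Eventually.self_of_nhds hx).2) (h0₂ _ (Eventually.self_of_nhds hx).2).ne')
    (by
      rintro (Φ | Φ) (Ψ | Ψ) x y hx hy he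
      · exact Or.inl ((contactGerm_smul_pb (Eventually.mono hx fun _ h => h.1)
          (Eventually.mono hy fun _ h => h.1) (hj₁ (Eventually.self_of_nhds hx).2
          (Eventually.self_of_nhds hy).2 he) α₁ g₁).map j₁)
      · exact Or.inl (hX Φ Ψ x y hx hy he)
      · exact Or.inr (hX Ψ Φ y x hy hx he.symm)
      · exact Or.inl ((contactGerm_smul_pb (Eventually.mono hx fun _ h => h.1)
          (Eventually.mono hy fun _ h => h.1) (hj₂ (Eventually.self_of_nhds hx).2
          (Eventually.self_of_nhds hy).2 he) α₂ g₂).map j₂))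
  exact ⟨t, cs, mf, β, hβ,
    fun Φ x hΦ hx => h (Sum.inl Φ) x (mem_paramDomain hU₁ hΦ hx),
    fun Φ x hΦ hx => h (Sum.inr Φ) x (mem_paramDomain hU₂ hΦ hx)⟩

end Pieces
end

/-! ### The contact connected sum along symmetric balls -/

noncomputable section
open Filter Topology

/-- The factor `N` cancels the `1/N` in `I^*θ = θ/N`, so the inversion carries the rescaled form of
one side to that of the other. -/
theorem shellFactorInv_contactInversion {c₁ c₂ : ℝ → ℝ} {p : ℝ × ℂ} (hp : gaugePow p ≠ 0) :
    shellFactorInv c₁ c₂ (Complex.normSq (contactInversion p).2, (contactInversion p).1) =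
      gaugePow p * shellFactor c₁ c₂ (Complex.normSq p.2, p.1) := by
  have h1 := gaugePow_contactInversion hp
  rw [gaugePow_eq] at h1
  rw [shellFactorInv]
  simp only [h1]
  rw [normSq_contactInversion hp, contactInversion]
  have e1 : Complex.normSq p.2 / gaugePow p / (gaugePow p)⁻¹ = Complex.normSq p.2 := by field_simp
  have e2 : -(-p.1 / gaugePow p) / (gaugePow p)⁻¹ = p.1 := by field_simp
  simp only [e1, e2, div_inv_eq_mul]
  ring

theorem contactInversion_mem_shell {p : ℝ × ℂ} (h1 : 1 / 2 < gaugePow p) (h2 : gaugePow p < 2) :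
    1 / 2 < gaugePow (contactInversion p) ∧ gaugePow (contactInversion p) < 2 := by
  have h0 : 0 < gaugePow p := by linarith
  rw [gaugePow_contactInversion h0.ne', inv_eq_one_div, lt_div_iff₀ h0, div_lt_iff₀ h0]
  constructor <;> linarith

/-- Off these exceptional sets either the monotonicity in `t²` (`N < 5/4`) or the unchanged integral
(`N > 5/4`) gives noncritical points. -/
theorem dense_generic_shell :
    Dense {p : ℝ × ℂ | p.1 ≠ 0 ∧ p.2 ≠ 0 ∧ gaugePow p ≠ 5 / 4} := by
  have h1 : Dense {p : ℝ × ℂ | p.1 ≠ 0 ∧ p.2 ≠ 0} :=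
    (dense_compl_singleton (0 : ℝ)).prod (dense_compl_singleton (0 : ℂ))
  refine dense_closure.1 (h1.mono fun p hp => ?_)
  by_cases h : gaugePow p = 5 / 4
  · have ht : Tendsto (fun s : ℝ => ((s * p.1, p.2) : ℝ × ℂ)) (𝓝[<] 1) (𝓝 p) := by
      have : ContinuousAt (fun s : ℝ => ((s * p.1, p.2) : ℝ × ℂ)) 1 := by fun_prop
      have h2 : Tendsto (fun s : ℝ => ((s * p.1, p.2) : ℝ × ℂ)) (𝓝 1) (𝓝 (1 * p.1, p.2)) := this
      rw [one_mul] at h2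
      exact h2.mono_left nhdsWithin_le_nhds
    refine mem_closure_of_tendsto ht ?_
    filter_upwards [Ioo_mem_nhdsLT (show (0 : ℝ) < 1 by norm_num)] with s hs
    refine ⟨mul_ne_zero hs.1.ne' hp.1, hp.2, ?_⟩
    rw [← h, gaugePow_eq, gaugePow_eq]
    have h3 : 0 < p.1 ^ 2 := by have := hp.1; positivity
    have h4 : s ^ 2 < 1 := by nlinarith [hs.1, hs.2]
    refine ne_of_lt ?_
    change Complex.normSq p.2 ^ 2 + 4 * (s * p.1) ^ 2 < _
    nlinarith
  · exact subset_closure ⟨hp.1, hp.2, h⟩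

section Closure

variable {Y Z : Type*}
  [TopologicalSpace Y] [ChartedSpace (EuclideanSpace ℝ (Fin 3)) Y] [IsManifold (𝓡 3) ∞ Y]
  [TopologicalSpace Z] [ChartedSpace (EuclideanSpace ℝ (Fin 3)) Z] [IsManifold (𝓡 3) ∞ Z]
  {α : OneForm (𝓡 3) Y} {β : OneForm (𝓡 3) Z} {U : Set Y} {g : Y → ℝ} {j : Y → Z} {y : Y}

theorem IsContactPiece.mem_closure (h : IsContactPiece α β U g j) (hU : IsOpen U) (hy : y ∈ U)
    {f : Z → ℝ} (hf : ContMDiff (𝓡 3) 𝓘(ℝ, ℝ) ∞ f) {f₁ : Y → ℝ} (hf₁ : IsReebIntegral α f₁)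
    (he : f ∘ j =ᶠ[𝓝 y] f₁) : j y ∈ closure {z | dFun (𝓡 3) f z ≠ 0} := by
  rw [mem_closure_iff_frequently, ← h.map_nhds_eq hy, Filter.frequently_map]
  refine ((mem_closure_iff_frequently.1 (hf₁.dense y)).and_eventually
    (he.eventually_nhds.and (hU.mem_nhds hy))).mono ?_
  rintro y' ⟨h1, h2, h3⟩
  obtain ⟨Φ, x, rfl, hΦ⟩ := exists_eventually_isParamAt y'
  exact (h.dFun_ne_zero_iff hf h2 hΦ h3).2
    ((not_congr (dFun_eq_zero_iff hf₁.smooth hΦ.self_of_nhds)).1 h1)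

theorem IsContactPiece.exists_separation [T2Space Y] (h : IsContactPiece α β U g j) (hU : IsOpen U)
    (hj : InjOn j U) {a b : Y} (ha : a ∈ U) (hb : b ∈ U) (hab : j a ≠ j b) :
    ∃ u v : Set Z, IsOpen u ∧ IsOpen v ∧ j a ∈ u ∧ j b ∈ v ∧ Disjoint u v := by
  obtain ⟨u, v, hu, hv, hau, hbv, huv⟩ := t2_separation fun e => hab (congrArg j e)
  refine ⟨_, _, h.isOpen_image (hu.inter hU) inter_subset_right,
    h.isOpen_image (hv.inter hU) inter_subset_right,
    mem_image_of_mem _ ⟨hau, ha⟩, mem_image_of_mem _ ⟨hbv, hb⟩, Set.disjoint_left.2 ?_⟩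
  rintro _ ⟨y, hy, rfl⟩ ⟨y', hy', he⟩
  exact Set.disjoint_left.1 huv hy.1 (hj hy'.2 hy.2 he ▸ hy'.1)

end Closure

section Sum

variable {Y₁ Y₂ : Type u}
  [TopologicalSpace Y₁] [T2Space Y₁] [ChartedSpace (EuclideanSpace ℝ (Fin 3)) Y₁]
  [IsManifold (𝓡 3) ∞ Y₁]
  [TopologicalSpace Y₂] [T2Space Y₂] [ChartedSpace (EuclideanSpace ℝ (Fin 3)) Y₂]
  [IsManifold (𝓡 3) ∞ Y₂]
  {α₁ : OneForm (𝓡 3) Y₁} {α₂ : OneForm (𝓡 3) Y₂} {f₁ : Y₁ → ℝ} {f₂ : Y₂ → ℝ}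
  {e₁ : ℝ × ℂ → Y₁} {e₂ : ℝ × ℂ → Y₂} {c₁ c₂ : ℝ → ℝ}

/-- The connected sum of two contact manifolds along `e₁` and `e₂`, with the contact form given by
the shell factors. -/
structure IsBallSum {Z : Type u} [TopologicalSpace Z] [ChartedSpace (EuclideanSpace ℝ (Fin 3)) Z]
    (α₁ : OneForm (𝓡 3) Y₁) (α₂ : OneForm (𝓡 3) Y₂) (e₁ : ℝ × ℂ → Y₁) (e₂ : ℝ × ℂ → Y₂)
    (c₁ c₂ : ℝ → ℝ) (α : OneForm (𝓡 3) Z) (j₁ : Y₁ → Z) (j₂ : Y₂ → Z) : Prop where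
  injOn₁ : InjOn j₁ (ballCompl e₁)
  injOn₂ : InjOn j₂ (ballCompl e₂)
  cover : ∀ z, (∃ y ∈ ballCompl e₁, j₁ y = z) ∨ ∃ y ∈ ballCompl e₂, j₂ y = z
  glue : ∀ a ∈ ballCompl e₁, ∀ b ∈ ballCompl e₂, (j₁ a = j₂ b ↔
    ∃ p, 1 / 2 < gaugePow p ∧ gaugePow p < 2 ∧ e₁ p = a ∧ e₂ (contactInversion p) = b)
  piece₁ : IsContactPiece α₁ α (ballCompl e₁) (ballFactor e₁ c₁ (shellFactor c₁ c₂)) j₁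
  piece₂ : IsContactPiece α₂ α (ballCompl e₂) (ballFactor e₂ c₂ (shellFactorInv c₁ c₂)) j₂

theorem IsReebBall.isShellFactor (h₁ : IsReebBall α₁ f₁ e₁ c₁) (h₂ : IsReebBall α₂ f₂ e₂ c₂) :
    IsShellFactor c₁ (shellFactor c₁ c₂) :=
  isShellFactor_shellFactor h₁.contDiffAt h₂.contDiffAt h₁.pos h₂.pos

theorem IsReebBall.isShellFactorInv (h₁ : IsReebBall α₁ f₁ e₁ c₁) (h₂ : IsReebBall α₂ f₂ e₂ c₂) :
    IsShellFactor c₂ (shellFactorInv c₁ c₂) :=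
  isShellFactor_shellFactorInv h₁.contDiffAt h₂.contDiffAt h₁.pos h₂.pos

/-- The inversion, read in the coordinates of the two balls, is the transition germ between the
pieces; being an involution of the shell it defines a partial bijection. -/
theorem exists_isBallSum (hα₁ : IsContactForm α₁) (hα₂ : IsContactForm α₂)
    (h₁ : IsReebBall α₁ f₁ e₁ c₁) (h₂ : IsReebBall α₂ f₂ e₂ c₂) :
    ∃ (Z : Type u) (_ : TopologicalSpace Z) (_ : ChartedSpace (EuclideanSpace ℝ (Fin 3)) Z)
      (_ : IsManifold (𝓡 3) ∞ Z) (α : OneForm (𝓡 3) Z) (j₁ : Y₁ → Z) (j₂ : Y₂ → Z),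
      IsContactForm α ∧ IsBallSum α₁ α₂ e₁ e₂ c₁ c₂ α j₁ j₂ := by
  have h0 : (ballCompl e₁).Nonempty := by
    have hp : (((1 / 2 : ℝ), 0) : ℝ × ℂ) ∈ standardBall 2 := by
      change gaugePow _ < 2
      rw [gaugePow_eq]
      norm_num
    refine ⟨_, (h₁.mem_ballCompl_iff hp).2 ?_⟩
    rw [gaugePow_eq]
    norm_num
  obtain ⟨Z, j₁, j₂, i₁, i₂, hcov, hglue⟩ := exists_partial_pushout (U₂ := ballCompl e₂) h0
    (fun a b => ∃ p, 1 / 2 < gaugePow p ∧ gaugePow p < 2 ∧ e₁ p = a ∧ e₂ (contactInversion p) = b)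
    (by
      rintro a b ⟨p, hp, hp', rfl, -⟩
      exact (h₁.mem_ballCompl_iff hp').2 hp)
    (by
      rintro a b b' ⟨p, hp, hp', rfl, rfl⟩ ⟨q, hq, hq', he, rfl⟩
      rw [h₁.injOn hq' hp' he])
    (by
      rintro a a' b ⟨p, hp, hp', rfl, rfl⟩ ⟨q, hq, hq', rfl, he⟩
      have h := h₂.injOn (contactInversion_mem_shell hq hq').2
        (contactInversion_mem_shell hp hp').2 he
      have h' := congrArg contactInversion h
      rw [contactInversion_contactInversion (by linarith : gaugePow q ≠ 0),
        contactInversion_contactInversion (by linarith : gaugePow p ≠ 0)] at h'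
      rw [h'])
  have hm₁ := h₁.isShellFactor h₂
  have hm₂ := h₁.isShellFactorInv h₂
  obtain ⟨t, cs, mf, α, hα, q₁, q₂⟩ := exists_contact_pieces (Z := Z) hα₁ hα₂ h₁.isOpen_ballCompl
    h₂.isOpen_ballCompl
    (g₁ := ballFactor e₁ c₁ (shellFactor c₁ c₂)) (g₂ := ballFactor e₂ c₂ (shellFactorInv c₁ c₂))
    (fun y hy => h₁.contMDiffAt_ballFactor hα₁ hm₁ hy)
    (fun y hy => h₂.contMDiffAt_ballFactor hα₂ hm₂ hy)
    (fun y hy => h₁.ballFactor_pos hm₁ hy) (fun y hy => h₂.ballFactor_pos hm₂ hy) i₁ i₂ hcov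
    (by
      intro a ha b hb hab
      obtain ⟨p, hp, hp', rfl, rfl⟩ := (hglue a ha b hb).1 hab
      have hI := contactInversion_mem_shell hp hp'
      refine ⟨e₁, p, e₂, contactInversion p, rfl, rfl, ?_, ?_, contactInversion,
        (contDiffAt_contactInversion (by linarith)).1, rfl, ?_⟩
      · filter_upwards [(isOpen_standardBall 2).mem_nhds hp'] with q hq using h₁.isParamAt hα₁ hq
      · filter_upwards [(isOpen_standardBall 2).mem_nhds hI.2] with q hq using h₂.isParamAt hα₂ hq
      · filter_upwards [isOpen_shell.mem_nhds ⟨hp, hp'⟩] with q hq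
        have hqI := contactInversion_mem_shell hq.1 hq.2
        have hq0 : gaugePow q ≠ 0 := by linarith [hq.1]
        refine ⟨((hglue _ ((h₁.mem_ballCompl_iff hq.2).2 hq.1) _
          ((h₂.mem_ballCompl_iff hqI.2).2 hqI.1)).2 ⟨q, hq.1, hq.2, rfl, rfl⟩).symm, ?_⟩
        have e1 := h₁.ballFactor_smul_pb (m := shellFactor c₁ c₂) hq.2
        have e2 := h₂.ballFactor_smul_pb (m := shellFactorInv c₁ c₂) hqI.2
        refine (congrArg (fun T : ℝ × ℂ →L[ℝ] ℝ => T.comp (fderiv ℝ contactInversion q)) e2).trans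
          (Eq.trans ?_ e1.symm)
        rw [ContinuousLinearMap.smul_comp, (contDiffAt_contactInversion hq0).2, smul_smul,
          shellFactorInv_contactInversion hq0]
        congr 1
        field_simp)
  exact ⟨Z, t, cs, mf, α, j₁, j₂, hα, i₁, i₂, hcov, hglue, q₁, q₂⟩

namespace IsBallSum

variable {Z : Type u} [TopologicalSpace Z] [ChartedSpace (EuclideanSpace ℝ (Fin 3)) Z]
  [IsManifold (𝓡 3) ∞ Z] {α : OneForm (𝓡 3) Z} {j₁ : Y₁ → Z} {j₂ : Y₂ → Z}

theorem glue_shell (h : IsBallSum α₁ α₂ e₁ e₂ c₁ c₂ α j₁ j₂)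
    (h₁ : IsReebBall α₁ f₁ e₁ c₁) (h₂ : IsReebBall α₂ f₂ e₂ c₂) {p : ℝ × ℂ}
    (hp : 1 / 2 < gaugePow p) (hp' : gaugePow p < 2) : j₁ (e₁ p) = j₂ (e₂ (contactInversion p)) :=
  have hI := contactInversion_mem_shell hp hp'
  (h.glue _ ((h₁.mem_ballCompl_iff hp').2 hp) _ ((h₂.mem_ballCompl_iff hI.2).2 hI.1)).2
    ⟨p, hp, hp', rfl, rfl⟩

theorem glue_shell' (h : IsBallSum α₁ α₂ e₁ e₂ c₁ c₂ α j₁ j₂)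
    (h₁ : IsReebBall α₁ f₁ e₁ c₁) (h₂ : IsReebBall α₂ f₂ e₂ c₂) {p : ℝ × ℂ}
    (hp : 1 / 2 < gaugePow p) (hp' : gaugePow p < 2) : j₂ (e₂ p) = j₁ (e₁ (contactInversion p)) := by
  have hI := contactInversion_mem_shell hp hp'
  rw [h.glue_shell h₁ h₂ hI.1 hI.2, contactInversion_contactInversion (by linarith)]

/-- The parts with `N ≤ 1` removed have disjoint open images, because inversion exchanges `N > 1`
and `N < 1`. If one of two points is not in such a part, it lies in the shell and can be seen in the
other, Hausdorff, piece. -/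
theorem t2Space (h : IsBallSum α₁ α₂ e₁ e₂ c₁ c₂ α j₁ j₂)
    (h₁ : IsReebBall α₁ f₁ e₁ c₁) (h₂ : IsReebBall α₂ f₂ e₂ c₂) : T2Space Z := by
  have hs₁ : (e₁ '' {p | gaugePow p ≤ 1})ᶜ ⊆ ballCompl e₁ := compl_subset_compl.2
    (image_mono fun p (hp : gaugePow p ≤ 1 / 2) => show gaugePow p ≤ 1 by linarith)
  have hs₂ : (e₂ '' {p | gaugePow p ≤ 1})ᶜ ⊆ ballCompl e₂ := compl_subset_compl.2
    (image_mono fun p (hp : gaugePow p ≤ 1 / 2) => show gaugePow p ≤ 1 by linarith)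
  have hdis : Disjoint (j₁ '' (e₁ '' {p | gaugePow p ≤ 1})ᶜ) (j₂ '' (e₂ '' {p | gaugePow p ≤ 1})ᶜ) := by
    rw [Set.disjoint_left]
    rintro _ ⟨a, ha, rfl⟩ ⟨b, hb, hab⟩
    obtain ⟨p, hp, hp', rfl, rfl⟩ := (h.glue a (hs₁ ha) b (hs₂ hb)).1 hab.symm
    have k1 : 1 < gaugePow p := not_le.1 fun h => ha ⟨p, h, rfl⟩
    refine hb ⟨_, ?_, rfl⟩
    change gaugePow _ ≤ 1
    rw [gaugePow_contactInversion (by linarith)]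
    exact inv_le_one_of_one_le₀ k1.le
  have key3 : ∀ a ∈ ballCompl e₁, ∀ b ∈ ballCompl e₂, j₁ a ≠ j₂ b →
      ∃ u v : Set Z, IsOpen u ∧ IsOpen v ∧ j₁ a ∈ u ∧ j₂ b ∈ v ∧ Disjoint u v := by
    intro a ha b hb hab
    by_cases h3 : a ∈ (e₁ '' {p | gaugePow p ≤ 1})ᶜ
    · by_cases h4 : b ∈ (e₂ '' {p | gaugePow p ≤ 1})ᶜ
      · exact ⟨_, _, h.piece₁.isOpen_image (h₁.isOpen_compl_image (by norm_num)) hs₁,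
          h.piece₂.isOpen_image (h₂.isOpen_compl_image (by norm_num)) hs₂,
          mem_image_of_mem _ h3, mem_image_of_mem _ h4, hdis⟩
      · obtain ⟨q, hq, rfl⟩ := not_not.1 h4
        have hq2 : gaugePow q < 2 := lt_of_le_of_lt hq (by norm_num)
        have hq1 := (h₂.mem_ballCompl_iff hq2).1 hb
        have hI := contactInversion_mem_shell hq1 hq2
        rw [h.glue_shell' h₁ h₂ hq1 hq2] at hab ⊢
        exact h.piece₁.exists_separation h₁.isOpen_ballCompl h.injOn₁ ha
          ((h₁.mem_ballCompl_iff hI.2).2 hI.1) hab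
    · obtain ⟨q, hq, rfl⟩ := not_not.1 h3
      have hq2 : gaugePow q < 2 := lt_of_le_of_lt hq (by norm_num)
      have hq1 := (h₁.mem_ballCompl_iff hq2).1 ha
      have hI := contactInversion_mem_shell hq1 hq2
      rw [h.glue_shell h₁ h₂ hq1 hq2] at hab ⊢
      exact h.piece₂.exists_separation h₂.isOpen_ballCompl h.injOn₂
        ((h₂.mem_ballCompl_iff hI.2).2 hI.1) hb hab
  refine ⟨fun z z' hzz' => ?_⟩
  rcases h.cover z with ⟨a, ha, rfl⟩ | ⟨a, ha, rfl⟩ <;>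
    rcases h.cover z' with ⟨b, hb, rfl⟩ | ⟨b, hb, rfl⟩
  · exact h.piece₁.exists_separation h₁.isOpen_ballCompl h.injOn₁ ha hb hzz'
  · exact key3 a ha b hb hzz'
  · obtain ⟨u, v, k1, k2, k3, k4, k5⟩ := key3 b hb a ha hzz'.symm
    exact ⟨v, u, k2, k1, k4, k3, k5.symm⟩
  · exact h.piece₂.exists_separation h₂.isOpen_ballCompl h.injOn₂ ha hb hzz'

end IsBallSum

theorem IsReebBall.isOpen_image_lt_one (h₁ : IsReebBall α₁ f₁ e₁ c₁) (hα₁ : IsContactForm α₁) :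
    IsOpen (e₁ '' {p | gaugePow p < 1}) := by
  rw [isOpen_iff_mem_nhds]
  rintro _ ⟨p, hp, rfl⟩
  have hp' : gaugePow p < 2 := lt_trans hp (by norm_num)
  rw [← (h₁.isParamAt hα₁ hp').map_nhds_eq]
  exact image_mem_map ((isOpen_standardBall 1).mem_nhds hp)

namespace IsBallSum

variable {Z : Type u} [TopologicalSpace Z] [ChartedSpace (EuclideanSpace ℝ (Fin 3)) Z]
  [IsManifold (𝓡 3) ∞ Z] {α : OneForm (𝓡 3) Z} {j₁ : Y₁ → Z} {j₂ : Y₂ → Z}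

/-- The images of the two compact pieces without `{N < 1}` cover: a shell point with `N < 1` on one
side has `N > 1` on the other. -/
theorem compactSpace [CompactSpace Y₁] [CompactSpace Y₂]
    (h : IsBallSum α₁ α₂ e₁ e₂ c₁ c₂ α j₁ j₂) (hα₁ : IsContactForm α₁) (hα₂ : IsContactForm α₂)
    (h₁ : IsReebBall α₁ f₁ e₁ c₁) (h₂ : IsReebBall α₂ f₂ e₂ c₂) : CompactSpace Z := by
  have hs₁ : (e₁ '' {p | gaugePow p < 1})ᶜ ⊆ ballCompl e₁ := compl_subset_compl.2
    (image_mono fun p (hp : gaugePow p ≤ 1 / 2) => show gaugePow p < 1 by linarith)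
  have hs₂ : (e₂ '' {p | gaugePow p < 1})ᶜ ⊆ ballCompl e₂ := compl_subset_compl.2
    (image_mono fun p (hp : gaugePow p ≤ 1 / 2) => show gaugePow p < 1 by linarith)
  have k1 : IsCompact (j₁ '' (e₁ '' {p | gaugePow p < 1})ᶜ) :=
    (h₁.isOpen_image_lt_one hα₁).isClosed_compl.isCompact.image_of_continuousOn fun y hy =>
      (h.piece₁.contMDiffAt (hs₁ hy)).continuousAt.continuousWithinAt
  have k2 : IsCompact (j₂ '' (e₂ '' {p | gaugePow p < 1})ᶜ) :=
    (h₂.isOpen_image_lt_one hα₂).isClosed_compl.isCompact.image_of_continuousOn fun y hy =>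
      (h.piece₂.contMDiffAt (hs₂ hy)).continuousAt.continuousWithinAt
  have key : ∀ {p : ℝ × ℂ}, 1 / 2 < gaugePow p → gaugePow p < 1 →
      1 < gaugePow (contactInversion p) ∧ gaugePow (contactInversion p) < 2 := fun {p} h1 h2 => by
    refine ⟨?_, (contactInversion_mem_shell h1 (by linarith)).2⟩
    rw [gaugePow_contactInversion (by linarith)]
    exact (one_lt_inv₀ (by linarith)).2 h2
  refine ⟨?_⟩
  convert k1.union k2
  symm
  rw [eq_univ_iff_forall]
  intro z
  rcases h.cover z with ⟨y, hy, rfl⟩ | ⟨y, hy, rfl⟩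
  · by_cases hy' : y ∈ (e₁ '' {p | gaugePow p < 1})ᶜ
    · exact Or.inl ⟨y, hy', rfl⟩
    · obtain ⟨p, hp, rfl⟩ := not_not.1 hy'
      have hp2 : gaugePow p < 2 := lt_trans hp (by norm_num)
      have hp1 := (h₁.mem_ballCompl_iff hp2).1 hy
      have hI := key hp1 hp
      rw [h.glue_shell h₁ h₂ hp1 hp2]
      refine Or.inr ⟨_, ?_, rfl⟩
      rintro ⟨q, hq, he⟩
      have := h₂.injOn (lt_trans hq (by norm_num) : gaugePow q < 2) hI.2 he
      subst this
      exact absurd hq (not_lt.2 hI.1.le)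
  · by_cases hy' : y ∈ (e₂ '' {p | gaugePow p < 1})ᶜ
    · exact Or.inr ⟨y, hy', rfl⟩
    · obtain ⟨p, hp, rfl⟩ := not_not.1 hy'
      have hp2 : gaugePow p < 2 := lt_trans hp (by norm_num)
      have hp1 := (h₂.mem_ballCompl_iff hp2).1 hy
      have hI := key hp1 hp
      rw [h.glue_shell' h₁ h₂ hp1 hp2]
      refine Or.inl ⟨_, ?_, rfl⟩
      rintro ⟨q, hq, he⟩
      have := h₁.injOn (lt_trans hq (by norm_num) : gaugePow q < 2) hI.2 he
      subst this
      exact absurd hq (not_lt.2 hI.1.le)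

end IsBallSum

end Sum
end

noncomputable section
open Filter Topology

/-! ### The integral on the connected sum -/

section Sum

variable {Y₁ Y₂ Z : Type u}
  [TopologicalSpace Y₁] [T2Space Y₁] [ChartedSpace (EuclideanSpace ℝ (Fin 3)) Y₁]
  [IsManifold (𝓡 3) ∞ Y₁]
  [TopologicalSpace Y₂] [T2Space Y₂] [ChartedSpace (EuclideanSpace ℝ (Fin 3)) Y₂]
  [IsManifold (𝓡 3) ∞ Y₂]
  [TopologicalSpace Z] [ChartedSpace (EuclideanSpace ℝ (Fin 3)) Z]
  [IsManifold (𝓡 3) ∞ Z]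
  {α₁ : OneForm (𝓡 3) Y₁} {α₂ : OneForm (𝓡 3) Y₂} {f₁ : Y₁ → ℝ} {f₂ : Y₂ → ℝ}
  {e₁ : ℝ × ℂ → Y₁} {e₂ : ℝ × ℂ → Y₂} {c₁ c₂ : ℝ → ℝ}
  {α : OneForm (𝓡 3) Z} {j₁ : Y₁ → Z} {j₂ : Y₂ → Z}

namespace IsBallSum

/-- The two rescaled integrals agree in the shell: under inversion the factor gains `N` and `|ζ|²`
loses it, so `m |ζ|²` is preserved. -/
theorem exists_function (h : IsBallSum α₁ α₂ e₁ e₂ c₁ c₂ α j₁ j₂)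
    (h₁ : IsReebBall α₁ f₁ e₁ c₁) (h₂ : IsReebBall α₂ f₂ e₂ c₂) :
    ∃ f : Z → ℝ,
      (∀ y ∈ ballCompl e₁, f (j₁ y) = ballFactor e₁ c₁ (shellFactor c₁ c₂) y * f₁ y) ∧
      ∀ y ∈ ballCompl e₂, f (j₂ y) = ballFactor e₂ c₂ (shellFactorInv c₁ c₂) y * f₂ y := by
  refine exists_descend h.injOn₁ h.injOn₂ _ _ fun a ha b hb hab => ?_
  obtain ⟨p, hp, hp', rfl, rfl⟩ := (h.glue a ha b hb).1 hab
  have h0 : gaugePow p ≠ 0 := by linarith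
  rw [h₁.ballFactor_mul_apply hp', h₂.ballFactor_mul_apply (contactInversion_mem_shell hp hp').2,
    shellFactorInv_contactInversion h0, normSq_contactInversion h0]
  field_simp

variable {f : Z → ℝ}

theorem contMDiff (h : IsBallSum α₁ α₂ e₁ e₂ c₁ c₂ α j₁ j₂) (hα₁ : IsContactForm α₁)
    (hα₂ : IsContactForm α₂) (hf₁ : IsReebIntegral α₁ f₁) (hf₂ : IsReebIntegral α₂ f₂)
    (h₁ : IsReebBall α₁ f₁ e₁ c₁) (h₂ : IsReebBall α₂ f₂ e₂ c₂)
    (k₁ : ∀ y ∈ ballCompl e₁, f (j₁ y) = ballFactor e₁ c₁ (shellFactor c₁ c₂) y * f₁ y)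
    (k₂ : ∀ y ∈ ballCompl e₂, f (j₂ y) = ballFactor e₂ c₂ (shellFactorInv c₁ c₂) y * f₂ y) :
    ContMDiff (𝓡 3) 𝓘(ℝ, ℝ) ∞ f := by
  intro z
  rcases h.cover z with ⟨y, hy, rfl⟩ | ⟨y, hy, rfl⟩
  · exact h.piece₁.contMDiffAt_of_comp hy
      (mem_of_superset (h₁.isOpen_ballCompl.mem_nhds hy) fun y' hy' => k₁ y' hy')
      ((h₁.contMDiffAt_ballFactor hα₁ (h₁.isShellFactor h₂) hy).mul (hf₁.smooth y))
  · exact h.piece₂.contMDiffAt_of_comp hy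
      (mem_of_superset (h₂.isOpen_ballCompl.mem_nhds hy) fun y' hy' => k₂ y' hy')
      ((h₂.contMDiffAt_ballFactor hα₂ (h₁.isShellFactorInv h₂) hy).mul (hf₂.smooth y))

/-- In the shell the differential of the integral does not vanish. -/
theorem mem_closure_of_shell (h : IsBallSum α₁ α₂ e₁ e₂ c₁ c₂ α j₁ j₂) (hα₁ : IsContactForm α₁)
    (hf₁ : IsReebIntegral α₁ f₁) (h₁ : IsReebBall α₁ f₁ e₁ c₁) (h₂ : IsReebBall α₂ f₂ e₂ c₂)
    (h4 : ∀ σ τ, |σ| < 2 → |τ| < 2 → c₁ σ ≤ c₂ τ / 2) (hf : ContMDiff (𝓡 3) 𝓘(ℝ, ℝ) ∞ f)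
    (k₁ : ∀ y ∈ ballCompl e₁, f (j₁ y) = ballFactor e₁ c₁ (shellFactor c₁ c₂) y * f₁ y)
    {p : ℝ × ℂ} (hp : 1 / 2 < gaugePow p) (hp' : gaugePow p < 2) :
    j₁ (e₁ p) ∈ closure {z | dFun (𝓡 3) f z ≠ 0} := by
  have hmem : ∀ q ∈ {p : ℝ × ℂ | 1 / 2 < gaugePow p ∧ gaugePow p < 2}, e₁ q ∈ ballCompl e₁ :=
    fun q hq => (h₁.mem_ballCompl_iff hq.2).2 hq.1
  have hpar : ∀ q ∈ standardBall 2, ∀ᶠ q' in 𝓝 q, IsParamAt (𝓡 3) e₁ q' := fun q hq =>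
    mem_of_superset ((isOpen_standardBall 2).mem_nhds hq) fun q' hq' => h₁.isParamAt hα₁ hq'
  suffices hd : ∃ᶠ q in 𝓝 p, j₁ (e₁ q) ∈ closure {z | dFun (𝓡 3) f z ≠ 0} by
    rw [← closure_closure, mem_closure_iff_frequently, ← h.piece₁.map_nhds_eq (hmem p ⟨hp, hp'⟩),
      ← (h₁.isParamAt hα₁ hp').map_nhds_eq]
    exact hd
  refine ((mem_closure_iff_frequently.1 (dense_generic_shell p)).and_eventually
    (isOpen_shell.mem_nhds ⟨hp, hp'⟩)).mono ?_
  rintro q ⟨⟨hq1, hq2, hq3⟩, hq⟩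
  rcases lt_or_gt_of_ne hq3 with hlt | hgt
  · refine subset_closure ?_
    have hev : f ∘ j₁ =ᶠ[𝓝 (e₁ q)] fun y => ballFactor e₁ c₁ (shellFactor c₁ c₂) y * f₁ y := by
      filter_upwards [h₁.isOpen_ballCompl.mem_nhds (hmem q hq)] with y hy using k₁ y hy
    refine (h.piece₁.dFun_ne_zero_iff hf hev (hpar q hq.2) (hmem q hq)).2 fun h0 => ?_
    have hev2 : (fun y => ballFactor e₁ c₁ (shellFactor c₁ c₂) y * f₁ y) ∘ e₁ =ᶠ[𝓝 q]
        fun p => shellFactor c₁ c₂ (Complex.normSq p.2, p.1) * Complex.normSq p.2 := by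
      filter_upwards [(isOpen_standardBall 2).mem_nhds hq.2] with q' hq'
        using h₁.ballFactor_mul_apply hq'
    rw [hev2.fderiv_eq] at h0
    have hn1 := hq.1
    have hn2 := hq.2
    rw [gaugePow_eq] at hn1 hn2 hlt
    have hm := hasFDerivAt_comp_normSq_fst (((h₁.isShellFactor h₂).contDiffAt
      (Complex.normSq q.2, q.1) hn1 hn2).differentiableAt (by simp))
    have hn : HasFDerivAt (fun p : ℝ × ℂ => Complex.normSq p.2)
        ((radForm q.2).comp (ContinuousLinearMap.snd ℝ ℝ ℂ)) q :=
      HasFDerivAt.comp q (g := fun z : ℂ => Complex.normSq z) (hasFDerivAt_normSq q.2)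
        hasFDerivAt_snd
    have hmul : HasFDerivAt (fun p : ℝ × ℂ =>
        shellFactor c₁ c₂ (Complex.normSq p.2, p.1) * Complex.normSq p.2) _ q := hm.mul hn
    rw [hmul.fderiv] at h0
    -- Along `∂_t` the derivative of `m |ζ|²` is `|ζ|² ∂_t m`, which is nonzero for `t, ζ ≠ 0` and
    -- `N < 5/4`.
    have h5 := DFunLike.congr_fun h0 ((1, 0) : ℝ × ℂ)
    have h6 : Complex.normSq q.2 * fderiv ℝ (shellFactor c₁ c₂) (Complex.normSq q.2, q.1) (0, 1) = 0 := by
      simpa using h5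
    exact mul_ne_zero (Complex.normSq_eq_zero.not.2 hq2) (fderiv_shellFactor_ne_zero
      h₁.contDiffAt h₂.contDiffAt h₂.deriv_pos h4 h₂.pos hn1 hlt hq1) h6
  -- For `N > 5/4` the cutoff is `1`, so the function is `f₁` near the point and density is
  -- inherited from `f₁`.
  · refine h.piece₁.mem_closure h₁.isOpen_ballCompl (hmem q hq) hf hf₁ ?_
    have hgt' : {p | 5 / 4 < gaugePow p ∧ gaugePow p < 2} ∈ 𝓝 q :=
      ((isOpen_lt continuous_const contDiff_gaugePow.continuous).inter
        (isOpen_standardBall 2)).mem_nhds ⟨hgt, hq.2⟩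
    rw [EventuallyEq, ← (h₁.isParamAt hα₁ hq.2).map_nhds_eq, eventually_map]
    filter_upwards [hgt'] with q' hq'
    refine (k₁ _ (hmem q' ⟨by linarith [hq'.1], hq'.2⟩)).trans ?_
    have hn := hq'.1.le
    rw [gaugePow_eq] at hn
    rw [h₁.ballFactor_mul_apply hq'.2, h₁.apply _ hq'.2, shellFactor_eq hn]

theorem isReebIntegral (h : IsBallSum α₁ α₂ e₁ e₂ c₁ c₂ α j₁ j₂) (hα : IsContactForm α)
    (hα₁ : IsContactForm α₁)
    (hα₂ : IsContactForm α₂) (hf₁ : IsReebIntegral α₁ f₁) (hf₂ : IsReebIntegral α₂ f₂)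
    (h₁ : IsReebBall α₁ f₁ e₁ c₁) (h₂ : IsReebBall α₂ f₂ e₂ c₂)
    (h4 : ∀ σ τ, |σ| < 2 → |τ| < 2 → c₁ σ ≤ c₂ τ / 2)
    (k₁ : ∀ y ∈ ballCompl e₁, f (j₁ y) = ballFactor e₁ c₁ (shellFactor c₁ c₂) y * f₁ y)
    (k₂ : ∀ y ∈ ballCompl e₂, f (j₂ y) = ballFactor e₂ c₂ (shellFactorInv c₁ c₂) y * f₂ y) :
    IsReebIntegral α f := by
  have hm₁ := h₁.isShellFactor h₂
  have hm₂ := h₁.isShellFactorInv h₂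
  have hf := h.contMDiff hα₁ hα₂ hf₁ hf₂ h₁ h₂ k₁ k₂
  refine ⟨hf, fun z v hv => ?_, fun z => ?_⟩
  · rcases h.cover z with ⟨y, hy, rfl⟩ | ⟨y, hy, rfl⟩
    · obtain ⟨Φ, x, rfl, hΦ, hR⟩ := h₁.exists_param_reebInvariant hα₁ hf₁ hm₁ hy
      exact h.piece₁.reebInvariant h₁.isOpen_ballCompl hα hf k₁ hΦ hy hR v hv
    · obtain ⟨Φ, x, rfl, hΦ, hR⟩ := h₂.exists_param_reebInvariant hα₂ hf₂ hm₂ hy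
      exact h.piece₂.reebInvariant h₂.isOpen_ballCompl hα hf k₂ hΦ hy hR v hv
  · rcases h.cover z with ⟨y, hy, rfl⟩ | ⟨y, hy, rfl⟩
    · rcases h₁.mem_ballCompl_cases hy with ⟨p, hp, hp', rfl⟩ | hy'
      · exact h.mem_closure_of_shell hα₁ hf₁ h₁ h₂ h4 hf k₁ hp' hp
      · refine h.piece₁.mem_closure h₁.isOpen_ballCompl hy hf hf₁ ?_
        filter_upwards [h₁.eventually_ballFactor_eq_one hm₁ hy', h₁.isOpen_ballCompl.mem_nhds hy]
          with y' e1 e2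
        rw [Function.comp_apply, k₁ y' e2, e1, one_mul]
    · rcases h₂.mem_ballCompl_cases hy with ⟨p, hp, hp', rfl⟩ | hy'
      -- The derivative estimate in the shell is made in the coordinates of the first ball;
      -- inversion moves the point there.
      · have hI := contactInversion_mem_shell hp' hp
        rw [h.glue_shell' h₁ h₂ hp' hp]
        exact h.mem_closure_of_shell hα₁ hf₁ h₁ h₂ h4 hf k₁ hI.1 hI.2
      · refine h.piece₂.mem_closure h₂.isOpen_ballCompl hy hf hf₂ ?_
        filter_upwards [h₂.eventually_ballFactor_eq_one hm₂ hy', h₂.isOpen_ballCompl.mem_nhds hy]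
          with y' e1 e2
        rw [Function.comp_apply, k₂ y' e2, e1, one_mul]

end IsBallSum

theorem IsReebBall.isDarbouxBall (h : IsReebBall α₁ f₁ e₁ c₁) : IsDarbouxBall α₁ 2 e₁ where
  smooth p hp := (h.smooth p hp).contMDiffWithinAt
  injOn := h.injOn
  pullback p hp := ⟨c₁ (Complex.normSq p.2), h.pos _ (normSq_lt_two hp), fun v => by
    rw [← stdForm_apply]
    exact DFunLike.congr_fun (h.pb p hp) v⟩

theorem notMem_image_gaugePow_le {y : Y₁} (hy : y ∉ e₁ '' standardBall 2)
    {r : ℝ} (hr : r < 2) : y ∉ e₁ '' {p | gaugePow p ≤ r} :=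
  fun hy' => hy (image_mono (fun p (hp : gaugePow p ≤ r) => lt_of_le_of_lt hp hr) hy')

/-- The data of the contact connected sum given by a ball sum. -/
def IsBallSum.contactConnectedSum (h : IsBallSum α₁ α₂ e₁ e₂ c₁ c₂ α j₁ j₂)
    (h₁ : IsReebBall α₁ f₁ e₁ c₁) (h₂ : IsReebBall α₂ f₂ e₂ c₂) :
    ContactConnectedSum α₁ α₂ α where
  R := 2
  one_lt_R := one_lt_two
  e₁ := e₁
  e₂ := e₂
  ball₁ := h₁.isDarbouxBall
  ball₂ := h₂.isDarbouxBall
  j₁ := j₁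
  j₂ := j₂
  smooth₁ _ hy := (h.piece₁.contMDiffAt hy).contMDiffWithinAt
  smooth₂ _ hy := (h.piece₂.contMDiffAt hy).contMDiffWithinAt
  injOn₁ := h.injOn₁
  injOn₂ := h.injOn₂
  factor₁ := ballFactor e₁ c₁ (shellFactor c₁ c₂)
  factor₂ := ballFactor e₂ c₂ (shellFactorInv c₁ c₂)
  pullback₁ _ hy := ⟨h₁.ballFactor_pos (h₁.isShellFactor h₂) hy, h.piece₁.pullback hy⟩
  pullback₂ _ hy := ⟨h₂.ballFactor_pos (h₁.isShellFactorInv h₂) hy, h.piece₂.pullback hy⟩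
  cover := h.cover
  glue := h.glue

end Sum

theorem exists_connectedSum {Y₁ Y₂ : Type u}
    [TopologicalSpace Y₁] [T2Space Y₁] [ChartedSpace (EuclideanSpace ℝ (Fin 3)) Y₁]
    [IsManifold (𝓡 3) ∞ Y₁] [CompactSpace Y₁]
    [TopologicalSpace Y₂] [T2Space Y₂] [ChartedSpace (EuclideanSpace ℝ (Fin 3)) Y₂]
    [IsManifold (𝓡 3) ∞ Y₂] [CompactSpace Y₂]
    {α₁ : OneForm (𝓡 3) Y₁} {α₂ : OneForm (𝓡 3) Y₂} {f₁ : Y₁ → ℝ} {f₂ : Y₂ → ℝ}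
    {e₁ : ℝ × ℂ → Y₁} {e₂ : ℝ × ℂ → Y₂} {c₁ c₂ : ℝ → ℝ} (hα₁ : IsContactForm α₁)
    (hα₂ : IsContactForm α₂) (hf₁ : IsReebIntegral α₁ f₁) (hf₂ : IsReebIntegral α₂ f₂)
    (h₁ : IsReebBall α₁ f₁ e₁ c₁) (h₂ : IsReebBall α₂ f₂ e₂ c₂)
    (h4 : ∀ σ τ, |σ| < 2 → |τ| < 2 → c₁ σ ≤ c₂ τ / 2) :
    ∃ (Z : Type u) (_ : TopologicalSpace Z) (_ : T2Space Z) (_ : CompactSpace Z)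
      (_ : ChartedSpace (EuclideanSpace ℝ (Fin 3)) Z) (_ : IsManifold (𝓡 3) ∞ Z)
      (α : OneForm (𝓡 3) Z) (C : ContactConnectedSum α₁ α₂ α) (f : Z → ℝ),
      IsContactForm α ∧ IsReebIntegral α f ∧ C.R = 2 ∧ C.e₁ = e₁ ∧ C.e₂ = e₂ ∧
      (∀ y ∉ e₁ '' standardBall 2, C.factor₁ y = 1 ∧ f (C.j₁ y) = f₁ y) ∧
      ∀ y ∉ e₂ '' standardBall 2, C.factor₂ y = 1 ∧ f (C.j₂ y) = f₂ y := by
  obtain ⟨Z, t, cs, mf, α, j₁, j₂, hα, h⟩ := exists_isBallSum hα₁ hα₂ h₁ h₂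
  obtain ⟨f, k₁, k₂⟩ := h.exists_function h₁ h₂
  refine ⟨Z, t, h.t2Space h₁ h₂, h.compactSpace hα₁ hα₂ h₁ h₂, cs, mf, α,
    h.contactConnectedSum h₁ h₂, f, hα, h.isReebIntegral hα hα₁ hα₂ hf₁ hf₂ h₁ h₂ h4 k₁ k₂,
    rfl, rfl, rfl, fun y hy => ?_, fun y hy => ?_⟩
  · have e := h₁.ballFactor_eq_one (h₁.isShellFactor h₂) (notMem_image_gaugePow_le hy (by norm_num))
    refine ⟨e, (k₁ y (notMem_image_gaugePow_le hy (by norm_num))).trans ?_⟩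
    rw [e, one_mul]
  · have e := h₂.ballFactor_eq_one (h₁.isShellFactorInv h₂) (notMem_image_gaugePow_le hy (by norm_num))
    refine ⟨e, (k₂ y (notMem_image_gaugePow_le hy (by norm_num))).trans ?_⟩
    rw [e, one_mul]
end

noncomputable section
open Filter Topology

/-! ### Connected sums of open books -/

section Surface

variable {W : Type u} [TopologicalSpace W] [T2Space W] [CompactSpace W]
    [ChartedSpace (EuclideanHalfSpace 2) W] [IsManifold (𝓡∂ 2) ∞ W] {k : ℕ}
    {S : LiouvilleSurface W k} {A : AutonomousHamiltonian S} {D : GirouxData A}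
    {Y : Type u} [TopologicalSpace Y] [T2Space Y] [ChartedSpace (EuclideanSpace ℝ (Fin 3)) Y]
    [IsManifold (𝓡 3) ∞ Y]

namespace OpenBook

open Classical in
/-- Integrals of the Reeb flow which equal `h₂` near a given binding component. -/
theorem exists_isReebIntegral_binding (O : OpenBook D Y) (i : Fin k) :
    ∃ f : Y → ℝ, IsReebIntegral O.form f ∧
      (∀ x, ∀ z : ℂ, ‖z‖ ≤ 1 / 2 → f (O.binding i (x, z)) = D.h₂ i ‖z‖) ∧
      ∀ {Z : Type u} (j : Y → Z) (F : Z → ℝ), (∀ y ∉ O.bindingRegion i, F (j y) = f y) →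
        O.ExtendsHamiltonian {i}ᶜ j fun p => F p.2 := by
  -- At the chosen component the constant is the slope, so that `h₂ - a_i + c_i = h₂` is the value
  -- of the form on the rotation field; elsewhere it is the boundary value of `H`.
  obtain ⟨f, h1, h2, h3⟩ := O.exists_isReebIntegral
    (Function.update (fun i => A.H (S.collar i (0, 0))) i (D.slope i))
  refine ⟨f, h1, fun x z hz => ?_, fun j F hF => ⟨fun t φ w hw hw' => ?_, ?_⟩⟩
  · rw [h3 i x z hz, Function.update_self]
    ring
  · refine (hF _ ?_).trans (h2 φ w hw hw')
    rintro ⟨x, z, hz, he⟩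
    exact absurd (O.overlap i x z (by linarith) (w, φ)
      ⟨S.mem_core_of_notMem_collarRegion hw, mem_univ _⟩ he) (not_lt.2 hz.le)
  · intro l hl _ t x z hz
    refine (hF _ ?_).trans ((h3 l x z hz).trans ?_)
    · rintro ⟨x', z', hz', he⟩
      exact hl ((O.binding_eq_iff i l x' x z' z (by linarith) (by linarith)).1 he).1.symm
    · rw [Function.update_of_ne hl]
      ring

end OpenBook

theorem exists_connectedSum_openBook {W' : Type u} [TopologicalSpace W'] [T2Space W']
    [CompactSpace W'] [ChartedSpace (EuclideanHalfSpace 2) W'] [IsManifold (𝓡∂ 2) ∞ W'] {k' : ℕ}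
    {S' : LiouvilleSurface W' k'} {A' : AutonomousHamiltonian S'} {D' : GirouxData A'}
    (O : OpenBook D Y) {Y' : Type u} [TopologicalSpace Y'] [T2Space Y']
    [ChartedSpace (EuclideanSpace ℝ (Fin 3)) Y'] [IsManifold (𝓡 3) ∞ Y'] (O' : OpenBook D' Y')
    (i : Fin k) (i' : Fin k') (x x' : ℝ) :
    ∃ (Z : Type u) (_ : TopologicalSpace Z) (_ : T2Space Z) (_ : CompactSpace Z)
      (_ : ChartedSpace (EuclideanSpace ℝ (Fin 3)) Z) (_ : IsManifold (𝓡 3) ∞ Z)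
      (α : OneForm (𝓡 3) Z) (C : ContactConnectedSum O.form O'.form α) (F : ℝ × Z → ℝ),
      IsContactForm α ∧
      C.e₁ 0 = O.binding i (x, 0) ∧ C.e₁ '' standardBall C.R ⊆ O.bindingRegion i ∧
      C.e₂ 0 = O'.binding i' (x', 0) ∧ C.e₂ '' standardBall C.R ⊆ O'.bindingRegion i' ∧
      (∀ y ∉ O.bindingRegion i, C.factor₁ y = 1) ∧
      (∀ y ∉ O'.bindingRegion i', C.factor₂ y = 1) ∧
      IsCompletelyIntegrable (symplectizationForm α) ![Prod.fst, F] ∧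
      O.ExtendsHamiltonian {i}ᶜ C.j₁ F ∧ O'.ExtendsHamiltonian {i'}ᶜ C.j₂ F := by
  have := O.compactSpace
  have := O'.compactSpace
  obtain ⟨f₁, hf₁, hb₁, hF₁⟩ := O.exists_isReebIntegral_binding i
  obtain ⟨f₂, hf₂, hb₂, hF₂⟩ := O'.exists_isReebIntegral_binding i'
  obtain ⟨η₁, hη₁, hB₁⟩ := O.exists_isReebBall i x hb₁
  obtain ⟨η₂, hη₂, hB₂⟩ := O'.exists_isReebBall i' x' hb₂
  set δ₂ := η₂ / 2 with hδ₂
  have hp₂ : 0 < δ₂ := by positivity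
  -- Then `c₁ < 2δ₁² ≤ δ₂²/8 < δ₂²/4 < c₂/2`, the comparison that monotonicity in the shell
  -- requires.
  set δ₁ := min (η₁ / 2) (δ₂ / 4) with hδ₁
  have hp₁ : 0 < δ₁ := by positivity
  obtain ⟨e₁, c₁, h₁, h01, hs₁, hc₁⟩ := hB₁ δ₁ hp₁ (by linarith [min_le_left (η₁ / 2) (δ₂ / 4)])
  obtain ⟨e₂, c₂, h₂, h02, hs₂, hc₂⟩ := hB₂ δ₂ hp₂ (by linarith)
  have h4 : ∀ σ τ, |σ| < 2 → |τ| < 2 → c₁ σ ≤ c₂ τ / 2 := by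
    intro σ τ hσ hτ
    have k1 := (hc₁ σ hσ).2
    have k2 := (hc₂ τ hτ).1
    have k3 : δ₁ ≤ δ₂ / 4 := min_le_right _ _
    nlinarith
  obtain ⟨Z, _, _, _, _, _, α, C, f, hα, hf, hR, he₁, he₂, hC₁, hC₂⟩ :=
    exists_connectedSum O.contact O'.contact hf₁ hf₂ h₁ h₂ h4
  refine ⟨Z, _, ‹_›, ‹_›, _, ‹_›, α, C, fun p => f p.2, hα, ?_, ?_, ?_, ?_, ?_, ?_,
    isCompletelyIntegrable_of_reebInvariant hα hf.smooth hf.invariant hf.dense, ?_, ?_⟩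
  · rw [he₁, h01]
  · rwa [he₁, hR]
  · rw [he₂, h02]
  · rwa [he₂, hR]
  · exact fun y hy => (hC₁ y fun h => hy (hs₁ h)).1
  · exact fun y hy => (hC₂ y fun h => hy (hs₂ h)).1
  · exact hF₁ C.j₁ f fun y hy => (hC₁ y fun h => hy (hs₁ h)).2
  · exact hF₂ C.j₂ f fun y hy => (hC₂ y fun h => hy (hs₂ h)).2

end Surface
end

theorem mainTheorem6
    {W : Type u} [TopologicalSpace W] [T2Space W] [CompactSpace W]
    [ChartedSpace (EuclideanHalfSpace 2) W] [IsManifold (𝓡∂ 2) ∞ W]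
    {W' : Type u} [TopologicalSpace W'] [T2Space W'] [CompactSpace W']
    [ChartedSpace (EuclideanHalfSpace 2) W'] [IsManifold (𝓡∂ 2) ∞ W']
    {k k' : ℕ} (S : LiouvilleSurface W k) (S' : LiouvilleSurface W' k')
    (A : AutonomousHamiltonian S) (A' : AutonomousHamiltonian S') :
    -- the contact open book exists
    Nonempty (GirouxData A) ∧
    (∀ D : GirouxData A, ∃ (Y : Type u) (_ : TopologicalSpace Y) (_ : T2Space Y)
      (_ : CompactSpace Y) (_ : ChartedSpace (EuclideanSpace ℝ (Fin 3)) Y)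
      (_ : IsManifold (𝓡 3) ∞ Y), Nonempty (OpenBook D Y)) ∧
    -- its symplectization is completely integrable
    (∀ (D : GirouxData A) (Y : Type u) [TopologicalSpace Y] [T2Space Y]
      [ChartedSpace (EuclideanSpace ℝ (Fin 3)) Y] [IsManifold (𝓡 3) ∞ Y] (O : OpenBook D Y),
      ∃ F : ℝ × Y → ℝ,
        IsCompletelyIntegrable (symplectizationForm O.form) ![Prod.fst, F] ∧
        O.ExtendsHamiltonian univ id F) ∧
    -- so is the symplectization of the contact connected sum of two such open books
    (∀ (D : GirouxData A) (D' : GirouxData A')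
      (Y : Type u) [TopologicalSpace Y] [T2Space Y]
      [ChartedSpace (EuclideanSpace ℝ (Fin 3)) Y] [IsManifold (𝓡 3) ∞ Y] (O : OpenBook D Y)
      (Y' : Type u) [TopologicalSpace Y'] [T2Space Y']
      [ChartedSpace (EuclideanSpace ℝ (Fin 3)) Y'] [IsManifold (𝓡 3) ∞ Y'] (O' : OpenBook D' Y')
      (i : Fin k) (i' : Fin k') (x x' : ℝ),
      ∃ (Z : Type u) (_ : TopologicalSpace Z) (_ : T2Space Z) (_ : CompactSpace Z)
        (_ : ChartedSpace (EuclideanSpace ℝ (Fin 3)) Z) (_ : IsManifold (𝓡 3) ∞ Z)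
        (α : OneForm (𝓡 3) Z) (C : ContactConnectedSum O.form O'.form α) (F : ℝ × Z → ℝ),
        IsContactForm α ∧
        C.e₁ 0 = O.binding i (x, 0) ∧ C.e₁ '' standardBall C.R ⊆ O.bindingRegion i ∧
        C.e₂ 0 = O'.binding i' (x', 0) ∧ C.e₂ '' standardBall C.R ⊆ O'.bindingRegion i' ∧
        (∀ y ∉ O.bindingRegion i, C.factor₁ y = 1) ∧
        (∀ y ∉ O'.bindingRegion i', C.factor₂ y = 1) ∧
        IsCompletelyIntegrable (symplectizationForm α) ![Prod.fst, F] ∧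
        O.ExtendsHamiltonian {i}ᶜ C.j₁ F ∧ O'.ExtendsHamiltonian {i'}ᶜ C.j₂ F) := by
  exact ⟨nonempty_girouxData A, exists_openBook, fun D Y _ _ _ _ O => O.exists_isCompletelyIntegrable,
    fun D D' Y _ _ _ _ O Y' _ _ _ _ O' i i' x x' => exists_connectedSum_openBook O O' i i' x x'⟩
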